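/- **Theorem (1+3-dimensional Bianchi I cosmic no-hair theorem).** Let $G>0$, $s\ge 0$, and let $\mathcal M$ be the Bianchi I spacetime with line element $$ds^2=-dt^2+a_1^2(t)\,dx^2+a_2^2(t)\,dy^2+a_3^2(t)\,dz^2,\qquad t\in(t_i,\infty),\quad -\infty\le t_i<\infty,$$ with smooth positive $a_i$. Write $a=(a_1a_2a_3)^{1/3}$. *Slices and entropy.* Foliate $\mathcal M$ by the past-directed light cones of the events $(t,x,y,z)=(T,0,0,0)$. A slice of such a cone is a smooth closed surface in it that meets each null generator exactly once, before the tip. The generalized entropy of a slice $\sigma$ is $S_{\rm gen}[\sigma]=\frac{A[\sigma]}{4G}+s\,\mathrm{vol}_c[\sigma]$, where $A$ is proper area and $\mathrm{vol}_c$ is the comoving coordinate volume of the interior of $\sigma$ (so $s$ is the constant thermodynamic entropy of matter per comoving volume). The quantum expansion of $\sigma$ at a point, along a null normal $k$, is $4G$ times the rate of change of $S_{\rm gen}$ per unit area when $\sigma$ is deformed along $k$ near that point. *Q-screen.* Suppose $\mathcal M$ admits a past Q-screen $\mathcal Q$ constructed with respect to these cones: for every $T>T_0$ there is a leaf $\sigma(T)$,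 a slice of the cone with tip $(T,0)$ depending smoothly on $T$, whose quantum expansion vanishes along the cone and is positive along the other future-directed null normal. Suppose each leaf has the largest generalized entropy among all slices of its cone, and that the Generalized Second Law holds on $\mathcal Q$, i.e. $T\mapsto S_{\rm gen}[\sigma(T)]$ is strictly increasing. Suppose moreover, for $i\in\{1,2,3\}$: 1. $a_i(t)\to\infty$ as $t\to\infty$; 2. $\mathcal Q$ is a timelike hypersurface past some $t_{\rm time}$ and extends out to future timelike infinity, i.e. in each direction $p$ the time at which the generator with direction $p$ meets $\sigma(T)$ tends to $\infty$ as $T\to\infty$; 3. $\dot a_i(t)>0$ for all $t$ past some $t_{\rm mono}$; 4. $S_{\rm gen}[\sigma(T)]\to S_{\max}<\infty$ as $T\to\infty$. Then $\mathcal M$ is asymptotically de Sitter, with the Hubble constant $H>0$ given by $H^2=\pi/(G\,S_{\max})$, the same as in the Robertson–Walker case, and each $a_i(t)$ approaches $C_ie^{Ht}$ in the following sense. There are constants $C_i>0$ such that: * the remaining conformal time $\eta_\infty-\eta(t)=\int_t^\infty dt'/a(t')$ is finite and $$a_i(t)\cdot H\,(\eta_\infty-\eta(t))\to C_i\quad(t\to\infty);$$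 equivalently, with conformal time normalized so that $\eta_\infty=0$, $a_i\sim C_i\cdot\frac{-1}{H\eta}$ as $\eta\to0^-$, where $-1/(H\eta)$ is the de Sitter scale factor $e^{Ht}$ in conformal time; * $\dot a_i(t)/a_i(t)\to H$ as $t\to\infty$; * for every $\Delta\in\mathbb R$, $a_i(t+\Delta)/a(t)\to C_ie^{H\Delta}$ as $t\to\infty$. -/

import Mathlib

open Set Filter Topology MeasureTheory
open scoped ContDiff

noncomputable section

namespace Bianchi

/-- Comoving space, with Cartesian coordinates `(x, y, z)`. -/
abbrev Space : Type := EuclideanSpace ℝ (Fin 3)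

/-- Events `(t, (x, y, z))`; the same type is used for tangent vectors in these coordinates. -/
abbrev Event : Type := ℝ × Space

end Bianchi

/-- A Bianchi I spacetime in 1+3 dimensions: `t` ranges over `(ti, ∞)` (with `ti = ⊥` standing for
`-∞`), and the line element is `-dt² + a₀(t)² dx² + a₁(t)² dy² + a₂(t)² dz²`. -/
structure BianchiI where
  ti : WithBot ℝ
  a : Fin 3 → ℝ → ℝ
  smooth : ∀ i, ContDiffOn ℝ ∞ (a i) {t : ℝ | ti < (t : WithBot ℝ)}
  pos : ∀ i (t : ℝ), ti < (t : WithBot ℝ) → 0 < a i t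

namespace BianchiI

open Bianchi

/-- The metric at the event `e`. -/
def metric (M : BianchiI) (e v w : Event) : ℝ :=
  -(v.1 * w.1) + ∑ i, M.a i e.1 ^ 2 * (v.2 i * w.2 i)

/-- The volumetric scale factor `(a₀ a₁ a₂)^(1/3)`. -/
def meanScale (M : BianchiI) (t : ℝ) : ℝ := (∏ i, M.a i t) ^ (1 / 3 : ℝ)

/-! ### Past light cones of the events `(T, 0)` -/

/-- The frequency, seen by comoving observers at time `t`, of a light ray with conserved comoving
momentum `p`. -/
def freq (M : BianchiI) (t : ℝ) (p : Space) : ℝ := √(∑ i, (p i / M.a i t) ^ 2)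

/-- Comoving velocity `-dx/dt` at time `t` of the null geodesic with conserved covector
proportional to `p` that runs into the origin. -/
def rayVelocity (M : BianchiI) (t : ℝ) (p : Space) : Space :=
  WithLp.toLp 2 fun j => p j / M.a j t ^ 2 / M.freq t p

/-- The event at time `t` on the past-directed null geodesic fired from `(T, 0)` in the direction
`p`. With `a = meanScale`, `a_j = a e^{b_j}` and conformal time `dη = dt / a`, the spatial position
is `p_j ∫ e^{-2 b_j} / √(∑ i, p_i² e^{-2 b_i}) dη`, that is, `(t, T, p)` are conformal light cone
coordinates. The past light cone of `(T, 0)` is swept out as `p` runs over the unit sphere. -/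
def lightCone (M : BianchiI) (T t : ℝ) (p : Space) : Event :=
  (t, WithLp.toLp 2 fun j => ∫ r in t..T, M.rayVelocity r p j)

/-- `f` is (the time function of) a smooth slice of the past light cone of `(T, 0)`: the slice
meets the generator with direction `p`, `‖p‖ = 1`, at time `f p`. Only the values of `f` on the unit
sphere matter. -/
structure IsSlice (M : BianchiI) (T : ℝ) (f : Space → ℝ) : Prop where
  smooth : ContDiffOn ℝ ∞ f {0}ᶜ
  mem : ∀ p ∈ Metric.sphere (0 : Space) 1, M.ti < (f p : WithBot ℝ) ∧ f p < T

/-- The slice as a surface parametrized by the unit sphere. -/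
def slice (M : BianchiI) (T : ℝ) (f : Space → ℝ) (p : Space) : Event := M.lightCone T (f p) p

/-! ### Area, comoving volume, generalized entropy -/

/-- Square root of the determinant of the induced metric of the parametrized surface `F`, in the
basis `e₁, e₂` of the tangent plane of the parameter sphere at `p`. -/
def areaDensity (M : BianchiI) (F : Space → Event) (p e₁ e₂ : Space) : ℝ :=
  √(M.metric (F p) (fderiv ℝ F p e₁) (fderiv ℝ F p e₁) *
      M.metric (F p) (fderiv ℝ F p e₂) (fderiv ℝ F p e₂) -
    M.metric (F p) (fderiv ℝ F p e₁) (fderiv ℝ F p e₂) ^ 2)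

/-- The unit vector with polar angles `θ, φ`. -/
def dir (θ φ : ℝ) : Space :=
  !₂[Real.sin θ * Real.cos φ, Real.sin θ * Real.sin φ, Real.cos θ]

/-- `∂ dir / ∂θ`. -/
def dirθ (θ φ : ℝ) : Space :=
  !₂[Real.cos θ * Real.cos φ, Real.cos θ * Real.sin φ, -Real.sin θ]

/-- `∂ dir / ∂φ`. -/
def dirφ (θ φ : ℝ) : Space :=
  !₂[-(Real.sin θ * Real.sin φ), Real.sin θ * Real.cos φ, 0]

/-- Proper area of a surface parametrized by the unit sphere. -/
def area (M : BianchiI) (F : Space → Event) : ℝ :=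
  ∫ θ in (0 : ℝ)..Real.pi, ∫ φ in (0 : ℝ)..(2 * Real.pi),
    M.areaDensity F (dir θ φ) (dirθ θ φ) (dirφ θ φ)

/-- The region of comoving space enclosed by a slice: the comoving positions of the points of the
light cone between the slice and the tip. Every Cauchy hypersurface through the slice, being a graph
over comoving space, has this region as the projection of the interior of the slice. -/
def enclosed (M : BianchiI) (T : ℝ) (f : Space → ℝ) : Set Space :=
  {x | ∃ p ∈ Metric.sphere (0 : Space) 1, ∃ t ∈ Icc (f p) T, x = (M.lightCone T t p).2}

/-- Generalized entropy `A / 4G + s · vol_c` of a slice of the past light cone of `(T, 0)`, where `s`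
is the thermodynamic entropy of matter per unit comoving volume. -/
def genEntropy (M : BianchiI) (G s T : ℝ) (f : Space → ℝ) : ℝ :=
  M.area (M.slice T f) / (4 * G) + s * volume.real (M.enclosed T f)

/-! ### Quantum expansion -/

/-- Determinant of three vectors of comoving space. -/
def det3 (u v w : Space) : ℝ := Matrix.det ![⇑u, ⇑v, ⇑w]

/-- A positively oriented basis of the tangent plane of the sphere at `p`. -/
def IsTangentFrame (p e₁ e₂ : Space) : Prop :=
  inner ℝ p e₁ = 0 ∧ inner ℝ p e₂ = 0 ∧ 0 < det3 p e₁ e₂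

/-- Quantum expansion of the surface `F` at the point with parameter `p`, along the normal vector
field `l`: `4G` times the rate of change per unit proper area of the generalized entropy, when the
surface is displaced along `l` near that point. The first term is the change of the area element;
in the second, `det3` is the flux of the displacement through the (outward oriented) comoving
surface element, that is, the rate of change of the enclosed comoving volume. The value does not
depend on the frame `e₁, e₂`. -/
def quantumExpansion (M : BianchiI) (G s : ℝ) (F l : Space → Event) (p e₁ e₂ : Space) : ℝ :=
  (deriv (fun ε : ℝ => M.areaDensity (fun q => F q + ε • l q) p e₁ e₂) 0 +
      4 * G * (s * det3 (l p).2 (fderiv ℝ F p e₁).2 (fderiv ℝ F p e₂).2)) /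
    M.areaDensity F p e₁ e₂

/-- The future-directed null generator of the light cone at the points of a slice. -/
def generator (M : BianchiI) (f : Space → ℝ) (p : Space) : Event :=
  (1, -M.rayVelocity (f p) p)

/-- `l` is a smooth future-directed null normal field of the slice `f` in the null direction other
than that of the generators of the cone. -/
structure IsOtherNullNormal (M : BianchiI) (T : ℝ) (f : Space → ℝ) (l : Space → Event) : Prop where
  smooth : ContDiffOn ℝ ∞ l {0}ᶜ
  future : ∀ p ∈ Metric.sphere (0 : Space) 1, 0 < (l p).1
  null : ∀ p ∈ Metric.sphere (0 : Space) 1, M.metric (M.slice T f p) (l p) (l p) = 0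
  normal : ∀ p ∈ Metric.sphere (0 : Space) 1, ∀ e : Space, inner ℝ p e = 0 →
    M.metric (M.slice T f p) (l p) (fderiv ℝ (M.slice T f) p e) = 0
  other : ∀ p ∈ Metric.sphere (0 : Space) 1,
    M.metric (M.slice T f p) (l p) (M.generator f p) ≠ 0

/-! ### Q-screens -/

/-- A past Q-screen constructed with respect to the past light cones of the events `(T, 0)`. It has
one leaf on the cone of each `T > T₀`, given by the slice `τ T`. The leaves vary smoothly with `T`,
they are quantum marginal along the light cone, and the quantum expansion in the other
future-directed null direction is positive (quantum anti-trapped). -/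
structure IsPastQScreen (M : BianchiI) (G s T₀ : ℝ) (τ : ℝ → Space → ℝ) : Prop where
  smooth : ContDiffOn ℝ ∞ (fun z : ℝ × Space => τ z.1 z.2) (Ioi T₀ ×ˢ {0}ᶜ)
  isSlice : ∀ T > T₀, M.IsSlice T (τ T)
  marginal : ∀ T > T₀, ∀ p ∈ Metric.sphere (0 : Space) 1, ∀ e₁ e₂, IsTangentFrame p e₁ e₂ →
    M.quantumExpansion G s (M.slice T (τ T)) (M.generator (τ T)) p e₁ e₂ = 0
  antitrapped : ∀ T > T₀, ∀ l, M.IsOtherNullNormal T (τ T) l →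
    ∀ p ∈ Metric.sphere (0 : Space) 1, ∀ e₁ e₂, IsTangentFrame p e₁ e₂ →
      0 < M.quantumExpansion G s (M.slice T (τ T)) l p e₁ e₂

/-- Each leaf globally maximizes generalized entropy among the slices of its light cone. -/
def HasGloballyMaximalLeaves (M : BianchiI) (G s T₀ : ℝ) (τ : ℝ → Space → ℝ) : Prop :=
  ∀ T > T₀, ∀ f, M.IsSlice T f → M.genEntropy G s T f ≤ M.genEntropy G s T (τ T)

/-- The Generalized Second Law: the generalized entropy of the leaves increases strictly under the
flow to the future. -/
def GeneralizedSecondLaw (M : BianchiI) (G s T₀ : ℝ) (τ : ℝ → Space → ℝ) : Prop :=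
  StrictMonoOn (fun T => M.genEntropy G s T (τ T)) (Ioi T₀)

/-- The screen as a hypersurface, parametrized by the tip time `T` and the direction `p`. -/
def screen (M : BianchiI) (τ : ℝ → Space → ℝ) (z : ℝ × Space) : Event :=
  M.slice z.1 (τ z.1) z.2

/-- The screen is a timelike hypersurface at all its points with `t > t₁`: its tangent space
contains a timelike vector. -/
def IsTimelikeAfter (M : BianchiI) (T₀ : ℝ) (τ : ℝ → Space → ℝ) (t₁ : ℝ) : Prop :=
  ∀ T > T₀, ∀ p ∈ Metric.sphere (0 : Space) 1, t₁ < τ T p →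
    ∃ (c : ℝ) (e : Space), inner ℝ p e = 0 ∧
      M.metric (M.screen τ (T, p)) (fderiv ℝ (M.screen τ) (T, p) (c, e))
        (fderiv ℝ (M.screen τ) (T, p) (c, e)) < 0

/-- The screen extends out to future timelike infinity: in each direction `p`, the time at which the
leaf meets the light cone generator tends to infinity along the screen. -/
def ExtendsToFutureInfinity (τ : ℝ → Space → ℝ) : Prop :=
  ∀ p ∈ Metric.sphere (0 : Space) 1, Tendsto (fun T => τ T p) atTop atTop

/-- Conformal time `η_∞ - η(t) = ∫_t^∞ dt' / a(t')` left after `t`. -/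
def conformalTimeLeft (M : BianchiI) (t : ℝ) : ℝ := ∫ r in Ioi t, (M.meanScale r)⁻¹

end BianchiI

end

/-! The comoving velocity of a light ray is the gradient of `fq` in the momentum `p`, and `fq a r`
is the support function of the ellipsoid with half axes `1 / a i r`. Hence the section at time `t`
of the cone with tip `T` has support function `∫ fq` over `[t, T]`: it is a Minkowski integral of
ellipsoids. Its area density over the sphere of directions is `vol3 * fq * curv`, with `curv` the
product of principal radii, however the slice is tilted along the cone (`gramDet_null`). Areas and
volumes of cone sections thereby become mixed volumes of ellipsoids.

From the screen to a limit density. Marginality makes the entropy per generator, `coneEnt`,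
stationary in the time of the section, and `coneEnt` increases with the tip time. So the entropy of
the leaves grows in every single direction (`LateScreen.coneEnt_mono`), not only in total.
Constant-time slices compete with the leaves, so their areas are at most `L = 4 G Smax`. As the tip
goes to infinity, sections of the limiting cones still have area at most `L`, and their densities
eventually dominate each leaf entropy up to a vanishing matter term. Since the total leaf entropies
approach `L`, the densities converge in L¹ to a positive density `α` of integral `L`
(`LateScreen.tailLimit`).

Isotropization. On a cone with tip at infinity let `V` be the comoving volume up to the tip and
`meanRad = 3 vol3 V / A`. Symmetry of mixed volumes (`integral_mixed_sub_eq_zero`) yields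
Minkowski's formula: the local radii `supTail / fq` have area-weighted mean `meanRad`. By AM-GM the
mean of their reciprocals exceeds `1 / meanRad`, up to the L¹ error; the excess is `deficit`. In the
clock `-(1/3) log V` it is exactly the rate at which `lyap` decreases, and `lyap` cannot decrease
linearly (`lyap_ge`). Where the deficit is small all local radii agree, and there are two cases
(`classification`). If the limiting shape `c` is non-degenerate, the section looks like a round
sphere of radius `R` with `4 π R² = L`, and `α = R² gam c` determines `c`. If an axis degenerates,
the ratio of the bounding box to `V` grows at a definite rate; but that ratio is bounded, so this
cannot last. Hence `lyap` converges and near-round states recur (`Clocked.tendsto_lyapunov`,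
`Clocked.exists_near`). Monotonicity of the scale factors pins all times between two such states, so
`meanRad` tends to `R` and the ratios `a i / a j` converge (`isotropization`).

Conclusion. With `a i / a → C i` and `meanRad → R`, L'Hôpital's rule gives the tail integrals, in
particular the remaining conformal time. Marginality at the leaves is one linear equation for the
three Hubble rates in each direction; letting the direction vary forces each rate to `1 / R`
(`LateScreen.tendsto_hub`). Thus `H = 1 / R` and `H² = π / (G Smax)`. -/

noncomputable section

namespace BianchiI

open Bianchi

/-! ### Frequencies as support functions of ellipsoids, and their Hessian weights. -/

/-- Frequency of a light ray with comoving momentum `p` for arbitrary scale factors `a`. -/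
def fq (a : Fin 3 → ℝ → ℝ) (t : ℝ) (p : Space) : ℝ := √(∑ i, (p i / a i t) ^ 2)

/-- Weights of the Hessian of `fq` in the momentum. -/
def hk (a : Fin 3 → ℝ → ℝ) (k : Fin 3) (t : ℝ) (p : Space) : ℝ :=
  ((a (k + 1) t * a (k + 2) t) ^ 2 * fq a t p ^ 3)⁻¹

/-- Weights of the Hessian of the support function of a cone section, up to the tip time `T`. -/
def hInt (a : Fin 3 → ℝ → ℝ) (k : Fin 3) (t T : ℝ) (p : Space) : ℝ := ∫ r in t..T, hk a k r p

/-- Product of the scale factors. -/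
def vol3 (a : Fin 3 → ℝ → ℝ) (t : ℝ) : ℝ := ∏ i, a i t

/-- Curvature function (product of the principal radii) from the Hessian weights. -/
def curv (m : Fin 3 → ℝ) (p : Space) : ℝ := ∑ n, p n ^ 2 * (m (n + 1) * m (n + 2))

section basic

variable {a : Fin 3 → ℝ → ℝ} {t : ℝ} {p : Space}

lemma fq_nonneg : 0 ≤ fq a t p := Real.sqrt_nonneg _

lemma fq_sq : fq a t p ^ 2 = ∑ i, (p i / a i t) ^ 2 :=
  Real.sq_sqrt (Finset.sum_nonneg fun _ _ => sq_nonneg _)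

lemma exists_ne_zero_of_ne_zero (hp : p ≠ 0) : ∃ i, p i ≠ 0 := by
  by_contra! h
  exact hp (by ext i; simpa using h i)

lemma fq_pos (ha : ∀ i, 0 < a i t) (hp : p ≠ 0) : 0 < fq a t p := by
  obtain ⟨i, hi⟩ := exists_ne_zero_of_ne_zero hp
  refine Real.sqrt_pos.2 (Finset.sum_pos' (fun _ _ => sq_nonneg _) ⟨i, Finset.mem_univ _, ?_⟩)
  have := (ha i).ne'
  positivity

/-- An ℓ² norm is at most the ℓ¹ norm: the ellipsoid lies in its bounding box. Conversely it
contains its axes (`abs_mul_inv_le_fq`), so the frequency is controlled from both sides by the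
inverse scale factors. -/
lemma fq_le_sum (ha : ∀ i, 0 < a i t) : fq a t p ≤ ∑ i, |p i| * (a i t)⁻¹ := by
  have h0 : ∀ i, 0 ≤ |p i| * (a i t)⁻¹ := fun i => mul_nonneg (abs_nonneg _) (inv_pos.2 (ha i)).le
  refine Real.sqrt_le_iff.2 ⟨Finset.sum_nonneg fun i _ => h0 i, ?_⟩
  have h2 : ∀ i, (p i / a i t) ^ 2 = (|p i| * (a i t)⁻¹) ^ 2 := fun i => by
    rw [mul_pow, sq_abs, ← mul_pow, div_eq_mul_inv]
  simp only [h2, Fin.sum_univ_three]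
  nlinarith [mul_nonneg (h0 0) (h0 1), mul_nonneg (h0 0) (h0 2), mul_nonneg (h0 1) (h0 2)]

lemma abs_mul_inv_le_fq (i : Fin 3) : |p i| * (a i t)⁻¹ ≤ fq a t p := by
  refine Real.le_sqrt_of_sq_le ?_
  have : (|p i| * (a i t)⁻¹) ^ 2 = (p i / a i t) ^ 2 := by
    rw [mul_pow, sq_abs, ← mul_pow, div_eq_mul_inv]
  rw [this]
  exact Finset.single_le_sum (f := fun i => (p i / a i t) ^ 2) (fun _ _ => sq_nonneg _)
    (Finset.mem_univ i)

lemma hk_nonneg (k : Fin 3) : 0 ≤ hk a k t p :=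
  inv_nonneg.2 (mul_nonneg (sq_nonneg _) (pow_nonneg fq_nonneg 3))

lemma hk_pos (ha : ∀ i, 0 < a i t) (hp : p ≠ 0) (k : Fin 3) : 0 < hk a k t p := by
  have := fq_pos ha hp
  have := ha (k + 1)
  have := ha (k + 2)
  unfold hk
  positivity

lemma vol3_pos (ha : ∀ i, 0 < a i t) : 0 < vol3 a t := Finset.prod_pos fun i _ => ha i

lemma curv_nonneg {m : Fin 3 → ℝ} (hm : ∀ k, 0 ≤ m k) : 0 ≤ curv m p :=
  Finset.sum_nonneg fun _ _ => mul_nonneg (sq_nonneg _) (mul_nonneg (hm _) (hm _))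

lemma curv_pos {m : Fin 3 → ℝ} (hm : ∀ k, 0 < m k) (hp : p ≠ 0) : 0 < curv m p := by
  obtain ⟨i, hi⟩ := exists_ne_zero_of_ne_zero hp
  refine Finset.sum_pos' (fun _ _ => mul_nonneg (sq_nonneg _) (mul_nonneg (hm _).le (hm _).le))
    ⟨i, Finset.mem_univ _, ?_⟩
  have h1 := hm (i + 1)
  have h2 := hm (i + 2)
  positivity

lemma curv_mono {m m' : Fin 3 → ℝ} (h0 : ∀ k, 0 ≤ m k) (h : ∀ k, m k ≤ m' k) :
    curv m p ≤ curv m' p :=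
  Finset.sum_le_sum fun _ _ => mul_le_mul_of_nonneg_left
    (mul_le_mul (h _) (h _) (h0 _) ((h0 _).trans (h _))) (sq_nonneg _)

end basic

/-- Scale factors that are continuous and positive at all times. -/
structure IsScale (a : Fin 3 → ℝ → ℝ) : Prop where
  cont : ∀ i, Continuous (a i)
  pos : ∀ i t, 0 < a i t

section regularity

variable {a : Fin 3 → ℝ → ℝ}

lemma continuous_fq (ha : IsScale a) : Continuous fun z : ℝ × Space => fq a z.1 z.2 := by
  unfold fq
  refine Real.continuous_sqrt.comp (continuous_finsetSum _ fun i _ => ?_)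
  refine Continuous.pow (Continuous.div ?_ ((ha.cont i).comp continuous_fst) fun z => (ha.pos i _).ne') 2
  fun_prop

lemma continuousOn_hk (ha : IsScale a) (k : Fin 3) :
    ContinuousOn (fun z : ℝ × Space => hk a k z.1 z.2) (univ ×ˢ {0}ᶜ) := by
  unfold hk
  refine ContinuousOn.inv₀ (Continuous.continuousOn ?_) ?_
  · exact ((((ha.cont _).comp continuous_fst).mul ((ha.cont _).comp continuous_fst)).pow 2).mul
      ((continuous_fq ha).pow 3)
  · rintro ⟨t, p⟩ ⟨-, hp⟩
    have := fq_pos (fun i => ha.pos i t) hp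
    have h1   := ha.pos (k + 1) t
    have h2   := ha.pos (k + 2) t
    positivity

end regularity

end BianchiI

/-! ### Symmetry of the mixed curvature integral of three ellipsoids. -/

namespace BianchiI

open Bianchi Real

/-- The quadratic form `∑ cᵢ pᵢ²` at the unit vector with polar angles `θ, φ`. -/
def polarForm (c : Fin 3 → ℝ) (θ φ : ℝ) : ℝ :=
  c 0 * (sin θ ^ 2 * cos φ ^ 2) + c 1 * (sin θ ^ 2 * sin φ ^ 2) + c 2 * cos θ ^ 2

lemma polarForm_pos {c : Fin 3 → ℝ} (hc : ∀ i, 0 < c i) (θ φ : ℝ) : 0 < polarForm c θ φ := by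
  unfold polarForm
  have h0 := hc 0; have h1 := hc 1; have h2 := hc 2
  have e1 := sin_sq_add_cos_sq θ
  have e2 := sin_sq_add_cos_sq φ
  by_cases h : sin θ = 0
  · have : cos θ ^ 2 = 1 := by rw [h] at e1; linarith
    rw [this, h]; simpa using h2
  · have h3 : 0 < sin θ ^ 2 := by positivity
    have h4 : 0 < c 0 * cos φ ^ 2 + c 1 * sin φ ^ 2 := by
      by_cases h' : sin φ = 0
      · have : cos φ ^ 2 = 1 := by rw [h'] at e2; linarith
        rw [this, h']; simpa using h0
      · have : 0 < sin φ ^ 2 := by positivity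
        positivity
    have : 0 < sin θ ^ 2 * (c 0 * cos φ ^ 2 + c 1 * sin φ ^ 2) := by positivity
    have h5 : 0 ≤ c 2 * cos θ ^ 2 := by positivity
    linarith

lemma hasDerivAt_inv_sqrt_mul {F G H : ℝ → ℝ} {F' G' H' x : ℝ} (hF : HasDerivAt F F' x)
    (hG : HasDerivAt G G' x) (hH : HasDerivAt H H' x) (pF : 0 < F x) (pG : 0 < G x)
    (pH : 0 < H x) :
    HasDerivAt (fun y => (√(F y) * √(G y) * √(H y) ^ 3)⁻¹)
      (-(√(F x) * √(G x) * √(H x) ^ 3)⁻¹ *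
        (F' / (2 * F x) + G' / (2 * G x) + 3 * H' / (2 * H x))) x := by
  have h := (((hF.sqrt pF.ne').mul (hG.sqrt pG.ne')).mul ((hH.sqrt pH.ne').pow 3)).inv
    (by have := sqrt_pos.2 pF; have := sqrt_pos.2 pG; have := sqrt_pos.2 pH
        simp only [Pi.mul_apply, Pi.pow_apply]; positivity)
  refine h.congr_deriv ?_
  simp only [Pi.mul_apply, Pi.pow_apply]
  have eF := sq_sqrt pF.le
  have eG := sq_sqrt pG.le
  have eH := sq_sqrt pH.le
  have := sqrt_pos.2 pF; have := sqrt_pos.2 pG; have := sqrt_pos.2 pH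
  set f := √(F x); set g := √(G x); set k := √(H x)
  rw [← eF, ← eG, ← eH]
  field_simp
  ring

/-- With `S = sin² θ` and `σ = sin² φ` the squared coordinates are `S(1-σ)`, `Sσ`, `1-S`. The left
side pairs the polar components of the field `x_i y_i` with those of half the gradient of `∑ c_i
x_i²`; the right side is the Cartesian pairing minus its radial part. -/
lemma tangential_pairing (S σ y0 y1 y2 c0 c1 c2 : ℝ) :
    S * (1 - S) * (y0 * (1 - σ) + y1 * σ - y2) * (c0 * (1 - σ) + c1 * σ - c2) +
        σ * (1 - σ) * (y1 - y0) * (S * (c1 - c0)) =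
      (S * (1 - σ) * y0 * c0 + S * σ * y1 * c1 + (1 - S) * y2 * c2) -
        (c0 * (S * (1 - σ)) + c1 * (S * σ) + c2 * (1 - S)) *
          (S * (1 - σ) * y0 + S * σ * y1 + (1 - S) * y2) := by ring

/-- Numerator of the mixed curvature function of two quadratic forms. -/
def mixNum (e d : Fin 3 → ℝ) (θ φ : ℝ) : ℝ :=
  sin θ ^ 2 * cos φ ^ 2 * (e 2 * e 0 * (d 0 * d 1) + e 0 * e 1 * (d 2 * d 0)) +
    sin θ ^ 2 * sin φ ^ 2 * (e 0 * e 1 * (d 1 * d 2) + e 1 * e 2 * (d 0 * d 1)) +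
    cos θ ^ 2 * (e 1 * e 2 * (d 2 * d 0) + e 2 * e 0 * (d 1 * d 2))

/-- Algebraic core of the divergence identity. Each `y_i` is the cofactor of the form `d` times `F
e_i - G c_i`; the left side is `F G` times the ambient divergence of the weighted field `x_i y_i`,
up to the weight. -/
lemma mixNum_identity (S σ c0 c1 c2 e0 e1 e2 d0 d1 d2 F G y0 y1 y2 : ℝ)
    (hF : F = c0 * (S * (1 - σ)) + c1 * (S * σ) + c2 * (1 - S))
    (hG : G = e0 * (S * (1 - σ)) + e1 * (S * σ) + e2 * (1 - S))
    (h0 : y0 = d1 * d2 * (F * e0 - G * c0)) (h1 : y1 = d2 * d0 * (F * e1 - G * c1))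
    (h2 : y2 = d0 * d1 * (F * e2 - G * c2)) :
    F * G * (y0 + y1 + y2) - G * (S * (1 - σ) * y0 * c0 + S * σ * y1 * c1 + (1 - S) * y2 * c2) -
        F * (S * (1 - σ) * y0 * e0 + S * σ * y1 * e1 + (1 - S) * y2 * e2) =
      F ^ 2 * (S * (1 - σ) * (e2 * e0 * (d0 * d1) + e0 * e1 * (d2 * d0)) +
          S * σ * (e0 * e1 * (d1 * d2) + e1 * e2 * (d0 * d1)) +
          (1 - S) * (e1 * e2 * (d2 * d0) + e2 * e0 * (d1 * d2))) -
        G ^ 2 * (S * (1 - σ) * (c2 * c0 * (d0 * d1) + c0 * c1 * (d2 * d0)) +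
          S * σ * (c0 * c1 * (d1 * d2) + c1 * c2 * (d0 * d1)) +
          (1 - S) * (c1 * c2 * (d2 * d0) + c2 * c0 * (d1 * d2))) := by
  subst h0 h1 h2
  subst hF hG
  ring

lemma continuous_polarForm (c : Fin 3 → ℝ) :
    Continuous fun z : ℝ × ℝ => polarForm c z.1 z.2 := by
  unfold polarForm; fun_prop

/-- Passage from the ambient to the polar divergence. The radial terms cancel: `-3B` and `2P = -2B`
from the field against `5B` from the exponents 1, 1, 3 of the weight. -/
lemma mixNum_combine (K : ℝ) {f g Y AF AG LF LG LH B P Xe Xc : ℝ} {h : ℝ} (hf : 0 < f)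
    (hg : 0 < g) (tF : LF / f = AF / f - B) (tG : LG / g = AG / g - B) (tH : LH / h = 0 / h - B)
    (I : f * g * Y - g * AF - f * AG = f ^ 2 * Xe - g ^ 2 * Xc) (hP : P = -B) :
    K * (f / g * Xe - g / f * Xc) =
      K * ((Y - 3 * B) + 2 * P - (LF / f + LG / g + 3 * (LH / h))) := by
  have h1 : f / g * Xe - g / f * Xc = Y - AF / f - AG / g := by
    field_simp
    linear_combination -I
  rw [h1, tF, tG, tH, hP]
  ring

/-- `∫ f D(g, h) = ∫ g D(f, h)` over the unit sphere, for the mixed curvature function `D` of three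
norms `f, g, h` given by diagonal quadratic forms: the difference is a divergence. -/
theorem integral_mixed_sub_eq_zero {c e d : Fin 3 → ℝ} (hc : ∀ i, 0 < c i) (he : ∀ i, 0 < e i)
    (hd : ∀ i, 0 < d i) :
    ∫ θ in (0 : ℝ)..π, ∫ φ in (0 : ℝ)..(2 * π), sin θ *
      (√(polarForm c θ φ) / (√(polarForm e θ φ) ^ 3 * √(polarForm d θ φ) ^ 3) * mixNum e d θ φ -
       √(polarForm e θ φ) / (√(polarForm c θ φ) ^ 3 * √(polarForm d θ φ) ^ 3) * mixNum c d θ φ)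
      = 0 := by
  set F := polarForm c with hFd
  set G := polarForm e with hGd
  set H := polarForm d with hHd
  have pF : ∀ θ φ, 0 < F θ φ := polarForm_pos hc
  have pG : ∀ θ φ, 0 < G θ φ := polarForm_pos he
  have pH : ∀ θ φ, 0 < H θ φ := polarForm_pos hd
  -- The integrand is recognised as the divergence of an explicit tangential field with Cartesian
  -- data `y0, y1, y2` and weight `r`. `DU` and `DW` are the derivatives of its polar flux
  -- components.
  let r : ℝ → ℝ → ℝ := fun θ φ => (√(F θ φ) * √(G θ φ) * √(H θ φ) ^ 3)⁻¹
  let y0 : ℝ → ℝ → ℝ := fun θ φ => d 1 * d 2 * (F θ φ * e 0 - G θ φ * c 0)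
  let y1 : ℝ → ℝ → ℝ := fun θ φ => d 2 * d 0 * (F θ φ * e 1 - G θ φ * c 1)
  let y2 : ℝ → ℝ → ℝ := fun θ φ => d 0 * d 1 * (F θ φ * e 2 - G θ φ * c 2)
  let Ds : (Fin 3 → ℝ) → ℝ → ℝ := fun c φ => c 0 * cos φ ^ 2 + c 1 * sin φ ^ 2 - c 2
  let N : ℝ → ℝ → ℝ := fun θ φ => y0 θ φ * cos φ ^ 2 + y1 θ φ * sin φ ^ 2 - y2 θ φ
  let Ns : ℝ → ℝ := fun φ => d 1 * d 2 * (Ds c φ * e 0 - Ds e φ * c 0) * cos φ ^ 2 +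
    d 2 * d 0 * (Ds c φ * e 1 - Ds e φ * c 1) * sin φ ^ 2 -
    d 0 * d 1 * (Ds c φ * e 2 - Ds e φ * c 2)
  let Ls : ℝ → ℝ → ℝ := fun θ φ =>
    Ds c φ / (2 * F θ φ) + Ds e φ / (2 * G θ φ) + 3 * Ds d φ / (2 * H θ φ)
  let Dp : (Fin 3 → ℝ) → ℝ → ℝ := fun c θ => sin θ ^ 2 * (c 1 - c 0)
  let Np : ℝ → ℝ := fun θ => d 2 * d 0 * (Dp c θ * e 1 - Dp e θ * c 1) -
    d 1 * d 2 * (Dp c θ * e 0 - Dp e θ * c 0)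
  let Lp : ℝ → ℝ → ℝ := fun θ φ =>
    Dp c θ / (2 * F θ φ) + Dp e θ / (2 * G θ φ) + 3 * Dp d θ / (2 * H θ φ)
  let DU : ℝ → ℝ → ℝ := fun θ φ => sin θ * r θ φ * ((2 * cos θ ^ 2 - sin θ ^ 2) * N θ φ +
    2 * sin θ ^ 2 * cos θ ^ 2 * (Ns φ - N θ φ * Ls θ φ))
  let DW : ℝ → ℝ → ℝ := fun θ φ => sin θ * r θ φ *
    ((cos φ ^ 2 - sin φ ^ 2) * (y1 θ φ - y0 θ φ) +
    2 * sin φ ^ 2 * cos φ ^ 2 * (Np θ - (y1 θ φ - y0 θ φ) * Lp θ φ))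
  have dθ : ∀ (c : Fin 3 → ℝ) θ φ, HasDerivAt (fun θ => polarForm c θ φ)
      (2 * sin θ * cos θ * Ds c φ) θ := by
    intro c θ φ
    have h1 := (hasDerivAt_sin θ).pow 2
    have h2 := (hasDerivAt_cos θ).pow 2
    have := (((h1.mul_const (cos φ ^ 2)).const_mul (c 0)).add
      ((h1.mul_const (sin φ ^ 2)).const_mul (c 1))).add (h2.const_mul (c 2))
    refine (this.congr_deriv ?_)
    simp only [Ds]; push_cast; ring
  have dφ : ∀ (c : Fin 3 → ℝ) θ φ, HasDerivAt (fun φ => polarForm c θ φ)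
      (2 * sin φ * cos φ * Dp c θ) φ := by
    intro c θ φ
    have h1 := (hasDerivAt_sin φ).pow 2
    have h2 := (hasDerivAt_cos φ).pow 2
    have := (((h2.const_mul (sin θ ^ 2)).const_mul (c 0)).add
      ((h1.const_mul (sin θ ^ 2)).const_mul (c 1))).add_const (c 2 * cos θ ^ 2)
    refine (this.congr_deriv ?_)
    simp only [Dp]; push_cast; ring
  have hU : ∀ θ φ, HasDerivAt (fun θ => sin θ ^ 2 * cos θ * (N θ φ * r θ φ)) (DU θ φ) θ := by
    intro θ φ
    have hr := hasDerivAt_inv_sqrt_mul (dθ c θ φ) (dθ e θ φ) (dθ d θ φ) (pF θ φ) (pG θ φ) (pH θ φ)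
    have hy : ∀ (k : ℝ) (i : Fin 3), HasDerivAt (fun θ => k * (F θ φ * e i - G θ φ * c i)) _ θ :=
      fun k i => (((dθ c θ φ).mul_const (e i)).sub ((dθ e θ φ).mul_const (c i))).const_mul k
    have hN := (((hy (d 1 * d 2) 0).mul_const (cos φ ^ 2)).add
      ((hy (d 2 * d 0) 1).mul_const (sin φ ^ 2))).sub (hy (d 0 * d 1) 2)
    have h1 := ((hasDerivAt_sin θ).pow 2).mul (hasDerivAt_cos θ)
    refine (h1.mul (hN.mul hr)).congr_deriv ?_
    simp only [DU, N, Ns, Ls, r, y0, y1, y2, hFd, hGd, hHd, Pi.mul_apply, Pi.pow_apply,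
      Pi.add_apply, Pi.sub_apply]
    push_cast
    ring
  have hW : ∀ θ φ, HasDerivAt (fun φ => sin θ * (sin φ * cos φ) * ((y1 θ φ - y0 θ φ) * r θ φ))
      (DW θ φ) φ := by
    intro θ φ
    have hr := hasDerivAt_inv_sqrt_mul (dφ c θ φ) (dφ e θ φ) (dφ d θ φ) (pF θ φ) (pG θ φ) (pH θ φ)
    have hy : ∀ (k : ℝ) (i : Fin 3), HasDerivAt (fun φ => k * (F θ φ * e i - G θ φ * c i)) _ φ :=
      fun k i => (((dφ c θ φ).mul_const (e i)).sub ((dφ e θ φ).mul_const (c i))).const_mul k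
    have hN := (hy (d 2 * d 0) 1).sub (hy (d 1 * d 2) 0)
    have h1 := ((hasDerivAt_sin φ).mul (hasDerivAt_cos φ)).const_mul (sin θ)
    refine (h1.mul (hN.mul hr)).congr_deriv ?_
    simp only [DW, Np, Lp, r, y0, y1, hFd, hGd, hHd, Pi.mul_apply, Pi.sub_apply]
    ring
  have key : ∀ θ φ, sin θ *
      (√(F θ φ) / (√(G θ φ) ^ 3 * √(H θ φ) ^ 3) * mixNum e d θ φ -
       √(G θ φ) / (√(F θ φ) ^ 3 * √(H θ φ) ^ 3) * mixNum c d θ φ) = DU θ φ + DW θ φ := by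
    intro θ φ
    have hS : cos θ ^ 2 = 1 - sin θ ^ 2 := cos_sq' θ
    have hσ : cos φ ^ 2 = 1 - sin φ ^ 2 := cos_sq' φ
    have eF := sq_sqrt (pF θ φ).le
    have eG := sq_sqrt (pG θ φ).le
    have qF := sqrt_pos.2 (pF θ φ); have qG := sqrt_pos.2 (pG θ φ)
    have qH := sqrt_pos.2 (pH θ φ)
    have p1 := pF θ φ; have p2 := pG θ φ; have p3 := pH θ φ
    have e1 : √(F θ φ) / (√(G θ φ) ^ 3 * √(H θ φ) ^ 3) = r θ φ * (F θ φ / G θ φ) := by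
      simp only [r]
      nth_rewrite 3 [← eF]; nth_rewrite 3 [← eG]
      field_simp
    have e2 : √(G θ φ) / (√(F θ φ) ^ 3 * √(H θ φ) ^ 3) = r θ φ * (G θ φ / F θ φ) := by
      simp only [r]
      nth_rewrite 3 [← eF]; nth_rewrite 3 [← eG]
      field_simp
    have vF : F θ φ = c 0 * (sin θ ^ 2 * (1 - sin φ ^ 2)) + c 1 * (sin θ ^ 2 * sin φ ^ 2) +
        c 2 * (1 - sin θ ^ 2) := by rw [hFd, polarForm, hS, hσ]
    have vG : G θ φ = e 0 * (sin θ ^ 2 * (1 - sin φ ^ 2)) + e 1 * (sin θ ^ 2 * sin φ ^ 2) +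
        e 2 * (1 - sin θ ^ 2) := by rw [hGd, polarForm, hS, hσ]
    have vH : H θ φ = d 0 * (sin θ ^ 2 * (1 - sin φ ^ 2)) + d 1 * (sin θ ^ 2 * sin φ ^ 2) +
        d 2 * (1 - sin θ ^ 2) := by rw [hHd, polarForm, hS, hσ]
    have I := mixNum_identity (sin θ ^ 2) (sin φ ^ 2) (c 0) (c 1) (c 2) (e 0) (e 1) (e 2) (d 0)
      (d 1) (d 2) (F θ φ) (G θ φ) (y0 θ φ) (y1 θ φ) (y2 θ φ) vF vG rfl rfl rfl
    have tp := fun c : Fin 3 → ℝ => tangential_pairing (sin θ ^ 2) (sin φ ^ 2) (y0 θ φ) (y1 θ φ)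
      (y2 θ φ) (c 0) (c 1) (c 2)
    have tF := tp c; have tG := tp e; have tH := tp d
    rw [← vF] at tF; rw [← vG] at tG; rw [← vH] at tH
    have hN1 := tangential_pairing (sin θ ^ 2) (sin φ ^ 2) (d 1 * d 2 * e 0) (d 2 * d 0 * e 1)
      (d 0 * d 1 * e 2) (c 0) (c 1) (c 2)
    have hN2 := tangential_pairing (sin θ ^ 2) (sin φ ^ 2) (d 1 * d 2 * c 0) (d 2 * d 0 * c 1)
      (d 0 * d 1 * c 2) (e 0) (e 1) (e 2)
    rw [← vF] at hN1; rw [← vG] at hN2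
    -- The cofactors make the field tangent to the level sets of `H`, so the factor `H` of the
    -- weight contributes only through the radial correction.
    have z : sin θ ^ 2 * (1 - sin φ ^ 2) * y0 θ φ * d 0 + sin θ ^ 2 * sin φ ^ 2 * y1 θ φ * d 1 +
        (1 - sin θ ^ 2) * y2 θ φ * d 2 = 0 := by
      simp only [y0, y1, y2]; rw [vF, vG]; ring
    rw [z] at tH
    rw [e1, e2]
    simp only [DU, DW, Ns, Np, Ls, Lp, N, Ds, Dp, mixNum]
    rw [hS, hσ]
    set S := sin θ ^ 2
    set σ := sin φ ^ 2
    have hBn : S * (1 - σ) * y0 θ φ + S * σ * y1 θ φ + (1 - S) * y2 θ φ =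
        F θ φ * (S * (1 - σ) * (d 1 * d 2 * e 0) + S * σ * (d 2 * d 0 * e 1) +
        (1 - S) * (d 0 * d 1 * e 2)) - G θ φ * (S * (1 - σ) * (d 1 * d 2 * c 0) +
        S * σ * (d 2 * d 0 * c 1) + (1 - S) * (d 0 * d 1 * c 2)) := by
      simp only [y0, y1, y2]; ring
    generalize y0 θ φ = Y0 at *
    generalize y1 θ φ = Y1 at *
    generalize y2 θ φ = Y2 at *
    generalize F θ φ = f at *
    generalize G θ φ = g at *
    generalize H θ φ = h at *
    generalize r θ φ = ρ at *
    clear vF vG vH tp eF eG qF qG qH e1 e2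
    have dv : ∀ {x l m n : ℝ}, 0 < x → l = m - x * n → l / x = m / x - n := by
      intro x l m n hx h
      field_simp; linarith
    have hP : S * (1 - S) * (d 1 * d 2 * e 0 * (1 - σ) + d 2 * d 0 * e 1 * σ - d 0 * d 1 * e 2) *
          (c 0 * (1 - σ) + c 1 * σ - c 2) +
        σ * (1 - σ) * (d 2 * d 0 * e 1 - d 1 * d 2 * e 0) * (S * (c 1 - c 0)) -
        (S * (1 - S) * (d 1 * d 2 * c 0 * (1 - σ) + d 2 * d 0 * c 1 * σ - d 0 * d 1 * c 2) *
          (e 0 * (1 - σ) + e 1 * σ - e 2) +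
        σ * (1 - σ) * (d 2 * d 0 * c 1 - d 1 * d 2 * c 0) * (S * (e 1 - e 0))) =
        -(S * (1 - σ) * Y0 + S * σ * Y1 + (1 - S) * Y2) := by
      rw [hN1, hN2, hBn]; ring
    have fin := mixNum_combine (sin θ * ρ) p1 p2 (dv p1 tF) (dv p2 tG) (dv p3 tH) I hP
    linear_combination fin
  have cF : Continuous fun z : ℝ × ℝ => F z.1 z.2 := continuous_polarForm c
  have cG : Continuous fun z : ℝ × ℝ => G z.1 z.2 := continuous_polarForm e
  have cH : Continuous fun z : ℝ × ℝ => H z.1 z.2 := continuous_polarForm d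
  have cr : Continuous fun z : ℝ × ℝ => r z.1 z.2 := by
    refine Continuous.inv₀ (by fun_prop) fun z => ?_
    have := sqrt_pos.2 (pF z.1 z.2); have := sqrt_pos.2 (pG z.1 z.2)
    have := sqrt_pos.2 (pH z.1 z.2)
    positivity
  have cL : ∀ (x y z : ℝ × ℝ → ℝ), Continuous x → Continuous y → Continuous z →
      Continuous fun w : ℝ × ℝ =>
        x w / (2 * F w.1 w.2) + y w / (2 * G w.1 w.2) + 3 * z w / (2 * H w.1 w.2) := by
    intro x y z hx hy hz
    refine ((hx.div (by fun_prop) fun w => ?_).add (hy.div (by fun_prop) fun w => ?_)).add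
      (((continuous_const.mul hz)).div (by fun_prop) fun w => ?_)
    · have := pF w.1 w.2; positivity
    · have := pG w.1 w.2; positivity
    · have := pH w.1 w.2; positivity
  have cLs : Continuous fun z : ℝ × ℝ => Ls z.1 z.2 :=
    cL (fun z => Ds c z.2) (fun z => Ds e z.2) (fun z => Ds d z.2) (by fun_prop) (by fun_prop)
      (by fun_prop)
  have cLp : Continuous fun z : ℝ × ℝ => Lp z.1 z.2 :=
    cL (fun z => Dp c z.1) (fun z => Dp e z.1) (fun z => Dp d z.1) (by fun_prop) (by fun_prop)
      (by fun_prop)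
  have cDU : Continuous fun z : ℝ × ℝ => DU z.1 z.2 := by fun_prop
  have cDW : Continuous fun z : ℝ × ℝ => DW z.1 z.2 := by fun_prop
  simp only [key]
  -- Both boundary terms vanish by themselves: the `φ`-flux carries `sin φ`, zero at `0` and `2π`,
  -- and the `θ`-flux carries `sin² θ`, zero at the poles.
  have hWi : ∀ θ, ∫ φ in (0 : ℝ)..(2 * π), DW θ φ = 0 := by
    intro θ
    rw [intervalIntegral.integral_eq_sub_of_hasDerivAt (fun φ _ => hW θ φ)
      ((by fun_prop : Continuous fun φ => DW θ φ).intervalIntegrable _ _)]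
    simp
  have hUi : ∀ φ, ∫ θ in (0 : ℝ)..π, DU θ φ = 0 := by
    intro φ
    rw [intervalIntegral.integral_eq_sub_of_hasDerivAt (fun θ _ => hU θ φ)
      ((by fun_prop : Continuous fun θ => DU θ φ).intervalIntegrable _ _)]
    simp
  have hsplit : ∀ θ, ∫ φ in (0 : ℝ)..(2 * π), (DU θ φ + DW θ φ) =
      ∫ φ in (0 : ℝ)..(2 * π), DU θ φ := by
    intro θ
    rw [intervalIntegral.integral_add
      ((by fun_prop : Continuous fun φ => DU θ φ).intervalIntegrable _ _)
      ((by fun_prop : Continuous fun φ => DW θ φ).intervalIntegrable _ _), hWi, add_zero]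
  simp only [hsplit]
  rw [intervalIntegral_intervalIntegral_swap]
  · simp [hUi]
  · exact cDU.continuousOn.integrableOn_compact (isCompact_uIcc.prod isCompact_uIcc) |>.mono_set
      (prod_mono uIoc_subset_uIcc uIoc_subset_uIcc)

end BianchiI

namespace BianchiI

open Bianchi

/-! ### The area measure of the unit sphere -/

/-- The unit vector with given polar angles, as a function of the pair of angles. -/
def dirMap (w : ℝ × ℝ) : Space := dir w.1 w.2

/-- The area element of the unit sphere in polar angles. -/
def angleMeasure : Measure (ℝ × ℝ) :=
  ((volume.restrict (Ioc 0 Real.pi)).prod (volume.restrict (Ioc 0 (2 * Real.pi)))).withDensity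
    fun w => ENNReal.ofReal (Real.sin w.1)

/-- The area measure of the unit sphere, as a measure on space. -/
def sph : Measure Space := angleMeasure.map dirMap

lemma continuous_dirMap : Continuous dirMap := by
  refine (PiLp.continuous_toLp 2 _).comp (continuous_pi fun i => ?_)
  fin_cases i <;> simp <;> fun_prop

lemma measurable_dirMap : Measurable dirMap := continuous_dirMap.measurable

lemma dir_sq_sum (θ φ : ℝ) : ∑ i, dir θ φ i ^ 2 = 1 := by
  simp [dir, Fin.sum_univ_three]
  have := Real.sin_sq_add_cos_sq θ
  have h2 := Real.sin_sq_add_cos_sq φ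
  linear_combination this + Real.sin θ ^ 2 * h2

lemma norm_dir (θ φ : ℝ) : ‖dir θ φ‖ = 1 := by
  rw [EuclideanSpace.norm_eq]
  simp only [Real.norm_eq_abs, sq_abs, dir_sq_sum, Real.sqrt_one]

lemma sum_sq_of_norm {p : Space} (hp : ‖p‖ = 1) : ∑ i, p i ^ 2 = 1 := by
  have := EuclideanSpace.norm_sq_eq p
  rw [hp] at this
  simpa using this.symm

lemma abs_le_one_of_norm {p : Space} (hp : ‖p‖ = 1) (i : Fin 3) : |p i| ≤ 1 := by
  rw [← hp]; simpa using PiLp.norm_apply_le p i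

lemma ne_zero_of_norm {p : Space} (hp : ‖p‖ = 1) : p ≠ 0 := by
  rintro rfl; simp at hp

instance : IsFiniteMeasure angleMeasure := by
  refine isFiniteMeasure_withDensity_ofReal ?_
  have : Integrable (fun w : ℝ × ℝ => Real.sin w.1)
      ((volume.restrict (Ioc 0 Real.pi)).prod (volume.restrict (Ioc 0 (2 * Real.pi)))) := by
    refine Integrable.of_bound (by fun_prop) 1 (Eventually.of_forall fun w => ?_)
    simpa using Real.abs_sin_le_one w.1
  exact this.2

instance : IsFiniteMeasure sph := by unfold sph; infer_instance

lemma ae_sph_norm : ∀ᵐ p ∂sph, ‖p‖ = 1 := by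
  unfold sph
  rw [ae_map_iff measurable_dirMap.aemeasurable (measurableSet_eq_fun (by fun_prop) (by fun_prop))]
  exact Eventually.of_forall fun w => norm_dir _ _

lemma sph_restrict : sph.restrict ({0}ᶜ : Set Space) = sph :=
  Measure.restrict_eq_self_of_ae_mem (ae_sph_norm.mono fun _ hp => ne_zero_of_norm hp)

lemma aestronglyMeasurable_sph {f : Space → ℝ} (hf : ContinuousOn f {0}ᶜ) :
    AEStronglyMeasurable f sph := by
  rw [← sph_restrict]
  exact hf.aestronglyMeasurable isOpen_compl_singleton.measurableSet

lemma exists_bound_sphere {f : Space → ℝ} (hf : ContinuousOn f {0}ᶜ) :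
    ∃ C, ∀ p : Space, ‖p‖ = 1 → |f p| ≤ C := by
  obtain ⟨C, hC⟩ := (isCompact_sphere (0 : Space) 1).exists_bound_of_continuousOn
    (hf.mono fun p hp => ne_zero_of_norm (by simpa using hp))
  exact ⟨C, fun p hp => hC p (by simpa using hp)⟩

lemma integrable_sph {f : Space → ℝ} (hf : ContinuousOn f {0}ᶜ) : Integrable f sph := by
  obtain ⟨C, hC⟩ := exists_bound_sphere hf
  exact Integrable.of_bound (aestronglyMeasurable_sph hf) C
    (ae_sph_norm.mono fun p hp => hC p hp)

lemma integral_angleMeasure {g : ℝ × ℝ → ℝ} (hg : Continuous g) :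
    ∫ w, g w ∂angleMeasure =
      ∫ θ in (0 : ℝ)..Real.pi, ∫ φ in (0 : ℝ)..(2 * Real.pi), Real.sin θ * g (θ, φ) := by
  have hpi := Real.pi_pos
  have h1 : ∫ w, g w ∂angleMeasure = ∫ w in Ioc 0 Real.pi ×ˢ Ioc 0 (2 * Real.pi),
      Real.sin w.1 * g w := by
    unfold angleMeasure
    rw [integral_withDensity_eq_integral_toReal_smul (by fun_prop)
      (Eventually.of_forall fun _ => ENNReal.ofReal_lt_top), Measure.prod_restrict]
    refine setIntegral_congr_fun (measurableSet_Ioc.prod measurableSet_Ioc) fun w hw => ?_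
    simp only [smul_eq_mul]
    rw [ENNReal.toReal_ofReal (Real.sin_nonneg_of_nonneg_of_le_pi hw.1.1.le hw.1.2)]
  rw [h1]
  rw [Measure.volume_eq_prod, setIntegral_prod]
  · rw [intervalIntegral.integral_of_le hpi.le]
    refine setIntegral_congr_fun measurableSet_Ioc fun θ _ => ?_
    rw [intervalIntegral.integral_of_le (by positivity)]
  · refine IntegrableOn.mono_set (t := Icc 0 Real.pi ×ˢ Icc 0 (2 * Real.pi)) ?_
      (prod_mono Ioc_subset_Icc_self Ioc_subset_Icc_self)
    rw [← Measure.volume_eq_prod]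
    exact Continuous.continuousOn (by fun_prop) |>.integrableOn_compact
      (isCompact_Icc.prod isCompact_Icc)

lemma integral_sph {f : Space → ℝ} (hf : ContinuousOn f {0}ᶜ) :
    ∫ p, f p ∂sph = ∫ θ in (0 : ℝ)..Real.pi, ∫ φ in (0 : ℝ)..(2 * Real.pi),
      Real.sin θ * f (dir θ φ) := by
  have := aestronglyMeasurable_sph hf
  unfold sph at this ⊢
  rw [integral_map measurable_dirMap.aemeasurable this]
  exact integral_angleMeasure
    (hf.comp_continuous continuous_dirMap fun w => ne_zero_of_norm (norm_dir _ _))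

/-- Directions off the coordinate planes have full measure. Any two of them are comparable in the
sense of `Near`, which later carries integrability from one direction to all of them. -/
lemma ae_sph_coord_ne : ∀ᵐ p ∂sph, ∀ i, p i ≠ 0 := by
  have hs : ∀ᵐ y : ℝ, Real.sin y ≠ 0 := by
    refine Set.Countable.ae_notMem (s := {y | Real.sin y = 0}) ?_ volume
    refine (countable_range fun n : ℤ => (n : ℝ) * Real.pi).mono fun y hy => ?_
    obtain ⟨n, hn⟩ := Real.sin_eq_zero_iff.1 hy
    exact ⟨n, hn⟩
  have hc : ∀ᵐ y : ℝ, Real.cos y ≠ 0 := by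
    refine Set.Countable.ae_notMem (s := {y | Real.cos y = 0}) ?_ volume
    refine (countable_range fun n : ℤ => (2 * (n : ℝ) + 1) * Real.pi / 2).mono fun y hy => ?_
    obtain ⟨n, hn⟩ := Real.cos_eq_zero_iff.1 hy
    exact ⟨n, hn.symm⟩
  unfold sph
  rw [ae_map_iff measurable_dirMap.aemeasurable (by
    simp only [ofPred_forall]
    refine MeasurableSet.iInter fun i => ?_
    exact (measurableSet_eq_fun (by fun_prop) measurable_const).compl)]
  refine (withDensity_absolutelyContinuous _ _).ae_le ?_
  rw [Measure.prod_restrict]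
  refine ae_restrict_of_ae ?_
  have h1 : ∀ᵐ w : ℝ × ℝ ∂(volume.prod volume), Real.sin w.1 ≠ 0 ∧ Real.cos w.1 ≠ 0 :=
    Measure.quasiMeasurePreserving_fst.ae (hs.and hc)
  have h2 : ∀ᵐ w : ℝ × ℝ ∂(volume.prod volume), Real.sin w.2 ≠ 0 ∧ Real.cos w.2 ≠ 0 :=
    Measure.quasiMeasurePreserving_snd.ae (hs.and hc)
  filter_upwards [h1, h2] with w h1 h2 i
  fin_cases i <;> simp [dirMap, dir, h1.1, h1.2, h2.1, h2.2]

end BianchiI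

namespace BianchiI

open Bianchi

/-! ### Mixed volumes of ellipsoids -/

/-- Support function of an ellipsoid. -/
def nf (c : Fin 3 → ℝ) (p : Space) : ℝ := √(∑ i, c i * p i ^ 2)

/-- Weights of the Hessian of `nf`. -/
def hw (c : Fin 3 → ℝ) (k : Fin 3) (p : Space) : ℝ := c (k + 1) * c (k + 2) / nf c p ^ 3

/-- Twice the mixed curvature function of two ellipsoids. -/
def mixW (e d : Fin 3 → ℝ) (p : Space) : ℝ :=
  ∑ n, p n ^ 2 * (hw e (n + 1) p * hw d (n + 2) p + hw e (n + 2) p * hw d (n + 1) p)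

/-- Six times the mixed volume of three ellipsoids. -/
def mv (c e d : Fin 3 → ℝ) : ℝ := ∫ p, nf c p * mixW e d p ∂sph

section

variable {c e d : Fin 3 → ℝ} {p : Space}

lemma nf_nonneg : 0 ≤ nf c p := Real.sqrt_nonneg _

lemma nf_pos (hc : ∀ i, 0 < c i) (hp : p ≠ 0) : 0 < nf c p := by
  obtain ⟨i, hi⟩ := exists_ne_zero_of_ne_zero hp
  refine Real.sqrt_pos.2 (Finset.sum_pos' (fun i _ => mul_nonneg (hc i).le (sq_nonneg _))
    ⟨i, Finset.mem_univ _, ?_⟩)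
  have := hc i
  positivity

lemma nf_sq (hc : ∀ i, 0 < c i) : nf c p ^ 2 = ∑ i, c i * p i ^ 2 :=
  Real.sq_sqrt (Finset.sum_nonneg fun i _ => mul_nonneg (hc i).le (sq_nonneg _))

lemma hw_nonneg (hc : ∀ i, 0 < c i) (k : Fin 3) : 0 ≤ hw c k p :=
  div_nonneg (mul_pos (hc _) (hc _)).le (pow_nonneg nf_nonneg 3)

lemma mixW_nonneg (he : ∀ i, 0 < e i) (hd : ∀ i, 0 < d i) : 0 ≤ mixW e d p :=
  Finset.sum_nonneg fun _ _ => mul_nonneg (sq_nonneg _) (add_nonneg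
    (mul_nonneg (hw_nonneg he _) (hw_nonneg hd _)) (mul_nonneg (hw_nonneg he _) (hw_nonneg hd _)))

lemma mixW_comm : mixW e d p = mixW d e p := Finset.sum_congr rfl fun _ _ => by ring

lemma continuous_nf : Continuous (nf c) := by unfold nf; fun_prop

lemma continuousOn_hw (hc : ∀ i, 0 < c i) (k : Fin 3) : ContinuousOn (hw c k) {0}ᶜ :=
  continuousOn_const.div (continuous_nf.continuousOn.pow 3) fun _ hp =>
    (pow_pos (nf_pos hc hp) 3).ne'

lemma continuousOn_mixW (he : ∀ i, 0 < e i) (hd : ∀ i, 0 < d i) :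
    ContinuousOn (mixW e d) {0}ᶜ := by
  unfold mixW
  refine continuousOn_finsetSum _ fun n _ => ContinuousOn.mul (by fun_prop) ?_
  exact ((continuousOn_hw he _).mul (continuousOn_hw hd _)).add
    ((continuousOn_hw he _).mul (continuousOn_hw hd _))

lemma integrable_mv (he : ∀ i, 0 < e i) (hd : ∀ i, 0 < d i) {f : Space → ℝ} (hf : Continuous f) :
    Integrable (fun p => f p * mixW e d p) sph :=
  integrable_sph (hf.continuousOn.mul (continuousOn_mixW he hd))

lemma nf_dir (θ φ : ℝ) : nf c (dir θ φ) = √(polarForm c θ φ) := by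
  unfold nf polarForm
  congr 1
  simp [Fin.sum_univ_three, dir]
  ring

lemma mixW_dir (θ φ : ℝ) : mixW e d (dir θ φ) =
    mixNum e d θ φ / (√(polarForm e θ φ) ^ 3 * √(polarForm d θ φ) ^ 3) := by
  simp only [mixW, hw, nf_dir, mixNum, Fin.sum_univ_three]
  simp only [dir, PiLp.toLp_apply, Matrix.cons_val, Fin.isValue, Fin.reduceAdd, zero_add]
  ring

lemma mv_swap_right (c e d : Fin 3 → ℝ) : mv c e d = mv c d e := by
  simp only [mv, mixW_comm (e := e)]

/-- The symmetry of `mixW` in its two arguments is built in; this transposition is the substantial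
one, and both together generate all permutations. -/
lemma mv_swap_left (hc : ∀ i, 0 < c i) (he : ∀ i, 0 < e i) (hd : ∀ i, 0 < d i) :
    mv c e d = mv e c d := by
  rw [← sub_eq_zero]
  unfold mv
  have h1 := integrable_mv he hd (continuous_nf (c := c))
  have h2 := integrable_mv hc hd (continuous_nf (c := e))
  rw [← integral_sub h1 h2]
  rw [integral_sph (f := fun p => nf c p * mixW e d p - nf e p * mixW c d p)
    ((continuous_nf.continuousOn.mul (continuousOn_mixW he hd)).sub
      (continuous_nf.continuousOn.mul (continuousOn_mixW hc hd)))]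
  refine Eq.trans ?_ (integral_mixed_sub_eq_zero hc he hd)
  refine intervalIntegral.integral_congr fun θ _ => ?_
  refine intervalIntegral.integral_congr fun φ _ => ?_
  simp only [nf_dir, mixW_dir]
  ring

/-- `mixW` is nonnegative, so inclusions of convex bodies, read as inequalities of support
functions, can be integrated. The function `f` is only continuous, so that it may also be the
support function of a segment. -/
lemma mv_le_sum (he : ∀ i, 0 < e i) (hd : ∀ i, 0 < d i) (f : Space → ℝ) (hf : Continuous f)
    (x : Fin 3 → ℝ) (s : Fin 3 → Fin 3 → ℝ)
    (h : ∀ p, ‖p‖ = 1 → f p ≤ ∑ n, x n * nf (s n) p) :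
    ∫ p, f p * mixW e d p ∂sph ≤ ∑ n, x n * mv (s n) e d := by
  have h1 : ∀ n ∈ Finset.univ, Integrable (fun p => x n * (nf (s n) p * mixW e d p)) sph :=
    fun n _ => (integrable_mv he hd continuous_nf).const_mul _
  have : ∑ n, x n * mv (s n) e d = ∫ p, ∑ n, x n * (nf (s n) p * mixW e d p) ∂sph := by
    rw [integral_finsetSum _ h1]
    simp only [mv, integral_const_mul]
  rw [this]
  refine integral_mono_ae (integrable_mv he hd hf) (integrable_finsetSum _ h1) ?_
  filter_upwards [ae_sph_norm] with p hp
  have := mul_le_mul_of_nonneg_right (h p hp) (mixW_nonneg he hd (p := p))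
  rw [Finset.sum_mul] at this
  simpa only [mul_assoc] using this

lemma mv_mono (he : ∀ i, 0 < e i) (hd : ∀ i, 0 < d i) {f g : Space → ℝ} (hf : Continuous f)
    (hg : Continuous g) (h : ∀ p, ‖p‖ = 1 → f p ≤ g p) :
    ∫ p, f p * mixW e d p ∂sph ≤ ∫ p, g p * mixW e d p ∂sph := by
  refine integral_mono_ae (integrable_mv he hd hf) (integrable_mv he hd hg) ?_
  filter_upwards [ae_sph_norm] with p hp
  exact mul_le_mul_of_nonneg_right (h p hp) (mixW_nonneg he hd)

lemma nf_le_sum (hc : ∀ i, 0 < c i) : nf c p ≤ ∑ n, √(c n) * |p n| := by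
  have h0 : ∀ i, 0 ≤ √(c i) * |p i| := fun i => mul_nonneg (Real.sqrt_nonneg _) (abs_nonneg _)
  refine Real.sqrt_le_iff.2 ⟨Finset.sum_nonneg fun i _ => h0 i, ?_⟩
  have h2 : ∀ i, c i * p i ^ 2 = (√(c i) * |p i|) ^ 2 := fun i => by
    rw [mul_pow, sq_abs, Real.sq_sqrt (hc i).le]
  simp only [h2, Fin.sum_univ_three]
  nlinarith [mul_nonneg (h0 0) (h0 1), mul_nonneg (h0 0) (h0 2), mul_nonneg (h0 1) (h0 2)]

lemma le_nf (hc : ∀ i, 0 < c i) (n : Fin 3) : √(c n) * |p n| ≤ nf c p := by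
  refine Real.le_sqrt_of_sq_le ?_
  rw [mul_pow, sq_abs, Real.sq_sqrt (hc n).le]
  exact Finset.single_le_sum (f := fun i => c i * p i ^ 2)
    (fun i _ => mul_nonneg (hc i).le (sq_nonneg _)) (Finset.mem_univ n)

lemma mixW_self (hc : ∀ i, 0 < c i) (hp : p ≠ 0) :
    mixW c c p = 2 * (c 0 * c 1 * c 2) / nf c p ^ 4 := by
  have h := nf_pos hc hp
  have h2 := nf_sq hc (p := p)
  simp only [mixW, hw, Fin.sum_univ_three, Fin.isValue, Fin.reduceAdd, zero_add] at h2 ⊢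
  field_simp
  rw [h2]
  ring

end

/-- Squared half axes of a thin ellipsoid around a coordinate segment. -/
def thin (ε : ℝ) (i n : Fin 3) : ℝ := if n = i then 1 else ε ^ 2

section

variable {ε : ℝ} {p : Space}

lemma thin_pos (hε : 0 < ε) (i n : Fin 3) : 0 < thin ε i n := by
  unfold thin; split_ifs <;> positivity

lemma nf_thin_sq (hε : 0 < ε) (i : Fin 3) (hp : ‖p‖ = 1) :
    nf (thin ε i) p ^ 2 = p i ^ 2 + ε ^ 2 * (1 - p i ^ 2) := by
  rw [nf_sq (thin_pos hε i), ← sum_sq_of_norm hp]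
  fin_cases i <;> simp [thin, Fin.sum_univ_three] <;> ring

lemma nf_thin_le_one (hε : 0 < ε) (hε1 : ε ≤ 1) (i : Fin 3) (hp : ‖p‖ = 1) :
    nf (thin ε i) p ≤ 1 := by
  have h := nf_thin_sq hε i hp
  have h1 := abs_le_one_of_norm hp i
  have h2 : p i ^ 2 ≤ 1 := by rw [← sq_abs]; nlinarith [abs_nonneg (p i)]
  have h3 : ε ^ 2 ≤ 1 := by nlinarith
  nlinarith [nf_nonneg (c := thin ε i) (p := p)]

lemma abs_le_nf_thin (hε : 0 < ε) (i : Fin 3) : |p i| ≤ nf (thin ε i) p := by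
  have := le_nf (thin_pos hε i) i (p := p)
  simpa [thin] using this

lemma nf_thin_le (hε : 0 < ε) (i : Fin 3) (hp : ‖p‖ = 1) : nf (thin ε i) p ≤ |p i| + ε := by
  refine abs_le_of_sq_le_sq' ?_ (by positivity) |>.2
  rw [nf_thin_sq hε i hp]
  nlinarith [sq_abs (p i), abs_nonneg (p i), sq_nonneg (ε * p i), mul_nonneg hε.le (abs_nonneg (p i))]

/-- Bound for mixed volumes with a repeated thin ellipsoid. -/
def thinErr (ε : ℝ) : ℝ := ∑ i, ∫ p, mixW (thin ε i) (thin ε i) p ∂sph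

/-- A thin ellipsoid collapses to a segment, whose curvature sits on the plane `p i = 0`. By
`mixW_self` the density is `2 (ε² / nf²)²`, which is at most 2 and tends to zero where `p i ≠ 0`. -/
lemma tendsto_thinErr : Tendsto thinErr (𝓝[>] 0) (𝓝 0) := by
  unfold thinErr
  suffices h : ∀ i, Tendsto (fun ε => ∫ p, mixW (thin ε i) (thin ε i) p ∂sph) (𝓝[>] 0) (𝓝 0) by
    simpa using tendsto_finsetSum Finset.univ fun i _ => h i
  intro i
  have hform : ∀ ε > 0, ∀ p : Space, ‖p‖ = 1 →
      mixW (thin ε i) (thin ε i) p = 2 * (ε ^ 2 / nf (thin ε i) p ^ 2) ^ 2 := by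
    intro ε hε p hp
    rw [mixW_self (thin_pos hε i) (ne_zero_of_norm hp)]
    have : thin ε i 0 * thin ε i 1 * thin ε i 2 = ε ^ 4 := by
      fin_cases i <;> simp [thin] <;> ring
    rw [this]; ring
  have h0 : (0 : ℝ) = ∫ _p : Space, (0 : ℝ) ∂sph := by simp
  rw [show 𝓝 (0 : ℝ) = 𝓝 (∫ _p : Space, (0 : ℝ) ∂sph) by rw [← h0]]
  refine tendsto_integral_filter_of_dominated_convergence (fun _ => 2) ?_ ?_ (integrable_const _) ?_
  · filter_upwards [self_mem_nhdsWithin] with ε hε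
    exact aestronglyMeasurable_sph (continuousOn_mixW (thin_pos hε i) (thin_pos hε i))
  · filter_upwards [Ioc_mem_nhdsGT one_pos] with ε hε
    filter_upwards [ae_sph_norm] with p hp
    rw [Real.norm_of_nonneg (mixW_nonneg (thin_pos hε.1 i) (thin_pos hε.1 i)),
      hform ε hε.1 p hp, nf_thin_sq hε.1 i hp]
    have h1 : ε ^ 2 ≤ p i ^ 2 + ε ^ 2 * (1 - p i ^ 2) := by
      nlinarith [mul_nonneg (sq_nonneg (p i)) (by nlinarith [hε.1, hε.2] : 0 ≤ 1 - ε ^ 2)]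
    have h2 : 0 < ε ^ 2 := pow_pos hε.1 2
    have h3 : ε ^ 2 / (p i ^ 2 + ε ^ 2 * (1 - p i ^ 2)) ≤ 1 := div_le_one_of_le₀ h1 (h2.le.trans h1)
    have h4 : 0 ≤ ε ^ 2 / (p i ^ 2 + ε ^ 2 * (1 - p i ^ 2)) := div_nonneg h2.le (h2.le.trans h1)
    nlinarith
  · filter_upwards [ae_sph_norm, ae_sph_coord_ne] with p hp hne
    have hc : ContinuousAt (fun ε : ℝ => 2 * (ε ^ 2 / (p i ^ 2 + ε ^ 2 * (1 - p i ^ 2))) ^ 2) 0 := by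
      have := hne i
      refine ContinuousAt.mul continuousAt_const (ContinuousAt.pow (ContinuousAt.div (by fun_prop)
        (by fun_prop) (by simpa using this)) 2)
    have h1 : Tendsto (fun ε : ℝ => 2 * (ε ^ 2 / (p i ^ 2 + ε ^ 2 * (1 - p i ^ 2))) ^ 2) (𝓝[>] 0)
        (𝓝 0) := by
      have := hc.tendsto.mono_left (nhdsWithin_le_nhds (s := Ioi 0))
      simpa using this
    refine h1.congr' ?_
    filter_upwards [self_mem_nhdsWithin] with ε hε
    rw [hform ε hε p hp, nf_thin_sq hε i hp]

lemma thinErr_nonneg (hε : 0 < ε) : 0 ≤ thinErr ε :=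
  Finset.sum_nonneg fun i _ => integral_nonneg fun _ => mixW_nonneg (thin_pos hε i) (thin_pos hε i)

lemma mv_thin_self_le (hε : 0 < ε) (hε1 : ε ≤ 1) (i j : Fin 3) :
    mv (thin ε j) (thin ε i) (thin ε i) ≤ thinErr ε := by
  have h := mv_mono (thin_pos hε i) (thin_pos hε i) (continuous_nf (c := thin ε j))
    continuous_const (fun p hp => nf_thin_le_one hε hε1 j hp)
  simp only [one_mul] at h
  refine h.trans (Finset.single_le_sum (f := fun i => ∫ p, mixW (thin ε i) (thin ε i) p ∂sph)
    (fun i _ => integral_nonneg fun _ => mixW_nonneg (thin_pos hε i) (thin_pos hε i))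
    (Finset.mem_univ i))

/-- Two parallel segments span no area: by symmetry the repeated index moves to the last two slots,
and the remaining thin ellipsoid fits in the unit ball. -/
lemma mv_thin_repeat_le (hε : 0 < ε) (hε1 : ε ≤ 1) {i j k : Fin 3} (h : i = j ∨ j = k ∨ i = k) :
    mv (thin ε i) (thin ε j) (thin ε k) ≤ thinErr ε := by
  rcases h with rfl | rfl | rfl
  · rw [mv_swap_right, mv_swap_left (thin_pos hε _) (thin_pos hε _) (thin_pos hε _)]
    exact mv_thin_self_le hε hε1 _ _
  · exact mv_thin_self_le hε hε1 _ _
  · rw [mv_swap_left (thin_pos hε _) (thin_pos hε _) (thin_pos hε _)]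
    exact mv_thin_self_le hε hε1 _ _

end

lemma nf_one {p : Space} (hp : ‖p‖ = 1) : nf 1 p = 1 := by
  simp [nf, sum_sq_of_norm hp]

/-- The mixed volume of three unit balls. -/
def mvBall : ℝ := mv 1 1 1

lemma sph_univ : sph.real univ = 4 * Real.pi := by
  have h := integral_sph (f := fun _ => 1) continuousOn_const
  simp at h
  rw [measureReal_def] at *
  linarith

lemma mvBall_pos : 0 < mvBall := by
  have h : mvBall = ∫ _ : Space, 2 ∂sph := by
    refine integral_congr_ae ?_
    filter_upwards [ae_sph_norm] with p hp
    rw [mixW_self (by simp) (ne_zero_of_norm hp), nf_one hp]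
    simp
  rw [h]
  simp [sph_univ, Real.pi_pos]

lemma one_pos_fun (i : Fin 3) : 0 < (1 : Fin 3 → ℝ) i := by simp

section

variable {ε : ℝ} {c e d : Fin 3 → ℝ}

lemma mv_mono_left {c' : Fin 3 → ℝ} (he : ∀ i, 0 < e i) (hd : ∀ i, 0 < d i)
    (h : ∀ p, ‖p‖ = 1 → nf c p ≤ nf c' p) : mv c e d ≤ mv c' e d :=
  mv_mono he hd continuous_nf continuous_nf h

lemma mv_thin_le (hε : 0 < ε) (hε1 : ε ≤ 1) (i j k : Fin 3) :
    mv (thin ε i) (thin ε j) (thin ε k) ≤ mvBall := by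
  have t := thin_pos hε
  have l : ∀ i p, ‖p‖ = 1 → nf (thin ε i) p ≤ nf 1 p := fun i p hp => by
    rw [nf_one hp]; exact nf_thin_le_one hε hε1 i hp
  calc mv (thin ε i) (thin ε j) (thin ε k) ≤ mv 1 (thin ε j) (thin ε k) :=
        mv_mono_left (t _) (t _) (l i)
    _ = mv (thin ε j) 1 (thin ε k) := mv_swap_left one_pos_fun (t _) (t _)
    _ ≤ mv 1 1 (thin ε k) := mv_mono_left one_pos_fun (t _) (l j)
    _ = mv (thin ε k) 1 1 := by rw [mv_swap_right, mv_swap_left one_pos_fun (t _) one_pos_fun]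
    _ ≤ mvBall := mv_mono_left one_pos_fun one_pos_fun (l k)

/-- The unit ball lies in the sum of the three coordinate segments, hence in the sum of the thin
ellipsoids. Multilinear expansion in the three slots gives 27 terms. -/
lemma mvBall_le (hε : 0 < ε) :
    mvBall ≤ ∑ i, ∑ j, ∑ k, mv (thin ε i) (thin ε j) (thin ε k) := by
  have t := thin_pos hε
  have l : ∀ p, ‖p‖ = 1 → nf 1 p ≤ ∑ n, (1 : ℝ) * nf (thin ε n) p := fun p hp =>
    (nf_le_sum one_pos_fun).trans (by
      refine Finset.sum_le_sum fun n _ => ?_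
      simpa using abs_le_nf_thin hε n)
  have step : ∀ {e d : Fin 3 → ℝ}, (∀ i, 0 < e i) → (∀ i, 0 < d i) →
      mv 1 e d ≤ ∑ n, mv (thin ε n) e d := fun he hd => by
    simpa [mv] using mv_le_sum he hd (nf 1) continuous_nf (fun _ => 1) (thin ε) l
  refine (step one_pos_fun one_pos_fun).trans (Finset.sum_le_sum fun i _ => ?_)
  rw [mv_swap_left (t _) one_pos_fun one_pos_fun]
  refine (step (t _) one_pos_fun).trans (Finset.sum_le_sum fun j _ => ?_)
  rw [mv_swap_right, mv_swap_left (t _) one_pos_fun (t _)]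
  refine (step (t _) (t _)).trans (Finset.sum_le_sum fun k _ => ?_)
  rw [mv_swap_left (t _) (t _) (t _), mv_swap_right, mv_swap_left (t _) (t _) (t _),
    mv_swap_left (t _) (t _) (t _)]

lemma mv_perm (hε : 0 < ε) {i j k : Fin 3} (hij : i ≠ j) (hjk : j ≠ k) (hik : i ≠ k) :
    mv (thin ε i) (thin ε j) (thin ε k) = mv (thin ε 0) (thin ε 1) (thin ε 2) := by
  have t := thin_pos hε
  have s1 : ∀ i j k, mv (thin ε i) (thin ε j) (thin ε k) = mv (thin ε i) (thin ε k) (thin ε j) :=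
    fun i j k => mv_swap_right _ _ _
  have s2 : ∀ i j k, mv (thin ε i) (thin ε j) (thin ε k) = mv (thin ε j) (thin ε i) (thin ε k) :=
    fun i j k => mv_swap_left (t _) (t _) (t _)
  have h1 := s1 0 2 1
  have h2 := s2 1 0 2
  have h3 := (s1 1 2 0).trans h2
  have h4 := (s2 2 0 1).trans h1
  have h5 := (s2 2 1 0).trans h3
  clear s1 s2
  fin_cases i <;> fin_cases j <;> fin_cases k <;>
    (first
      | exact (hij rfl).elim
      | exact (hjk rfl).elim
      | exact (hik rfl).elim
      | rfl
      | assumption)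

/-- In `mvBall_le` the 6 terms with distinct indices coincide and the other 21 are at most `thinErr
ε`; the quotient 21/6 is rounded up to 4. -/
lemma le_mv_thin (hε : 0 < ε) (hε1 : ε ≤ 1) {i j k : Fin 3} (hij : i ≠ j) (hjk : j ≠ k)
    (hik : i ≠ k) : mvBall / 6 - 4 * thinErr ε ≤ mv (thin ε i) (thin ε j) (thin ε k) := by
  rw [mv_perm hε hij hjk hik]
  have h := mvBall_le hε
  have hz := thinErr_nonneg hε
  have h2 : ∀ i j k : Fin 3, mv (thin ε i) (thin ε j) (thin ε k) ≤
      if i = j ∨ j = k ∨ i = k then thinErr ε else mv (thin ε 0) (thin ε 1) (thin ε 2) := by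
    intro i j k
    split_ifs with h
    · exact mv_thin_repeat_le hε hε1 h
    · push Not at h
      exact (mv_perm hε h.1 h.2.1 h.2.2).le
  have h3 := h.trans (Finset.sum_le_sum fun i _ => Finset.sum_le_sum fun j _ =>
    Finset.sum_le_sum fun k _ => h2 i j k)
  simp [Fin.sum_univ_three] at h3
  linarith

/-- A segment, with support function `|p i|`, is not among the ellipsoids for which `mv` is known to
be symmetric. It is replaced by `thin ε i`, and `thin_le_abs_integral` shows that the replacement
costs at most a multiple of `ε`. -/
lemma abs_integral_le_thin (he : ∀ i, 0 < e i) (hd : ∀ i, 0 < d i) (hε : 0 < ε) (i : Fin 3) :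
    ∫ p, |p i| * mixW e d p ∂sph ≤ mv (thin ε i) e d :=
  mv_mono he hd (f := fun p => |p i|) (by fun_prop) continuous_nf fun _ _ => abs_le_nf_thin hε i

lemma thin_le_abs_integral (he : ∀ i, 0 < e i) (hd : ∀ i, 0 < d i) (hε : 0 < ε) (i : Fin 3) :
    mv (thin ε i) e d ≤ ∫ p, |p i| * mixW e d p ∂sph + ε * mv 1 e d := by
  have h := mv_mono he hd (f := nf (thin ε i)) (g := fun p => |p i| + ε * nf 1 p) continuous_nf
    (by have := continuous_nf (c := 1); fun_prop) fun p hp => by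
      rw [nf_one hp, mul_one]; exact nf_thin_le hε i hp
  refine h.trans (le_of_eq ?_)
  rw [mv, ← integral_const_mul, ← integral_add (integrable_mv he hd (by fun_prop))
    ((integrable_mv he hd continuous_nf).const_mul _)]
  refine integral_congr_ae (Eventually.of_forall fun p => ?_)
  simp only
  ring

lemma sqrt_mul_abs_integral_le (he : ∀ i, 0 < e i) (hd : ∀ i, 0 < d i) (hc : ∀ i, 0 < c i)
    (i : Fin 3) : √(c i) * ∫ p, |p i| * mixW e d p ∂sph ≤ mv c e d := by
  rw [← integral_const_mul]
  have h := mv_mono he hd (f := fun p => √(c i) * |p i|) (g := nf c) (by fun_prop) continuous_nf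
    fun p _ => le_nf hc i
  refine le_trans (le_of_eq ?_) h
  simp only [mul_assoc]

/-- Weighted projection areas of ellipsoids: upper bound by the bounding boxes. -/
theorem abs_integral_mixW_le (he : ∀ i, 0 < e i) (hd : ∀ i, 0 < d i) (i : Fin 3) :
    ∫ p, |p i| * mixW e d p ∂sph ≤
      mvBall * (√(e (i + 1)) * √(d (i + 2)) + √(e (i + 2)) * √(d (i + 1))) := by
  have key : ∀ᶠ ε in 𝓝[>] (0 : ℝ), ∫ p, |p i| * mixW e d p ∂sph ≤
      mvBall * (√(e (i + 1)) * √(d (i + 2)) + √(e (i + 2)) * √(d (i + 1))) +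
        thinErr ε * ((∑ n, √(e n)) * (∑ n, √(d n))) := by
    filter_upwards [Ioc_mem_nhdsGT one_pos] with ε hε
    obtain ⟨hε, hε1⟩ := hε
    have t := thin_pos hε
    have hz := thinErr_nonneg hε
    have step : ∀ {c e d : Fin 3 → ℝ}, (∀ i, 0 < c i) → (∀ i, 0 < e i) → (∀ i, 0 < d i) →
        mv c e d ≤ ∑ n, √(c n) * mv (thin ε n) e d := fun hc he hd =>
      mv_le_sum he hd (nf _) continuous_nf _ (thin ε) fun p _ => (nf_le_sum hc).trans
        (Finset.sum_le_sum fun n _ => mul_le_mul_of_nonneg_left (abs_le_nf_thin hε n)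
          (Real.sqrt_nonneg _))
    -- Both ellipsoids are enlarged to sums of three thin ones along the axes. Only the terms whose
    -- indices differ from each other and from `i` survive as `ε → 0`.
    have h1 : ∫ p, |p i| * mixW e d p ∂sph ≤ ∑ n, √(e n) * ∑ m, √(d m) *
        (if m = n ∨ n = i ∨ m = i then thinErr ε else mvBall) := by
      refine (abs_integral_le_thin he hd hε i).trans ?_
      rw [mv_swap_left (t _) he hd]
      refine (step he (t _) hd).trans (Finset.sum_le_sum fun n _ => ?_)
      refine mul_le_mul_of_nonneg_left ?_ (Real.sqrt_nonneg _)
      rw [mv_swap_right, mv_swap_left (t _) hd (t _)]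
      refine (step hd (t _) (t _)).trans (Finset.sum_le_sum fun m _ => ?_)
      refine mul_le_mul_of_nonneg_left ?_ (Real.sqrt_nonneg _)
      split_ifs with h
      · exact mv_thin_repeat_le hε hε1 h
      · exact mv_thin_le hε hε1 _ _ _
    refine h1.trans ?_
    have he' : ∀ n, 0 ≤ √(e n) := fun _ => Real.sqrt_nonneg _
    have hd' : ∀ n, 0 ≤ √(d n) := fun _ => Real.sqrt_nonneg _
    have h3 : ∀ n m, 0 ≤ thinErr ε * (√(e n) * √(d m)) := fun n m =>
      mul_nonneg hz (mul_nonneg (he' n) (hd' m))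
    have := h3 0 0; have := h3 0 1; have := h3 0 2; have := h3 1 0; have := h3 1 1
    have := h3 1 2; have := h3 2 0; have := h3 2 1; have := h3 2 2
    fin_cases i <;> simp [Fin.sum_univ_three] <;> nlinarith
  have hl : Tendsto (fun ε => mvBall * (√(e (i + 1)) * √(d (i + 2)) + √(e (i + 2)) * √(d (i + 1))) +
        thinErr ε * ((∑ n, √(e n)) * (∑ n, √(d n)))) (𝓝[>] 0)
        (𝓝 (mvBall * (√(e (i + 1)) * √(d (i + 2)) + √(e (i + 2)) * √(d (i + 1))))) := by
    simpa using (tendsto_thinErr.mul_const ((∑ n, √(e n)) * (∑ n, √(d n)))).const_add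
      (mvBall * (√(e (i + 1)) * √(d (i + 2)) + √(e (i + 2)) * √(d (i + 1))))
  exact ge_of_tendsto hl key

/-- Weighted projection areas of ellipsoids: lower bound by inscribed diamonds. -/
theorem le_abs_integral_mixW (he : ∀ i, 0 < e i) (hd : ∀ i, 0 < d i) {i j k : Fin 3}
    (hij : i ≠ j) (hjk : j ≠ k) (hik : i ≠ k) :
    mvBall / 6 * (√(e j) * √(d k)) ≤ ∫ p, |p i| * mixW e d p ∂sph := by
  have key : ∀ᶠ ε in 𝓝[>] (0 : ℝ), √(e j) * (√(d k) * (mvBall / 6 - 4 * thinErr ε - ε * mvBall) -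
      ε * mv d 1 1) - ε * mv 1 e d ≤ ∫ p, |p i| * mixW e d p ∂sph := by
    filter_upwards [Ioc_mem_nhdsGT one_pos] with ε hε
    obtain ⟨hε, hε1⟩ := hε
    have t := thin_pos hε
    have l : ∀ i p, ‖p‖ = 1 → nf (thin ε i) p ≤ nf 1 p := fun i p hp => by
      rw [nf_one hp]; exact nf_thin_le_one hε hε1 i hp
    -- Slot by slot, the ellipsoid is bounded below by an axis segment inside it and the segment is
    -- exchanged for its thin ellipsoid at the price of an `ε` term, until three distinct thin
    -- ellipsoids remain.
    have h1 := thin_le_abs_integral he hd hε i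
    have h2 := sqrt_mul_abs_integral_le (t i) hd he j
    have h3 := thin_le_abs_integral (t i) hd hε j
    have h4 := sqrt_mul_abs_integral_le (t j) (t i) hd k
    have h5 := thin_le_abs_integral (t j) (t i) hε k
    have h6 := le_mv_thin hε hε1 hjk.symm hij.symm hik.symm
    have h7 : mv 1 (thin ε i) d ≤ mv d 1 1 := by
      rw [mv_swap_left one_pos_fun (t i) hd]
      refine (mv_mono_left one_pos_fun hd (l i)).trans (le_of_eq ?_)
      rw [mv_swap_right, mv_swap_left one_pos_fun hd one_pos_fun]
    have h8 : mv 1 (thin ε j) (thin ε i) ≤ mvBall := by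
      rw [mv_swap_left one_pos_fun (t j) (t i)]
      refine (mv_mono_left one_pos_fun (t i) (l j)).trans ?_
      rw [mv_swap_right, mv_swap_left one_pos_fun (t i) one_pos_fun]
      exact mv_mono_left one_pos_fun one_pos_fun (l i)
    rw [mv_swap_left he (t i) hd] at h2
    rw [mv_swap_left hd (t j) (t i), mv_swap_right] at h4
    have e0 := Real.sqrt_nonneg (e j)
    have d0 := Real.sqrt_nonneg (d k)
    have g1 : mvBall / 6 - 4 * thinErr ε - ε * mvBall ≤
        ∫ p, |p k| * mixW (thin ε j) (thin ε i) p ∂sph := by nlinarith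
    have g2 : √(d k) * (mvBall / 6 - 4 * thinErr ε - ε * mvBall) - ε * mv d 1 1 ≤
        ∫ p, |p j| * mixW (thin ε i) d p ∂sph := by
      have := mul_le_mul_of_nonneg_left g1 d0
      have := mul_le_mul_of_nonneg_left h7 hε.le
      linarith
    have := mul_le_mul_of_nonneg_left g2 e0
    linarith
  have hid : Tendsto (fun ε : ℝ => ε) (𝓝[>] 0) (𝓝 0) := nhdsWithin_le_nhds
  have hl : Tendsto (fun ε => √(e j) * (√(d k) * (mvBall / 6 - 4 * thinErr ε - ε * mvBall) -
      ε * mv d 1 1) - ε * mv 1 e d) (𝓝[>] 0)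
      (𝓝 (√(e j) * (√(d k) * (mvBall / 6 - 4 * 0 - 0 * mvBall) - 0 * mv d 1 1) - 0 * mv 1 e d)) :=
    (((((tendsto_thinErr.const_mul 4).const_sub _).sub (hid.mul_const _)).const_mul _).sub
      (hid.mul_const _) |>.const_mul _).sub (hid.mul_const _)
  refine (le_of_eq ?_).trans (le_of_tendsto hl key)
  ring

end

end BianchiI

end

open scoped ContDiff ENNReal

noncomputable section

namespace BianchiI

open Bianchi

/-! ### Light cones of the infinite future -/

/-- Squared inverse scale factors. -/
def isq (a : Fin 3 → ℝ → ℝ) (t : ℝ) (i : Fin 3) : ℝ := (a i t ^ 2)⁻¹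

/-- Hessian weights of the support function of the section of a light cone with tip at infinity. -/
def hTail (a : Fin 3 → ℝ → ℝ) (k : Fin 3) (t : ℝ) (p : Space) : ℝ := ∫ r in Ioi t, hk a k r p

/-- Curvature function of the section of a light cone with tip at infinity. -/
def curvTail (a : Fin 3 → ℝ → ℝ) (t : ℝ) (p : Space) : ℝ := curv (fun k => hTail a k t p) p

section

variable {a : Fin 3 → ℝ → ℝ} {t r s u : ℝ} {p : Space}

lemma fq_eq_nf : fq a t p = nf (isq a t) p := by
  unfold fq nf isq
  congr 1
  exact Finset.sum_congr rfl fun i _ => by rw [div_pow]; ring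

lemma hk_eq_hw (k : Fin 3) : hk a k t p = hw (isq a t) k p := by
  unfold hk hw
  rw [← fq_eq_nf, isq, isq]
  simp only [mul_pow, mul_inv, div_eq_mul_inv]

lemma isq_pos (ha : IsScale a) (t : ℝ) (i : Fin 3) : 0 < isq a t i :=
  inv_pos.2 (pow_pos (ha.pos i t) 2)

lemma sqrt_isq (ha : IsScale a) (t : ℝ) (i : Fin 3) : √(isq a t i) = (a i t)⁻¹ := by
  rw [isq, Real.sqrt_inv, Real.sqrt_sq (ha.pos i t).le]

lemma measurable_fq (ha : IsScale a) : Measurable fun z : ℝ × Space => fq a z.1 z.2 :=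
  (continuous_fq ha).measurable

lemma measurable_hk (ha : IsScale a) (k : Fin 3) :
    Measurable fun z : ℝ × Space => hk a k z.1 z.2 := by
  unfold hk
  have h := fun i => (ha.cont i).measurable
  have h1 := h (k + 1)
  have h2 := h (k + 2)
  have h3 := measurable_fq ha
  exact ((((h1.comp measurable_fst).mul (h2.comp measurable_fst)).pow_const 2).mul
    (h3.pow_const 3)).inv

/-- Mixed curvature of the ellipsoids at two times, as an extended nonnegative number. -/
def mixE (a : Fin 3 → ℝ → ℝ) (r s : ℝ) (p : Space) : ℝ≥0∞ :=
  ENNReal.ofReal (mixW (isq a r) (isq a s) p)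

lemma measurable_mixE (ha : IsScale a) :
    Measurable fun z : ℝ × ℝ × Space => mixE a z.1 z.2.1 z.2.2 := by
  unfold mixE mixW
  simp only [← hk_eq_hw]
  have h := measurable_hk ha
  have h1 : ∀ k, Measurable fun z : ℝ × ℝ × Space => hk a k z.1 z.2.2 := fun k =>
    (h k).comp (measurable_fst.prodMk (measurable_snd.comp measurable_snd))
  have h2 : ∀ k, Measurable fun z : ℝ × ℝ × Space => hk a k z.2.1 z.2.2 := fun k =>
    (h k).comp measurable_snd
  refine (Finset.measurable_sum _ fun n _ => ?_).ennreal_ofReal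
  have h3 : Measurable fun z : ℝ × ℝ × Space => z.2.2 n ^ 2 := by fun_prop
  exact h3.mul (((h1 _).mul (h2 _)).add ((h1 _).mul (h2 _)))

/-- `curv` is quadratic in the weights and the weights of a cone section are time integrals, so
polarization yields the mixed curvature of the ellipsoids at two times. The 2 appears because `mixW`
is twice the polarized form. -/
lemma lintegral_mixE (ha : IsScale a) (t : ℝ) (p : Space)
    (hp : ∀ k, IntegrableOn (fun r => hk a k r p) (Ioi t)) :
    ∫⁻ r in Ioi t, ∫⁻ s in Ioi t, mixE a r s p = 2 * ENNReal.ofReal (curvTail a t p) := by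
  have hm : ∀ k, Measurable fun r => hk a k r p := fun k =>
    (measurable_hk ha k).comp (measurable_id.prodMk measurable_const)
  have hT : ∀ k, ENNReal.ofReal (hTail a k t p) = ∫⁻ r in Ioi t, ENNReal.ofReal (hk a k r p) :=
    fun k => ofReal_integral_eq_lintegral_ofReal (hp k) (Eventually.of_forall fun _ => hk_nonneg k)
  have hT0 : ∀ k, 0 ≤ hTail a k t p := fun k => integral_nonneg fun _ => hk_nonneg k
  have e1 : ∀ r s, mixE a r s p = ∑ n, ENNReal.ofReal (p n ^ 2) *
      (ENNReal.ofReal (hk a (n + 1) r p) * ENNReal.ofReal (hk a (n + 2) s p) +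
        ENNReal.ofReal (hk a (n + 2) r p) * ENNReal.ofReal (hk a (n + 1) s p)) := by
    intro r s
    rw [mixE, mixW, ENNReal.ofReal_sum_of_nonneg]
    · refine Finset.sum_congr rfl fun n _ => ?_
      simp only [← hk_eq_hw]
      rw [ENNReal.ofReal_mul (sq_nonneg _), ENNReal.ofReal_add (mul_nonneg (hk_nonneg _)
        (hk_nonneg _)) (mul_nonneg (hk_nonneg _) (hk_nonneg _)), ENNReal.ofReal_mul (hk_nonneg _),
        ENNReal.ofReal_mul (hk_nonneg _)]
    · intro n _
      exact mul_nonneg (sq_nonneg _) (add_nonneg (mul_nonneg (hw_nonneg (isq_pos ha r) _)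
        (hw_nonneg (isq_pos ha s) _)) (mul_nonneg (hw_nonneg (isq_pos ha r) _)
        (hw_nonneg (isq_pos ha s) _)))
  have hmE : ∀ k, Measurable fun r => ENNReal.ofReal (hk a k r p) := fun k =>
    (hm k).ennreal_ofReal
  simp only [e1]
  have e2 : ∀ r, ∫⁻ s in Ioi t, ∑ n, ENNReal.ofReal (p n ^ 2) *
      (ENNReal.ofReal (hk a (n + 1) r p) * ENNReal.ofReal (hk a (n + 2) s p) +
        ENNReal.ofReal (hk a (n + 2) r p) * ENNReal.ofReal (hk a (n + 1) s p)) =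
      ∑ n, ENNReal.ofReal (p n ^ 2) *
      (ENNReal.ofReal (hk a (n + 1) r p) * ENNReal.ofReal (hTail a (n + 2) t p) +
        ENNReal.ofReal (hk a (n + 2) r p) * ENNReal.ofReal (hTail a (n + 1) t p)) := by
    intro r
    rw [lintegral_finsetSum _ fun n _ => by fun_prop]
    refine Finset.sum_congr rfl fun n _ => ?_
    rw [lintegral_const_mul _ (by fun_prop), lintegral_add_left (by fun_prop),
      lintegral_const_mul _ (by fun_prop), lintegral_const_mul _ (by fun_prop), hT, hT]
  simp only [e2]
  rw [lintegral_finsetSum _ fun n _ => by fun_prop, curvTail, curv,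
    ENNReal.ofReal_sum_of_nonneg fun n _ => mul_nonneg (sq_nonneg _) (mul_nonneg (hT0 _) (hT0 _)),
    Finset.mul_sum]
  refine Finset.sum_congr rfl fun n _ => ?_
  rw [lintegral_const_mul _ (by fun_prop), lintegral_add_left (by fun_prop),
    lintegral_mul_const _ (by fun_prop), lintegral_mul_const _ (by fun_prop), ← hT, ← hT,
    ENNReal.ofReal_mul (sq_nonneg _), ENNReal.ofReal_mul (hT0 _)]
  ring

/-- Integrability of the Hessian weights in all generic directions. -/
def TailIntegrable (a : Fin 3 → ℝ → ℝ) : Prop :=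
  ∀ p : Space, (∀ i, p i ≠ 0) → ∀ k t, IntegrableOn (fun r => hk a k r p) (Ioi t)

/-- Tonelli, with values in `ℝ≥0∞` because nothing is known yet about finiteness of these integrals.
-/
lemma two_lintegral_curvTail (ha : IsScale a) (hT : TailIntegrable a) {g : Space → ℝ≥0∞}
    (hg : Measurable g) (t : ℝ) :
    2 * ∫⁻ p, g p * ENNReal.ofReal (curvTail a t p) ∂sph =
      ∫⁻ r in Ioi t, ∫⁻ s in Ioi t, ∫⁻ p, g p * mixE a r s p ∂sph := by
  have hm := measurable_mixE ha
  have h1 : 2 * ∫⁻ p, g p * ENNReal.ofReal (curvTail a t p) ∂sph =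
      ∫⁻ p, (∫⁻ r in Ioi t, ∫⁻ s in Ioi t, g p * mixE a r s p) ∂sph := by
    rw [← lintegral_const_mul' _ _ (by simp)]
    refine lintegral_congr_ae ?_
    filter_upwards [ae_sph_coord_ne] with p hp
    have : ∀ r, Measurable fun s => mixE a r s p := fun r =>
      hm.comp (f := fun s => (r, s, p)) (by fun_prop)
    have h2 : Measurable fun r => ∫⁻ s in Ioi t, mixE a r s p := by
      refine Measurable.lintegral_prod_right' (f := fun z : ℝ × ℝ => mixE a z.1 z.2 p) ?_
      exact hm.comp (f := fun z : ℝ × ℝ => (z.1, z.2, p)) (by fun_prop)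
    simp only [lintegral_const_mul _ (this _)]
    rw [lintegral_const_mul _ h2, lintegral_mixE ha t p fun k => hT p hp k t]
    ring
  rw [h1]
  refine (lintegral_lintegral_swap ?_).trans ?_
  rotate_left
  · refine lintegral_congr fun r => ?_
    refine lintegral_lintegral_swap ?_
    have : Measurable fun z : Space × ℝ => g z.1 * mixE a r z.2 z.1 :=
      (hg.comp measurable_fst).mul (hm.comp (f := fun z : Space × ℝ => (r, z.2, z.1)) (by fun_prop))
    exact this.aemeasurable
  · have : Measurable fun z : (Space × ℝ) × ℝ => g z.1.1 * mixE a z.1.2 z.2 z.1.1 :=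
      (hg.comp (measurable_fst.comp measurable_fst)).mul
        (hm.comp (f := fun z : (Space × ℝ) × ℝ => (z.1.2, z.2, z.1.1)) (by fun_prop))
    exact (this.lintegral_prod_right' (ν := volume.restrict (Ioi t))).aemeasurable

/-- Tail integrals of the inverse scale factors. -/
def xE (a : Fin 3 → ℝ → ℝ) (i : Fin 3) (t : ℝ) : ℝ≥0∞ :=
  ∫⁻ r in Ioi t, ENNReal.ofReal (a i r)⁻¹

lemma lintegral_abs_mixE (ha : IsScale a) (i : Fin 3) :
    ∫⁻ p, ENNReal.ofReal |p i| * mixE a r s p ∂sph =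
      ENNReal.ofReal (∫ p, |p i| * mixW (isq a r) (isq a s) p ∂sph) := by
  rw [ofReal_integral_eq_lintegral_ofReal (integrable_mv (isq_pos ha r) (isq_pos ha s)
    (by fun_prop)) (Eventually.of_forall fun p => mul_nonneg (abs_nonneg _)
      (mixW_nonneg (isq_pos ha r) (isq_pos ha s)))]
  refine lintegral_congr fun p => ?_
  rw [ENNReal.ofReal_mul (abs_nonneg _), mixE]

lemma lintegral_inv_inv (ha : IsScale a) (j k : Fin 3) (t : ℝ) (C : ℝ≥0∞) :
    ∫⁻ r in Ioi t, ∫⁻ s in Ioi t, C * (ENNReal.ofReal (a j r)⁻¹ * ENNReal.ofReal (a k s)⁻¹) =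
      C * (xE a j t * xE a k t) := by
  have h : ∀ i, Measurable fun r => ENNReal.ofReal (a i r)⁻¹ := fun i =>
    ((ha.cont i).measurable.inv).ennreal_ofReal
  have e : ∀ r, ∫⁻ s in Ioi t, C * (ENNReal.ofReal (a j r)⁻¹ * ENNReal.ofReal (a k s)⁻¹) =
      C * (ENNReal.ofReal (a j r)⁻¹ * xE a k t) := fun r => by
    rw [lintegral_const_mul _ ((h k).const_mul _), lintegral_const_mul _ (h k), xE]
  simp only [e]
  rw [lintegral_const_mul _ ((h j).mul_const _), lintegral_mul_const _ (h j)]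
  rfl

/-- Up to a factor the left side is the area of the shadow of the section along axis `i`. The box
bound for each pair of times, integrated over both times, bounds it by the shadow of the bounding
box. -/
theorem lintegral_abs_curvTail_le (ha : IsScale a) (hT : TailIntegrable a) (i : Fin 3) (t : ℝ) :
    ∫⁻ p, ENNReal.ofReal |p i| * ENNReal.ofReal (curvTail a t p) ∂sph ≤
      ENNReal.ofReal mvBall * (xE a (i + 1) t * xE a (i + 2) t) := by
  have h2 := two_lintegral_curvTail ha hT (g := fun p => ENNReal.ofReal |p i|) (by fun_prop) t
  rw [← ENNReal.mul_le_mul_iff_right (a := 2) (by simp) (by simp), h2]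
  simp only [lintegral_abs_mixE ha]
  have hb : ∀ r s, ENNReal.ofReal (∫ p, |p i| * mixW (isq a r) (isq a s) p ∂sph) ≤
      ENNReal.ofReal mvBall *
        (ENNReal.ofReal (a (i + 1) r)⁻¹ * ENNReal.ofReal (a (i + 2) s)⁻¹) +
      ENNReal.ofReal mvBall *
        (ENNReal.ofReal (a (i + 2) r)⁻¹ * ENNReal.ofReal (a (i + 1) s)⁻¹) := by
    intro r s
    have i0 : ∀ j t, 0 ≤ (a j t)⁻¹ := fun j t => (inv_pos.2 (ha.pos j t)).le
    have := abs_integral_mixW_le (isq_pos ha r) (isq_pos ha s) i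
    simp only [sqrt_isq ha] at this
    refine (ENNReal.ofReal_le_ofReal this).trans (le_of_eq ?_)
    rw [ENNReal.ofReal_mul mvBall_pos.le, ENNReal.ofReal_add (mul_nonneg (i0 _ _) (i0 _ _))
      (mul_nonneg (i0 _ _) (i0 _ _)), ENNReal.ofReal_mul (i0 _ _), ENNReal.ofReal_mul (i0 _ _),
      mul_add]
  refine (lintegral_mono fun r => lintegral_mono fun s => hb r s).trans (le_of_eq ?_)
  have h : ∀ i, Measurable fun r => ENNReal.ofReal (a i r)⁻¹ := fun i =>
    ((ha.cont i).measurable.inv).ennreal_ofReal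
  have e : ∀ r, ∫⁻ s in Ioi t, (ENNReal.ofReal mvBall *
        (ENNReal.ofReal (a (i + 1) r)⁻¹ * ENNReal.ofReal (a (i + 2) s)⁻¹) +
      ENNReal.ofReal mvBall *
        (ENNReal.ofReal (a (i + 2) r)⁻¹ * ENNReal.ofReal (a (i + 1) s)⁻¹)) =
      (∫⁻ s in Ioi t, ENNReal.ofReal mvBall *
        (ENNReal.ofReal (a (i + 1) r)⁻¹ * ENNReal.ofReal (a (i + 2) s)⁻¹)) +
      ∫⁻ s in Ioi t, ENNReal.ofReal mvBall *
        (ENNReal.ofReal (a (i + 2) r)⁻¹ * ENNReal.ofReal (a (i + 1) s)⁻¹) := fun r =>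
    lintegral_add_left (((h _).const_mul _).const_mul _) _
  simp only [e]
  rw [lintegral_add_left, lintegral_inv_inv ha, lintegral_inv_inv ha]
  · ring
  · refine Measurable.lintegral_prod_right' (f := fun z : ℝ × ℝ => ENNReal.ofReal mvBall *
        (ENNReal.ofReal (a (i + 1) z.1)⁻¹ * ENNReal.ofReal (a (i + 2) z.2)⁻¹)) ?_
    exact (((h _).comp measurable_fst).mul ((h _).comp measurable_snd)).const_mul _

/-- The inscribed-diamond bound for each pair of times, integrated over both. Together with the
upper bound it makes shadows comparable to those of the bounding box. -/
theorem le_lintegral_abs_curvTail (ha : IsScale a) (hT : TailIntegrable a) {i j k : Fin 3}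
    (hij : i ≠ j) (hjk : j ≠ k) (hik : i ≠ k) (t : ℝ) :
    ENNReal.ofReal (mvBall / 6) * (xE a j t * xE a k t) ≤
      2 * ∫⁻ p, ENNReal.ofReal |p i| * ENNReal.ofReal (curvTail a t p) ∂sph := by
  rw [two_lintegral_curvTail ha hT (g := fun p => ENNReal.ofReal |p i|) (by fun_prop) t,
    ← lintegral_inv_inv ha]
  refine lintegral_mono fun r => lintegral_mono fun s => ?_
  have i0 : ∀ j t, 0 ≤ (a j t)⁻¹ := fun j t => (inv_pos.2 (ha.pos j t)).le
  have hB := mvBall_pos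
  rw [lintegral_abs_mixE ha, ← ENNReal.ofReal_mul (i0 _ _), ← ENNReal.ofReal_mul (by positivity)]
  refine ENNReal.ofReal_le_ofReal ?_
  have := le_abs_integral_mixW (isq_pos ha r) (isq_pos ha s) hij hjk hik
  simpa only [sqrt_isq ha] using this

/-- Mixed volume of the ellipsoids at three times. -/
def mvE (a : Fin 3 → ℝ → ℝ) (u r s : ℝ) : ℝ≥0∞ :=
  ∫⁻ p, ENNReal.ofReal (fq a u p) * mixE a r s p ∂sph

lemma mvE_eq (ha : IsScale a) : mvE a u r s = ENNReal.ofReal (mv (isq a u) (isq a r) (isq a s)) := by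
  rw [mv, ofReal_integral_eq_lintegral_ofReal (integrable_mv (isq_pos ha r) (isq_pos ha s)
    continuous_nf) (Eventually.of_forall fun p => mul_nonneg nf_nonneg
      (mixW_nonneg (isq_pos ha r) (isq_pos ha s)))]
  refine lintegral_congr fun p => ?_
  rw [ENNReal.ofReal_mul nf_nonneg, mixE, fq_eq_nf]

lemma mvE_swap_left (ha : IsScale a) : mvE a u r s = mvE a r u s := by
  rw [mvE_eq ha, mvE_eq ha, mv_swap_left (isq_pos ha _) (isq_pos ha _) (isq_pos ha _)]

lemma mvE_swap_right (ha : IsScale a) : mvE a u r s = mvE a u s r := by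
  rw [mvE_eq ha, mvE_eq ha, mv_swap_right]

lemma measurable_mvE (ha : IsScale a) :
    Measurable fun z : ℝ × ℝ × ℝ => mvE a z.1 z.2.1 z.2.2 := by
  unfold mvE
  refine Measurable.lintegral_prod_right' (f := fun z : (ℝ × ℝ × ℝ) × Space =>
    ENNReal.ofReal (fq a z.1.1 z.2) * mixE a z.1.2.1 z.1.2.2 z.2) ?_
  refine Measurable.mul (M := ℝ≥0∞) ?_ ?_
  · exact ((measurable_fq ha).comp ((measurable_fst.comp measurable_fst).prodMk
      measurable_snd)).ennreal_ofReal
  · exact (measurable_mixE ha).comp (f := fun z : (ℝ × ℝ × ℝ) × Space => (z.1.2.1, z.1.2.2, z.2))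
      (by fun_prop)

end

/-- A symmetric function integrates over a cube to three times its integral over the part of the
cube where the first variable is smallest. -/
lemma lintegral_symm_cube {w : ℝ → ℝ → ℝ → ℝ≥0∞}
    (hw : Measurable fun z : ℝ × ℝ × ℝ => w z.1 z.2.1 z.2.2)
    (h12 : ∀ x y z, w x y z = w y x z) (h23 : ∀ x y z, w x y z = w x z y) (t : ℝ) :
    ∫⁻ x in Ioi t, ∫⁻ y in Ioi t, ∫⁻ z in Ioi t, w x y z =
      3 * ∫⁻ x in Ioi t, ∫⁻ y in Ioi x, ∫⁻ z in Ioi x, w x y z := by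
  set μ := volume.restrict (Ioi t) with hμ
  let v : ℝ → ℝ → ℝ → ℝ≥0∞ := fun x y z => if x < y ∧ x < z then w x y z else 0
  have hv : Measurable fun q : ℝ × ℝ × ℝ => v q.1 q.2.1 q.2.2 := by
    refine Measurable.ite ?_ hw measurable_const
    exact (measurableSet_lt measurable_fst (measurable_fst.comp measurable_snd)).inter
      (measurableSet_lt measurable_fst (measurable_snd.comp measurable_snd))
  have hae : ∀ x : ℝ, ∀ᵐ y ∂μ, y ≠ x := fun x =>
    ae_restrict_of_ae (Measure.ae_ne volume x)
  -- Almost every triple has a unique smallest entry. The three cases are the three summands,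
  -- brought to the form `w x y z` by symmetry.
  have h1 : ∫⁻ x, ∫⁻ y, ∫⁻ z, w x y z ∂μ ∂μ ∂μ =
      ∫⁻ x, ∫⁻ y, ∫⁻ z, (v x y z + v y x z) + v z x y ∂μ ∂μ ∂μ := by
    refine lintegral_congr fun x => lintegral_congr_ae ?_
    filter_upwards [hae x] with y hy
    refine lintegral_congr_ae ?_
    filter_upwards [hae x, hae y] with z hzx hzy
    simp only [v]
    rcases lt_or_gt_of_ne hy with h | h <;> rcases lt_or_gt_of_ne hzx with h' | h' <;>
      rcases lt_or_gt_of_ne hzy with h'' | h'' <;>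
      simp [h, h', h'', h.not_gt, h'.not_gt, h''.not_gt]
    all_goals first
      | (exfalso; linarith)
      | (rw [h12 z x y, h23 x z y])
      | (rw [h12])
  have a2 : ∫⁻ x, ∫⁻ y, ∫⁻ z, v y x z ∂μ ∂μ ∂μ = ∫⁻ x, ∫⁻ y, ∫⁻ z, v x y z ∂μ ∂μ ∂μ := by
    refine lintegral_lintegral_swap ?_
    refine (Measurable.lintegral_prod_right' (f := fun q : (ℝ × ℝ) × ℝ => v q.1.2 q.1.1 q.2)
      ?_).aemeasurable
    exact hv.comp (f := fun q : (ℝ × ℝ) × ℝ => (q.1.2, q.1.1, q.2)) (by fun_prop)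
  have a3 : ∫⁻ x, ∫⁻ y, ∫⁻ z, v z x y ∂μ ∂μ ∂μ = ∫⁻ x, ∫⁻ y, ∫⁻ z, v x y z ∂μ ∂μ ∂μ := by
    have : ∀ x, ∫⁻ y, ∫⁻ z, v z x y ∂μ ∂μ = ∫⁻ z, ∫⁻ y, v z x y ∂μ ∂μ := fun x =>
      lintegral_lintegral_swap
        (hv.comp (f := fun q : ℝ × ℝ => (q.2, x, q.1)) (by fun_prop)).aemeasurable
    simp only [this]
    refine lintegral_lintegral_swap ?_
    refine (Measurable.lintegral_prod_right' (f := fun q : (ℝ × ℝ) × ℝ => v q.1.2 q.1.1 q.2)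
      ?_).aemeasurable
    exact hv.comp (f := fun q : (ℝ × ℝ) × ℝ => (q.1.2, q.1.1, q.2)) (by fun_prop)
  have b1 : Measurable fun q : (ℝ × ℝ) × ℝ => v q.1.1 q.1.2 q.2 :=
    hv.comp (f := fun q : (ℝ × ℝ) × ℝ => (q.1.1, q.1.2, q.2)) (by fun_prop)
  have b2 : Measurable fun q : (ℝ × ℝ) × ℝ => v q.1.2 q.1.1 q.2 :=
    hv.comp (f := fun q : (ℝ × ℝ) × ℝ => (q.1.2, q.1.1, q.2)) (by fun_prop)
  have c1 : Measurable fun q : ℝ × ℝ => ∫⁻ z, v q.1 q.2 z ∂μ := b1.lintegral_prod_right'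
  have c2 : Measurable fun q : ℝ × ℝ => ∫⁻ z, v q.2 q.1 z ∂μ := b2.lintegral_prod_right'
  have e1 : ∀ x y, ∫⁻ z, (v x y z + v y x z) + v z x y ∂μ =
      (∫⁻ z, v x y z ∂μ + ∫⁻ z, v y x z ∂μ) + ∫⁻ z, v z x y ∂μ := fun x y => by
    have n1 : Measurable fun z => v x y z := hv.comp (f := fun z => (x, y, z)) (by fun_prop)
    have n2 : Measurable fun z => v y x z := hv.comp (f := fun z => (y, x, z)) (by fun_prop)
    rw [lintegral_add_left (f := fun z => v x y z + v y x z) (n1.add n2), lintegral_add_left n1]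
  have e2 : ∀ x, ∫⁻ y, ((∫⁻ z, v x y z ∂μ + ∫⁻ z, v y x z ∂μ) + ∫⁻ z, v z x y ∂μ) ∂μ =
      (∫⁻ y, ∫⁻ z, v x y z ∂μ ∂μ + ∫⁻ y, ∫⁻ z, v y x z ∂μ ∂μ) + ∫⁻ y, ∫⁻ z, v z x y ∂μ ∂μ := by
    intro x
    have n1 : Measurable fun y => ∫⁻ z, v x y z ∂μ := c1.comp (f := fun y => (x, y)) (by fun_prop)
    have n2 : Measurable fun y => ∫⁻ z, v y x z ∂μ := c2.comp (f := fun y => (x, y)) (by fun_prop)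
    rw [lintegral_add_left (f := fun y => ∫⁻ z, v x y z ∂μ + ∫⁻ z, v y x z ∂μ) (n1.add n2),
      lintegral_add_left n1]
  have d1 : Measurable fun x => ∫⁻ y, ∫⁻ z, v x y z ∂μ ∂μ := c1.lintegral_prod_right'
  have d2 : Measurable fun x => ∫⁻ y, ∫⁻ z, v y x z ∂μ ∂μ := c2.lintegral_prod_right'
  rw [h1]
  simp only [e1, e2]
  rw [lintegral_add_left (f := fun x => ∫⁻ y, ∫⁻ z, v x y z ∂μ ∂μ + ∫⁻ y, ∫⁻ z, v y x z ∂μ ∂μ)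
    (d1.add d2), lintegral_add_left d1, a2, a3]
  have fin : ∫⁻ x, ∫⁻ y, ∫⁻ z, v x y z ∂μ ∂μ ∂μ =
      ∫⁻ x in Ioi t, ∫⁻ y in Ioi x, ∫⁻ z in Ioi x, w x y z := by
    refine setLIntegral_congr_fun measurableSet_Ioi fun x hx => ?_
    have hres : ∀ f : ℝ → ℝ≥0∞, ∫⁻ y in Ioi t, (Ioi x).indicator f y = ∫⁻ y in Ioi x, f y := by
      intro f
      rw [setLIntegral_indicator measurableSet_Ioi, inter_eq_left.2 (Ioi_subset_Ioi (le_of_lt hx))]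
    rw [← hres]
    refine lintegral_congr fun y => ?_
    by_cases hy : x < y
    · rw [indicator_of_mem (show y ∈ Ioi x from hy), ← hres]
      refine lintegral_congr fun z => ?_
      by_cases hz : x < z
      · simp [v, hy, hz]
      · simp [v, hz]
    · simp [v, hy]
  rw [fin]
  ring

/-- The first variation formula: the volume between a light cone section and the tip at infinity,
computed from the support function and by slicing. -/
theorem lintegral_support_curvTail {a : Fin 3 → ℝ → ℝ} (ha : IsScale a) (hT : TailIntegrable a)
    (t : ℝ) :
    ∫⁻ p, (∫⁻ u in Ioi t, ENNReal.ofReal (fq a u p)) * ENNReal.ofReal (curvTail a t p) ∂sph =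
      3 * ∫⁻ u in Ioi t, ∫⁻ p, ENNReal.ofReal (fq a u p) * ENNReal.ofReal (curvTail a u p) ∂sph := by
  have hfm : Measurable fun z : Space × ℝ => ENNReal.ofReal (fq a z.2 z.1) :=
    ((measurable_fq ha).comp measurable_swap).ennreal_ofReal
  have hm := measurable_mixE ha
  -- Once the support function and the curvature are both expanded in time, the left side is an
  -- integral over all triples of times of a symmetric mixed volume. The triples with the first time
  -- smallest form the slices on the right.
  have hsymm := lintegral_symm_cube (w := mvE a) (measurable_mvE ha)
    (fun x y z => mvE_swap_left ha) (fun x y z => mvE_swap_right ha) t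
  have hL : 2 * ∫⁻ p, (∫⁻ u in Ioi t, ENNReal.ofReal (fq a u p)) *
      ENNReal.ofReal (curvTail a t p) ∂sph =
      ∫⁻ x in Ioi t, ∫⁻ y in Ioi t, ∫⁻ z in Ioi t, mvE a x y z := by
    rw [two_lintegral_curvTail ha hT hfm.lintegral_prod_right']
    have e : ∀ r s, ∫⁻ p, (∫⁻ u in Ioi t, ENNReal.ofReal (fq a u p)) * mixE a r s p ∂sph =
        ∫⁻ u in Ioi t, mvE a u r s := by
      intro r s
      unfold mvE
      have : Measurable fun z : Space × ℝ => ENNReal.ofReal (fq a z.2 z.1) * mixE a r s z.1 :=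
        hfm.mul (hm.comp (f := fun z : Space × ℝ => (r, s, z.1)) (by fun_prop))
      rw [← lintegral_lintegral_swap this.aemeasurable]
      refine lintegral_congr fun p => ?_
      rw [lintegral_mul_const]
      exact hfm.comp (f := fun u => (p, u)) (by fun_prop)
    simp only [e]
    refine lintegral_congr fun r => lintegral_congr fun s => lintegral_congr fun u => ?_
    rw [mvE_swap_right ha, mvE_swap_left ha, mvE_swap_right ha, mvE_swap_left ha]
  have hR : ∀ x, ∫⁻ y in Ioi x, ∫⁻ z in Ioi x, mvE a x y z =
      2 * ∫⁻ p, ENNReal.ofReal (fq a x p) * ENNReal.ofReal (curvTail a x p) ∂sph := fun x =>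
    (two_lintegral_curvTail ha hT (hfm.comp (f := fun p => (p, x)) (by fun_prop)) x).symm
  simp only [hR] at hsymm
  rw [lintegral_const_mul' _ _ (by simp)] at hsymm
  rw [← hL] at hsymm
  rw [← ENNReal.mul_right_inj (a := 2) (by simp) (by simp), hsymm]
  ring

end BianchiI

end

open scoped ContDiff ENNReal

noncomputable section

/-! ### Cones with tip at infinity in an expanding spacetime. -/

namespace BianchiI

open Bianchi

lemma hasDerivAt_tail {f : ℝ → ℝ} {t₀ t : ℝ} (hf : ContinuousOn f (Ioi t₀))
    (hi : ∀ x > t₀, IntegrableOn f (Ioi x)) (ht : t₀ < t) :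
    HasDerivAt (fun x => ∫ r in Ioi x, f r) (-f t) t := by
  have h1 : HasDerivAt (fun x => (∫ r in Ioi t, f r) - ∫ r in t..x, f r) (-f t) t := by
    have := intervalIntegral.integral_hasDerivAt_right (f := f) (a := t) (b := t)
      IntervalIntegrable.refl (hf.stronglyMeasurableAtFilter isOpen_Ioi t ht)
      (hf.continuousAt (Ioi_mem_nhds ht))
    exact this.const_sub _
  refine h1.congr_of_eventuallyEq ?_
  filter_upwards [Ioi_mem_nhds ht] with x hx
  rw [← intervalIntegral.integral_Ioi_sub_Ioi' (hi t ht) (hi x hx)]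
  ring

lemma tail_pos {f : ℝ → ℝ} {t : ℝ} (hf : ∀ x, 0 < f x) (hi : IntegrableOn f (Ioi t)) :
    0 < ∫ r in Ioi t, f r := by
  rw [setIntegral_pos_iff_support_of_nonneg_ae (Eventually.of_forall fun x => (hf x).le) hi]
  have : Function.support f = univ := eq_univ_of_forall fun x => (hf x).ne'
  simp [this]

lemma tendsto_tail {f : ℝ → ℝ} {t : ℝ} (hi : IntegrableOn f (Ioi t)) :
    Tendsto (fun x => ∫ r in Ioi x, f r) atTop (𝓝 0) := by
  have h := intervalIntegral_tendsto_integral_Ioi t hi tendsto_id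
  have h2 := h.const_sub (∫ r in Ioi t, f r)
  rw [sub_self] at h2
  refine h2.congr' ?_
  filter_upwards [eventually_ge_atTop t] with x hx
  simp only [id]
  rw [← intervalIntegral.integral_Ioi_sub_Ioi hi hx]
  ring

section mono

variable {a : Fin 3 → ℝ → ℝ} {p : Space}

lemma fq_anti (ha : IsScale a) (hm : ∀ i, Monotone (a i)) {t t' : ℝ} (h : t ≤ t') :
    fq a t' p ≤ fq a t p := by
  refine Real.sqrt_le_sqrt (Finset.sum_le_sum fun i _ => ?_)
  rw [div_pow, div_pow]
  have := ha.pos i t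
  have h2 := hm i h
  gcongr

lemma vol3_mono (ha : IsScale a) (hm : ∀ i, Monotone (a i)) : Monotone (vol3 a) := fun _ _ h =>
  Finset.prod_le_prod (fun i _ => (ha.pos i _).le) fun i _ => hm i h

lemma continuous_vol3 (ha : IsScale a) : Continuous (vol3 a) :=
  continuous_finsetProd _ fun i _ => ha.cont i

lemma continuous_fq_left (ha : IsScale a) (p : Space) : Continuous fun t => fq a t p :=
  (continuous_fq ha).comp (f := fun t => (t, p)) (by fun_prop)

lemma continuous_fq_right (ha : IsScale a) (t : ℝ) : Continuous fun p => fq a t p :=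
  (continuous_fq ha).comp (f := fun p => (t, p)) (by fun_prop)

lemma continuous_hk_left (ha : IsScale a) (k : Fin 3) (hp : p ≠ 0) :
    Continuous fun t => hk a k t p :=
  (continuousOn_hk ha k).comp_continuous (f := fun t => (t, p)) (by fun_prop) fun t => ⟨trivial, hp⟩

lemma hTail_nonneg (k : Fin 3) (t : ℝ) : 0 ≤ hTail a k t p := integral_nonneg fun _ => hk_nonneg k

lemma curvTail_nonneg (t : ℝ) : 0 ≤ curvTail a t p := curv_nonneg fun k => hTail_nonneg k t

lemma ne_zero_of_generic {p : Space} (hp : ∀ i, p i ≠ 0) : p ≠ 0 := by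
  rintro rfl; exact hp 0 rfl

lemma hTail_pos (ha : IsScale a) (hT : TailIntegrable a) (hp : ∀ i, p i ≠ 0) (k : Fin 3) (t : ℝ) :
    0 < hTail a k t p :=
  tail_pos (fun r => hk_pos (fun i => ha.pos i r) (ne_zero_of_generic hp) k) (hT p hp k t)

lemma hTail_anti (hT : TailIntegrable a) (hp : ∀ i, p i ≠ 0) (k : Fin 3) {t t' : ℝ} (h : t ≤ t') :
    hTail a k t' p ≤ hTail a k t p :=
  setIntegral_mono_set (hT p hp k t) (Eventually.of_forall fun _ => hk_nonneg k)
    (Ioi_subset_Ioi h).eventuallyLE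

lemma continuous_hTail (ha : IsScale a) (hT : TailIntegrable a) (hp : ∀ i, p i ≠ 0) (k : Fin 3) :
    Continuous fun t => hTail a k t p := by
  rw [continuous_iff_continuousAt]
  intro t
  exact (hasDerivAt_tail (t₀ := t - 1) (continuous_hk_left ha k (ne_zero_of_generic hp)).continuousOn
    (fun x _ => hT p hp k x) (by linarith)).continuousAt

lemma curvTail_pos (ha : IsScale a) (hT : TailIntegrable a) (hp : ∀ i, p i ≠ 0) (t : ℝ) :
    0 < curvTail a t p :=
  curv_pos (fun k => hTail_pos ha hT hp k t) (ne_zero_of_generic hp)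

lemma curvTail_anti (hT : TailIntegrable a) (hp : ∀ i, p i ≠ 0) {t t' : ℝ} (h : t ≤ t') :
    curvTail a t' p ≤ curvTail a t p :=
  curv_mono (fun k => hTail_nonneg k t') fun k => hTail_anti hT hp k h

lemma continuous_curvTail (ha : IsScale a) (hT : TailIntegrable a) (hp : ∀ i, p i ≠ 0) :
    Continuous fun t => curvTail a t p := by
  unfold curvTail curv
  have := continuous_hTail ha hT hp
  fun_prop

lemma measurable_curvTail (ha : IsScale a) (t : ℝ) : Measurable fun p => curvTail a t p := by
  have : ∀ k, Measurable fun p => hTail a k t p := fun k => by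
    have := ((measurable_hk ha k).comp measurable_swap).stronglyMeasurable
    exact (this.integral_prod_right' (ν := volume.restrict (Ioi t))).measurable
  unfold curvTail curv
  fun_prop

end mono

/-- Area density of the section at time `t` of the light cone with tip at infinity. -/
def densTail (a : Fin 3 → ℝ → ℝ) (t : ℝ) (p : Space) : ℝ := vol3 a t * fq a t p * curvTail a t p

/-- Area of the section at time `t` of the light cone with tip at infinity. -/
def areaTail (a : Fin 3 → ℝ → ℝ) (t : ℝ) : ℝ := ∫ p, densTail a t p ∂sph

/-- Comoving volume between the section at time `t` and the tip at infinity. -/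
def volTail (a : Fin 3 → ℝ → ℝ) (t : ℝ) : ℝ := ∫ r in Ioi t, areaTail a r / vol3 a r

/-- Support function of the section at time `t` of the light cone with tip at infinity. -/
def supTail (a : Fin 3 → ℝ → ℝ) (t : ℝ) (p : Space) : ℝ := ∫ r in Ioi t, fq a r p

/-- Tail integrals of the inverse scale factors. -/
def xTail (a : Fin 3 → ℝ → ℝ) (i : Fin 3) (t : ℝ) : ℝ := ∫ r in Ioi t, (a i r)⁻¹

/-- Mean radius of the section at time `t` of the light cone with tip at infinity. -/
def meanRad (a : Fin 3 → ℝ → ℝ) (t : ℝ) : ℝ := 3 * vol3 a t * volTail a t / areaTail a t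

/-- Expanding scale factors for which the area densities of the light cone with tip at infinity
converge to a positive limit density. -/
structure TailLimit (a : Fin 3 → ℝ → ℝ) (t₀ : ℝ) (α : Space → ℝ) : Prop where
  scale : IsScale a
  mono : ∀ i, Monotone (a i)
  tail : TailIntegrable a
  int : ∀ t > t₀, Integrable (densTail a t) sph
  limInt : Integrable α sph
  limPos : ∀ᵐ p ∂sph, 0 < α p
  lim : Tendsto (fun t => ∫ p, |densTail a t p - α p| ∂sph) atTop (𝓝 0)

namespace TailLimit

variable {a : Fin 3 → ℝ → ℝ} {t₀ : ℝ} {α : Space → ℝ} {t : ℝ} {p : Space}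

lemma vol3_pos' (h : TailLimit a t₀ α) (t : ℝ) : 0 < vol3 a t := vol3_pos fun i => h.scale.pos i t

lemma fq_pos' (h : TailLimit a t₀ α) (t : ℝ) (hp : p ≠ 0) : 0 < fq a t p :=
  fq_pos (fun i => h.scale.pos i t) hp

lemma densTail_nonneg (h : TailLimit a t₀ α) (t : ℝ) (p : Space) : 0 ≤ densTail a t p :=
  mul_nonneg (mul_nonneg (h.vol3_pos' t).le fq_nonneg) (curvTail_nonneg t)

lemma densTail_pos (h : TailLimit a t₀ α) (t : ℝ) (hp : ∀ i, p i ≠ 0) : 0 < densTail a t p :=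
  mul_pos (mul_pos (h.vol3_pos' t) (h.fq_pos' t (ne_zero_of_generic hp)))
    (curvTail_pos h.scale h.tail hp t)

lemma sph_ne_zero : sph ≠ 0 := by
  intro h
  have := sph_univ
  rw [h] at this
  simp at this

lemma ae_pos_integral_pos {f : Space → ℝ} (hi : Integrable f sph) (hf : ∀ᵐ p ∂sph, 0 < f p) :
    0 < ∫ p, f p ∂sph := by
  rw [integral_pos_iff_support_of_nonneg_ae (hf.mono fun _ h => h.le) hi]
  have : sph (Function.support f) = sph univ := by
    refine measure_congr ?_
    filter_upwards [hf] with p hp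
    exact propext ⟨fun _ => trivial, fun _ => hp.ne'⟩
  rw [this]
  exact Measure.measure_univ_pos.2 sph_ne_zero

lemma areaTail_pos (h : TailLimit a t₀ α) (ht : t₀ < t) : 0 < areaTail a t :=
  ae_pos_integral_pos (h.int t ht) (ae_sph_coord_ne.mono fun _ hp => h.densTail_pos t hp)

lemma lim_pos (h : TailLimit a t₀ α) : 0 < ∫ p, α p ∂sph :=
  ae_pos_integral_pos h.limInt h.limPos

lemma tendsto_areaTail (h : TailLimit a t₀ α) :
    Tendsto (areaTail a) atTop (𝓝 (∫ p, α p ∂sph)) := by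
  rw [tendsto_iff_dist_tendsto_zero]
  refine squeeze_zero' (Eventually.of_forall fun _ => dist_nonneg) ?_ h.lim
  filter_upwards [eventually_gt_atTop t₀] with t ht
  rw [Real.dist_eq, areaTail, ← integral_sub (h.int t ht) h.limInt]
  exact abs_integral_le_integral_abs

/-- Since `fq` and `curvTail` decrease while `vol3` increases, the densities near `t` are dominated
by the density at a slightly earlier time times a ratio of volumes. -/
lemma continuousOn_areaTail (h : TailLimit a t₀ α) : ContinuousOn (areaTail a) (Ioi t₀) := by
  intro t ht
  refine ContinuousAt.continuousWithinAt ?_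
  obtain ⟨t₁, ht₁, ht₁'⟩ := exists_between (show t₀ < t from ht)
  have hb : ∀ s ∈ Ioo t₁ (t + 1), ∀ p : Space, (∀ i, p i ≠ 0) →
      densTail a s p ≤ vol3 a (t + 1) / vol3 a t₁ * densTail a t₁ p := by
    intro s hs p hp
    have h1 := vol3_mono h.scale h.mono hs.2.le
    have h2 := fq_anti h.scale h.mono (p := p) hs.1.le
    have h3 := curvTail_anti h.tail hp hs.1.le
    have h4 := h.vol3_pos' t₁
    have h5 := h.vol3_pos' s
    have h6 := curvTail_nonneg (a := a) (p := p) s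
    have h7 := fq_nonneg (a := a) (t := s) (p := p)
    have h8 := fq_nonneg (a := a) (t := t₁) (p := p)
    calc densTail a s p ≤ vol3 a (t + 1) * fq a t₁ p * curvTail a t₁ p := by
          unfold densTail
          exact mul_le_mul (mul_le_mul h1 h2 h7 (h5.le.trans h1)) h3 h6
            (mul_nonneg (h5.le.trans h1) h8)
      _ = _ := by unfold densTail; field_simp
  refine continuousAt_of_dominated (F := fun s p => densTail a s p) (bound := fun p =>
    vol3 a (t + 1) / vol3 a t₁ * densTail a t₁ p) ?_ ?_ ((h.int t₁ ht₁).const_mul _) ?_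
  · filter_upwards [Ioi_mem_nhds ht] with s hs
    exact (h.int s hs).1
  · filter_upwards [Ioo_mem_nhds ht₁' (lt_add_one t)] with s hs
    filter_upwards [ae_sph_coord_ne] with p hp
    rw [Real.norm_of_nonneg (h.densTail_nonneg s p)]
    exact hb s hs p hp
  · filter_upwards [ae_sph_coord_ne] with p hp
    refine Continuous.continuousAt ?_
    exact ((continuous_vol3 h.scale).mul (continuous_fq_left h.scale p)).mul
      (continuous_curvTail h.scale h.tail hp)

/-- A direction with all components nonzero. -/
def diagDir : Space := WithLp.toLp 2 fun _ => 1

/-- In the direction `(1,1,1)` the weights sum to `(∑ a²) / (vol3² fq³)`. Combined with `vol3 * fq ≤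
∑ a²` and `fq² ≤ 3 / m²` this bounds `1 / vol3` by tail-integrable weights. -/
lemma inv_vol3_le (ha : IsScale a) {m r : ℝ} (hm : 0 < m) (hmr : ∀ i, m ≤ a i r) :
    (vol3 a r)⁻¹ ≤ 3 / m ^ 2 * ∑ k, hk a k r diagDir := by
  have hp : (diagDir : Space) ≠ 0 := ne_zero_of_generic fun i => by simp [diagDir]
  have hφ := fq_pos (fun i => ha.pos i r) hp
  have hsq := fq_sq (a := a) (t := r) (p := diagDir)
  have p0 := ha.pos 0 r; have p1 := ha.pos 1 r; have p2 := ha.pos 2 r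
  simp [Fin.sum_univ_three, diagDir] at hsq
  have hle : fq a r diagDir ^ 2 ≤ 3 / m ^ 2 := by
    have : ∀ i, (a i r ^ 2)⁻¹ ≤ (m ^ 2)⁻¹ := fun i => by
      have := hmr i
      gcongr
    rw [show fq a r diagDir = fq a r (WithLp.toLp 2 fun _ => 1) from rfl, hsq]
    have h0 := this 0; have h1 := this 1; have h2 := this 2
    rw [div_eq_mul_inv]
    linarith
  have hv : vol3 a r = a 0 r * a 1 r * a 2 r := by simp [vol3, Fin.prod_univ_three]
  have key : vol3 a r * fq a r diagDir ≤ a 0 r ^ 2 + a 1 r ^ 2 + a 2 r ^ 2 := by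
    refine abs_le_of_sq_le_sq' ?_ (by positivity) |>.2
    rw [mul_pow, show fq a r diagDir = fq a r (WithLp.toLp 2 fun _ => 1) from rfl, hsq, hv]
    have : (a 0 r * a 1 r * a 2 r) ^ 2 * ((a 0 r ^ 2)⁻¹ + (a 1 r ^ 2)⁻¹ + (a 2 r ^ 2)⁻¹) =
      (a 1 r * a 2 r) ^ 2 + (a 0 r * a 2 r) ^ 2 + (a 0 r * a 1 r) ^ 2 := by field_simp
    rw [this]
    nlinarith [sq_nonneg (a 0 r), sq_nonneg (a 1 r), sq_nonneg (a 2 r),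
      mul_nonneg (sq_nonneg (a 0 r)) (sq_nonneg (a 1 r)),
      mul_nonneg (sq_nonneg (a 0 r)) (sq_nonneg (a 2 r)),
      mul_nonneg (sq_nonneg (a 1 r)) (sq_nonneg (a 2 r)), sq_nonneg (a 0 r ^ 2),
      sq_nonneg (a 1 r ^ 2), sq_nonneg (a 2 r ^ 2)]
  have hv0 := vol3_pos fun i => ha.pos i r
  have hsum : ∑ k, hk a k r diagDir =
      (a 0 r ^ 2 + a 1 r ^ 2 + a 2 r ^ 2) / (vol3 a r ^ 2 * fq a r diagDir ^ 3) := by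
    simp only [hk, Fin.sum_univ_three, hv, Fin.isValue, zero_add, Fin.reduceAdd]
    field_simp
  rw [hsum]
  have e : (vol3 a r)⁻¹ = fq a r diagDir ^ 2 * ((vol3 a r * fq a r diagDir) /
      (vol3 a r ^ 2 * fq a r diagDir ^ 3)) := by field_simp
  rw [e]
  gcongr

lemma integrableOn_inv_vol3_of (ha : IsScale a) (hmono : ∀ i, Monotone (a i))
    (hT : TailIntegrable a) (t : ℝ) :
    IntegrableOn (fun r => (vol3 a r)⁻¹) (Ioi t) := by
  have hd : ∀ i, (diagDir : Space) i ≠ 0 := fun i => by simp [diagDir]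
  obtain ⟨m, hm, hmi⟩ : ∃ m > 0, ∀ i, m ≤ a i t := by
    refine ⟨min (a 0 t) (min (a 1 t) (a 2 t)), lt_min (ha.pos 0 t)
      (lt_min (ha.pos 1 t) (ha.pos 2 t)), fun i => ?_⟩
    fin_cases i <;> simp
  have hi : IntegrableOn (fun r => 3 / m ^ 2 * ∑ k, hk a k r diagDir) (Ioi t) :=
    (integrable_finsetSum _ fun k _ => hT _ hd k t).const_mul _
  refine Integrable.mono' hi ?_ ?_
  · exact ((continuous_vol3 ha).inv₀ fun r => (vol3_pos fun i => ha.pos i r).ne').aestronglyMeasurable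
  · filter_upwards [ae_restrict_mem measurableSet_Ioi] with r hr
    rw [Real.norm_of_nonneg (inv_nonneg.2 (vol3_pos fun i => ha.pos i r).le)]
    exact inv_vol3_le ha hm fun i => (hmi i).trans (hmono i hr.le)

lemma integrableOn_inv_vol3 (h : TailLimit a t₀ α) (t : ℝ) :
    IntegrableOn (fun r => (vol3 a r)⁻¹) (Ioi t) :=
  integrableOn_inv_vol3_of h.scale h.mono h.tail t

lemma integrableOn_area_div (h : TailLimit a t₀ α) (ht : t₀ < t) :
    IntegrableOn (fun r => areaTail a r / vol3 a r) (Ioi t) := by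
  have hc : ContinuousOn (fun r => areaTail a r / vol3 a r) (Ioi t₀) :=
    h.continuousOn_areaTail.div (continuous_vol3 h.scale).continuousOn fun r _ => (h.vol3_pos' r).ne'
  obtain ⟨t₁, h1⟩ := eventually_atTop.1
    (h.tendsto_areaTail.eventually_le_const (lt_add_one (∫ p, α p ∂sph)))
  set t₂ := max t t₁
  have hI : IntegrableOn (fun r => areaTail a r / vol3 a r) (Ioi t₂) := by
    refine Integrable.mono' ((h.integrableOn_inv_vol3 t₂).const_mul (∫ p, α p ∂sph + 1)) ?_ ?_
    · refine (hc.mono ?_).aestronglyMeasurable measurableSet_Ioi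
      exact Ioi_subset_Ioi (ht.le.trans (le_max_left _ _))
    · filter_upwards [ae_restrict_mem measurableSet_Ioi] with r hr
      have hr1 : t₁ < r := (le_max_right _ _).trans_lt hr
      have hr2 : t₀ < r := ht.trans ((le_max_left _ _).trans_lt hr)
      rw [Real.norm_of_nonneg (div_nonneg (h.areaTail_pos hr2).le (h.vol3_pos' r).le),
        div_eq_mul_inv]
      exact mul_le_mul_of_nonneg_right (h1 r hr1.le) (inv_nonneg.2 (h.vol3_pos' r).le)
  rw [← Ioc_union_Ioi_eq_Ioi (le_max_left t t₁)]
  refine IntegrableOn.union ?_ hI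
  refine IntegrableOn.mono_set (t := Icc t t₂) ?_ Ioc_subset_Icc_self
  exact (hc.mono fun x hx => ht.trans_le hx.1).integrableOn_Icc

lemma volTail_pos (h : TailLimit a t₀ α) (ht : t₀ < t) : 0 < volTail a t := by
  unfold volTail
  rw [setIntegral_pos_iff_support_of_nonneg_ae _ (h.integrableOn_area_div ht)]
  · have : Ioi t ⊆ Function.support fun r => areaTail a r / vol3 a r := fun r hr =>
      (div_pos (h.areaTail_pos (ht.trans hr)) (h.vol3_pos' r)).ne'
    rw [inter_eq_right.2 this]
    simp
  · filter_upwards [ae_restrict_mem measurableSet_Ioi] with r hr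
    exact (div_pos (h.areaTail_pos (ht.trans hr)) (h.vol3_pos' r)).le

lemma hasDerivAt_volTail (h : TailLimit a t₀ α) (ht : t₀ < t) :
    HasDerivAt (volTail a) (-(areaTail a t / vol3 a t)) t :=
  hasDerivAt_tail (h.continuousOn_areaTail.div (continuous_vol3 h.scale).continuousOn
    fun r _ => (h.vol3_pos' r).ne') (fun _ hx => h.integrableOn_area_div hx) ht

lemma tendsto_volTail (h : TailLimit a t₀ α) : Tendsto (volTail a) atTop (𝓝 0) :=
  tendsto_tail (h.integrableOn_area_div (lt_add_one t₀))

lemma meanRad_pos (h : TailLimit a t₀ α) (ht : t₀ < t) : 0 < meanRad a t := by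
  have := h.volTail_pos ht; have := h.areaTail_pos ht; have := h.vol3_pos' t
  unfold meanRad; positivity

end TailLimit

end BianchiI

end

open scoped ContDiff ENNReal

noncomputable section

/-! ### Minkowski's formula and the comparison of a section with its bounding box. -/

namespace BianchiI

open Bianchi

namespace TailLimit

variable {a : Fin 3 → ℝ → ℝ} {t₀ : ℝ} {α : Space → ℝ} {t : ℝ} {p : Space}

lemma lintegral_fq_curvTail (h : TailLimit a t₀ α) (ht : t₀ < t) :
    ∫⁻ p, ENNReal.ofReal (fq a t p) * ENNReal.ofReal (curvTail a t p) ∂sph =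
      ENNReal.ofReal (areaTail a t / vol3 a t) := by
  have hv := h.vol3_pos' t
  have e : ∀ p, ENNReal.ofReal (fq a t p) * ENNReal.ofReal (curvTail a t p) =
      ENNReal.ofReal ((vol3 a t)⁻¹ * densTail a t p) := fun p => by
    rw [← ENNReal.ofReal_mul fq_nonneg, densTail]
    congr 1
    field_simp
  simp only [e]
  rw [← ofReal_integral_eq_lintegral_ofReal ((h.int t ht).const_mul _)
    (Eventually.of_forall fun p => mul_nonneg (inv_pos.2 hv).le (h.densTail_nonneg t p)),
    integral_const_mul, areaTail, div_eq_inv_mul]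

lemma lintegral_sup_curvTail (h : TailLimit a t₀ α) (ht : t₀ < t) :
    ∫⁻ p, (∫⁻ u in Ioi t, ENNReal.ofReal (fq a u p)) * ENNReal.ofReal (curvTail a t p) ∂sph =
      ENNReal.ofReal (3 * volTail a t) := by
  rw [lintegral_support_curvTail h.scale h.tail, ENNReal.ofReal_mul (by norm_num)]
  congr 1
  · simp
  rw [volTail, ofReal_integral_eq_lintegral_ofReal (h.integrableOn_area_div ht)]
  · refine setLIntegral_congr_fun measurableSet_Ioi fun u hu => ?_
    exact h.lintegral_fq_curvTail (ht.trans hu)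
  · filter_upwards [ae_restrict_mem measurableSet_Ioi] with r hr
    exact (div_pos (h.areaTail_pos (ht.trans hr)) (h.vol3_pos' r)).le

/-- `lintegral_sup_curvTail` is finite, so some generic direction has a finite product of `∫ fq`
with a positive curvature. There `∫ fq` is finite, and `fq` dominates a multiple of every `1 / a i`.
-/
lemma integrableOn_inv (h : TailLimit a t₀ α) (ht : t₀ < t) (i : Fin 3) :
    IntegrableOn (fun r => (a i r)⁻¹) (Ioi t) := by
  have hfm : Measurable fun z : Space × ℝ => ENNReal.ofReal (fq a z.2 z.1) :=
    ((measurable_fq h.scale).comp measurable_swap).ennreal_ofReal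
  have h1 : ∀ᵐ p ∂sph, (∫⁻ u in Ioi t, ENNReal.ofReal (fq a u p)) *
      ENNReal.ofReal (curvTail a t p) < ⊤ := by
    refine ae_lt_top ?_ (by rw [h.lintegral_sup_curvTail ht]; exact ENNReal.ofReal_ne_top)
    exact hfm.lintegral_prod_right'.mul (measurable_curvTail h.scale t).ennreal_ofReal
  have : NeBot (ae sph) := ae_neBot.2 sph_ne_zero
  obtain ⟨p, hp1, hp⟩ := (h1.and ae_sph_coord_ne).exists
  have hκ : ENNReal.ofReal (curvTail a t p) ≠ 0 := by
    simpa using curvTail_pos h.scale h.tail hp t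
  have hfin : ∫⁻ u in Ioi t, ENNReal.ofReal (fq a u p) < ⊤ := by
    by_contra hcon
    rw [not_lt, top_le_iff] at hcon
    rw [hcon, ENNReal.top_mul hκ] at hp1
    exact lt_irrefl _ hp1
  have hi : IntegrableOn (fun u => fq a u p) (Ioi t) := by
    refine ⟨(continuous_fq_left h.scale p).aestronglyMeasurable, ?_⟩
    rw [hasFiniteIntegral_iff_ofReal (Eventually.of_forall fun _ => fq_nonneg)]
    exact hfin
  have hpi : 0 < |p i| := abs_pos.2 (hp i)
  refine Integrable.mono' (hi.const_mul |p i|⁻¹) ?_ ?_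
  · exact ((h.scale.cont i).inv₀ fun r => (h.scale.pos i r).ne').aestronglyMeasurable
  · refine Eventually.of_forall fun r => ?_
    have := abs_mul_inv_le_fq (a := a) (t := r) (p := p) i
    rw [Real.norm_of_nonneg (inv_pos.2 (h.scale.pos i r)).le, inv_mul_eq_div, le_div_iff₀ hpi,
      mul_comm]
    exact this

lemma integrableOn_fq (h : TailLimit a t₀ α) (ht : t₀ < t) (p : Space) :
    IntegrableOn (fun r => fq a r p) (Ioi t) := by
  refine Integrable.mono' (g := fun r => ∑ i, |p i| * (a i r)⁻¹)
    (integrable_finsetSum _ fun i _ => (h.integrableOn_inv ht i).const_mul _)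
    (continuous_fq_left h.scale p).aestronglyMeasurable (Eventually.of_forall fun r => ?_)
  rw [Real.norm_of_nonneg fq_nonneg]
  exact fq_le_sum fun i => h.scale.pos i r

lemma xTail_pos (h : TailLimit a t₀ α) (ht : t₀ < t) (i : Fin 3) : 0 < xTail a i t :=
  tail_pos (fun r => inv_pos.2 (h.scale.pos i r)) (h.integrableOn_inv ht i)

lemma supTail_pos (h : TailLimit a t₀ α) (ht : t₀ < t) (hp : p ≠ 0) : 0 < supTail a t p :=
  tail_pos (fun r => h.fq_pos' r hp) (h.integrableOn_fq ht p)

lemma supTail_le_sum (h : TailLimit a t₀ α) (ht : t₀ < t) :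
    supTail a t p ≤ ∑ i, |p i| * xTail a i t := by
  have : ∑ i, |p i| * xTail a i t = ∫ r in Ioi t, ∑ i, |p i| * (a i r)⁻¹ := by
    rw [integral_finsetSum _ fun i _ => (h.integrableOn_inv ht i).const_mul _]
    simp only [integral_const_mul, xTail]
  rw [this]
  exact integral_mono (h.integrableOn_fq ht p)
    (integrable_finsetSum _ fun i _ => (h.integrableOn_inv ht i).const_mul _)
    fun r => fq_le_sum fun i => h.scale.pos i r

lemma abs_mul_xTail_le (h : TailLimit a t₀ α) (ht : t₀ < t) (i : Fin 3) :
    |p i| * xTail a i t ≤ supTail a t p := by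
  rw [xTail, ← integral_const_mul]
  exact integral_mono ((h.integrableOn_inv ht i).const_mul _) (h.integrableOn_fq ht p)
    fun _ => abs_mul_inv_le_fq i

lemma hasDerivAt_xTail (h : TailLimit a t₀ α) (ht : t₀ < t) (i : Fin 3) :
    HasDerivAt (xTail a i) (-(a i t)⁻¹) t :=
  hasDerivAt_tail ((h.scale.cont i).inv₀ fun r => (h.scale.pos i r).ne').continuousOn
    (fun _ hx => h.integrableOn_inv hx i) ht

lemma hasDerivAt_supTail (h : TailLimit a t₀ α) (ht : t₀ < t) (p : Space) :
    HasDerivAt (fun t => supTail a t p) (-fq a t p) t :=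
  hasDerivAt_tail (continuous_fq_left h.scale p).continuousOn
    (fun _ hx => h.integrableOn_fq hx p) ht

lemma measurable_supTail (h : TailLimit a t₀ α) (t : ℝ) : Measurable (supTail a t) := by
  have := ((measurable_fq h.scale).comp measurable_swap).stronglyMeasurable
  exact (this.integral_prod_right' (ν := volume.restrict (Ioi t))).measurable

lemma ofReal_supTail (h : TailLimit a t₀ α) (ht : t₀ < t) (p : Space) :
    ENNReal.ofReal (supTail a t p) = ∫⁻ u in Ioi t, ENNReal.ofReal (fq a u p) :=
  ofReal_integral_eq_lintegral_ofReal (h.integrableOn_fq ht p)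
    (Eventually.of_forall fun _ => fq_nonneg)

lemma ofReal_xTail (h : TailLimit a t₀ α) (ht : t₀ < t) (i : Fin 3) :
    ENNReal.ofReal (xTail a i t) = xE a i t :=
  ofReal_integral_eq_lintegral_ofReal (h.integrableOn_inv ht i)
    (Eventually.of_forall fun r => (inv_pos.2 (h.scale.pos i r)).le)

lemma supTail_nonneg (t : ℝ) (p : Space) : 0 ≤ supTail a t p := integral_nonneg fun _ => fq_nonneg

lemma integrable_sup_curv (h : TailLimit a t₀ α) (ht : t₀ < t) :
    Integrable (fun p => supTail a t p * curvTail a t p) sph := by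
  refine ⟨((h.measurable_supTail t).mul (measurable_curvTail h.scale t)).aestronglyMeasurable, ?_⟩
  rw [hasFiniteIntegral_iff_ofReal (Eventually.of_forall fun p =>
    mul_nonneg (supTail_nonneg t p) (curvTail_nonneg t))]
  simp only [ENNReal.ofReal_mul (supTail_nonneg t _), h.ofReal_supTail ht]
  rw [h.lintegral_sup_curvTail ht]
  exact ENNReal.ofReal_lt_top

/-- The comoving volume as a third of the integral of the support function over the section. -/
lemma integral_sup_curv (h : TailLimit a t₀ α) (ht : t₀ < t) :
    ∫ p, supTail a t p * curvTail a t p ∂sph = 3 * volTail a t := by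
  rw [integral_eq_lintegral_of_nonneg_ae (Eventually.of_forall fun p =>
    mul_nonneg (supTail_nonneg t p) (curvTail_nonneg t)) (h.integrable_sup_curv ht).1]
  simp only [ENNReal.ofReal_mul (supTail_nonneg t _), h.ofReal_supTail ht]
  rw [h.lintegral_sup_curvTail ht, ENNReal.toReal_ofReal]
  have := h.volTail_pos ht
  positivity

lemma integrable_abs_curv (h : TailLimit a t₀ α) (ht : t₀ < t) (i : Fin 3) :
    Integrable (fun p => |p i| * curvTail a t p) sph := by
  have hx := h.xTail_pos ht i
  refine Integrable.mono' ((h.integrable_sup_curv ht).const_mul (xTail a i t)⁻¹) ?_ ?_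
  · exact (by fun_prop : Measurable fun p : Space => |p i|).mul
      (measurable_curvTail h.scale t) |>.aestronglyMeasurable
  · refine Eventually.of_forall fun p => ?_
    rw [Real.norm_of_nonneg (mul_nonneg (abs_nonneg _) (curvTail_nonneg t)), ← mul_assoc]
    refine mul_le_mul_of_nonneg_right ?_ (curvTail_nonneg t)
    rw [inv_mul_eq_div, le_div_iff₀ hx]
    exact h.abs_mul_xTail_le ht i

lemma ofReal_integral_abs_curv (h : TailLimit a t₀ α) (ht : t₀ < t) (i : Fin 3) :
    ENNReal.ofReal (∫ p, |p i| * curvTail a t p ∂sph) =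
      ∫⁻ p, ENNReal.ofReal |p i| * ENNReal.ofReal (curvTail a t p) ∂sph := by
  rw [ofReal_integral_eq_lintegral_ofReal (h.integrable_abs_curv ht i)
    (Eventually.of_forall fun p => mul_nonneg (abs_nonneg _) (curvTail_nonneg t))]
  simp only [ENNReal.ofReal_mul (abs_nonneg _)]

lemma integral_abs_curv_le (h : TailLimit a t₀ α) (ht : t₀ < t) (i : Fin 3) :
    ∫ p, |p i| * curvTail a t p ∂sph ≤ mvBall * (xTail a (i + 1) t * xTail a (i + 2) t) := by
  have hB := mvBall_pos
  have h1 := h.xTail_pos ht (i + 1)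
  have h2 := h.xTail_pos ht (i + 2)
  rw [← ENNReal.ofReal_le_ofReal_iff (by positivity), h.ofReal_integral_abs_curv ht,
    ENNReal.ofReal_mul hB.le, ENNReal.ofReal_mul h1.le, h.ofReal_xTail ht, h.ofReal_xTail ht]
  exact lintegral_abs_curvTail_le h.scale h.tail i t

lemma le_integral_abs_curv (h : TailLimit a t₀ α) (ht : t₀ < t) (i : Fin 3) :
    mvBall / 12 * (xTail a (i + 1) t * xTail a (i + 2) t) ≤ ∫ p, |p i| * curvTail a t p ∂sph := by
  have hB := mvBall_pos
  have h1 := h.xTail_pos ht (i + 1)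
  have h2 := h.xTail_pos ht (i + 2)
  have h0 : 0 ≤ ∫ p, |p i| * curvTail a t p ∂sph :=
    integral_nonneg fun p => mul_nonneg (abs_nonneg _) (curvTail_nonneg t)
  have key : mvBall / 6 * (xTail a (i + 1) t * xTail a (i + 2) t) ≤
      2 * ∫ p, |p i| * curvTail a t p ∂sph := by
    rw [← ENNReal.ofReal_le_ofReal_iff (by positivity), ENNReal.ofReal_mul (q := ∫ p, _ ∂sph)
      (by norm_num), h.ofReal_integral_abs_curv ht, ENNReal.ofReal_mul (p := mvBall / 6)
      (by positivity), ENNReal.ofReal_mul h1.le,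
      h.ofReal_xTail ht, h.ofReal_xTail ht]
    refine (le_lintegral_abs_curvTail h.scale h.tail (i := i) ?_ ?_ ?_ t).trans (le_of_eq ?_)
    · fin_cases i <;> simp
    · fin_cases i <;> simp
    · fin_cases i <;> simp
    · simp
  linarith

/-- The support function is at least that of the segment along axis 0, and the shadow along that
axis is bounded below; Minkowski's factor 3 times 12 gives 36. -/
lemma le_volTail (h : TailLimit a t₀ α) (ht : t₀ < t) :
    mvBall / 36 * ∏ i, xTail a i t ≤ volTail a t := by
  have h1 := h.le_integral_abs_curv ht 0
  have hx := h.xTail_pos ht 0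
  have h2 : xTail a 0 t * ∫ p, |p 0| * curvTail a t p ∂sph ≤ 3 * volTail a t := by
    rw [← h.integral_sup_curv ht, ← integral_const_mul]
    refine integral_mono ((h.integrable_abs_curv ht 0).const_mul _) (h.integrable_sup_curv ht)
      fun p => ?_
    simp only
    rw [← mul_assoc, mul_comm (xTail a 0 t)]
    exact mul_le_mul_of_nonneg_right (h.abs_mul_xTail_le ht 0) (curvTail_nonneg t)
  have h3 := mul_le_mul_of_nonneg_left h1 hx.le
  simp only [Fin.prod_univ_three, zero_add] at *
  linarith

/-- The support function is at most that of the bounding box, and each of the three shadows has its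
box bound; the three equal contributions absorb Minkowski's factor 3. -/
lemma volTail_le (h : TailLimit a t₀ α) (ht : t₀ < t) :
    volTail a t ≤ mvBall * ∏ i, xTail a i t := by
  have h2 : 3 * volTail a t ≤ ∑ i, xTail a i t * ∫ p, |p i| * curvTail a t p ∂sph := by
    simp only [← integral_const_mul]
    rw [← h.integral_sup_curv ht,
      ← integral_finsetSum _ fun i _ => (h.integrable_abs_curv ht i).const_mul _]
    refine integral_mono (h.integrable_sup_curv ht) (integrable_finsetSum _ fun i _ =>
      (h.integrable_abs_curv ht i).const_mul _) fun p => ?_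
    simp only
    refine (mul_le_mul_of_nonneg_right (h.supTail_le_sum ht) (curvTail_nonneg t)).trans
      (le_of_eq ?_)
    rw [Finset.sum_mul]
    exact Finset.sum_congr rfl fun i _ => by ring
  have h3 : ∀ i, xTail a i t * ∫ p, |p i| * curvTail a t p ∂sph ≤ mvBall * ∏ i, xTail a i t := by
    intro i
    refine (mul_le_mul_of_nonneg_left (h.integral_abs_curv_le ht i) (h.xTail_pos ht i).le).trans
      (le_of_eq ?_)
    fin_cases i <;> simp [Fin.prod_univ_three] <;> ring
  have h4 := h2.trans (Finset.sum_le_sum fun i _ => h3 i)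
  simp at h4
  linarith

end TailLimit

end BianchiI

namespace BianchiI

open Bianchi

/-! ### Polar angles -/

lemma exists_polar (x y : ℝ) : ∃ φ ∈ Icc 0 (2 * Real.pi),
    x = √(x ^ 2 + y ^ 2) * Real.cos φ ∧ y = √(x ^ 2 + y ^ 2) * Real.sin φ := by
  have hn : ‖(⟨x, y⟩ : ℂ)‖ = √(x ^ 2 + y ^ 2) := by
    rw [Complex.norm_def, Complex.normSq_mk]; ring_nf
  have h1 := Complex.norm_mul_cos_arg (⟨x, y⟩ : ℂ)
  have h2 := Complex.norm_mul_sin_arg (⟨x, y⟩ : ℂ)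
  rw [hn] at h1 h2
  have hpi := Real.pi_pos
  have h3 := Complex.neg_pi_lt_arg (⟨x, y⟩ : ℂ)
  have h4 := Complex.arg_le_pi (⟨x, y⟩ : ℂ)
  by_cases h : 0 ≤ Complex.arg (⟨x, y⟩ : ℂ)
  · exact ⟨_, ⟨h, by linarith⟩, h1.symm, h2.symm⟩
  · refine ⟨Complex.arg (⟨x, y⟩ : ℂ) + 2 * Real.pi, ⟨by linarith, by linarith⟩, ?_, ?_⟩
    · rw [Real.cos_add_two_pi]; exact h1.symm
    · rw [Real.sin_add_two_pi]; exact h2.symm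

lemma exists_dir {p : Space} (hp : ‖p‖ = 1) :
    ∃ θ ∈ Icc 0 Real.pi, ∃ φ ∈ Icc 0 (2 * Real.pi), p = dir θ φ := by
  have hs := sum_sq_of_norm hp
  have h2 := abs_le.1 (abs_le_one_of_norm hp 2)
  obtain ⟨φ, hφ, h0, h1⟩ := exists_polar (p 0) (p 1)
  have hsin : Real.sin (Real.arccos (p 2)) = √(p 0 ^ 2 + p 1 ^ 2) := by
    rw [Real.sin_arccos]
    congr 1
    rw [Fin.sum_univ_three] at hs
    linarith
  refine ⟨Real.arccos (p 2), ⟨Real.arccos_nonneg _, Real.arccos_le_pi _⟩, φ, hφ, ?_⟩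
  ext i
  fin_cases i
  · simpa [dir, hsin] using h0
  · simpa [dir, hsin] using h1
  · simpa [dir] using (Real.cos_arccos h2.1 h2.2).symm

/-- Polar angles cover the sphere and the open rectangle of angles is dense in the closed one, so
the preimage of `U` meets the open rectangle, where `sin θ > 0`. -/
lemma sph_pos_of_isOpen {U : Set Space} (hU : IsOpen U) {p : Space} (hp : ‖p‖ = 1) (hpU : p ∈ U) :
    0 < sph U := by
  obtain ⟨θ, hθ, φ, hφ, rfl⟩ := exists_dir hp
  have hpi := Real.pi_pos
  have hV : IsOpen (dirMap ⁻¹' U) := hU.preimage continuous_dirMap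
  have hcl : ((θ, φ) : ℝ × ℝ) ∈ closure (Ioo 0 Real.pi ×ˢ Ioo 0 (2 * Real.pi)) := by
    rw [closure_prod_eq, closure_Ioo hpi.ne, closure_Ioo (by positivity)]
    exact ⟨hθ, hφ⟩
  obtain ⟨w, hwV, hwb⟩ := mem_closure_iff.1 hcl _ hV hpU
  set W := dirMap ⁻¹' U ∩ Ioo 0 Real.pi ×ˢ Ioo 0 (2 * Real.pi) with hW
  have hWo : IsOpen W := hV.inter (isOpen_Ioo.prod isOpen_Ioo)
  rw [sph, Measure.map_apply measurable_dirMap hU.measurableSet]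
  refine lt_of_lt_of_le ?_ (measure_mono (inter_subset_left : W ⊆ dirMap ⁻¹' U))
  rw [angleMeasure, Measure.prod_restrict, withDensity_apply _ hWo.measurableSet,
    Measure.restrict_restrict hWo.measurableSet]
  have hsub : W ∩ Ioc 0 Real.pi ×ˢ Ioc 0 (2 * Real.pi) = W := inter_eq_left.2 fun x hx =>
    ⟨Ioo_subset_Ioc_self hx.2.1, Ioo_subset_Ioc_self hx.2.2⟩
  rw [hsub, lintegral_pos_iff_support (by fun_prop), Measure.restrict_apply']
  · have : Function.support (fun w : ℝ × ℝ => ENNReal.ofReal (Real.sin w.1)) ∩ W = W :=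
      inter_eq_right.2 fun x hx => by
        simpa using Real.sin_pos_of_mem_Ioo hx.2.1
    rw [this]
    exact hWo.measure_pos _ ⟨w, hwV, hwb⟩
  · exact hWo.measurableSet

lemma eq_of_ae_sph {f g : Space → ℝ} (hf : ContinuousOn f {0}ᶜ) (hg : ContinuousOn g {0}ᶜ)
    (h : ∀ᵐ p ∂sph, f p = g p) {p : Space} (hp : ‖p‖ = 1) : f p = g p := by
  by_contra hne
  have ho : IsOpen ({0}ᶜ ∩ (fun p => f p - g p) ⁻¹' {0}ᶜ) :=
    (hf.sub hg).isOpen_inter_preimage isOpen_compl_singleton isOpen_compl_singleton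
  have := sph_pos_of_isOpen ho hp ⟨ne_zero_of_norm hp, sub_ne_zero.2 hne⟩
  refine this.ne' (measure_mono_null ?_ h)
  rintro q ⟨-, hq⟩ hq'
  exact hq (by simp [show f q = g q from hq'])

/-! ### Comparison of directions -/

/-- The moduli of the components of two momenta agree up to the factor `θ`. -/
def Near (θ : ℝ) (p q : Space) : Prop := ∀ i, |q i| ≤ θ * |p i| ∧ |p i| ≤ θ * |q i|

section

variable {a : Fin 3 → ℝ → ℝ} {θ t : ℝ} {p q : Space}

lemma Near.symm (h : Near θ p q) : Near θ q p := fun i => (h i).symm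

lemma Near.fq_le (h : Near θ p q) (hθ : 0 ≤ θ) : fq a t q ≤ θ * fq a t p := by
  refine Real.sqrt_le_iff.2 ⟨mul_nonneg hθ fq_nonneg, ?_⟩
  rw [mul_pow, fq_sq, Finset.mul_sum]
  refine Finset.sum_le_sum fun i _ => ?_
  rw [div_pow, div_pow, ← mul_div_assoc, ← mul_pow, ← sq_abs (q i), ← sq_abs (θ * p i), abs_mul,
    abs_of_nonneg hθ]
  have := (h i).1
  gcongr

lemma Near.hk_le (h : Near θ p q) (ha : IsScale a) (hθ : 0 < θ) (hp : p ≠ 0) (hq : q ≠ 0)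
    (k : Fin 3) : hk a k t q ≤ θ ^ 3 * hk a k t p := by
  have h1 := h.symm.fq_le (a := a) (t := t) hθ.le
  have p1 := fq_pos (fun i => ha.pos i t) hp
  have p2 := fq_pos (fun i => ha.pos i t) hq
  have a1 := ha.pos (k + 1) t
  have a2 := ha.pos (k + 2) t
  have h2 : fq a t p ^ 3 ≤ θ ^ 3 * fq a t q ^ 3 := by
    rw [← mul_pow]; gcongr
  unfold hk
  rw [← div_eq_mul_inv, inv_eq_one_div, div_le_div_iff₀ (by positivity) (by positivity)]
  nlinarith [mul_le_mul_of_nonneg_left h2 (sq_nonneg (a (k + 1) t * a (k + 2) t))]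

end

/-! ### Local radii and Hubble-type lengths. -/

namespace TailLimit

variable {a : Fin 3 → ℝ → ℝ} {t₀ : ℝ} {α : Space → ℝ} {t : ℝ} {p : Space}

lemma supTail_le_of_near (h : TailLimit a t₀ α) (ht : t₀ < t) {θ : ℝ} {q : Space}
    (hn : Near θ p q) (hθ : 0 ≤ θ) : supTail a t q ≤ θ * supTail a t p := by
  unfold supTail
  rw [← integral_const_mul]
  exact integral_mono (h.integrableOn_fq ht q) ((h.integrableOn_fq ht p).const_mul _) fun r =>
    hn.fq_le hθ

/-- Local radius of the section of the light cone with tip at infinity, in units of the mean. -/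
def relRad (a : Fin 3 → ℝ → ℝ) (t : ℝ) (p : Space) : ℝ := supTail a t p / fq a t p / meanRad a t

lemma relRad_pos (h : TailLimit a t₀ α) (ht : t₀ < t) (hp : p ≠ 0) : 0 < relRad a t p :=
  div_pos (div_pos (h.supTail_pos ht hp) (h.fq_pos' t hp)) (h.meanRad_pos ht)

lemma relRad_le_of_near (h : TailLimit a t₀ α) (ht : t₀ < t) {θ : ℝ} {q : Space}
    (hn : Near θ p q) (hθ : 0 < θ) (hp : p ≠ 0) (hq : q ≠ 0) :
    relRad a t q ≤ θ ^ 2 * relRad a t p := by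
  unfold relRad
  have h1 := h.supTail_le_of_near ht hn hθ.le
  have h2 := hn.symm.fq_le (a := a) (t := t) hθ.le
  have h3 := h.fq_pos' t hp
  have h4 := h.fq_pos' t hq
  have h5 := h.supTail_pos ht hp
  rw [← mul_div_assoc]
  have h6 := (h.meanRad_pos ht).le
  refine div_le_div_of_nonneg_right ?_ h6
  rw [← mul_div_assoc, div_le_div_iff₀ h4 h3]
  calc supTail a t q * fq a t p ≤ (θ * supTail a t p) * (θ * fq a t q) := by gcongr
    _ = _ := by ring

/-- Hubble-type length `a_i ∫ 1/a_i` of a scale factor. -/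
def qLen (a : Fin 3 → ℝ → ℝ) (i : Fin 3) (t : ℝ) : ℝ := a i t * xTail a i t

lemma qLen_pos (h : TailLimit a t₀ α) (ht : t₀ < t) (i : Fin 3) : 0 < qLen a i t :=
  mul_pos (h.scale.pos i t) (h.xTail_pos ht i)

lemma vol3_eq (i : Fin 3) (t : ℝ) : vol3 a t = a i t * (a (i + 1) t * a (i + 2) t) := by
  unfold vol3
  rw [Fin.prod_univ_three]
  fin_cases i <;> simp <;> ring

lemma prod_eq (f : Fin 3 → ℝ) (i : Fin 3) : ∏ j, f j = f i * (f (i + 1) * f (i + 2)) := by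
  rw [Fin.prod_univ_three]
  fin_cases i <;> simp <;> ring

/-- A bound uniform in the direction; it dominates the integrands when reciprocal radii are averaged
against `α`. -/
lemma fq_div_supTail_le (h : TailLimit a t₀ α) (ht : t₀ < t) (hp : p ≠ 0) :
    fq a t p / supTail a t p ≤ ∑ i, (qLen a i t)⁻¹ := by
  have hS := h.supTail_pos ht hp
  rw [div_le_iff₀ hS]
  refine (fq_le_sum fun i => h.scale.pos i t).trans ?_
  rw [Finset.sum_mul]
  refine Finset.sum_le_sum fun i _ => ?_
  have h1 := h.xTail_pos ht i
  have h2 := h.scale.pos i t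
  have h3 := h.abs_mul_xTail_le ht i (p := p)
  rw [qLen, mul_inv]
  calc |p i| * (a i t)⁻¹ = (a i t)⁻¹ * (xTail a i t)⁻¹ * (|p i| * xTail a i t) := by field_simp
    _ ≤ _ := by gcongr

/-- Fraction of the frequency carried by one momentum component. -/
def freqPart (a : Fin 3 → ℝ → ℝ) (i : Fin 3) (t : ℝ) (p : Space) : ℝ := |p i| / (a i t * fq a t p)

lemma freqPart_nonneg (h : TailLimit a t₀ α) (i : Fin 3) : 0 ≤ freqPart a i t p :=
  div_nonneg (abs_nonneg _) (mul_nonneg (h.scale.pos i t).le fq_nonneg)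

lemma freqPart_le_one (h : TailLimit a t₀ α) (i : Fin 3) : freqPart a i t p ≤ 1 := by
  have h1 := abs_mul_inv_le_fq (a := a) (t := t) (p := p) i
  have h2 := h.scale.pos i t
  refine div_le_one_of_le₀ ?_ (mul_nonneg h2.le fq_nonneg)
  rw [← div_eq_mul_inv, div_le_iff₀ h2] at h1
  linarith

lemma measurable_freqPart (h : TailLimit a t₀ α) (i : Fin 3) (t : ℝ) :
    Measurable (freqPart a i t) := by
  have := (continuous_fq_right h.scale t).measurable
  unfold freqPart
  fun_prop

lemma integrable_freqPart_mul (h : TailLimit a t₀ α) {f : Space → ℝ} (hf : Integrable f sph)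
    (i : Fin 3) (t : ℝ) : Integrable (fun p => f p * freqPart a i t p) sph := by
  refine hf.mul_bdd (c := 1) (h.measurable_freqPart i t).aestronglyMeasurable
    (Eventually.of_forall fun p => ?_)
  rw [Real.norm_of_nonneg (h.freqPart_nonneg i)]
  exact h.freqPart_le_one i

/-- The lower shadow bound along axis `i`, multiplied by the two other scale factors. The weight
`freqPart` is at most one, but it is kept because it vanishes in the limit when axis `i` of the
shape degenerates. -/
lemma qLen_mul_le (h : TailLimit a t₀ α) (ht : t₀ < t) (i : Fin 3) :
    mvBall / 12 * (qLen a (i + 1) t * qLen a (i + 2) t) ≤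
      ∫ p, densTail a t p * freqPart a i t p ∂sph := by
  have h1 := h.le_integral_abs_curv ht i
  have p1 := h.scale.pos (i + 1) t
  have p2 := h.scale.pos (i + 2) t
  have e : ∫ p, densTail a t p * freqPart a i t p ∂sph =
      (a (i + 1) t * a (i + 2) t) * ∫ p, |p i| * curvTail a t p ∂sph := by
    rw [← integral_const_mul]
    refine integral_congr_ae ?_
    filter_upwards [ae_sph_coord_ne] with p hp
    have := h.fq_pos' t (ne_zero_of_generic hp)
    have := h.scale.pos i t
    simp only [densTail, freqPart, vol3_eq i]
    field_simp
  rw [e, qLen, qLen]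
  calc _ = (a (i + 1) t * a (i + 2) t) *
        (mvBall / 12 * (xTail a (i + 1) t * xTail a (i + 2) t)) := by ring
    _ ≤ _ := by gcongr

lemma qLen_mul_le_area (h : TailLimit a t₀ α) (ht : t₀ < t) (i : Fin 3) :
    mvBall / 12 * (qLen a (i + 1) t * qLen a (i + 2) t) ≤ areaTail a t := by
  refine (h.qLen_mul_le ht i).trans ?_
  refine integral_mono (h.integrable_freqPart_mul (h.int t ht) i t) (h.int t ht) fun p => ?_
  simp only
  have := h.freqPart_le_one i (t := t) (p := p)
  have := h.densTail_nonneg t p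
  nlinarith

lemma prod_qLen (t : ℝ) : ∏ i, qLen a i t = vol3 a t * ∏ i, xTail a i t := by
  simp only [qLen, Finset.prod_mul_distrib, vol3]

lemma meanRad_le (h : TailLimit a t₀ α) (ht : t₀ < t) :
    meanRad a t ≤ 3 * mvBall / areaTail a t * ∏ i, qLen a i t := by
  have h1 := h.volTail_le ht
  have hA := h.areaTail_pos ht
  have hv := h.vol3_pos' t
  rw [meanRad, prod_qLen, div_mul_eq_mul_div]
  refine div_le_div_of_nonneg_right ?_ hA.le
  nlinarith [mul_le_mul_of_nonneg_left h1 hv.le]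

lemma meanRad_div_le (h : TailLimit a t₀ α) (ht : t₀ < t) (i : Fin 3) :
    meanRad a t / qLen a i t ≤
      3 * mvBall / areaTail a t * (qLen a (i + 1) t * qLen a (i + 2) t) := by
  have h1 := h.meanRad_le ht
  have hq := h.qLen_pos ht i
  rw [div_le_iff₀ hq]
  rw [prod_eq _ i] at h1
  linarith

/-- The volume bound contributes `3 mvBall / A` and the area bound `12 A / mvBall`; their product is
36. -/
lemma meanRad_div_le_const (h : TailLimit a t₀ α) (ht : t₀ < t) (i : Fin 3) :
    meanRad a t / qLen a i t ≤ 36 := by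
  refine (h.meanRad_div_le ht i).trans ?_
  have h1 := h.qLen_mul_le_area ht i
  have hA := h.areaTail_pos ht
  rw [div_mul_eq_mul_div, div_le_iff₀ hA]
  linarith

end TailLimit

end BianchiI

namespace BianchiI

open Bianchi

/-! ### The deficit, and rigidity of the local radii when it is small. -/

namespace TailLimit

variable {a : Fin 3 → ℝ → ℝ} {t₀ : ℝ} {α : Space → ℝ} {t : ℝ} {p : Space}

lemma supTail_smul (t c : ℝ) (p : Space) : supTail a t (c • p) = |c| * supTail a t p := by
  unfold supTail
  rw [← integral_const_mul]
  refine integral_congr_ae (Eventually.of_forall fun r => ?_)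
  simp only [fq, PiLp.smul_apply, smul_eq_mul, mul_div_assoc, mul_pow, ← Finset.mul_sum]
  rw [Real.sqrt_mul (sq_nonneg c), Real.sqrt_sq_eq_abs]

lemma fq_smul (t c : ℝ) (p : Space) : fq a t (c • p) = |c| * fq a t p := by
  simp only [fq, PiLp.smul_apply, smul_eq_mul, mul_div_assoc, mul_pow, ← Finset.mul_sum]
  rw [Real.sqrt_mul (sq_nonneg c), Real.sqrt_sq_eq_abs]

lemma relRad_smul (t : ℝ) {c : ℝ} (hc : c ≠ 0) (p : Space) : relRad a t (c • p) = relRad a t p := by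
  unfold relRad
  rw [supTail_smul, fq_smul, mul_div_mul_left _ _ (abs_pos.2 hc).ne']

/-- Relative defect of the harmonic mean of the local radii. -/
def deficit (a : Fin 3 → ℝ → ℝ) (α : Space → ℝ) (t : ℝ) : ℝ :=
  meanRad a t / (∫ p, α p ∂sph) * ∫ p, α p * (fq a t p / supTail a t p) ∂sph - 1

/-- Distance of the area density from its limit. -/
def defect (a : Fin 3 → ℝ → ℝ) (α : Space → ℝ) (t : ℝ) : ℝ := ∫ p, |densTail a t p - α p| ∂sph

lemma integrable_fq_div_supTail (h : TailLimit a t₀ α) (ht : t₀ < t) :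
    Integrable (fun p => α p * (fq a t p / supTail a t p)) sph := by
  refine h.limInt.mul_bdd (c := ∑ i, (qLen a i t)⁻¹)
    ((continuous_fq_right h.scale t).measurable.div (h.measurable_supTail t)).aestronglyMeasurable ?_
  filter_upwards [ae_sph_norm] with p hp
  rw [Real.norm_of_nonneg (div_nonneg fq_nonneg (supTail_nonneg t p))]
  exact h.fq_div_supTail_le ht (ne_zero_of_norm hp)

lemma integrable_inv_relRad (h : TailLimit a t₀ α) (ht : t₀ < t) :
    Integrable (fun p => α p * (relRad a t p)⁻¹) sph := by
  refine ((h.integrable_fq_div_supTail ht).mul_const (meanRad a t)).congr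
    (Eventually.of_forall fun p => ?_)
  simp only [relRad, div_eq_mul_inv, mul_inv, inv_inv]
  ring

lemma integral_inv_relRad (h : TailLimit a t₀ α) :
    ∫ p, α p * (relRad a t p)⁻¹ ∂sph = (∫ p, α p ∂sph) * (deficit a α t + 1) := by
  have hL := h.lim_pos
  have e : ∀ p, α p * (relRad a t p)⁻¹ = meanRad a t * (α p * (fq a t p / supTail a t p)) := by
    intro p
    simp only [relRad, div_eq_mul_inv, mul_inv, inv_inv]
    ring
  simp only [e]
  rw [integral_const_mul, deficit]
  field_simp
  ring

lemma dens_mul_relRad (h : TailLimit a t₀ α) (hp : p ≠ 0) :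
    densTail a t p * relRad a t p = vol3 a t / meanRad a t * (supTail a t p * curvTail a t p) := by
  have := h.fq_pos' t hp
  simp only [densTail, relRad]
  field_simp

lemma integrable_relRad (h : TailLimit a t₀ α) (ht : t₀ < t) :
    Integrable (fun p => densTail a t p * relRad a t p) sph := by
  refine ((h.integrable_sup_curv ht).const_mul (vol3 a t / meanRad a t)).congr ?_
  filter_upwards [ae_sph_norm] with p hp
  exact (h.dens_mul_relRad (ne_zero_of_norm hp)).symm

/-- Minkowski's formula `integral_sup_curv` in normalized form: `meanRad` is defined so that the
relative radii have mean one with respect to area. -/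
lemma integral_relRad (h : TailLimit a t₀ α) (ht : t₀ < t) :
    ∫ p, densTail a t p * relRad a t p ∂sph = areaTail a t := by
  have e : ∫ p, densTail a t p * relRad a t p ∂sph =
      ∫ p, vol3 a t / meanRad a t * (supTail a t p * curvTail a t p) ∂sph := by
    refine integral_congr_ae ?_
    filter_upwards [ae_sph_norm] with p hp
    exact h.dens_mul_relRad (ne_zero_of_norm hp)
  rw [e, integral_const_mul, h.integral_sup_curv ht, meanRad]
  have := h.volTail_pos ht; have := h.areaTail_pos ht; have := h.vol3_pos' t
  field_simp

lemma integrable_defect (h : TailLimit a t₀ α) (ht : t₀ < t) :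
    Integrable (fun p => |densTail a t p - α p|) sph := ((h.int t ht).sub h.limInt).abs

/-- Chebyshev-type bound: the local radii on a set of directions are close to their mean unless the
deficit is large. -/
lemma le_deficit_of_subset (h : TailLimit a t₀ α) (ht : t₀ < t) {U : Set Space}
    (hU : MeasurableSet U) {c : ℝ} (hc : 0 ≤ c)
    (hcU : ∀ p ∈ U, (∀ i, p i ≠ 0) → c * relRad a t p ≤ (relRad a t p - 1) ^ 2) :
    c * (∫ p in U, α p ∂sph - defect a α t) ≤
      (∫ p, α p ∂sph) * deficit a α t + defect a α t := by
  have hA := h.int t ht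
  have i1 := h.integrable_inv_relRad ht
  have i2 := h.integrable_relRad ht
  have i3 := h.integrable_defect ht
  -- The mean-one identity for `relRad` is added, at no cost, to the deficit of its reciprocal. The
  -- result is essentially the integral of `z + 1/z - 2 = (z - 1)² / z`.
  have e1 : (∫ p, α p ∂sph) * deficit a α t + defect a α t =
      ∫ p, (α p * (relRad a t p)⁻¹ - α p) + (densTail a t p * relRad a t p - densTail a t p) +
        |densTail a t p - α p| ∂sph := by
    rw [integral_add (f := fun p => (α p * (relRad a t p)⁻¹ - α p) +
      (densTail a t p * relRad a t p - densTail a t p)) ((i1.sub h.limInt).add (i2.sub hA)) i3,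
      integral_add (f := fun p => α p * (relRad a t p)⁻¹ - α p)
        (g := fun p => densTail a t p * relRad a t p - densTail a t p)
        (i1.sub h.limInt) (i2.sub hA), integral_sub i1 h.limInt, integral_sub i2 hA,
      h.integral_inv_relRad, h.integral_relRad ht]
    unfold areaTail defect
    ring
  have e2 : c * (∫ p in U, α p ∂sph - defect a α t) ≤
      ∫ p, c * (U.indicator (fun p => α p - |densTail a t p - α p|) p) ∂sph := by
    rw [integral_const_mul, integral_indicator hU]
    refine mul_le_mul_of_nonneg_left ?_ hc
    rw [integral_sub h.limInt.integrableOn i3.integrableOn]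
    have := setIntegral_le_integral (s := U) i3 (Eventually.of_forall fun p => abs_nonneg _)
    unfold defect
    linarith
  refine e2.trans ?_
  rw [e1]
  refine integral_mono_ae (((h.limInt.sub i3).indicator hU).const_mul c)
    (((i1.sub h.limInt).add (i2.sub hA)).add i3) ?_
  filter_upwards [ae_sph_coord_ne, h.limPos] with p hp hα
  have hz := h.relRad_pos ht (ne_zero_of_generic hp)
  have hd := h.densTail_nonneg t p
  set z := relRad a t p
  set x := α p
  set y := densTail a t p
  have hg : 0 ≤ z + z⁻¹ - 2 := by
    have : z + z⁻¹ - 2 = (z - 1) ^ 2 / z := by field_simp; ring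
    rw [this]; positivity
  -- The two terms carry different densities, `α` and the actual one. The inequality is used with
  -- the smaller of the two and the difference is charged to `|y - x|`.
  have hmain : min x y * (z + z⁻¹ - 2) ≤ (x * z⁻¹ - x) + (y * z - y) + |y - x| := by
    have hzi : 0 < z⁻¹ := inv_pos.2 hz
    rcases le_total x y with hxy | hxy
    · rw [min_eq_left hxy, abs_of_nonneg (sub_nonneg.2 hxy)]
      nlinarith
    · rw [min_eq_right hxy, abs_of_nonpos (sub_nonpos.2 hxy)]
      nlinarith
  refine le_trans ?_ hmain
  by_cases hpU : p ∈ U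
  · rw [indicator_of_mem hpU]
    have h1 := hcU p hpU hp
    have h2 : c ≤ z + z⁻¹ - 2 := by
      have : z + z⁻¹ - 2 = (z - 1) ^ 2 / z := by field_simp; ring
      rw [this, le_div_iff₀ hz]; exact h1
    have h3 : x - |y - x| ≤ min x y := by
      refine le_min ?_ ?_
      · linarith [abs_nonneg (y - x)]
      · linarith [neg_abs_le (y - x)]
    have h4 : 0 ≤ min x y := le_min hα.le hd
    calc c * (x - |y - x|) ≤ c * min x y := by gcongr
      _ ≤ _ := by rw [mul_comm]; gcongr
  · rw [indicator_of_notMem hpU, mul_zero]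
    exact mul_nonneg (le_min hα.le hd) hg

/-- The previous estimate for the empty set of directions: the AM-GM inequality up to the L¹ error.
-/
lemma neg_defect_le (h : TailLimit a t₀ α) (ht : t₀ < t) :
    -(defect a α t / ∫ p, α p ∂sph) ≤ deficit a α t := by
  have hL := h.lim_pos
  have := h.le_deficit_of_subset ht MeasurableSet.empty le_rfl (by simp)
  rw [zero_mul] at this
  rw [← neg_div, div_le_iff₀ hL]
  linarith

lemma eventually_neg_le_deficit (h : TailLimit a t₀ α) {δ : ℝ} (hδ : 0 < δ) :
    ∀ᶠ t in atTop, -δ < deficit a α t := by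
  have h1 : Tendsto (fun t => -(defect a α t / ∫ p, α p ∂sph)) atTop (𝓝 0) := by
    have h2 : Tendsto (defect a α) atTop (𝓝 0) := h.lim
    simpa using (h2.div_const (∫ p, α p ∂sph)).neg
  filter_upwards [h1.eventually_const_lt (neg_lt_zero.2 hδ), eventually_gt_atTop t₀] with t h2 ht
  exact h2.trans_le (h.neg_defect_le ht)

/-- Where the deficit tends to zero, the local radii in all directions approach their mean. -/
theorem tendsto_relRad (h : TailLimit a t₀ α) {l : Filter ℝ} (hl : l ≤ atTop)
    (hD : Tendsto (deficit a α) l (𝓝 0)) (hp : ∀ i, p i ≠ 0) :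
    Tendsto (fun t => relRad a t p) l (𝓝 1) := by
  wlog hn : ‖p‖ = 1 generalizing p
  · have hp0 : ‖p‖⁻¹ ≠ 0 := inv_ne_zero (norm_ne_zero_iff.2 (ne_zero_of_generic hp))
    have := this (p := ‖p‖⁻¹ • p) (fun i => by simpa using ⟨ne_zero_of_generic hp, hp i⟩)
      (by
        rw [norm_smul, norm_inv, norm_norm, inv_mul_cancel₀ (norm_ne_zero_iff.2
          (ne_zero_of_generic hp))])
    simpa only [relRad_smul _ hp0] using this
  rw [Metric.tendsto_nhds]
  intro ε₀ hε₀
  wlog hε1 : ε₀ ≤ 1 generalizing ε₀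
  · exact (this 1 one_pos le_rfl).mono fun t ht => ht.trans (not_le.1 hε1)
  set ε := ε₀
  -- `θ²` is the ratio of `1 + ε` to `1 + ε/2`. Radii of directions that are `θ`-near differ by at
  -- most this factor, so a deviation `ε` at `p` forces a deviation `ε/2` on all of `U`, a set of
  -- positive `α`-mass.
  set θ := √((1 + ε) / (1 + ε / 2)) with hθ
  have hθ2 : θ ^ 2 = (1 + ε) / (1 + ε / 2) := Real.sq_sqrt (by positivity)
  have hθ1 : 1 < θ := by
    rw [hθ, Real.lt_sqrt zero_le_one, one_pow, lt_div_iff₀ (by positivity)]; linarith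
  have hθ0 : 0 < θ := one_pos.trans hθ1
  set U : Set Space := {q | ∀ i, |q i| < θ * |p i| ∧ |p i| < θ * |q i|} with hU
  have hUo : IsOpen U := by
    rw [hU]
    simp only [ofPred_forall]
    refine isOpen_iInter_of_finite fun i => ?_
    exact (isOpen_lt (f := fun q : Space => |q i|) (g := fun _ => θ * |p i|) (by fun_prop)
      (by fun_prop)).inter (isOpen_lt (f := fun _ => |p i|) (g := fun q : Space => θ * |q i|)
        (by fun_prop) (by fun_prop))
  have hpU : p ∈ U := fun i => by
    have := abs_pos.2 (hp i)
    constructor <;> nlinarith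
  have hβ : 0 < ∫ q in U, α q ∂sph := by
    rw [setIntegral_pos_iff_support_of_nonneg_ae (ae_restrict_of_ae (h.limPos.mono fun _ h => h.le))
      h.limInt.integrableOn]
    have : sph (Function.support α ∩ U) = sph U := by
      refine measure_congr ?_
      filter_upwards [h.limPos] with q hq
      exact propext ⟨fun h => h.2, fun h => ⟨hq.ne', h⟩⟩
    rw [this]
    exact sph_pos_of_isOpen hUo hn hpU
  set β := ∫ q in U, α q ∂sph
  -- For `ε ≤ 1` this satisfies `c z ≤ (z - 1)²` whenever `z ≥ 1 + ε/2` or `z ≤ 1 - ε/2`.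
  set c := ε ^ 2 / 8
  have hc : 0 < c := by positivity
  have h1 : Tendsto (fun t => c * (β - defect a α t)) l (𝓝 (c * (β - 0))) :=
    ((h.lim.mono_left hl).const_sub β).const_mul c
  have h2 : Tendsto (fun t => (∫ p, α p ∂sph) * deficit a α t + defect a α t) l
      (𝓝 ((∫ p, α p ∂sph) * 0 + 0)) := (hD.const_mul _).add (h.lim.mono_left hl)
  have h3 := h2.eventually_lt h1 (by simp; positivity)
  filter_upwards [h3, hl (eventually_gt_atTop t₀)] with t h3 ht
  by_contra hcon
  rw [not_lt, Real.dist_eq] at hcon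
  refine absurd (h.le_deficit_of_subset ht hUo.measurableSet hc.le ?_) (not_le.2 h3)
  intro q hqU hq
  have hn1 : Near θ p q := fun i => ⟨(hqU i).1.le, (hqU i).2.le⟩
  have hp0 := ne_zero_of_generic hp
  have hq0 := ne_zero_of_generic hq
  have g1 := h.relRad_le_of_near ht hn1 hθ0 hp0 hq0
  have g2 := h.relRad_le_of_near ht hn1.symm hθ0 hq0 hp0
  rw [hθ2, div_mul_eq_mul_div, le_div_iff₀ (by positivity)] at g1 g2
  have hz := h.relRad_pos ht hq0
  have hw := h.relRad_pos ht hp0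
  set z := relRad a t q
  set w := relRad a t p
  rcases le_abs.1 hcon with h4 | h4
  · have : 1 + ε / 2 ≤ z := by nlinarith
    simp only [c]
    nlinarith
  · have : z ≤ 1 - ε / 2 := by nlinarith
    simp only [c]
    nlinarith

end TailLimit

end BianchiI

namespace BianchiI

open Bianchi

/-! ### The Lyapunov function and the ratio of box to volume. -/

namespace TailLimit

variable {a : Fin 3 → ℝ → ℝ} {t₀ : ℝ} {α : Space → ℝ} {t : ℝ} {p : Space}

lemma supTail_le_mul (h : TailLimit a t₀ α) (ht : t₀ < t) {t' : ℝ} (ht' : t₀ < t') (p : Space) :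
    supTail a t p ≤ (∑ i, xTail a i t / xTail a i t') * supTail a t' p := by
  refine (h.supTail_le_sum ht).trans ?_
  rw [Finset.sum_mul]
  refine Finset.sum_le_sum fun i _ => ?_
  have h1 := h.xTail_pos ht i
  have h2 := h.xTail_pos ht' i
  have h3 := h.abs_mul_xTail_le ht' i (p := p)
  calc |p i| * xTail a i t = xTail a i t / xTail a i t' * (|p i| * xTail a i t') := by field_simp
    _ ≤ _ := by gcongr

lemma sum_xTail_div_pos (h : TailLimit a t₀ α) (ht : t₀ < t) {t' : ℝ} (ht' : t₀ < t') :
    0 < ∑ i, xTail a i t / xTail a i t' :=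
  Finset.sum_pos (fun i _ => div_pos (h.xTail_pos ht i) (h.xTail_pos ht' i)) Finset.univ_nonempty

/-- Logarithm of the ratio of the support functions at time `t` and at a reference time. -/
def logSup (a : Fin 3 → ℝ → ℝ) (t₀ t : ℝ) (p : Space) : ℝ :=
  Real.log (supTail a t p / supTail a (t₀ + 1) p)

lemma logSup_le (h : TailLimit a t₀ α) (ht : t₀ < t) (hp : p ≠ 0) :
    logSup a t₀ t p ≤ Real.log (∑ i, xTail a i t / xTail a i (t₀ + 1)) := by
  have h1 := h.supTail_pos ht hp
  have h2 := h.supTail_pos (lt_add_one t₀) hp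
  refine Real.log_le_log (by positivity) ?_
  rw [div_le_iff₀ h2]
  exact h.supTail_le_mul ht (lt_add_one t₀) p

lemma le_logSup (h : TailLimit a t₀ α) (ht : t₀ < t) (hp : p ≠ 0) :
    -Real.log (∑ i, xTail a i (t₀ + 1) / xTail a i t) ≤ logSup a t₀ t p := by
  have h1 := h.supTail_pos ht hp
  have h2 := h.supTail_pos (lt_add_one t₀) hp
  have h3 := h.sum_xTail_div_pos (lt_add_one t₀) ht
  rw [← Real.log_inv]
  refine Real.log_le_log (inv_pos.2 h3) ?_
  rw [inv_le_comm₀ h3 (div_pos h1 h2), inv_div, div_le_iff₀ h1]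
  exact h.supTail_le_mul (lt_add_one t₀) ht p

lemma measurable_logSup (h : TailLimit a t₀ α) (t : ℝ) : Measurable (logSup a t₀ t) :=
  ((h.measurable_supTail t).div (h.measurable_supTail _)).log

lemma integrable_logSup (h : TailLimit a t₀ α) (ht : t₀ < t) :
    Integrable (fun p => α p * logSup a t₀ t p) sph := by
  refine h.limInt.mul_bdd (c := max |Real.log (∑ i, xTail a i t / xTail a i (t₀ + 1))|
    |Real.log (∑ i, xTail a i (t₀ + 1) / xTail a i t)|)
    (h.measurable_logSup t).aestronglyMeasurable ?_
  filter_upwards [ae_sph_norm] with p hp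
  have h1 := h.logSup_le ht (ne_zero_of_norm hp)
  have h2 := h.le_logSup ht (ne_zero_of_norm hp)
  rw [Real.norm_eq_abs, abs_le]
  constructor
  · refine le_trans ?_ h2
    exact neg_le_neg ((le_abs_self _).trans (le_max_right _ _))
  · exact h1.trans ((le_abs_self _).trans (le_max_left _ _))

/-- A Lyapunov function: mean logarithm of the support function, normalized by the volume. -/
def lyap (a : Fin 3 → ℝ → ℝ) (t₀ : ℝ) (α : Space → ℝ) (t : ℝ) : ℝ :=
  (∫ p, α p ∂sph)⁻¹ * ∫ p, α p * logSup a t₀ t p ∂sph - 1 / 3 * Real.log (volTail a t)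

lemma hasDerivAt_log_volTail (h : TailLimit a t₀ α) (ht : t₀ < t) :
    HasDerivAt (fun t => Real.log (volTail a t)) (-(3 / meanRad a t)) t := by
  have hP := h.volTail_pos ht
  refine ((h.hasDerivAt_volTail ht).log hP.ne').congr_deriv ?_
  have := h.areaTail_pos ht; have := h.vol3_pos' t
  rw [meanRad]
  field_simp

lemma continuousOn_sum_inv_qLen (h : TailLimit a t₀ α) :
    ContinuousOn (fun t => ∑ i, (qLen a i t)⁻¹) (Ioi t₀) := by
  refine continuousOn_finsetSum _ fun i _ => ContinuousOn.inv₀ ?_ fun t ht => (h.qLen_pos ht i).ne'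
  exact (h.scale.cont i).continuousOn.mul fun t ht =>
    (h.hasDerivAt_xTail ht i).continuousAt.continuousWithinAt

/-- The logarithm of `supTail` has derivative `-fq / supTail`, whose `α`-mean is `-(1 + deficit) /
meanRad`, while a third of `log V` has derivative `-1 / meanRad`. -/
lemma hasDerivAt_lyap (h : TailLimit a t₀ α) (ht : t₀ < t) :
    HasDerivAt (lyap a t₀ α) (-(deficit a α t / meanRad a t)) t := by
  have hL := h.lim_pos
  obtain ⟨ε, hε, hball⟩ : ∃ ε > 0, ∀ x ∈ Metric.ball t ε, t₀ < x ∧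
      ∑ i, (qLen a i x)⁻¹ ≤ (∑ i, (qLen a i t)⁻¹) + 1 := by
    have h1 := ((h.continuousOn_sum_inv_qLen.continuousAt (Ioi_mem_nhds ht)).eventually_le_const
      (lt_add_one _)).and (Ioi_mem_nhds ht)
    obtain ⟨ε, hε, h2⟩ := Metric.eventually_nhds_iff_ball.1 h1
    exact ⟨ε, hε, fun x hx => ⟨(h2 x hx).2, (h2 x hx).1⟩⟩
  have hder : ∀ x, t₀ < x → ∀ p : Space, p ≠ 0 → HasDerivAt (fun x => α p * logSup a t₀ x p)
      (-(α p * (fq a x p / supTail a x p))) x := by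
    intro x hx p hp
    have h1 := h.supTail_pos hx hp
    have h2 := h.supTail_pos (lt_add_one t₀) hp
    have := (((h.hasDerivAt_supTail hx p).div_const (supTail a (t₀ + 1) p)).log
      (div_pos h1 h2).ne').const_mul (α p)
    refine this.congr_deriv ?_
    field_simp
  have h1 := hasDerivAt_integral_of_dominated_loc_of_deriv_le (μ := sph) (x₀ := t)
    (F := fun x p => α p * logSup a t₀ x p)
    (F' := fun x p => -(α p * (fq a x p / supTail a x p)))
    (bound := fun p => |α p| * ((∑ i, (qLen a i t)⁻¹) + 1)) (Metric.ball_mem_nhds t hε)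
    (Filter.mem_of_superset (Ioi_mem_nhds ht) fun x hx => (h.integrable_logSup hx).1)
    (h.integrable_logSup ht) (h.integrable_fq_div_supTail ht).neg.1 ?_ (h.limInt.abs.mul_const _) ?_
  · have h2 := (h1.2.const_mul (∫ p, α p ∂sph)⁻¹).sub
      ((h.hasDerivAt_log_volTail ht).const_mul (1 / 3))
    refine h2.congr_deriv ?_
    rw [integral_neg, deficit]
    have := h.meanRad_pos ht
    field_simp
    ring
  · filter_upwards [ae_sph_norm] with p hp x hx
    obtain ⟨hx1, hx2⟩ := hball x hx
    rw [norm_neg, norm_mul, Real.norm_eq_abs,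
      Real.norm_of_nonneg (div_nonneg fq_nonneg (supTail_nonneg x p))]
    exact mul_le_mul_of_nonneg_left ((h.fq_div_supTail_le hx1 (ne_zero_of_norm hp)).trans hx2)
      (abs_nonneg _)
  · filter_upwards [ae_sph_norm] with p hp x hx
    exact hder x (hball x hx).1 p (ne_zero_of_norm hp)

/-- Logarithmic ratio of the volume of a bounding box to the actual volume. -/
def boxLog (a : Fin 3 → ℝ → ℝ) (t : ℝ) : ℝ :=
  1 / 3 * ∑ i, Real.log (xTail a i t) - 1 / 3 * Real.log (volTail a t)

lemma hasDerivAt_boxLog (h : TailLimit a t₀ α) (ht : t₀ < t) :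
    HasDerivAt (boxLog a) ((1 - 1 / 3 * ∑ i, meanRad a t / qLen a i t) / meanRad a t) t := by
  have h1 : HasDerivAt (fun t => ∑ i, Real.log (xTail a i t)) (∑ i, -(qLen a i t)⁻¹) t := by
    refine HasDerivAt.fun_sum fun i _ => ?_
    refine ((h.hasDerivAt_xTail ht i).log (h.xTail_pos ht i).ne').congr_deriv ?_
    rw [qLen, mul_inv]
    ring
  refine ((h1.const_mul (1 / 3)).sub ((h.hasDerivAt_log_volTail ht).const_mul (1 / 3))).congr_deriv ?_
  have := h.meanRad_pos ht
  have e : ∀ i, meanRad a t / qLen a i t = meanRad a t * (qLen a i t)⁻¹ := fun i => rfl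
  simp only [e, ← Finset.mul_sum, Finset.sum_neg_distrib]
  field_simp
  ring

/-- Section and bounding box have comparable volumes by `le_volTail` and `volTail_le`, with
constants independent of time. -/
lemma abs_boxLog_le (h : TailLimit a t₀ α) : ∃ C, ∀ t > t₀, |boxLog a t| ≤ C := by
  have hB := mvBall_pos
  refine ⟨1 / 3 * |Real.log mvBall| + 1 / 3 * |Real.log (mvBall / 36)|, fun t ht => ?_⟩
  have hP := h.volTail_pos ht
  have hx : 0 < ∏ i, xTail a i t := Finset.prod_pos fun i _ => h.xTail_pos ht i
  have e : boxLog a t = 1 / 3 * (Real.log (∏ i, xTail a i t) - Real.log (volTail a t)) := by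
    rw [boxLog, Real.log_prod fun i _ => (h.xTail_pos ht i).ne']; ring
  have h1 := Real.log_le_log (by positivity) (h.le_volTail ht)
  have h2 := Real.log_le_log hP (h.volTail_le ht)
  rw [Real.log_mul (by positivity) hx.ne'] at h1 h2
  rw [e, abs_le]
  have a1 := le_abs_self (Real.log mvBall)
  have a2 := neg_abs_le (Real.log (mvBall / 36))
  have a3 := abs_nonneg (Real.log mvBall)
  have a4 := abs_nonneg (Real.log (mvBall / 36))
  constructor <;> linarith

/-- The logarithmic derivative of `xTail` is `-1 / qLen ≥ -36 / meanRad`, and that of `volTail` is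
`-3 / meanRad`; hence the exponent 12. -/
lemma xTail_ge (h : TailLimit a t₀ α) (i : Fin 3) (ht : t₀ + 1 ≤ t) :
    Real.log (xTail a i (t₀ + 1)) + 12 * (Real.log (volTail a t) - Real.log (volTail a (t₀ + 1))) ≤
      Real.log (xTail a i t) := by
  have hd : ∀ x, t₀ < x → HasDerivAt (fun x => Real.log (xTail a i x) - 12 * Real.log (volTail a x))
      (-(qLen a i x)⁻¹ - 12 * (-(3 / meanRad a x))) x := by
    intro x hx
    have h1 := (h.hasDerivAt_xTail hx i).log (h.xTail_pos hx i).ne'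
    refine (h1.sub ((h.hasDerivAt_log_volTail hx).const_mul 12)).congr_deriv ?_
    rw [qLen, mul_inv]
    ring
  have hm : MonotoneOn (fun x => Real.log (xTail a i x) - 12 * Real.log (volTail a x))
      (Ici (t₀ + 1)) := by
    refine monotoneOn_of_deriv_nonneg (convex_Ici _) (fun x hx => ?_) (fun x hx => ?_) fun x hx => ?_
    · exact (hd x ((lt_add_one t₀).trans_le hx)).continuousAt.continuousWithinAt
    · rw [interior_Ici] at hx
      exact (hd x ((lt_add_one t₀).trans hx)).differentiableAt.differentiableWithinAt
    · rw [interior_Ici] at hx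
      have hx' : t₀ < x := (lt_add_one t₀).trans hx
      rw [(hd x hx').deriv]
      have h1 := h.meanRad_div_le_const hx' i
      have h2 := h.meanRad_pos hx'
      have h3 := h.qLen_pos hx' i
      rw [div_le_iff₀ h3] at h1
      have : (qLen a i x)⁻¹ ≤ 36 / meanRad a x := by
        rw [inv_eq_one_div, div_le_div_iff₀ h3 h2]; linarith
      have e : 36 / meanRad a x = 12 * (3 / meanRad a x) := by ring
      linarith
  have := hm (mem_Ici.2 le_rfl) ht ht
  simp only at this
  linarith

lemma logSup_ge (h : TailLimit a t₀ α) (ht : t₀ + 1 ≤ t) (hp : p ≠ 0) :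
    -Real.log 3 + 12 * (Real.log (volTail a t) - Real.log (volTail a (t₀ + 1))) ≤
      logSup a t₀ t p := by
  have ht0 : t₀ < t := (lt_add_one t₀).trans_le ht
  refine le_trans ?_ (h.le_logSup ht0 hp)
  set w := Real.log (volTail a t) - Real.log (volTail a (t₀ + 1))
  have h1 : ∑ i, xTail a i (t₀ + 1) / xTail a i t ≤ 3 * Real.exp (-(12 * w)) := by
    have : ∀ i, xTail a i (t₀ + 1) / xTail a i t ≤ Real.exp (-(12 * w)) := fun i => by
      have p1 := h.xTail_pos (lt_add_one t₀) i
      have p2 := h.xTail_pos ht0 i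
      rw [← Real.log_le_iff_le_exp (by positivity), Real.log_div p1.ne' p2.ne']
      have := h.xTail_ge i ht
      linarith
    refine (Finset.sum_le_sum fun i _ => this i).trans (le_of_eq ?_)
    simp
  have h2 := Real.log_le_log (h.sum_xTail_div_pos (lt_add_one t₀) ht0) h1
  rw [Real.log_mul (by norm_num) (Real.exp_pos _).ne', Real.log_exp] at h2
  linarith

/-- Away from the coordinate planes the support function dominates each `xTail`, hence their
geometric mean, which is comparable to the cube root of the volume from above. -/
lemma logSup_ge_of_le (h : TailLimit a t₀ α) {δ : ℝ} (hδ : 0 < δ) : ∃ C, ∀ t > t₀, ∀ p : Space,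
    ‖p‖ = 1 → (∀ i, δ ≤ |p i|) → 1 / 3 * Real.log (volTail a t) - C ≤ logSup a t₀ t p := by
  have hB := mvBall_pos
  refine ⟨1 / 3 * Real.log mvBall + Real.log (∑ i, xTail a i (t₀ + 1)) - Real.log δ,
    fun t ht p hp hd => ?_⟩
  have hp0 := ne_zero_of_norm hp
  have h1 := h.supTail_pos ht hp0
  have h2 := h.supTail_pos (lt_add_one t₀) hp0
  have h3 : ∀ i, Real.log δ + Real.log (xTail a i t) ≤ Real.log (supTail a t p) := fun i => by
    have hx := h.xTail_pos ht i
    rw [← Real.log_mul hδ.ne' hx.ne']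
    refine Real.log_le_log (by positivity) (le_trans ?_ (h.abs_mul_xTail_le ht i))
    exact mul_le_mul_of_nonneg_right (hd i) hx.le
  have h4 : Real.log (supTail a (t₀ + 1) p) ≤ Real.log (∑ i, xTail a i (t₀ + 1)) := by
    refine Real.log_le_log h2 ((h.supTail_le_sum (lt_add_one t₀)).trans ?_)
    refine Finset.sum_le_sum fun i _ => ?_
    have := h.xTail_pos (lt_add_one t₀) i
    have := abs_le_one_of_norm hp i
    nlinarith
  have h5 : Real.log (volTail a t) ≤ Real.log mvBall + ∑ i, Real.log (xTail a i t) := by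
    have hx : 0 < ∏ i, xTail a i t := Finset.prod_pos fun i _ => h.xTail_pos ht i
    rw [← Real.log_prod fun i _ => (h.xTail_pos ht i).ne', ← Real.log_mul hB.ne' hx.ne']
    exact Real.log_le_log (h.volTail_pos ht) (h.volTail_le ht)
  rw [logSup, Real.log_div h1.ne' h2.ne']
  rw [Fin.sum_univ_three] at h5
  have := h3 0; have := h3 1; have := h3 2
  linarith

lemma exists_generic_set (h : TailLimit a t₀ α) {η : ℝ} (hη : 0 < η) : ∃ δ > 0,
    ∫ p in {p : Space | ∀ i, δ ≤ |p i|}ᶜ, α p ∂sph < η := by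
  let K : ℕ → Set Space := fun n => {p : Space | ∀ i, 1 / ((n : ℝ) + 1) ≤ |p i|}
  have hK : ∀ n, MeasurableSet (K n) := fun n => by
    simp only [K, ofPred_forall]
    exact MeasurableSet.iInter fun i => measurableSet_le measurable_const (by fun_prop)
  have hlim : Tendsto (fun n => ∫ p, (K n)ᶜ.indicator α p ∂sph) atTop
      (𝓝 (∫ _p : Space, (0 : ℝ) ∂sph)) := by
    refine tendsto_integral_of_dominated_convergence (fun p => |α p|)
      (fun n => (h.limInt.indicator (hK n).compl).1) h.limInt.abs (fun n => ?_) ?_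
    · exact Eventually.of_forall fun p => norm_indicator_le_norm_self _ _
    · filter_upwards [ae_sph_coord_ne] with p hp
      refine tendsto_const_nhds.congr' ?_
      have : ∀ i, ∀ᶠ n : ℕ in atTop, 1 / ((n : ℝ) + 1) ≤ |p i| := fun i =>
        tendsto_one_div_add_atTop_nhds_zero_nat.eventually_le_const (abs_pos.2 (hp i))
      filter_upwards [eventually_all.2 this] with n hn
      rw [indicator_of_notMem]
      exact fun hcon => hcon hn
  rw [integral_zero] at hlim
  obtain ⟨n, hn⟩ := (hlim.eventually_lt_const hη).exists
  refine ⟨1 / ((n : ℝ) + 1), by positivity, ?_⟩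
  rw [← integral_indicator (hK n).compl]
  exact hn

/-- The Lyapunov function decays slower than any positive power of the volume. -/
lemma lyap_ge (h : TailLimit a t₀ α) {η : ℝ} (hη : 0 < η) :
    ∃ C, ∀ t ≥ t₀ + 1, η * Real.log (volTail a t) - C ≤ lyap a t₀ α t := by
  have hL := h.lim_pos
  set L := ∫ p, α p ∂sph
  -- Where all components are at least `δ` the support function is at least of order `V^(1/3)`,
  -- which balances the volume term of `lyap`. Elsewhere only the exponent 12 of `logSup_ge` is
  -- available, so those directions are given a share below `η / 12` of the mass.
  obtain ⟨δ, hδ, hK⟩ := h.exists_generic_set (η := η / 12 * L) (by positivity)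
  set K := {p : Space | ∀ i, δ ≤ |p i|} with hKd
  have hKm : MeasurableSet K := by
    simp only [hKd, ofPred_forall]
    exact MeasurableSet.iInter fun i => measurableSet_le measurable_const (by fun_prop)
  obtain ⟨C₁, hC₁⟩ := h.logSup_ge_of_le hδ
  set l₁ := Real.log (volTail a (t₀ + 1))
  refine ⟨|C₁| + |Real.log 3| + 12 * |l₁| + η * |l₁| + |l₁|, fun t ht => ?_⟩
  have ht0 : t₀ < t := (lt_add_one t₀).trans_le ht
  set l := Real.log (volTail a t)
  have hll : l ≤ l₁ := by
    refine Real.log_le_log (h.volTail_pos ht0) ?_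
    exact setIntegral_mono_set (h.integrableOn_area_div (lt_add_one t₀))
      ((ae_restrict_mem measurableSet_Ioi).mono fun r hr => (div_pos (h.areaTail_pos
        ((lt_add_one t₀).trans hr)) (h.vol3_pos' r)).le) (Ioi_subset_Ioi ht).eventuallyLE
  set x := ∫ p in K, α p ∂sph
  set y := ∫ p in Kᶜ, α p ∂sph
  have hxy : x + y = L := integral_add_compl hKm h.limInt
  have hx0 : 0 ≤ x := setIntegral_nonneg_of_ae (h.limPos.mono fun p hp => hp.le)
  have hy0 : 0 ≤ y := setIntegral_nonneg_of_ae (h.limPos.mono fun p hp => hp.le)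
  have i1 : (1 / 3 * l - C₁) * x ≤ ∫ p in K, α p * logSup a t₀ t p ∂sph := by
    rw [← integral_const_mul]
    refine setIntegral_mono_on_ae (h.limInt.const_mul _).integrableOn
      (h.integrable_logSup ht0).integrableOn hKm ?_
    filter_upwards [h.limPos, ae_sph_norm] with p hp hn hpK
    rw [mul_comm]
    exact mul_le_mul_of_nonneg_left (hC₁ t ht0 p hn hpK) hp.le
  have i2 : (-Real.log 3 + 12 * (l - l₁)) * y ≤ ∫ p in Kᶜ, α p * logSup a t₀ t p ∂sph := by
    rw [← integral_const_mul]
    refine setIntegral_mono_on_ae (h.limInt.const_mul _).integrableOn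
      (h.integrable_logSup ht0).integrableOn hKm.compl ?_
    filter_upwards [h.limPos, ae_sph_norm] with p hp hn hpK
    rw [mul_comm]
    exact mul_le_mul_of_nonneg_left (h.logSup_ge ht (ne_zero_of_norm hn)) hp.le
  have i3 := integral_add_compl hKm (h.integrable_logSup ht0)
  set m := x / L
  set n := y / L
  have hm0 : 0 ≤ m := by positivity
  have hn0 : 0 ≤ n := by positivity
  have hmn : m + n = 1 := by simp only [m, n]; rw [← add_div, hxy, div_self hL.ne']
  have hn1 : 12 * n ≤ η := by
    have : n < η / 12 := by simp only [n]; rw [div_lt_iff₀ hL]; exact hK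
    linarith
  have key : (1 / 3 * l - C₁) * m + (-Real.log 3 + 12 * (l - l₁)) * n - 1 / 3 * l ≤
      lyap a t₀ α t := by
    unfold lyap
    refine sub_le_sub_right ?_ _
    rw [← i3, inv_mul_eq_div, le_div_iff₀ hL]
    have e1 : m * L = x := div_mul_cancel₀ _ hL.ne'
    have e2 : n * L = y := div_mul_cancel₀ _ hL.ne'
    calc _ = (1 / 3 * l - C₁) * (m * L) + (-Real.log 3 + 12 * (l - l₁)) * (n * L) := by ring
      _ ≤ _ := by rw [e1, e2]; exact add_le_add i1 i2
  refine le_trans ?_ key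
  have hm : m = 1 - n := by linarith
  have hn2 : n ≤ 1 := by linarith
  rw [hm]
  have b1 : (1 - n) * C₁ ≤ |C₁| := by
    calc (1 - n) * C₁ ≤ (1 - n) * |C₁| := mul_le_mul_of_nonneg_left (le_abs_self _) (by linarith)
      _ ≤ 1 * |C₁| := mul_le_mul_of_nonneg_right (by linarith) (abs_nonneg _)
      _ = _ := one_mul _
  have b2 : n * Real.log 3 ≤ |Real.log 3| := by
    calc n * Real.log 3 ≤ n * |Real.log 3| := mul_le_mul_of_nonneg_left (le_abs_self _) hn0
      _ ≤ 1 * |Real.log 3| := mul_le_mul_of_nonneg_right hn2 (abs_nonneg _)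
      _ = _ := one_mul _
  have b3 : n * l₁ ≤ |l₁| := by
    calc n * l₁ ≤ n * |l₁| := mul_le_mul_of_nonneg_left (le_abs_self _) hn0
      _ ≤ 1 * |l₁| := mul_le_mul_of_nonneg_right hn2 (abs_nonneg _)
      _ = _ := one_mul _
  have b4 : (η - 12 * n) * l ≤ η * |l₁| := by
    calc (η - 12 * n) * l ≤ (η - 12 * n) * |l₁| :=
          mul_le_mul_of_nonneg_left (hll.trans (le_abs_self _)) (by linarith)
      _ ≤ η * |l₁| := mul_le_mul_of_nonneg_right (by linarith) (abs_nonneg _)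
  have b5 : n * l ≤ |l₁| := (mul_le_mul_of_nonneg_left hll hn0).trans b3
  have := abs_nonneg l₁
  nlinarith

end TailLimit

end BianchiI

namespace BianchiI

open Bianchi

namespace TailLimit

/-! ### Anisotropy -/

/-- Sum of the squared inverse scale factors. -/
def isqSum (a : Fin 3 → ℝ → ℝ) (t : ℝ) : ℝ := ∑ i, isq a t i

/-- Normalized squared inverse scale factors. -/
def ell (a : Fin 3 → ℝ → ℝ) (t : ℝ) (i : Fin 3) : ℝ := isq a t i / isqSum a t

/-- Rescaled tail integrals of the inverse scale factors. -/
def xRel (a : Fin 3 → ℝ → ℝ) (i : Fin 3) (t : ℝ) : ℝ := xTail a i t / (meanRad a t * √(isqSum a t))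

/-- Rescaled support function. -/
def supRel (a : Fin 3 → ℝ → ℝ) (t : ℝ) (p : Space) : ℝ :=
  supTail a t p / (meanRad a t * √(isqSum a t))

variable {a : Fin 3 → ℝ → ℝ} {t₀ : ℝ} {α : Space → ℝ} {t : ℝ} {p : Space}

lemma isqSum_pos (h : TailLimit a t₀ α) (t : ℝ) : 0 < isqSum a t :=
  Finset.sum_pos (fun i _ => isq_pos h.scale t i) Finset.univ_nonempty

lemma ell_pos (h : TailLimit a t₀ α) (t : ℝ) (i : Fin 3) : 0 < ell a t i :=
  div_pos (isq_pos h.scale t i) (h.isqSum_pos t)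

lemma sum_ell (h : TailLimit a t₀ α) (t : ℝ) : ∑ i, ell a t i = 1 := by
  simp only [ell, ← Finset.sum_div]
  exact div_self (h.isqSum_pos t).ne'

lemma ell_le_one (h : TailLimit a t₀ α) (t : ℝ) (i : Fin 3) : ell a t i ≤ 1 := by
  rw [← h.sum_ell t]
  exact Finset.single_le_sum (f := ell a t) (fun i _ => (h.ell_pos t i).le) (Finset.mem_univ i)

lemma fq_eq_ell (h : TailLimit a t₀ α) (t : ℝ) (p : Space) :
    fq a t p = √(isqSum a t) * nf (ell a t) p := by
  rw [fq_eq_nf, nf, nf, ← Real.sqrt_mul (h.isqSum_pos t).le, Finset.mul_sum]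
  congr 1
  refine Finset.sum_congr rfl fun i _ => ?_
  have := (h.isqSum_pos t).ne'
  rw [ell]
  field_simp

lemma sqrt_ell (h : TailLimit a t₀ α) (t : ℝ) (i : Fin 3) :
    √(ell a t i) = (a i t)⁻¹ / √(isqSum a t) := by
  rw [ell, Real.sqrt_div (isq_pos h.scale t i).le, sqrt_isq h.scale]

lemma supRel_eq (h : TailLimit a t₀ α) (ht : t₀ < t) (hp : p ≠ 0) :
    supRel a t p = relRad a t p * nf (ell a t) p := by
  have h1 := nf_pos (h.ell_pos t) hp
  have h2 := Real.sqrt_pos.2 (h.isqSum_pos t)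
  have h3 := h.meanRad_pos ht
  rw [supRel, relRad, h.fq_eq_ell]
  field_simp

lemma qLen_div_eq (h : TailLimit a t₀ α) (ht : t₀ < t) (i : Fin 3) :
    qLen a i t / meanRad a t = xRel a i t / √(ell a t i) := by
  have h2 := Real.sqrt_pos.2 (h.isqSum_pos t)
  have h3 := h.meanRad_pos ht
  have h4 := h.scale.pos i t
  rw [h.sqrt_ell, qLen, xRel]
  field_simp

lemma abs_mul_xRel_le (h : TailLimit a t₀ α) (ht : t₀ < t) (i : Fin 3) :
    |p i| * xRel a i t ≤ supRel a t p := by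
  have h3 := h.meanRad_pos ht
  rw [xRel, supRel, ← mul_div_assoc]
  exact div_le_div_of_nonneg_right (h.abs_mul_xTail_le ht i)
    (mul_nonneg h3.le (Real.sqrt_nonneg _))

lemma supRel_le_sum (h : TailLimit a t₀ α) (ht : t₀ < t) :
    supRel a t p ≤ ∑ i, |p i| * xRel a i t := by
  have h3 := h.meanRad_pos ht
  simp only [xRel, supRel, ← mul_div_assoc, ← Finset.sum_div]
  exact div_le_div_of_nonneg_right (h.supTail_le_sum ht) (mul_nonneg h3.le (Real.sqrt_nonneg _))

lemma tendsto_nf {l : Filter ℝ} {f : ℝ → Fin 3 → ℝ} {c : Fin 3 → ℝ}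
    (hl : ∀ i, Tendsto (fun t => f t i) l (𝓝 (c i))) (p : Space) :
    Tendsto (fun t => nf (f t) p) l (𝓝 (nf c p)) := by
  unfold nf
  exact (Real.continuous_sqrt.tendsto _).comp
    (tendsto_finsetSum _ fun i _ => (hl i).mul_const _)

lemma tendsto_supRel (h : TailLimit a t₀ α) {l : Filter ℝ} (hl : l ≤ atTop)
    (hD : Tendsto (deficit a α) l (𝓝 0)) {c : Fin 3 → ℝ}
    (hc : ∀ i, Tendsto (fun t => ell a t i) l (𝓝 (c i))) (hp : ∀ i, p i ≠ 0) :
    Tendsto (fun t => supRel a t p) l (𝓝 (nf c p)) := by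
  have := (h.tendsto_relRad hl hD hp).mul (tendsto_nf hc p)
  rw [one_mul] at this
  refine this.congr' ?_
  filter_upwards [hl (eventually_gt_atTop t₀)] with t ht
  exact (h.supRel_eq ht (ne_zero_of_generic hp)).symm

/-- Convergence of `supRel` is known only in generic directions, so the axis is approached by
directions with other components `δ`. Since `supRel` dominates one axis term, every `xRel` is
bounded above; the box bound then leaves `xRel` of the given axis plus an error of order `δ`. -/
lemma tendsto_xRel (h : TailLimit a t₀ α) {l : Filter ℝ} (hl : l ≤ atTop)
    (hD : Tendsto (deficit a α) l (𝓝 0)) {c : Fin 3 → ℝ} (hc0 : ∀ i, 0 ≤ c i) (hc1 : ∑ i, c i = 1)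
    (hc : ∀ i, Tendsto (fun t => ell a t i) l (𝓝 (c i))) (i : Fin 3) :
    Tendsto (fun t => xRel a i t) l (𝓝 √(c i)) := by
  let q : ℝ → Fin 3 → Space := fun δ i => WithLp.toLp 2 fun n => if n = i then 1 else δ
  have hle1 : ∀ i, c i ≤ 1 := fun i => by
    rw [← hc1]; exact Finset.single_le_sum (fun i _ => hc0 i) (Finset.mem_univ i)
  have hq : ∀ δ, 0 < δ → ∀ i n, q δ i n ≠ 0 := by
    intro δ hδ i n
    simp only [q]
    split_ifs
    · exact one_ne_zero
    · exact hδ.ne'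
  have hnf : ∀ δ, 0 < δ → δ ≤ 1 → ∀ i, nf c (q δ i) ≤ √(c i) + 2 * δ := by
    intro δ hδ hδ1 i
    refine Real.sqrt_le_iff.2 ⟨by positivity, ?_⟩
    have e : ∑ n, c n * q δ i n ^ 2 = c i + δ ^ 2 * (1 - c i) := by
      rw [← hc1]
      fin_cases i <;> simp [q, Fin.sum_univ_three] <;> ring
    rw [e]
    nlinarith [Real.sq_sqrt (hc0 i), Real.sqrt_nonneg (c i), hc0 i, sq_nonneg δ,
      mul_nonneg (sq_nonneg δ) (hc0 i), mul_nonneg hδ.le (Real.sqrt_nonneg (c i))]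
  have hnf' : ∀ δ i, √(c i) ≤ nf c (q δ i) := by
    intro δ i
    refine Real.sqrt_le_sqrt ?_
    refine le_trans (le_of_eq ?_) (Finset.single_le_sum (f := fun n => c n * q δ i n ^ 2)
      (fun n _ => mul_nonneg (hc0 n) (sq_nonneg _)) (Finset.mem_univ i))
    simp [q]
  have hup : ∀ δ, 0 < δ → δ ≤ 1 → ∀ i, ∀ᶠ t in l, xRel a i t ≤ √(c i) + 3 * δ := by
    intro δ hδ hδ1 i
    have h1 := (h.tendsto_supRel hl hD hc (hq δ hδ i)).eventually_lt_const
      (show nf c (q δ i) < √(c i) + 3 * δ by linarith [hnf δ hδ hδ1 i])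
    filter_upwards [h1, hl (eventually_gt_atTop t₀)] with t h1 ht
    have h2 := h.abs_mul_xRel_le ht i (p := q δ i)
    simp only [q, if_true, abs_one, one_mul] at h2
    exact h2.trans h1.le
  rw [Metric.tendsto_nhds]
  intro ε hε
  set δ := min 1 (ε / 20)
  have hδ : 0 < δ := lt_min one_pos (by positivity)
  have hδ1 : δ ≤ 1 := min_le_left _ _
  have hδε : δ ≤ ε / 20 := min_le_right _ _
  have h1 := (h.tendsto_supRel hl hD hc (hq δ hδ i)).eventually_const_lt
      (show √(c i) - δ < nf c (q δ i) by linarith [hnf' δ i])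
  filter_upwards [h1, eventually_all.2 (hup δ hδ hδ1), hl (eventually_gt_atTop t₀)] with t h1 h2 ht
  have h3 := h.supRel_le_sum ht (p := q δ i)
  have h4 : ∀ j, xRel a j t ≤ 4 := fun j => by
    have := h2 j
    have : √(c j) ≤ 1 := Real.sqrt_le_one.2 (hle1 j)
    linarith
  -- The 8 comes from the two other axes, each with `xRel` at most 4.
  have h5 : ∑ n, |q δ i n| * xRel a n t ≤ xRel a i t + 8 * δ := by
    have e : ∑ n, |q δ i n| * xRel a n t =
        xRel a i t + δ * (∑ n, if n = i then 0 else xRel a n t) := by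
      fin_cases i <;> simp [q, Fin.sum_univ_three, abs_of_pos hδ] <;> ring
    have e2 : (∑ n, if n = i then 0 else xRel a n t) ≤ 8 := by
      have := h4 0; have := h4 1; have := h4 2
      fin_cases i <;> simp [Fin.sum_univ_three] <;> linarith
    rw [e]
    nlinarith
  rw [Real.dist_eq, abs_lt]
  have := h2 i
  constructor <;> linarith

lemma tendsto_qLen_div (h : TailLimit a t₀ α) {l : Filter ℝ} (hl : l ≤ atTop)
    (hD : Tendsto (deficit a α) l (𝓝 0)) {c : Fin 3 → ℝ} (hc0 : ∀ i, 0 ≤ c i) (hc1 : ∑ i, c i = 1)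
    (hc : ∀ i, Tendsto (fun t => ell a t i) l (𝓝 (c i))) {i : Fin 3} (hi : c i ≠ 0) :
    Tendsto (fun t => qLen a i t / meanRad a t) l (𝓝 1) := by
  have hs : √(c i) ≠ 0 := by
    rw [Real.sqrt_ne_zero (hc0 i)]; exact hi
  have h1 := (h.tendsto_xRel hl hD hc0 hc1 hc i).div
    ((Real.continuous_sqrt.tendsto _).comp (hc i)) hs
  rw [div_self hs] at h1
  refine h1.congr' ?_
  filter_upwards [hl (eventually_gt_atTop t₀)] with t ht
  exact (h.qLen_div_eq ht i).symm

/-! ### The Hessian weights of a nearly isotropically expanding light cone -/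

/-- After division by the quadratic mean `S`, the ratios `y = s / S` satisfy `∑ w y² = 1`, and the
gap `1 - ∑ w y` is half of `∑ w (y - 1)²`. Weights bounded below by `m` let the gap control each `y
- 1`; Young's inequality with parameter `η` turns the linear estimate of `y_i² y_j² - 1` into the
stated one. -/
lemma jensen_gap_pointwise {w s : Fin 3 → ℝ} {m η : ℝ} (hm : 0 < m) (hη : 0 < η)
    (hw : ∀ i, m ≤ w i) (hw1 : ∑ i, w i = 1) (hs : ∀ i, 0 < s i) (i j : Fin 3) (hij : i ≠ j) :
    |s i ^ 2 * s j ^ 2 / √(∑ n, w n * s n ^ 2) ^ 3 - √(∑ n, w n * s n ^ 2)| ≤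
      η * √(∑ n, w n * s n ^ 2) +
        (1 / m + 1) ^ 4 / (η * m) * (√(∑ n, w n * s n ^ 2) - ∑ n, w n * s n) := by
  have hw0 : ∀ i, 0 < w i := fun i => hm.trans_le (hw i)
  have hsum : 0 < ∑ n, w n * s n ^ 2 := Finset.sum_pos (fun n _ => by
    have := hw0 n; have := hs n; positivity) Finset.univ_nonempty
  set S := √(∑ n, w n * s n ^ 2)
  have hS : 0 < S := Real.sqrt_pos.2 hsum
  have hS2 : S ^ 2 = ∑ n, w n * s n ^ 2 := Real.sq_sqrt hsum.le
  set y : Fin 3 → ℝ := fun n => s n / S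
  have hy0 : ∀ n, 0 < y n := fun n => div_pos (hs n) hS
  have hsy : ∀ n, s n = S * y n := fun n => by simp only [y]; field_simp
  have hy : ∑ n, w n * y n ^ 2 = 1 := by
    have : ∑ n, w n * y n ^ 2 = (∑ n, w n * s n ^ 2) / S ^ 2 := by
      rw [Finset.sum_div]; exact Finset.sum_congr rfl fun n _ => by simp only [y]; ring
    rw [this, ← hS2, div_self (by positivity)]
  set g := 1 - ∑ n, w n * y n with hg
  have hgap : 2 * g = ∑ n, w n * (y n - 1) ^ 2 := by
    have : ∑ n, w n * (y n - 1) ^ 2 = ∑ n, w n * y n ^ 2 - 2 * ∑ n, w n * y n + ∑ n, w n := by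
      simp only [Fin.sum_univ_three]; ring
    rw [this, hy, hw1]; ring
  have hterm : ∀ n, 0 ≤ w n * (y n - 1) ^ 2 := fun n => mul_nonneg (hw0 n).le (sq_nonneg _)
  have hpair : m * ((y i - 1) ^ 2 + (y j - 1) ^ 2) ≤ 2 * g := by
    have h1 : w i * (y i - 1) ^ 2 + w j * (y j - 1) ^ 2 ≤ ∑ n, w n * (y n - 1) ^ 2 := by
      rw [← Finset.sum_pair (f := fun n => w n * (y n - 1) ^ 2) hij]
      exact Finset.sum_le_sum_of_subset_of_nonneg (Finset.subset_univ _) fun n _ _ => hterm n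
    have h2 := mul_le_mul_of_nonneg_right (hw i) (sq_nonneg (y i - 1))
    have h3 := mul_le_mul_of_nonneg_right (hw j) (sq_nonneg (y j - 1))
    linarith
  set b := 1 / m + 1
  have hmb : 0 < 1 / m := by positivity
  have hb1 : 1 ≤ b := by simp only [b]; linarith
  have hyb : ∀ n, y n ≤ b := fun n => by
    have h1 : w n * y n ^ 2 ≤ 1 := by
      rw [← hy]
      exact Finset.single_le_sum (f := fun n => w n * y n ^ 2)
        (fun n _ => mul_nonneg (hw0 n).le (sq_nonneg _)) (Finset.mem_univ n)
    have h2 : y n ^ 2 ≤ 1 / m := by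
      rw [le_div_iff₀ hm]
      nlinarith [mul_le_mul_of_nonneg_right (hw n) (sq_nonneg (y n))]
    simp only [b]
    nlinarith [sq_nonneg (y n - 1), hy0 n]
  have hyy : ∀ n k, y n * y k ≤ 1 / m := fun n k => by
    have h1 : ∀ n, y n ^ 2 ≤ 1 / m := fun n => by
      have h1 : w n * y n ^ 2 ≤ 1 := by
        rw [← hy]
        exact Finset.single_le_sum (f := fun n => w n * y n ^ 2)
          (fun n _ => mul_nonneg (hw0 n).le (sq_nonneg _)) (Finset.mem_univ n)
      rw [le_div_iff₀ hm]
      nlinarith [mul_le_mul_of_nonneg_right (hw n) (sq_nonneg (y n))]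
    nlinarith [h1 n, h1 k, sq_nonneg (y n - y k)]
  have hlin : |y i ^ 2 * y j ^ 2 - 1| ≤ b ^ 2 * (|y i - 1| + |y j - 1|) := by
    have e1 : y i ^ 2 * y j ^ 2 - 1 = (y i * y j + 1) * (y i * (y j - 1) + (y i - 1)) := by ring
    have p1 : 0 ≤ y i * y j + 1 := by have := hy0 i; have := hy0 j; positivity
    rw [e1, abs_mul, abs_of_nonneg p1]
    have h1 : y i * y j + 1 ≤ b := by have := hyy i j; simp only [b]; linarith
    have h2 : |y i * (y j - 1) + (y i - 1)| ≤ b * (|y i - 1| + |y j - 1|) := by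
      refine (abs_add_le _ _).trans ?_
      rw [abs_mul, abs_of_pos (hy0 i)]
      have := mul_le_mul_of_nonneg_right (hyb i) (abs_nonneg (y j - 1))
      have := mul_le_mul_of_nonneg_right hb1 (abs_nonneg (y i - 1))
      linarith
    calc _ ≤ b * (b * (|y i - 1| + |y j - 1|)) := mul_le_mul h1 h2 (abs_nonneg _) (by linarith)
      _ = _ := by ring
  have hyoung : ∀ d : ℝ, b ^ 2 * |d| ≤ η / 2 + b ^ 4 / (2 * η) * d ^ 2 := by
    intro d
    have : 0 ≤ (b ^ 2 * |d| - η) ^ 2 / (2 * η) := by positivity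
    have e : (b ^ 2 * |d| - η) ^ 2 / (2 * η) =
        b ^ 4 / (2 * η) * d ^ 2 - b ^ 2 * |d| + η / 2 := by
      rw [← sq_abs d]; field_simp; ring
    linarith
  have hmain : |y i ^ 2 * y j ^ 2 - 1| ≤ η + b ^ 4 / (η * m) * g := by
    have h1 := hyoung (y i - 1)
    have h2 := hyoung (y j - 1)
    have h3 : b ^ 4 / (2 * η) * ((y i - 1) ^ 2 + (y j - 1) ^ 2) ≤ b ^ 4 / (η * m) * g := by
      have e : b ^ 4 / (η * m) * g = b ^ 4 / (2 * η) * (2 * g / m) := by field_simp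
      rw [e]
      refine mul_le_mul_of_nonneg_left ?_ (by positivity)
      rw [le_div_iff₀ hm]; linarith
    linarith
  have e1 : s i ^ 2 * s j ^ 2 / S ^ 3 - S = S * (y i ^ 2 * y j ^ 2 - 1) := by
    rw [hsy i, hsy j]; field_simp
  have e2 : S - ∑ n, w n * s n = S * g := by
    have : ∑ n, w n * s n = S * ∑ n, w n * y n := by
      rw [Finset.mul_sum]
      exact Finset.sum_congr rfl fun n _ => by rw [hsy n]; ring
    rw [this, hg]; ring
  rw [e1, e2, abs_mul, abs_of_pos hS]
  calc S * |y i ^ 2 * y j ^ 2 - 1| ≤ S * (η + b ^ 4 / (η * m) * g) := by gcongr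
    _ = _ := by ring

/-- Squared frequency fractions. -/
def wgt (a : Fin 3 → ℝ → ℝ) (t : ℝ) (p : Space) (i : Fin 3) : ℝ := (p i / a i t) ^ 2 / fq a t p ^ 2

lemma sum_wgt (h : TailLimit a t₀ α) (hp : p ≠ 0) : ∑ i, wgt a t p i = 1 := by
  have := h.fq_pos' t hp
  simp only [wgt, ← Finset.sum_div]
  rw [← fq_sq, div_self (by positivity)]

lemma wgt_eq (h : TailLimit a t₀ α) (hp : p ≠ 0) (i : Fin 3) :
    wgt a t p i = ell a t i * p i ^ 2 / nf (ell a t) p ^ 2 := by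
  have h1 := nf_pos (h.ell_pos t) hp
  have h2 := h.isqSum_pos t
  have h3 := h.scale.pos i t
  rw [wgt, h.fq_eq_ell, mul_pow, Real.sq_sqrt h2.le, ell, isq]
  field_simp

/-- `jensen_gap_pointwise` is applied to `s n = a n t / a n r`. Their quadratic mean is `fq a r p /
fq a t p`, the Hessian weight is the quartic expression, and the arithmetic mean integrates over `r`
to `∑ wgt * qLen`. -/
lemma hTail_div_le (h : TailLimit a t₀ α) (ht : t₀ < t) (hp : ∀ i, p i ≠ 0) {m η : ℝ} (hm : 0 < m)
    (hη : 0 < η) (hw : ∀ i, m ≤ wgt a t p i) (k : Fin 3) :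
    |hTail a k t p / hk a k t p - supTail a t p / fq a t p| ≤
      η * (supTail a t p / fq a t p) + (1 / m + 1) ^ 4 / (η * m) *
        (supTail a t p / fq a t p - ∑ n, wgt a t p n * qLen a n t) := by
  have hp0 := ne_zero_of_generic hp
  have hf := h.fq_pos' t hp0
  have hkp := hk_pos (fun i => h.scale.pos i t) hp0 k
  have i1 : IntegrableOn (fun r => hk a k r p / hk a k t p) (Ioi t) := (h.tail p hp k t).div_const _
  have i2 : IntegrableOn (fun r => fq a r p / fq a t p) (Ioi t) :=
    (h.integrableOn_fq ht p).div_const _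
  have i3 : ∀ n, IntegrableOn (fun r => a n t / a n r) (Ioi t) := fun n =>
    ((h.integrableOn_inv ht n).const_mul (a n t)).congr (Eventually.of_forall fun r => by
      simp only [div_eq_mul_inv])
  have i4 : IntegrableOn (fun r => ∑ n, wgt a t p n * (a n t / a n r)) (Ioi t) :=
    integrable_finsetSum _ fun n _ => (i3 n).const_mul _
  have i5 : IntegrableOn (fun r => fq a r p / fq a t p - ∑ n, wgt a t p n * (a n t / a n r))
    (Ioi t) := i2.sub i4
  have e1 : hTail a k t p / hk a k t p = ∫ r in Ioi t, hk a k r p / hk a k t p := by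
    rw [integral_div, hTail]
  have e2 : supTail a t p / fq a t p = ∫ r in Ioi t, fq a r p / fq a t p := by
    rw [integral_div, supTail]
  have e3 : ∑ n, wgt a t p n * qLen a n t = ∫ r in Ioi t, ∑ n, wgt a t p n * (a n t / a n r) := by
    rw [integral_finsetSum _ fun n _ => (i3 n).const_mul _]
    refine Finset.sum_congr rfl fun n _ => ?_
    rw [integral_const_mul, qLen, xTail, ← integral_const_mul]
    simp only [div_eq_mul_inv]
  rw [e1, e2, e3, ← integral_sub i1 i2, ← integral_sub i2 i4, ← integral_const_mul,
    ← integral_const_mul, ← integral_add (i2.const_mul _) (i5.const_mul _)]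
  refine abs_integral_le_integral_abs.trans (integral_mono (i1.sub i2).abs
    ((i2.const_mul _).add (i5.const_mul _)) fun r => ?_)
  have hr := h.fq_pos' r hp0
  have hS : √(∑ n, wgt a t p n * (a n t / a n r) ^ 2) = fq a r p / fq a t p := by
    have : ∑ n, wgt a t p n * (a n t / a n r) ^ 2 = (fq a r p / fq a t p) ^ 2 := by
      rw [div_pow, fq_sq (t := r), Finset.sum_div]
      refine Finset.sum_congr rfl fun n _ => ?_
      have := h.scale.pos n t; have := h.scale.pos n r
      rw [wgt]
      field_simp
    rw [this, Real.sqrt_sq (by positivity)]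
  have hG : (a (k + 1) t / a (k + 1) r) ^ 2 * (a (k + 2) t / a (k + 2) r) ^ 2 /
      (fq a r p / fq a t p) ^ 3 = hk a k r p / hk a k t p := by
    have := h.scale.pos (k + 1) t; have := h.scale.pos (k + 1) r
    have := h.scale.pos (k + 2) t; have := h.scale.pos (k + 2) r
    unfold hk
    field_simp
  have := jensen_gap_pointwise (s := fun n => a n t / a n r) hm hη hw (h.sum_wgt hp0)
    (fun n => div_pos (h.scale.pos n t) (h.scale.pos n r)) (k + 1) (k + 2)
    (by fin_cases k <;> simp)
  rw [hS, hG] at this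
  exact this

end TailLimit

end BianchiI

namespace BianchiI

open Bianchi

/-! ### Area densities of ellipsoids -/

/-- Curvature function of an ellipsoid, up to its support function and a power of the axes. -/
def gam (c : Fin 3 → ℝ) (p : Space) : ℝ := √(∏ i, c i) / nf c p ^ 3

lemma gam_pos {c : Fin 3 → ℝ} (hc : ∀ i, 0 < c i) {p : Space} (hp : p ≠ 0) : 0 < gam c p :=
  div_pos (Real.sqrt_pos.2 (Finset.prod_pos fun i _ => hc i)) (pow_pos (nf_pos hc hp) 3)

lemma continuousOn_gam {c : Fin 3 → ℝ} (hc : ∀ i, 0 < c i) : ContinuousOn (gam c) {0}ᶜ :=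
  continuousOn_const.div (continuous_nf.continuousOn.pow 3) fun _ hp =>
    (pow_pos (nf_pos hc hp) 3).ne'

lemma integral_sin_div_cube {A B : ℝ} (hA : 0 < A) (hB : 0 < B) :
    ∫ θ in (0 : ℝ)..Real.pi, Real.sin θ / √(A * Real.sin θ ^ 2 + B * Real.cos θ ^ 2) ^ 3 =
      2 / (A * √B) := by
  have hpos : ∀ θ, 0 < A * Real.sin θ ^ 2 + B * Real.cos θ ^ 2 := fun θ => by
    have := Real.sin_sq_add_cos_sq θ
    rcases eq_or_ne (Real.sin θ) 0 with h | h
    · have h2 : Real.cos θ ^ 2 = 1 := by rw [h] at this; linarith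
      rw [h, h2]; simpa using hB
    · have : 0 < Real.sin θ ^ 2 := by positivity
      positivity
  have hd : ∀ θ, HasDerivAt (fun θ => -Real.cos θ / (A * √(A * Real.sin θ ^ 2 + B * Real.cos θ ^ 2)))
      (Real.sin θ / √(A * Real.sin θ ^ 2 + B * Real.cos θ ^ 2) ^ 3) θ := by
    intro θ
    have hq := Real.sqrt_pos.2 (hpos θ)
    have h1 := ((((Real.hasDerivAt_sin θ).pow 2).const_mul A).add
      (((Real.hasDerivAt_cos θ).pow 2).const_mul B)).sqrt (hpos θ).ne'
    have h2 := (Real.hasDerivAt_cos θ).neg.div (h1.const_mul A) (mul_pos hA hq).ne'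
    refine h2.congr_deriv ?_
    have e := Real.sq_sqrt (hpos θ).le
    have e1 : Real.cos θ ^ 2 = 1 - Real.sin θ ^ 2 := Real.cos_sq' θ
    simp only [Pi.add_apply, Pi.pow_apply, Pi.neg_apply]
    set f := √(A * Real.sin θ ^ 2 + B * Real.cos θ ^ 2)
    field_simp
    push_cast
    rw [show f ^ 2 = A * Real.sin θ ^ 2 + B * Real.cos θ ^ 2 from e]
    ring_nf
    rw [show Real.cos θ ^ 2 = 1 - Real.sin θ ^ 2 from e1]
    ring
  rw [intervalIntegral.integral_eq_sub_of_hasDerivAt (fun θ _ => hd θ)]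
  · simp
    field_simp
    norm_num
  · refine Continuous.intervalIntegrable (Real.continuous_sin.div (by fun_prop) fun θ => ?_) _ _
    exact (pow_pos (Real.sqrt_pos.2 (hpos θ)) 3).ne'

lemma integral_inv_cos_sq_add {a b : ℝ} (ha : 0 < a) (hb : 0 < b) :
    ∫ φ in (0 : ℝ)..(2 * Real.pi), (a * Real.cos φ ^ 2 + b * Real.sin φ ^ 2)⁻¹ =
      2 * Real.pi / √(a * b) := by
  set k := √(b / a) with hk
  have hk0 : 0 < k := Real.sqrt_pos.2 (by positivity)
  have hk2 : b = a * k ^ 2 := by rw [hk, Real.sq_sqrt (by positivity)]; field_simp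
  have hab : √(a * b) = a * k := by
    rw [hk2, show a * (a * k ^ 2) = (a * k) ^ 2 by ring, Real.sqrt_sq (by positivity)]
  have hpos : ∀ c > 0, ∀ φ, 0 < Real.cos φ ^ 2 + c * Real.sin φ ^ 2 := fun c hc φ => by
    have := Real.sin_sq_add_cos_sq φ
    rcases eq_or_ne (Real.sin φ) 0 with h | h
    · have h2 : Real.cos φ ^ 2 = 1 := by rw [h] at this; linarith
      rw [h, h2]; simp
    · have : 0 < Real.sin φ ^ 2 := by positivity
      positivity
  -- Up to the constant this primitive is `arctan (k tan φ)`, written as `φ` plus a smooth periodic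
  -- correction, so that one formula is valid on the whole circle.
  have hd : ∀ φ, HasDerivAt (fun φ => (a * k)⁻¹ * (φ + Real.arctan ((k - 1) * (Real.sin φ *
      Real.cos φ) / (Real.cos φ ^ 2 + k * Real.sin φ ^ 2))))
      ((a * Real.cos φ ^ 2 + b * Real.sin φ ^ 2)⁻¹) φ := by
    intro φ
    have hD := hpos k hk0 φ
    have h1 := ((Real.hasDerivAt_sin φ).mul (Real.hasDerivAt_cos φ)).const_mul (k - 1)
    have h2 := ((Real.hasDerivAt_cos φ).pow 2).add (((Real.hasDerivAt_sin φ).pow 2).const_mul k)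
    have h3 := ((hasDerivAt_id φ).add ((h1.div h2 hD.ne').arctan)).const_mul (a * k)⁻¹
    refine h3.congr_deriv ?_
    have hE := hpos (k ^ 2) (by positivity) φ
    have e1 : Real.cos φ ^ 2 = 1 - Real.sin φ ^ 2 := Real.cos_sq' φ
    simp only [Pi.add_apply, Pi.pow_apply, Pi.mul_apply, Pi.div_apply]
    push_cast
    have hsum : (Real.cos φ ^ 2 + k * Real.sin φ ^ 2) ^ 2 +
        ((k - 1) * (Real.sin φ * Real.cos φ)) ^ 2 = Real.cos φ ^ 2 + k ^ 2 * Real.sin φ ^ 2 := by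
      rw [mul_pow, mul_pow, e1]; ring
    have hr : 1 + ((k - 1) * (Real.sin φ * Real.cos φ) /
        (Real.cos φ ^ 2 + k * Real.sin φ ^ 2)) ^ 2 =
        (Real.cos φ ^ 2 + k ^ 2 * Real.sin φ ^ 2) / (Real.cos φ ^ 2 + k * Real.sin φ ^ 2) ^ 2 := by
      rw [← hsum]; field_simp
    rw [hr, hk2, show a * Real.cos φ ^ 2 + a * k ^ 2 * Real.sin φ ^ 2 =
      a * (Real.cos φ ^ 2 + k ^ 2 * Real.sin φ ^ 2) by ring]
    field_simp
    have e2 : Real.cos φ * Real.cos φ = 1 - Real.sin φ ^ 2 := by rw [← e1]; ring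
    ring_nf
    have e3 : Real.cos φ ^ 4 = (1 - Real.sin φ ^ 2) ^ 2 := by rw [← e1]; ring
    simp only [e1, e3]
    ring
  rw [intervalIntegral.integral_eq_sub_of_hasDerivAt (fun φ _ => hd φ), hab]
  · simp
    field_simp
  · refine Continuous.intervalIntegrable (Continuous.inv₀ (by fun_prop) fun φ => ?_) _ _
    rw [hk2, show a * Real.cos φ ^ 2 + a * k ^ 2 * Real.sin φ ^ 2 =
      a * (Real.cos φ ^ 2 + k ^ 2 * Real.sin φ ^ 2) by ring]
    exact (mul_pos ha (hpos _ (by positivity) φ)).ne'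

/-- `gam c` is the Jacobian of the normalized linear map `p ↦ √c p / |√c p|` of the sphere to
itself, so its total is the area of the sphere for every shape. This fixes the radius independently
of the shape. -/
lemma integral_gam {c : Fin 3 → ℝ} (hc : ∀ i, 0 < c i) : ∫ p, gam c p ∂sph = 4 * Real.pi := by
  have h0 := hc 0; have h1 := hc 1; have h2 := hc 2
  have hcont : Continuous fun z : ℝ × ℝ => Real.sin z.1 * gam c (dir z.1 z.2) :=
    (Real.continuous_sin.comp continuous_fst).mul ((continuousOn_gam hc).comp_continuous
      continuous_dirMap fun z => ne_zero_of_norm (norm_dir _ _))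
  rw [integral_sph (continuousOn_gam hc), intervalIntegral_intervalIntegral_swap]
  swap
  · exact hcont.continuousOn.integrableOn_compact (isCompact_uIcc.prod isCompact_uIcc) |>.mono_set
      (prod_mono uIoc_subset_uIcc uIoc_subset_uIcc)
  have hA : ∀ φ, 0 < c 0 * Real.cos φ ^ 2 + c 1 * Real.sin φ ^ 2 := fun φ => by
    have := Real.sin_sq_add_cos_sq φ
    rcases eq_or_ne (Real.sin φ) 0 with h | h
    · have h2 : Real.cos φ ^ 2 = 1 := by rw [h] at this; linarith
      rw [h, h2]; simpa using h0
    · have : 0 < Real.sin φ ^ 2 := by positivity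
      positivity
  have hin : ∀ φ, ∫ θ in (0 : ℝ)..Real.pi, Real.sin θ * gam c (dir θ φ) =
      √(∏ i, c i) * (2 / √(c 2)) * (c 0 * Real.cos φ ^ 2 + c 1 * Real.sin φ ^ 2)⁻¹ := by
    intro φ
    have e : ∀ θ, Real.sin θ * gam c (dir θ φ) = √(∏ i, c i) * (Real.sin θ /
        √((c 0 * Real.cos φ ^ 2 + c 1 * Real.sin φ ^ 2) * Real.sin θ ^ 2 +
          c 2 * Real.cos θ ^ 2) ^ 3) := fun θ => by
      rw [gam, nf_dir, polarForm, show c 0 * (Real.sin θ ^ 2 * Real.cos φ ^ 2) +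
        c 1 * (Real.sin θ ^ 2 * Real.sin φ ^ 2) + c 2 * Real.cos θ ^ 2 =
        (c 0 * Real.cos φ ^ 2 + c 1 * Real.sin φ ^ 2) * Real.sin θ ^ 2 + c 2 * Real.cos θ ^ 2
        by ring]
      ring
    simp only [e]
    rw [intervalIntegral.integral_const_mul, integral_sin_div_cube (hA φ) h2]
    have := hA φ
    field_simp
  simp only [hin]
  rw [intervalIntegral.integral_const_mul, integral_inv_cos_sq_add h0 h1]
  have e : √(∏ i, c i) = √(c 0 * c 1) * √(c 2) := by
    rw [← Real.sqrt_mul (by positivity), Fin.prod_univ_three]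
  rw [e]
  have := Real.sqrt_pos.2 h2
  have := Real.sqrt_pos.2 (mul_pos h0 h1)
  field_simp
  norm_num

namespace TailLimit

variable {a : Fin 3 → ℝ → ℝ} {t₀ : ℝ} {α : Space → ℝ} {t : ℝ} {p : Space}

/-- Hessian weights in units of the mean radius. -/
def hRel (a : Fin 3 → ℝ → ℝ) (k : Fin 3) (t : ℝ) (p : Space) : ℝ :=
  hTail a k t p / hk a k t p / meanRad a t

lemma sqrt_prod_ell (h : TailLimit a t₀ α) (t : ℝ) :
    √(∏ i, ell a t i) = (vol3 a t)⁻¹ / √(isqSum a t) ^ 3 := by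
  have hc := h.isqSum_pos t
  have hsc := Real.sqrt_pos.2 hc
  have : ∏ i, ell a t i = ((vol3 a t)⁻¹ / √(isqSum a t) ^ 3) ^ 2 := by
    have := h.scale.pos 0 t; have := h.scale.pos 1 t; have := h.scale.pos 2 t
    have e := Real.sq_sqrt hc.le
    rw [div_pow, ← pow_mul, show 3 * 2 = 2 * 3 from rfl, pow_mul, e]
    simp only [Fin.prod_univ_three, ell, isq, vol3]
    field_simp
  rw [this, Real.sqrt_sq (div_nonneg (inv_pos.2 (h.vol3_pos' t)).le (by positivity))]

/-- An exact factorization in which the weights `wgt` sum to one: if all `hRel` tend to one, the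
density in units of `meanRad²` tends to `gam` of the shape. -/
lemma densTail_eq (h : TailLimit a t₀ α) (ht : t₀ < t) (hp : p ≠ 0) :
    densTail a t p / meanRad a t ^ 2 =
      gam (ell a t) p * ∑ n, wgt a t p n * (hRel a (n + 1) t p * hRel a (n + 2) t p) := by
  have hu := h.meanRad_pos ht
  have hf := h.fq_pos' t hp
  have hc := h.isqSum_pos t
  have hn := nf_pos (h.ell_pos t) hp
  have hsc := Real.sqrt_pos.2 hc
  have hg : gam (ell a t) p = (vol3 a t * fq a t p ^ 3)⁻¹ := by
    rw [gam, h.sqrt_prod_ell, h.fq_eq_ell, mul_pow, mul_inv, mul_inv]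
    field_simp
  rw [hg, densTail, curvTail, curv, Finset.mul_sum, Finset.sum_div, Finset.mul_sum]
  refine Finset.sum_congr rfl fun n _ => ?_
  have hkk : hk a (n + 1) t p * hk a (n + 2) t p =
      (a n t ^ 2 * vol3 a t ^ 2 * fq a t p ^ 6)⁻¹ := by
    have := h.scale.pos 0 t; have := h.scale.pos 1 t; have := h.scale.pos 2 t
    rw [vol3_eq n]
    unfold hk
    fin_cases n <;> simp <;> field_simp
  have k1 := hk_pos (fun i => h.scale.pos i t) hp (n + 1)
  have k2 := hk_pos (fun i => h.scale.pos i t) hp (n + 2)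
  have hv := h.vol3_pos' t
  have hn := h.scale.pos n t
  have e : hRel a (n + 1) t p * hRel a (n + 2) t p = hTail a (n + 1) t p * hTail a (n + 2) t p *
      (a n t ^ 2 * vol3 a t ^ 2 * fq a t p ^ 6) / meanRad a t ^ 2 := by
    have : a n t ^ 2 * vol3 a t ^ 2 * fq a t p ^ 6 = (hk a (n + 1) t p * hk a (n + 2) t p)⁻¹ := by
      rw [hkk, inv_inv]
    rw [this, hRel, hRel]
    field_simp
  rw [e, wgt]
  field_simp

lemma tendsto_wgt (h : TailLimit a t₀ α) {l : Filter ℝ} {c : Fin 3 → ℝ} (hc0 : ∀ i, 0 < c i)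
    (hc : ∀ i, Tendsto (fun t => ell a t i) l (𝓝 (c i))) (hp : p ≠ 0) (i : Fin 3) :
    Tendsto (fun t => wgt a t p i) l (𝓝 (c i * p i ^ 2 / nf c p ^ 2)) := by
  simp only [h.wgt_eq hp]
  exact ((hc i).mul_const _).div ((tendsto_nf hc p).pow 2) (pow_pos (nf_pos hc0 hp) 2).ne'

/-- In units of `meanRad` both the local radius and the axis lengths tend to one, so the Jensen gap
in `hTail_div_le` vanishes and only the arbitrary `η` remains. A non-degenerate shape keeps the
weights away from zero. -/
lemma tendsto_hRel (h : TailLimit a t₀ α) {l : Filter ℝ} (hl : l ≤ atTop)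
    (hD : Tendsto (deficit a α) l (𝓝 0)) {c : Fin 3 → ℝ} (hc0 : ∀ i, 0 < c i) (hc1 : ∑ i, c i = 1)
    (hc : ∀ i, Tendsto (fun t => ell a t i) l (𝓝 (c i))) (hp : ∀ i, p i ≠ 0) (k : Fin 3) :
    Tendsto (fun t => hRel a k t p) l (𝓝 1) := by
  have hp0 := ne_zero_of_generic hp
  have hw := h.tendsto_wgt hc0 hc hp0
  have hw0 : ∀ i, 0 < c i * p i ^ 2 / nf c p ^ 2 := fun i => by
    have := hc0 i; have := nf_pos hc0 hp0; have := hp i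
    positivity
  obtain ⟨m, hm, hmi⟩ : ∃ m > 0, ∀ i, m < c i * p i ^ 2 / nf c p ^ 2 := by
    obtain ⟨m, hm, hm2⟩ := exists_between (lt_min (hw0 0) (lt_min (hw0 1) (hw0 2)))
    refine ⟨m, hm, fun i => ?_⟩
    rw [lt_min_iff, lt_min_iff] at hm2
    fin_cases i
    · exact hm2.1
    · exact hm2.2.1
    · exact hm2.2.2
  have hz := h.tendsto_relRad hl hD hp
  have hq : ∀ i, Tendsto (fun t => qLen a i t / meanRad a t) l (𝓝 1) := fun i =>
    h.tendsto_qLen_div hl hD (fun i => (hc0 i).le) hc1 hc (hc0 i).ne'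
  rw [Metric.tendsto_nhds]
  intro ε hε
  set η := ε / 4
  have hη : 0 < η := by positivity
  set K := (1 / m + 1) ^ 4 / (η * m)
  have hR : Tendsto (fun t => η * relRad a t p + K * (relRad a t p - ∑ n, wgt a t p n *
      (qLen a n t / meanRad a t)) + |relRad a t p - 1|) l
      (𝓝 (η * 1 + K * (1 - ∑ n, c n * p n ^ 2 / nf c p ^ 2 * 1) + |(1 : ℝ) - 1|)) :=
    ((hz.const_mul η).add ((hz.sub (tendsto_finsetSum _ fun n _ => (hw n).mul (hq n))).const_mul
      K)).add (hz.sub_const 1).abs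
  have hlim : η * 1 + K * (1 - ∑ n, c n * p n ^ 2 / nf c p ^ 2 * 1) + |(1 : ℝ) - 1| < ε := by
    have := nf_pos hc0 hp0
    have e : ∑ n, c n * p n ^ 2 / nf c p ^ 2 * 1 = 1 := by
      simp only [mul_one, ← Finset.sum_div]
      rw [← nf_sq hc0, div_self (by positivity)]
    rw [e]
    simp only [η, sub_self, abs_zero]
    linarith
  filter_upwards [hR.eventually_lt_const hlim, eventually_all.2 fun i => (hw i).eventually_const_lt
    (hmi i), hl (eventually_gt_atTop t₀)] with t h1 h2 ht
  have hu := h.meanRad_pos ht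
  have h3 := h.hTail_div_le ht hp hm hη (fun i => (h2 i).le) k
  have h4 : |hRel a k t p - relRad a t p| ≤ η * relRad a t p + K * (relRad a t p -
      ∑ n, wgt a t p n * (qLen a n t / meanRad a t)) := by
    have e1 : hRel a k t p - relRad a t p =
        (hTail a k t p / hk a k t p - supTail a t p / fq a t p) / meanRad a t := by
      rw [hRel, relRad, sub_div]
    rw [e1, abs_div, abs_of_pos hu, div_le_iff₀ hu]
    refine h3.trans (le_of_eq ?_)
    have e2 : ∑ n, wgt a t p n * (qLen a n t / meanRad a t) =
        (∑ n, wgt a t p n * qLen a n t) / meanRad a t := by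
      rw [Finset.sum_div]
      exact Finset.sum_congr rfl fun n _ => (mul_div_assoc _ _ _).symm
    rw [e2, relRad]
    change _ + K * _ = _
    clear_value K
    field_simp
  rw [Real.dist_eq]
  calc |hRel a k t p - 1| ≤ |hRel a k t p - relRad a t p| + |relRad a t p - 1| := abs_sub_le _ _ _
    _ ≤ _ := by gcongr
    _ < ε := h1

/-- In a non-degenerate limit the area density is that of a round sphere. -/
lemma tendsto_densTail (h : TailLimit a t₀ α) {l : Filter ℝ} (hl : l ≤ atTop)
    (hD : Tendsto (deficit a α) l (𝓝 0)) {c : Fin 3 → ℝ} (hc0 : ∀ i, 0 < c i) (hc1 : ∑ i, c i = 1)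
    (hc : ∀ i, Tendsto (fun t => ell a t i) l (𝓝 (c i))) (hp : ∀ i, p i ≠ 0) :
    Tendsto (fun t => densTail a t p / meanRad a t ^ 2) l (𝓝 (gam c p)) := by
  have hp0 := ne_zero_of_generic hp
  have hm := h.tendsto_hRel hl hD hc0 hc1 hc hp
  have hg : Tendsto (fun t => gam (ell a t) p) l (𝓝 (gam c p)) :=
    ((Real.continuous_sqrt.tendsto _).comp (tendsto_finsetProd _ fun i _ => hc i)).div
      ((tendsto_nf hc p).pow 3) (pow_pos (nf_pos hc0 hp0) 3).ne'
  have hs : Tendsto (fun t => ∑ n, wgt a t p n * (hRel a (n + 1) t p * hRel a (n + 2) t p)) l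
      (𝓝 (∑ n, c n * p n ^ 2 / nf c p ^ 2 * (1 * 1))) :=
    tendsto_finsetSum _ fun n _ => (h.tendsto_wgt hc0 hc hp0 n).mul ((hm _).mul (hm _))
  have e : ∑ n, c n * p n ^ 2 / nf c p ^ 2 * (1 * 1) = 1 := by
    have := nf_pos hc0 hp0
    simp only [mul_one, ← Finset.sum_div]
    rw [← nf_sq hc0, div_self (by positivity)]
  rw [e] at hs
  have := hg.mul hs
  rw [mul_one] at this
  refine this.congr' ?_
  filter_upwards [hl (eventually_gt_atTop t₀)] with t ht
  exact (h.densTail_eq ht hp0).symm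

end TailLimit

end BianchiI

namespace BianchiI

open Bianchi

/-! ### Limit points of the shape -/

lemma gam_axis {c : Fin 3 → ℝ} (i : Fin 3) :
    gam c (EuclideanSpace.single i 1) = √(∏ j, c j) / √(c i) ^ 3 := by
  have : ∑ n, c n * (EuclideanSpace.single i (1 : ℝ)) n ^ 2 = c i := by
    fin_cases i <;> simp
  rw [gam, nf, this]

/-- The curvature function of an ellipsoid determines its axes. -/
lemma eq_of_gam_ae_eq {c d : Fin 3 → ℝ} (hc : ∀ i, 0 < c i) (hd : ∀ i, 0 < d i)
    (hc1 : ∑ i, c i = 1) (hd1 : ∑ i, d i = 1) (h : ∀ᵐ p ∂sph, gam c p = gam d p) : c = d := by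
  have key : ∀ i, √(c i) / √(d i) = √(c 0) / √(d 0) := by
    intro i
    -- By continuity the equality holds at the axes, where it forces `c` and `d` to be proportional;
    -- the normalization of the sums then fixes the factor.
    have e : ∀ i, (√(c i) / √(d i)) ^ 3 = √(∏ j, c j) / √(∏ j, d j) := fun i => by
      have := eq_of_ae_sph (continuousOn_gam hc) (continuousOn_gam hd) h
        (p := EuclideanSpace.single i 1) (by simp)
      rw [gam_axis, gam_axis] at this
      have h1 := Real.sqrt_pos.2 (hc i)
      have h2 := Real.sqrt_pos.2 (hd i)
      have h3 := Real.sqrt_pos.2 (Finset.prod_pos fun j (_ : j ∈ Finset.univ) => hd j)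
      field_simp at this ⊢
      linarith
    exact (pow_left_inj₀ (by positivity) (by positivity) three_ne_zero).1
      ((e i).trans (e 0).symm)
  set k := √(c 0) / √(d 0)
  have hk : ∀ i, c i = k ^ 2 * d i := fun i => by
    rw [← key i, div_pow, Real.sq_sqrt (hc i).le, Real.sq_sqrt (hd i).le,
      div_mul_cancel₀ _ (hd i).ne']
  have hk1 : k ^ 2 = 1 := by
    rw [← hc1, Finset.sum_congr rfl fun i _ => hk i, ← Finset.mul_sum, hd1, mul_one]
  funext i
  rw [hk, hk1, one_mul]

lemma sum_eq_cyclic (f : Fin 3 → ℝ) (i : Fin 3) : ∑ j, f j = f i + (f (i + 1) + f (i + 2)) := by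
  fin_cases i <;> simp [Fin.sum_univ_three] <;> ring

namespace TailLimit

variable {a : Fin 3 → ℝ → ℝ} {t₀ : ℝ} {α : Space → ℝ} {t : ℝ} {p : Space}

lemma tendsto_defect (h : TailLimit a t₀ α) : Tendsto (defect a α) atTop (𝓝 0) := h.lim

/-- As axis `i` of the shape vanishes, so does the frequency fraction `freqPart` in generic
directions and its `α`-mean. Replacing `α` by the actual density in `qLen_mul_le` costs only the L¹
defect. -/
lemma tendsto_qLen_mul (h : TailLimit a t₀ α) {l : Filter ℝ} [l.IsCountablyGenerated]
    (hl : l ≤ atTop) {c : Fin 3 → ℝ} (hc0 : ∀ i, 0 ≤ c i) (hc1 : ∑ i, c i = 1)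
    (hc : ∀ i, Tendsto (fun t => ell a t i) l (𝓝 (c i))) {i : Fin 3} (hi : c i = 0) :
    Tendsto (fun t => qLen a (i + 1) t * qLen a (i + 2) t) l (𝓝 0) := by
  have hpt : ∀ p : Space, (∀ i, p i ≠ 0) → Tendsto (fun t => freqPart a i t p) l (𝓝 0) := by
    intro p hp
    have hn : 0 < nf c p := by
      obtain ⟨j, hj⟩ : ∃ j, c j ≠ 0 := by
        by_contra! hcon
        simp [hcon] at hc1
      refine Real.sqrt_pos.2 (Finset.sum_pos' (fun n _ => by have := hc0 n; positivity)
        ⟨j, Finset.mem_univ _, ?_⟩)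
      have := (hc0 j).lt_of_ne' hj
      have := hp j
      positivity
    have h1 := (((Real.continuous_sqrt.tendsto _).comp (hc i)).const_mul |p i|).div
      (tendsto_nf hc p) hn.ne'
    rw [hi, Real.sqrt_zero, mul_zero, zero_div] at h1
    refine h1.congr fun t => ?_
    have := h.scale.pos i t
    have hS := Real.sqrt_pos.2 (h.isqSum_pos t)
    have := nf_pos (h.ell_pos t) (ne_zero_of_generic hp)
    simp only [Function.comp_apply, Pi.div_apply]
    rw [h.sqrt_ell, freqPart, h.fq_eq_ell]
    field_simp
  have hI : Tendsto (fun t => ∫ p, α p * freqPart a i t p ∂sph) l (𝓝 (∫ p, α p * 0 ∂sph)) := by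
    refine tendsto_integral_filter_of_dominated_convergence (fun p => |α p|)
      (Eventually.of_forall fun t => (h.integrable_freqPart_mul h.limInt i t).aestronglyMeasurable)
      (Eventually.of_forall fun t => ?_) h.limInt.abs ?_
    · filter_upwards with p
      rw [Real.norm_eq_abs, abs_mul, abs_of_nonneg (h.freqPart_nonneg i)]
      exact mul_le_of_le_one_right (abs_nonneg _) (h.freqPart_le_one i)
    · filter_upwards [ae_sph_coord_ne] with p hp
      exact (hpt p hp).const_mul _
  simp only [mul_zero, integral_zero] at hI
  have hB := mvBall_pos
  have hup := ((hI.add (h.tendsto_defect.mono_left hl)).const_mul (mvBall / 12)⁻¹)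
  simp only [add_zero, mul_zero] at hup
  have hev := hl (eventually_gt_atTop t₀)
  refine tendsto_of_tendsto_of_tendsto_of_le_of_le' tendsto_const_nhds hup ?_ ?_
  · filter_upwards [hev] with t ht
    exact (mul_pos (h.qLen_pos ht _) (h.qLen_pos ht _)).le
  · filter_upwards [hev] with t ht
    rw [inv_mul_eq_div, le_div_iff₀ (by positivity), mul_comm]
    refine (h.qLen_mul_le ht i).trans ?_
    rw [← sub_le_iff_le_add', ← integral_sub (h.integrable_freqPart_mul (h.int t ht) i t)
      (h.integrable_freqPart_mul h.limInt i t)]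
    refine integral_mono ((h.integrable_freqPart_mul (h.int t ht) i t).sub
      (h.integrable_freqPart_mul h.limInt i t)) (h.integrable_defect ht) fun p => ?_
    rw [← sub_mul]
    exact (mul_le_mul_of_nonneg_right (le_abs_self _) (h.freqPart_nonneg i)).trans
      (mul_le_of_le_one_right (abs_nonneg _) (h.freqPart_le_one i))

/-- A limiting shape with a vanishing axis has mean radius zero, and its volume shrinks at most
3/4 as fast as that of the surrounding box. -/
lemma degenerate (h : TailLimit a t₀ α) {l : Filter ℝ} [l.IsCountablyGenerated]
    (hl : l ≤ atTop) (hD : Tendsto (deficit a α) l (𝓝 0)) {c : Fin 3 → ℝ} (hc0 : ∀ i, 0 ≤ c i)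
    (hc1 : ∑ i, c i = 1) (hc : ∀ i, Tendsto (fun t => ell a t i) l (𝓝 (c i))) {i : Fin 3}
    (hi : c i = 0) : Tendsto (meanRad a) l (𝓝 0) ∧
      ∀ᶠ t in l, ∑ i, meanRad a t / qLen a i t ≤ 9 / 4 := by
  have hev := hl (eventually_gt_atTop t₀)
  have hA := h.tendsto_areaTail.mono_left hl
  have hL := h.lim_pos
  have hB := mvBall_pos
  have hK : Tendsto (fun t => 3 * mvBall / areaTail a t) l (𝓝 (3 * mvBall / ∫ p, α p ∂sph)) :=
    tendsto_const_nhds.div hA hL.ne'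
  have hz : ∀ i, c i = 0 → Tendsto (fun t => meanRad a t / qLen a i t) l (𝓝 0) := by
    intro i hi
    have := hK.mul (h.tendsto_qLen_mul hl hc0 hc1 hc hi)
    rw [mul_zero] at this
    refine tendsto_of_tendsto_of_tendsto_of_le_of_le' tendsto_const_nhds this ?_ ?_
    · filter_upwards [hev] with t ht
      exact (div_pos (h.meanRad_pos ht) (h.qLen_pos ht i)).le
    · filter_upwards [hev] with t ht using h.meanRad_div_le ht i
  have hnz : ∀ i, c i ≠ 0 → Tendsto (fun t => meanRad a t / qLen a i t) l (𝓝 1) := by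
    intro i hi
    have := (h.tendsto_qLen_div hl hD hc0 hc1 hc hi).inv₀ one_ne_zero
    rw [inv_one] at this
    exact this.congr fun t => inv_div _ _
  have hle : ∀ i, Tendsto (fun t => meanRad a t / qLen a i t) l (𝓝 (if c i = 0 then 0 else 1)) :=
    fun i => by split_ifs with h0; exacts [hz i h0, hnz i h0]
  obtain ⟨j, hj⟩ : ∃ j, c j ≠ 0 := by
    by_contra! hcon
    simp [hcon] at hc1
  constructor
  · set P : ℝ := 12 / mvBall * ((∫ p, α p ∂sph) + 1)
    have hbd : ∀ᶠ t in l, ∀ i, qLen a (i + 1) t * qLen a (i + 2) t ≤ P := by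
      filter_upwards [hev, hA.eventually_lt_const (lt_add_one _)] with t ht h1 i
      have := (h.qLen_mul_le_area ht i).trans h1.le
      simp only [P]
      rw [div_mul_eq_mul_div, le_div_iff₀ hB]
      linarith
    -- For a surviving axis `j ≠ i`, multiplying the volume bound by `qLen j` gives the product of
    -- `qLen i * qLen j`, bounded by `P`, and the pair without `i`, which tends to zero. As `meanRad
    -- / qLen j → 1`, this forces `meanRad² → 0`.
    have hsq : Tendsto (fun t => meanRad a t ^ 2) l (𝓝 0) := by
      have hup := ((hK.mul_const P).mul (h.tendsto_qLen_mul hl hc0 hc1 hc hi)).mul (hnz j hj)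
      simp only [mul_zero, mul_one] at hup
      refine tendsto_of_tendsto_of_tendsto_of_le_of_le' tendsto_const_nhds hup
        (Eventually.of_forall fun t => sq_nonneg _) ?_
      filter_upwards [hev, hbd] with t ht hb
      have q := fun i => h.qLen_pos ht i
      have hu := h.meanRad_pos ht
      have hKt : 0 < 3 * mvBall / areaTail a t := div_pos (by positivity) (h.areaTail_pos ht)
      have h1 := h.meanRad_le ht
      rw [Fin.prod_univ_three] at h1
      have h2 : meanRad a t * qLen a j t ≤ 3 * mvBall / areaTail a t *
          (P * (qLen a (i + 1) t * qLen a (i + 2) t)) := by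
        have hij : j ≠ i := fun e => hj (e ▸ hi)
        have b0 := hb 0; have b1 := hb 1; have b2 := hb 2
        have q0 := q 0; have q1 := q 1; have q2 := q 2
        refine (mul_le_mul_of_nonneg_right h1 (q j).le).trans ?_
        rw [mul_assoc]
        refine mul_le_mul_of_nonneg_left ?_ hKt.le
        fin_cases i <;> fin_cases j <;> simp at hij b0 b1 b2 ⊢
        · nlinarith [mul_pos q1 q2, mul_pos q0 q1]
        · nlinarith [mul_pos q1 q2, mul_pos q0 q2]
        · nlinarith [mul_pos q0 q2, mul_pos q0 q1]
        · nlinarith [mul_pos q0 q2, mul_pos q1 q2]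
        · nlinarith [mul_pos q0 q1, mul_pos q0 q2]
        · nlinarith [mul_pos q0 q1, mul_pos q1 q2]
      calc meanRad a t ^ 2 = meanRad a t * qLen a j t * (meanRad a t / qLen a j t) := by
            have := (q j).ne'
            field_simp
        _ ≤ 3 * mvBall / areaTail a t * (P * (qLen a (i + 1) t * qLen a (i + 2) t)) *
            (meanRad a t / qLen a j t) :=
          mul_le_mul_of_nonneg_right h2 (div_pos hu (q j)).le
        _ = _ := by ring
    have := (Real.continuous_sqrt.tendsto _).comp hsq
    rw [Real.sqrt_zero] at this
    refine this.congr' ?_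
    filter_upwards [hev] with t ht
    exact Real.sqrt_sq (h.meanRad_pos ht).le
  -- Vanishing axes contribute 0 and the others 1, so the limit is at most 2. The threshold `9 / 4`
  -- leaves room and corresponds to a growth rate `1 / 4` of `boxLog`.
  · have hs := tendsto_finsetSum Finset.univ fun i _ => hle i
    refine (hs.eventually_lt_const (u := 9 / 4) ?_).mono fun t ht => ht.le
    have : ∑ i, (if c i = 0 then (0 : ℝ) else 1) ≤ 2 := by
      rw [sum_eq_cyclic _ i, if_pos hi, zero_add]
      have e : ∀ x : ℝ, (if x = 0 then (0 : ℝ) else 1) ≤ 1 := fun x => by split_ifs <;> norm_num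
      linarith [e (c (i + 1)), e (c (i + 2))]
    linarith

/-- Value of the Lyapunov function in the limit of shape `c`. -/
def lyapLim (a : Fin 3 → ℝ → ℝ) (t₀ : ℝ) (α : Space → ℝ) (R : ℝ) (c : Fin 3 → ℝ) : ℝ :=
  (∫ p, α p ∂sph)⁻¹ * ∫ p, α p * Real.log (nf c p / supTail a (t₀ + 1) p) ∂sph +
    1 / 3 * Real.log (3 * R ^ 2 / ((∫ p, α p ∂sph) * √(∏ i, c i)))

lemma supTail_eq_supRel (h : TailLimit a t₀ α) (ht : t₀ < t) (p : Space) :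
    supTail a t p = meanRad a t * √(isqSum a t) * supRel a t p := by
  have := h.meanRad_pos ht
  have := Real.sqrt_pos.2 (h.isqSum_pos t)
  rw [supRel]
  field_simp

/-- The scale `meanRad * √isqSum` cancels between the mean of `logSup` and the volume term. What
remains depends only on the shape and the radius, and limits of `xRel` supply a bound uniform in the
direction. -/
lemma tendsto_lyap (h : TailLimit a t₀ α) {l : Filter ℝ} [l.IsCountablyGenerated]
    (hl : l ≤ atTop) (hD : Tendsto (deficit a α) l (𝓝 0)) {c : Fin 3 → ℝ} (hc0 : ∀ i, 0 < c i)
    (hc1 : ∑ i, c i = 1) (hc : ∀ i, Tendsto (fun t => ell a t i) l (𝓝 (c i))) {R : ℝ}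
    (hR0 : 0 < R) (hR : Tendsto (meanRad a) l (𝓝 R)) :
    Tendsto (lyap a t₀ α) l (𝓝 (lyapLim a t₀ α R c)) := by
  have hev := hl (eventually_gt_atTop t₀)
  have hL := h.lim_pos
  have h1 : t₀ < t₀ + 1 := lt_add_one _
  have hx := fun i => h.tendsto_xRel hl hD (fun i => (hc0 i).le) hc1 hc i
  have hxp : ∀ i, 0 < √(c i) := fun i => Real.sqrt_pos.2 (hc0 i)
  have hx0 := fun i => h.xTail_pos h1 i
  set sc : ℝ → ℝ := fun t => meanRad a t * √(isqSum a t) with hsc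
  have hscp : ∀ t > t₀, 0 < sc t := fun t ht =>
    mul_pos (h.meanRad_pos ht) (Real.sqrt_pos.2 (h.isqSum_pos t))
  have hxe : ∀ t > t₀, ∀ i, xTail a i t = sc t * xRel a i t := fun t ht i => by
    have := (hscp t ht).ne'
    change xTail a i t = sc t * (xTail a i t / sc t)
    field_simp
  set g : ℝ → Space → ℝ := fun t p => logSup a t₀ t p - Real.log (sc t) with hg
  have hup : Tendsto (fun t => Real.log (∑ i, xRel a i t / xTail a i (t₀ + 1))) l
      (𝓝 (Real.log (∑ i, √(c i) / xTail a i (t₀ + 1)))) := by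
    refine (tendsto_finsetSum _ fun i _ => (hx i).div_const _).log (ne_of_gt ?_)
    exact Finset.sum_pos (fun i _ => div_pos (hxp i) (hx0 i)) Finset.univ_nonempty
  have hlo : Tendsto (fun t => Real.log (∑ i, xTail a i (t₀ + 1) / xRel a i t)) l
      (𝓝 (Real.log (∑ i, xTail a i (t₀ + 1) / √(c i)))) := by
    refine (tendsto_finsetSum _ fun i _ => tendsto_const_nhds.div (hx i) (hxp i).ne').log
      (ne_of_gt ?_)
    exact Finset.sum_pos (fun i _ => div_pos (hx0 i) (hxp i)) Finset.univ_nonempty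
  set C := max (Real.log (∑ i, √(c i) / xTail a i (t₀ + 1)) + 1)
    (Real.log (∑ i, xTail a i (t₀ + 1) / √(c i)) + 1)
  have hpos : ∀ᶠ t in l, ∀ i, 0 < xRel a i t :=
    eventually_all.2 fun i => (hx i).eventually_const_lt (hxp i)
  have hbd : ∀ᶠ t in l, ∀ p : Space, p ≠ 0 → |g t p| ≤ C := by
    filter_upwards [hev, hpos, hup.eventually_lt_const (lt_add_one _),
      hlo.eventually_lt_const (lt_add_one _)] with t ht hp e1 e2 p hp0
    have hs := hscp t ht
    have u := h.logSup_le ht hp0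
    have v := h.le_logSup ht hp0
    have eu : ∑ i, xTail a i t / xTail a i (t₀ + 1) =
        sc t * ∑ i, xRel a i t / xTail a i (t₀ + 1) := by
      rw [Finset.mul_sum]
      exact Finset.sum_congr rfl fun i _ => by rw [hxe t ht, mul_div_assoc]
    have ev : ∑ i, xTail a i (t₀ + 1) / xTail a i t =
        (sc t)⁻¹ * ∑ i, xTail a i (t₀ + 1) / xRel a i t := by
      rw [Finset.mul_sum]
      refine Finset.sum_congr rfl fun i _ => ?_
      rw [hxe t ht]
      have := (hp i).ne'
      field_simp
    rw [eu, Real.log_mul hs.ne' (ne_of_gt (Finset.sum_pos (fun i _ => div_pos (hp i) (hx0 i))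
      Finset.univ_nonempty))] at u
    rw [ev, Real.log_mul (inv_pos.2 hs).ne' (ne_of_gt (Finset.sum_pos (fun i _ =>
      div_pos (hx0 i) (hp i)) Finset.univ_nonempty)), Real.log_inv] at v
    have c1 := le_max_left (Real.log (∑ i, √(c i) / xTail a i (t₀ + 1)) + 1)
      (Real.log (∑ i, xTail a i (t₀ + 1) / √(c i)) + 1)
    have c2 := le_max_right (Real.log (∑ i, √(c i) / xTail a i (t₀ + 1)) + 1)
      (Real.log (∑ i, xTail a i (t₀ + 1) / √(c i)) + 1)
    simp only [hg]
    rw [abs_le]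
    constructor <;> linarith
  have hI : Tendsto (fun t => ∫ p, α p * g t p ∂sph) l
      (𝓝 (∫ p, α p * Real.log (nf c p / supTail a (t₀ + 1) p) ∂sph)) := by
    refine tendsto_integral_filter_of_dominated_convergence (fun p => C * |α p|)
      (Eventually.of_forall fun t => h.limInt.aestronglyMeasurable.mul
        ((h.measurable_logSup t).sub_const _).aestronglyMeasurable) ?_
      (h.limInt.abs.const_mul C) ?_
    · filter_upwards [hbd] with t ht
      filter_upwards [ae_sph_coord_ne] with p hp
      rw [Real.norm_eq_abs, abs_mul, mul_comm]
      exact mul_le_mul_of_nonneg_right (ht p (ne_zero_of_generic hp)) (abs_nonneg _)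
    · filter_upwards [ae_sph_coord_ne] with p hp
      have hp0 := ne_zero_of_generic hp
      have s0 := h.supTail_pos h1 hp0
      refine Tendsto.const_mul _ ((((h.tendsto_supRel hl hD hc hp).div_const _).log
        (div_pos (nf_pos hc0 hp0) s0).ne').congr' ?_)
      filter_upwards [hev] with t ht
      have hs := hscp t ht
      have e := h.supTail_eq_supRel ht p
      have h2 := h.supTail_pos ht hp0
      have h3 : 0 < supRel a t p := by
        rw [e] at h2; exact pos_of_mul_pos_right h2 hs.le
      simp only [hg, logSup]
      rw [e, mul_div_assoc, Real.log_mul hs.ne' (div_pos h3 s0).ne', add_sub_cancel_left]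
  have hP : 0 < ∏ i, c i := Finset.prod_pos fun i _ => hc0 i
  have hF : Tendsto (fun t => 1 / 3 * Real.log (3 * meanRad a t ^ 2 /
      (areaTail a t * √(∏ i, ell a t i)))) l
      (𝓝 (1 / 3 * Real.log (3 * R ^ 2 / ((∫ p, α p ∂sph) * √(∏ i, c i))))) := by
    have := Real.sqrt_pos.2 hP
    refine Tendsto.const_mul _ (Tendsto.log (((hR.pow 2).const_mul 3).div
      ((h.tendsto_areaTail.mono_left hl).mul ((Real.continuous_sqrt.tendsto _).comp
        (tendsto_finsetProd _ fun i _ => hc i))) (by positivity)) (by positivity))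
  refine ((hI.const_mul _).add hF).congr' ?_
  filter_upwards [hev] with t ht
  have hs := hscp t ht
  have hA := h.areaTail_pos ht
  have hv := h.vol3_pos' t
  have hV := h.volTail_pos ht
  have hS := Real.sqrt_pos.2 (h.isqSum_pos t)
  have e : ∫ p, α p * g t p ∂sph =
      ∫ p, α p * logSup a t₀ t p ∂sph - (∫ p, α p ∂sph) * Real.log (sc t) := by
    rw [← integral_mul_const, ← integral_sub (h.integrable_logSup ht) (h.limInt.mul_const _)]
    exact integral_congr_ae (Eventually.of_forall fun p => mul_sub _ _ _)
  have e2 : 3 * meanRad a t ^ 2 / (areaTail a t * √(∏ i, ell a t i)) = sc t ^ 3 / volTail a t := by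
    rw [h.sqrt_prod_ell, hsc]
    simp only [mul_pow]
    have e3 : volTail a t = meanRad a t * areaTail a t / (3 * vol3 a t) := by
      rw [meanRad]; field_simp
    have := h.meanRad_pos ht
    rw [e3]
    field_simp
  rw [e, e2, Real.log_div (pow_pos hs 3).ne' hV.ne', Real.log_pow, lyap]
  push_cast
  field_simp
  ring

/-- In a non-degenerate limiting shape the light cones are round. -/
lemma nondegenerate (h : TailLimit a t₀ α) {l : Filter ℝ} [l.NeBot] [l.IsCountablyGenerated]
    (hl : l ≤ atTop) (hD : Tendsto (deficit a α) l (𝓝 0)) {c : Fin 3 → ℝ} (hc0 : ∀ i, 0 < c i)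
    (hc1 : ∑ i, c i = 1) (hc : ∀ i, Tendsto (fun t => ell a t i) l (𝓝 (c i)))
    (hae : ∀ᵐ p ∂sph, Tendsto (fun t => densTail a t p) l (𝓝 (α p))) {R : ℝ} (hR0 : 0 < R)
    (hR : 4 * Real.pi * R ^ 2 = ∫ p, α p ∂sph) :
    (∀ᵐ p ∂sph, α p = R ^ 2 * gam c p) ∧ Tendsto (meanRad a) l (𝓝 R) := by
  have hev := hl (eventually_gt_atTop t₀)
  have : NeBot (ae sph) := ae_neBot.2 sph_ne_zero
  obtain ⟨p, h1, hp, h2⟩ := (hae.and (ae_sph_coord_ne.and h.limPos)).exists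
  have hgp := gam_pos hc0 (ne_zero_of_generic hp)
  have hsq : Tendsto (fun t => meanRad a t ^ 2) l (𝓝 (α p / gam c p)) := by
    refine (h1.div (h.tendsto_densTail hl hD hc0 hc1 hc hp) hgp.ne').congr' ?_
    filter_upwards [hev] with t ht
    have := h.densTail_pos t hp
    have := h.meanRad_pos ht
    simp only [Pi.div_apply]
    field_simp
  set K := α p / gam c p
  have hK : ∀ᵐ q ∂sph, α q = K * gam c q := by
    filter_upwards [hae, ae_sph_coord_ne] with q h3 hq
    refine tendsto_nhds_unique h3 ((hsq.mul (h.tendsto_densTail hl hD hc0 hc1 hc hq)).congr' ?_)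
    filter_upwards [hev] with t ht
    have := h.meanRad_pos ht
    field_simp
  -- Compare totals: `α` has integral `4 π R²` and `gam c` has integral `4 π`.
  have hKR : K = R ^ 2 := by
    rw [integral_congr_ae hK, integral_const_mul, integral_gam hc0] at hR
    have := Real.pi_pos
    nlinarith
  rw [hKR] at hK hsq
  refine ⟨hK, ?_⟩
  have := (Real.continuous_sqrt.tendsto _).comp hsq
  rw [Real.sqrt_sq hR0.le] at this
  refine this.congr' ?_
  filter_upwards [hev] with t ht
  exact Real.sqrt_sq (h.meanRad_pos ht).le

/-- When the deficit is small, the shape is close to one fixed non-degenerate shape, or the mean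
radius is small and the shape almost degenerate. -/
theorem classification (h : TailLimit a t₀ α) {R : ℝ} (hR0 : 0 < R)
    (hR : 4 * Real.pi * R ^ 2 = ∫ p, α p ∂sph) :
    ∃ (c : Fin 3 → ℝ) (F : ℝ), (∀ i, 0 < c i) ∧ ∀ ε > 0, ∃ δ > 0, ∃ t₁, ∀ t > t₁,
      |deficit a α t| < δ →
        (|meanRad a t - R| < ε ∧ (∀ i, |ell a t i - c i| < ε) ∧ |lyap a t₀ α t - F| < ε) ∨
        (meanRad a t < ε ∧ ∑ i, meanRad a t / qLen a i t ≤ 9 / 4) := by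
  classical
  -- `α` determines the shape. If no shape is compatible with `α`, the non-degenerate alternative
  -- never arises and any positive `c` serves.
  obtain ⟨c, hc0, hcu⟩ : ∃ c : Fin 3 → ℝ, (∀ i, 0 < c i) ∧ ∀ d : Fin 3 → ℝ, (∀ i, 0 < d i) →
      ∑ i, d i = 1 → (∀ᵐ p ∂sph, α p = R ^ 2 * gam d p) → d = c := by
    by_cases hex : ∃ c : Fin 3 → ℝ, (∀ i, 0 < c i) ∧ ∑ i, c i = 1 ∧
        ∀ᵐ p ∂sph, α p = R ^ 2 * gam c p
    · obtain ⟨c, hc0, hc1, hc⟩ := hex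
      refine ⟨c, hc0, fun d hd0 hd1 hd => eq_of_gam_ae_eq hd0 hc0 hd1 hc1 ?_⟩
      filter_upwards [hc, hd] with p e1 e2
      exact mul_left_cancel₀ (pow_pos hR0 2).ne' (e2.symm.trans e1)
    · exact ⟨1, one_pos_fun, fun d hd0 hd1 hd => (hex ⟨d, hd0, hd1, hd⟩).elim⟩
  refine ⟨c, lyapLim a t₀ α R c, hc0, fun ε hε => ?_⟩
  by_contra! hcon
  choose t htn hD hfar using fun n : ℕ => hcon (1 / ((n : ℝ) + 1)) (by positivity) (max n t₀)
  have htop : Tendsto t atTop atTop :=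
    tendsto_atTop_mono (fun n => (le_max_left _ _).trans (htn n).le) tendsto_natCast_atTop_atTop
  have hD0 : Tendsto (fun n => deficit a α (t n)) atTop (𝓝 0) :=
    squeeze_zero_norm (fun n => (hD n).le) tendsto_one_div_add_atTop_nhds_zero_nat
  have hmeas : TendstoInMeasure sph (fun n => densTail a (t n)) atTop α := by
    refine tendstoInMeasure_of_tendsto_eLpNorm one_ne_zero (fun n => (h.int _
      ((le_max_right _ _).trans_lt (htn n))).aestronglyMeasurable) h.limInt.aestronglyMeasurable ?_
    have e : ∀ n, eLpNorm (densTail a (t n) - α) 1 sph = ENNReal.ofReal (defect a α (t n)) := by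
      intro n
      rw [eLpNorm_one_eq_lintegral_enorm, defect, ofReal_integral_eq_lintegral_ofReal
        (h.integrable_defect ((le_max_right _ _).trans_lt (htn n)))
        (Eventually.of_forall fun _ => abs_nonneg _)]
      refine lintegral_congr fun p => ?_
      rw [Real.enorm_eq_ofReal_abs, Pi.sub_apply]
    simp only [e]
    have := (ENNReal.continuous_ofReal.tendsto _).comp (h.tendsto_defect.comp htop)
    rwa [ENNReal.ofReal_zero] at this
  -- L¹ convergence gives almost everywhere convergence along a subsequence, and compactness of the
  -- normalized shapes allows a further one along which the shape converges.
  obtain ⟨φ, hφ, hae⟩ := hmeas.exists_seq_tendsto_ae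
  obtain ⟨d, hd, ψ, hψ, hlim⟩ := (isCompact_univ_pi fun _ : Fin 3 => isCompact_Icc
    (a := (0 : ℝ)) (b := 1)).tendsto_subseq (x := fun n => ell a (t (φ n)))
    (fun n i _ => ⟨(h.ell_pos _ i).le, h.ell_le_one _ i⟩)
  have hsub : Tendsto (fun n => φ (ψ n)) atTop atTop :=
    hφ.tendsto_atTop.comp hψ.tendsto_atTop
  set l : Filter ℝ := map (fun n => t (φ (ψ n))) atTop
  have hl : l ≤ atTop := htop.comp hsub
  have hDl : Tendsto (deficit a α) l (𝓝 0) := tendsto_map'_iff.2 (hD0.comp hsub)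
  have hcl : ∀ i, Tendsto (fun t => ell a t i) l (𝓝 (d i)) := fun i =>
    tendsto_map'_iff.2 (tendsto_pi_nhds.1 hlim i)
  have hd0 : ∀ i, 0 ≤ d i := fun i => (hd i (mem_univ i)).1
  have hd1 : ∑ i, d i = 1 := by
    refine tendsto_nhds_unique (tendsto_finsetSum _ fun i _ => hcl i) ?_
    simp only [h.sum_ell]
    exact tendsto_const_nhds
  have hfreq : ∀ᶠ s in l, (|meanRad a s - R| < ε ∧ (∀ i, |ell a s i - c i| < ε) ∧
      |lyap a t₀ α s - lyapLim a t₀ α R c| < ε) ∨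
      (meanRad a s < ε ∧ ∑ i, meanRad a s / qLen a i s ≤ 9 / 4) := by
    by_cases hz : ∃ i, d i = 0
    · obtain ⟨i, hi⟩ := hz
      obtain ⟨h1, h2⟩ := h.degenerate hl hDl hd0 hd1 hcl hi
      filter_upwards [h1.eventually_lt_const hε, h2] with s h3 h4 using Or.inr ⟨h3, h4⟩
    · push Not at hz
      have hdp : ∀ i, 0 < d i := fun i => (hd0 i).lt_of_ne' (hz i)
      have hael : ∀ᵐ p ∂sph, Tendsto (fun t => densTail a t p) l (𝓝 (α p)) := by
        filter_upwards [hae] with p hp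
        exact tendsto_map'_iff.2 (hp.comp hψ.tendsto_atTop)
      obtain ⟨h1, h2⟩ := h.nondegenerate hl hDl hdp hd1 hcl hael hR0 hR
      have h3 := h.tendsto_lyap hl hDl hdp hd1 hcl hR0 h2
      obtain rfl := hcu d hdp hd1 h1
      filter_upwards [Metric.tendsto_nhds.1 h2 ε hε, Metric.tendsto_nhds.1 h3 ε hε,
        eventually_all.2 fun i => Metric.tendsto_nhds.1 (hcl i) ε hε] with s e1 e2 e3
      exact Or.inl ⟨e1, e3, e2⟩
  obtain ⟨n, hn⟩ := (eventually_map.1 hfreq).exists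
  rcases hn with h1 | h1
  · exact absurd h1.2.2 (not_lt.2 ((hfar _).1 h1.1 h1.2.1))
  · exact absurd h1.2 (not_le.2 ((hfar _).2 h1.1))

end TailLimit

end BianchiI

namespace BianchiI

open Bianchi

/-! ### Convergence from an approximate Lyapunov function -/

lemma sub_le_sub_of_deriv_le {f g f' g' : ℝ → ℝ} {u v : ℝ} (huv : u ≤ v)
    (hf : ∀ r ∈ Icc u v, HasDerivAt f (f' r) r) (hg : ∀ r ∈ Icc u v, HasDerivAt g (g' r) r)
    (h : ∀ r ∈ Icc u v, f' r ≤ g' r) : f v - f u ≤ g v - g u := by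
  have hm : MonotoneOn (g - f) (Icc u v) := by
    refine monotoneOn_of_deriv_nonneg (convex_Icc u v)
      (fun r hr => ((hg r hr).sub (hf r hr)).continuousAt.continuousWithinAt)
      (fun r hr => ((hg r (interior_subset hr)).sub
        (hf r (interior_subset hr))).differentiableAt.differentiableWithinAt) fun r hr => ?_
    rw [((hg r (interior_subset hr)).sub (hf r (interior_subset hr))).deriv]
    exact sub_nonneg.2 (h r (interior_subset hr))
  have := hm (left_mem_Icc.2 huv) (right_mem_Icc.2 huv) huv
  simp only [Pi.sub_apply] at this
  linarith

/-- A clock `s`, an approximately decreasing function `x` with rate `D` and a bounded function `y`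
with rate `E`, which grows while `D` is small unless the alternative `P` holds. -/
structure Clocked (t₀ : ℝ) (s x y D E : ℝ → ℝ) (F : ℝ) (P : ℝ → ℝ → Prop) : Prop where
  rate : ∃ w : ℝ → ℝ, ∀ t > t₀, 0 < w t ∧ HasDerivAt s (w t) t ∧
    HasDerivAt x (-(D t * w t)) t ∧ HasDerivAt y (E t * w t) t
  top : Tendsto s atTop atTop
  bound : ∃ C, ∀ t > t₀, |y t| ≤ C
  lower : ∀ t > t₀, -35 ≤ E t
  decr : ∀ δ > 0, ∀ᶠ t in atTop, -δ < D t
  sublinear : ∀ η > 0, ∃ C, ∀ᶠ t in atTop, -(η * s t) - C ≤ x t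
  dichotomy : ∀ ε > 0, ∃ δ > 0, ∀ᶠ t in atTop, |D t| < δ → P ε t ∨ 1 / 4 ≤ E t
  near : ∀ ε t, P ε t → |x t - F| < ε

namespace Clocked

variable {t₀ : ℝ} {s x y D E : ℝ → ℝ} {F : ℝ} {P : ℝ → ℝ → Prop}

lemma continuousOn_clock (h : Clocked t₀ s x y D E F P) : ContinuousOn s (Ioi t₀) := by
  obtain ⟨w, hw⟩ := h.rate
  exact fun t ht => (hw t ht).2.1.continuousAt.continuousWithinAt

lemma clock_mono (h : Clocked t₀ s x y D E F P) {u v : ℝ} (hu : t₀ < u) (huv : u ≤ v) :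
    s u ≤ s v := by
  obtain ⟨w, hw⟩ := h.rate
  have := sub_le_sub_of_deriv_le (f := fun _ => (0 : ℝ)) (f' := fun _ => 0) huv
    (fun r _ => hasDerivAt_const r 0)
    (fun r hr => (hw r (hu.trans_le hr.1)).2.1) fun r hr => (hw r (hu.trans_le hr.1)).1.le
  linarith

lemma exists_later (h : Clocked t₀ s x y D E F P) {u m : ℝ} (hu : t₀ < u) (hm : 0 ≤ m) :
    ∃ v ≥ u, s v = s u + m := by
  obtain ⟨v, hv, hvu⟩ := ((h.top.eventually_ge_atTop (s u + m)).and (eventually_ge_atTop u)).exists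
  obtain ⟨r, hr, e⟩ := intermediate_value_Icc hvu (h.continuousOn_clock.mono fun r hr =>
    hu.trans_le hr.1) (⟨by linarith, hv⟩ : s u + m ∈ Icc (s u) (s v))
  exact ⟨r, hr.1, e⟩

lemma exists_earlier (h : Clocked t₀ s x y D E F P) {u v m : ℝ} (hu : t₀ < u) (huv : u ≤ v)
    (hm : 0 ≤ m) (hs : s u + m ≤ s v) : ∃ r, u ≤ r ∧ r ≤ v ∧ s r + m = s v := by
  obtain ⟨r, hr, e⟩ := intermediate_value_Icc huv (h.continuousOn_clock.mono fun r hr =>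
    hu.trans_le hr.1) (⟨by linarith, by linarith⟩ : s v - m ∈ Icc (s u) (s v))
  exact ⟨r, hr.1, hr.2, by linarith⟩

lemma sub_le (h : Clocked t₀ s x y D E F P) {δ u v : ℝ} (hu : t₀ < u) (huv : u ≤ v)
    (hD : ∀ r ∈ Icc u v, -δ ≤ D r) : x v - x u ≤ δ * (s v - s u) := by
  obtain ⟨w, hw⟩ := h.rate
  have := sub_le_sub_of_deriv_le huv (fun r hr => (hw r (hu.trans_le hr.1)).2.2.1)
    (fun r hr => (hw r (hu.trans_le hr.1)).2.1.const_mul δ) fun r hr => by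
      have := mul_le_mul_of_nonneg_right (hD r hr) (hw r (hu.trans_le hr.1)).1.le
      linarith
  linarith

/-- In windows of a fixed length, either `x` drops by a definite amount or `P` occurs. -/
lemma window (h : Clocked t₀ s x y D E F P) : ∃ M > 0, ∀ ε > 0, ∃ μ > 0, μ ≤ ε ∧
    ∀ᶠ u in atTop, ∀ v ≥ u, s v = s u + M → x u - x v < μ → ∃ r ∈ Icc u v, P ε r := by
  obtain ⟨C, hC⟩ := h.bound
  obtain ⟨w, hw⟩ := h.rate
  have hC0 : 0 ≤ C := (abs_nonneg _).trans (hC (t₀ + 1) (lt_add_one _))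
  -- As long as `P` fails, `y - (36/δ) x` grows at rate at least `1/8` in the clock, hence by at
  -- least `2C + 2` over the window. But `y` changes by at most `2C`, and a drop of `x` below `δ/36`
  -- contributes at most 1.
  refine ⟨16 * C + 16, by positivity, fun ε hε => ?_⟩
  obtain ⟨δ, hδ, hcl⟩ := h.dichotomy ε hε
  refine ⟨min ε (δ / 36), by positivity, min_le_left _ _, ?_⟩
  have hδ' : 0 < δ / 288 := by positivity
  obtain ⟨T, hT⟩ := eventually_atTop.1 (hcl.and ((h.decr _ hδ').and (eventually_gt_atTop t₀)))
  filter_upwards [eventually_ge_atTop T] with u hu v huv hs hx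
  by_contra! hcon
  have hut : t₀ < u := (hT u hu).2.2
  have key := sub_le_sub_of_deriv_le huv
    (fun r hr => (hw r (hut.trans_le hr.1)).2.1.const_mul (1 / 8))
    (fun r hr => (hw r (hut.trans_le hr.1)).2.2.2.sub
      ((hw r (hut.trans_le hr.1)).2.2.1.const_mul (36 / δ))) fun r hr => by
        have hw0 := (hw r (hut.trans_le hr.1)).1
        obtain ⟨h1, h2, h3⟩ := hT r (hu.trans hr.1)
        have hge : 1 / 8 ≤ E r + 36 / δ * D r := by
          -- If `|D| < δ`, then `E ≥ 1/4` and the bound `D > -δ/288` costs only `1/8`. Otherwise `D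
          -- ≥ δ`, and 36 outweighs the worst value `-35` of `E`.
          by_cases hd : |D r| < δ
          · rcases h1 hd with hp | he
            · exact absurd hp (hcon r hr)
            · have : 36 / δ * -(δ / 288) ≤ 36 / δ * D r :=
                mul_le_mul_of_nonneg_left h2.le (by positivity)
              have e : 36 / δ * -(δ / 288) = -(1 / 8) := by field_simp; norm_num
              linarith
          · have hd2 : δ ≤ D r := by
              rcases le_abs.1 (not_lt.1 hd) with h4 | h4
              · exact h4
              · linarith
            have : 36 / δ * δ ≤ 36 / δ * D r := mul_le_mul_of_nonneg_left hd2 (by positivity)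
            rw [div_mul_cancel₀ _ hδ.ne'] at this
            linarith [h.lower r h3]
        nlinarith
  simp only [Pi.sub_apply] at key
  have y1 := abs_le.1 (hC u hut)
  have y2 := abs_le.1 (hC v (hut.trans_le huv))
  have hx2 : 36 / δ * (x u - x v) ≤ 36 / δ * (δ / 36) :=
    mul_le_mul_of_nonneg_left (hx.le.trans (min_le_right _ _)) (by positivity)
  have e : 36 / δ * (δ / 36) = 1 := by field_simp
  rw [hs] at key
  linarith

/-- Iterating the hypothesis gives a decrease of `x` with slope `μ / M` in the clock, twice the
slope `μ / (2M)` at which the sublinear lower bound is invoked. -/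
lemma no_linear_drop (h : Clocked t₀ s x y D E F P) {M μ : ℝ} (hM : 0 < M) (hμ : 0 < μ) :
    ∀ᶠ T in atTop, ∀ Q : ℝ → Prop,
      (∀ t ≥ T, Q t → ∃ t' ≥ t, s t' = s t + M ∧ x t' ≤ x t - μ ∧ Q t') → ∀ t ≥ T, ¬Q t := by
  obtain ⟨C, hC⟩ := h.sublinear (μ / (2 * M)) (by positivity)
  obtain ⟨T₁, hT₁⟩ := eventually_atTop.1 hC
  filter_upwards [eventually_ge_atTop T₁] with T hT Q hQ t ht hQt
  have hn : ∀ n : ℕ, ∃ t' ≥ T, Q t' ∧ s t' = s t + n * M ∧ x t' ≤ x t - n * μ := by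
    intro n
    induction n with
    | zero => exact ⟨t, ht, hQt, by simp, by simp⟩
    | succ n ih =>
      obtain ⟨r, h1, h2, h3, h4⟩ := ih
      obtain ⟨r', k1, k2, k3, k4⟩ := hQ r h1 h2
      refine ⟨r', h1.le.trans k1, k4, ?_, ?_⟩ <;> push_cast <;> linarith
  obtain ⟨n, hn2⟩ := exists_nat_gt ((x t + C + μ / (2 * M) * s t) / (μ / 2))
  obtain ⟨r, h1, -, h3, h4⟩ := hn n
  have h5 := hT₁ r (hT.trans h1)
  rw [h3] at h5
  rw [div_lt_iff₀ (by positivity)] at hn2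
  have e : μ / (2 * M) * (s t + n * M) = μ / (2 * M) * s t + n * (μ / 2) := by field_simp
  linarith

/-- Each window contains a drop by `μ` or a visit to `P`, where `x` is within `ε` of `F`. Drops
cannot go on forever by `no_linear_drop`, and within one window `x` rises by at most `ε` because `D`
is almost nonnegative. -/
theorem tendsto_lyapunov (h : Clocked t₀ s x y D E F P) : Tendsto x atTop (𝓝 F) := by
  obtain ⟨M, hM, hW⟩ := h.window
  have main : ∀ ε > 0, ∀ᶠ t in atTop, F - 3 * ε ≤ x t ∧ x t ≤ F + 4 * ε := by
    intro ε hε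
    obtain ⟨μ, hμ, hμε, hW⟩ := hW ε hε
    have hδ : 0 < ε / M := by positivity
    obtain ⟨T, hT⟩ := eventually_atTop.1 ((hW.and (h.decr _ hδ)).and
      (eventually_gt_atTop t₀))
    obtain ⟨T', hT', hTT⟩ := ((h.no_linear_drop hM hμ).and (eventually_ge_atTop T)).exists
    have hup : ∀ u ≥ T, ∀ v ≥ u, s v ≤ s u + M → x v ≤ x u + ε := by
      intro u hu v huv hs
      have := h.sub_le (hT u hu).2 huv fun r hr => (hT r (hu.trans hr.1)).1.2.le
      have h2 : ε / M * (s v - s u) ≤ ε / M * M :=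
        mul_le_mul_of_nonneg_left (by linarith) hδ.le
      rw [div_mul_cancel₀ _ hM.ne'] at h2
      linarith
    have hsmall : ∀ u ≥ T, ∀ v ≥ u, s v = s u + M → x u - x v < μ →
        F - 2 * ε ≤ x u ∧ x u ≤ F + 3 * ε := by
      intro u hu v huv hs hx
      obtain ⟨r, hr, hP⟩ := (hT u hu).1.1 v huv hs hx
      have h1 := abs_lt.1 (h.near _ _ hP)
      have h2 := hup u hu r hr.1 ((h.clock_mono ((hT u hu).2.trans_le hr.1) hr.2).trans hs.le)
      have h3 := hup r (hu.trans hr.1) v hr.2 (by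
        rw [hs]; linarith [h.clock_mono (hT u hu).2 hr.1])
      constructor <;> linarith
    -- Starting below `F - 3ε` every window is a drop, and its end lies below `F - 3ε` again: an
    -- endless linear decrease.
    have hlow : ∀ t ≥ T', F - 3 * ε ≤ x t := by
      by_contra! hcon
      obtain ⟨t, ht, hxt⟩ := hcon
      refine hT' (fun t => x t < F - 3 * ε) (fun t ht hx => ?_) t ht hxt
      obtain ⟨v, hv, hs⟩ := h.exists_later (hT t (hTT.trans ht)).2 hM.le
      have : μ ≤ x t - x v := by
        by_contra! h1
        have := (hsmall t (hTT.trans ht) v hv hs h1).1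
        linarith
      exact ⟨v, hv, hs, by linarith, by linarith⟩
    obtain ⟨t₁, ht₁, hx₁⟩ : ∃ t₁ ≥ T', x t₁ ≤ F + 3 * ε := by
      by_contra! hcon
      refine hT' (fun t => T' ≤ t) (fun t ht _ => ?_) T' le_rfl le_rfl
      obtain ⟨v, hv, hs⟩ := h.exists_later (hT t (hTT.trans ht)).2 hM.le
      have : μ ≤ x t - x v := by
        by_contra! h1
        have h2 := (hsmall t (hTT.trans ht) v hv hs h1).2
        have h3 := hcon t ht
        linarith
      exact ⟨v, hv, hs, by linarith, ht.le.trans hv⟩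
    have hT1 : t₀ < t₁ := (hT t₁ (hTT.trans ht₁)).2
    -- Induction on the number of windows since `t₁`. The last window either drops, inheriting the
    -- bound from its start, or visits `P`, which gives the bound afresh.
    have hind : ∀ n : ℕ, ∀ t ≥ t₁, s t ≤ s t₁ + n * M → x t ≤ F + 4 * ε := by
      intro n
      induction n with
      | zero =>
        intro t ht hs
        have := hup t₁ (hTT.trans ht₁) t ht (by simp at hs; linarith)
        linarith
      | succ n ih =>
        intro t ht hs
        by_cases hc : s t ≤ s t₁ + M
        · have := hup t₁ (hTT.trans ht₁) t ht hc
          linarith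
        · obtain ⟨r, hr1, hr2, hr3⟩ := h.exists_earlier hT1 ht hM.le (not_le.1 hc).le
          have hrT : T ≤ r := (hTT.trans ht₁).trans hr1
          have h1 := ih r hr1 (by push_cast at hs; linarith)
          by_cases h2 : x r - x t < μ
          · have h3 := (hsmall r hrT t hr2 hr3.symm h2).2
            have h4 := hup r hrT t hr2 hr3.symm.le
            linarith
          · linarith
    filter_upwards [eventually_ge_atTop t₁] with t ht
    refine ⟨hlow t (ht₁.le.trans ht), ?_⟩
    obtain ⟨n, hn⟩ := exists_nat_gt ((s t - s t₁) / M)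
    rw [div_lt_iff₀ hM] at hn
    exact hind n t ht (by linarith)
  rw [Metric.tendsto_nhds]
  intro ε hε
  filter_upwards [main (ε / 5) (by positivity)] with t ht
  rw [Real.dist_eq, abs_lt]
  constructor <;> linarith [ht.1, ht.2]

/-- Once `x` converges, no late window can drop by `μ`, so each one visits `P`. -/
theorem exists_near (h : Clocked t₀ s x y D E F P) : ∃ M > 0, ∀ ε > 0, ∀ᶠ u in atTop,
    ∀ v ≥ u, s v = s u + M → ∃ r ∈ Icc u v, P ε r := by
  obtain ⟨M, hM, hW⟩ := h.window
  refine ⟨M, hM, fun ε hε => ?_⟩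
  obtain ⟨μ, hμ, -, hW⟩ := hW ε hε
  have hx := Metric.tendsto_atTop.1 h.tendsto_lyapunov (μ / 2) (by positivity)
  obtain ⟨T, hT⟩ := hx
  filter_upwards [hW, eventually_ge_atTop T] with u h1 h2 v hv hs
  have e1 := abs_lt.1 (hT u h2)
  have e2 := abs_lt.1 (hT v (h2.trans hv))
  exact h1 v hv hs (by linarith)

/-- The rate `D` is small somewhere in every short window. -/
theorem exists_small (h : Clocked t₀ s x y D E F P) {κ δ : ℝ} (hκ : 0 < κ) (hδ : 0 < δ) :
    ∀ᶠ u in atTop, ∀ v ≥ u, s v = s u + κ → ∃ r ∈ Icc u v, |D r| < δ := by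
  have hx := Metric.tendsto_atTop.1 h.tendsto_lyapunov (δ * κ / 2) (by positivity)
  obtain ⟨T, hT⟩ := hx
  obtain ⟨T₁, hT₁⟩ := eventually_atTop.1 ((h.decr _ hδ).and (eventually_gt_atTop t₀))
  filter_upwards [eventually_ge_atTop T, eventually_ge_atTop T₁] with u h1 h2 v hv hs
  by_contra! hcon
  have hu := (hT₁ u h2).2
  have hD : ∀ r ∈ Icc u v, -(-δ) ≤ D r := fun r hr => by
    rcases le_abs.1 (hcon r hr) with h3 | h3
    · linarith
    · linarith [(hT₁ r (h2.trans hr.1)).1]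
  have h3 := h.sub_le hu hv hD
  have e1 := abs_lt.1 (hT u h1)
  have e2 := abs_lt.1 (hT v (h1.trans hv))
  rw [hs, add_sub_cancel_left] at h3
  linarith

end Clocked

end BianchiI

namespace BianchiI

open Bianchi

/-! ### Isotropization. -/

namespace TailLimit

variable {a : Fin 3 → ℝ → ℝ} {t₀ : ℝ} {α : Space → ℝ} {t : ℝ} {p : Space}

/-- Logarithmic scale of the remaining comoving volume. -/
def clock (a : Fin 3 → ℝ → ℝ) (t : ℝ) : ℝ := -(1 / 3 * Real.log (volTail a t))

/-- The state at time `t` is `ε`-close to the round state with mean radius `R` and shape `c`. -/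
def IsNear (a : Fin 3 → ℝ → ℝ) (t₀ : ℝ) (α : Space → ℝ) (R : ℝ) (c : Fin 3 → ℝ) (F ε t : ℝ) : Prop :=
  |Real.log (meanRad a t) - Real.log R| < ε ∧ (∀ i, |Real.log (ell a t i) - Real.log (c i)| < ε) ∧
    |lyap a t₀ α t - F| < ε

lemma classification_log (h : TailLimit a t₀ α) {R : ℝ} (hR0 : 0 < R)
    (hR : 4 * Real.pi * R ^ 2 = ∫ p, α p ∂sph) :
    ∃ (c : Fin 3 → ℝ) (F : ℝ), ∀ ε > 0, ∃ δ > 0, ∀ᶠ t in atTop,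
      |deficit a α t| < δ → IsNear a t₀ α R c F ε t ∨
        (meanRad a t < ε ∧ ∑ i, meanRad a t / qLen a i t ≤ 9 / 4) := by
  obtain ⟨c, F, hc, H⟩ := h.classification hR0 hR
  refine ⟨c, F, fun ε hε => ?_⟩
  obtain ⟨e₁, he₁, h1⟩ := Metric.continuousAt_iff.1 (Real.continuousAt_log hR0.ne') ε hε
  choose e₂ he₂ h2 using fun i => Metric.continuousAt_iff.1 (Real.continuousAt_log (hc i).ne') ε hε
  set e := min ε (min e₁ (min (e₂ 0) (min (e₂ 1) (e₂ 2))))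
  have he : 0 < e := by
    have := he₂ 0; have := he₂ 1; have := he₂ 2
    positivity
  have hle : e ≤ ε ∧ e ≤ e₁ ∧ ∀ i, e ≤ e₂ i := by
    refine ⟨min_le_left _ _, (min_le_right _ _).trans (min_le_left _ _), fun i => ?_⟩
    refine ((min_le_right _ _).trans (min_le_right _ _)).trans ?_
    fin_cases i <;> simp
  obtain ⟨δ, hδ, t₁, ht₁⟩ := H e he
  refine ⟨δ, hδ, ?_⟩
  filter_upwards [eventually_gt_atTop t₁] with t ht hD
  rcases ht₁ t ht hD with ⟨k1, k2, k3⟩ | ⟨k1, k2⟩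
  · exact Or.inl ⟨h1 (k1.trans_le hle.2.1), fun i => h2 i ((k2 i).trans_le (hle.2.2 i)),
      k3.trans_le hle.1⟩
  · exact Or.inr ⟨k1.trans_le hle.1, k2⟩

/-- The clock rate is `1 / meanRad`. The constants come from `1 - 36 = -35`, by
`meanRad_div_le_const`, and from `1 - (1/3)(9/4) = 1/4` in the degenerate case. -/
lemma clocked (h : TailLimit a t₀ α) {R F : ℝ} {c : Fin 3 → ℝ}
    (H : ∀ ε > 0, ∃ δ > 0, ∀ᶠ t in atTop,
      |deficit a α t| < δ → IsNear a t₀ α R c F ε t ∨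
        (meanRad a t < ε ∧ ∑ i, meanRad a t / qLen a i t ≤ 9 / 4)) :
    Clocked t₀ (clock a) (lyap a t₀ α) (boxLog a) (deficit a α)
      (fun t => 1 - 1 / 3 * ∑ i, meanRad a t / qLen a i t) F (IsNear a t₀ α R c F) where
  rate := by
    refine ⟨fun t => (meanRad a t)⁻¹, fun t ht => ⟨inv_pos.2 (h.meanRad_pos ht), ?_, ?_, ?_⟩⟩
    · refine ((h.hasDerivAt_log_volTail ht).const_mul (1 / 3)).neg.congr_deriv ?_
      ring
    · exact h.hasDerivAt_lyap ht
    · exact h.hasDerivAt_boxLog ht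
  top := by
    have h1 : Tendsto (fun t => Real.log (volTail a t)) atTop atBot := by
      refine Real.tendsto_log_nhdsGT_zero.comp (tendsto_nhdsWithin_iff.2 ⟨h.tendsto_volTail, ?_⟩)
      filter_upwards [eventually_gt_atTop t₀] with t ht using h.volTail_pos ht
    exact tendsto_neg_atBot_atTop.comp (h1.const_mul_atBot (by norm_num))
  bound := h.abs_boxLog_le
  lower t ht := by
    have : ∑ i, meanRad a t / qLen a i t ≤ ∑ _i : Fin 3, (36 : ℝ) :=
      Finset.sum_le_sum fun i _ => h.meanRad_div_le_const ht i
    simp at this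
    linarith
  decr δ hδ := h.eventually_neg_le_deficit hδ
  sublinear η hη := by
    obtain ⟨C, hC⟩ := h.lyap_ge (η := η / 3) (by positivity)
    refine ⟨C, ?_⟩
    filter_upwards [eventually_ge_atTop (t₀ + 1)] with t ht
    have := hC t ht
    rw [clock]
    linarith
  dichotomy ε hε := by
    obtain ⟨δ, hδ, h1⟩ := H ε hε
    refine ⟨δ, hδ, h1.mono fun t ht hd => (ht hd).imp_right fun h2 => ?_⟩
    linarith [h2.2]
  near ε t h1 := h1.2.2

lemma log_vol3 (h : TailLimit a t₀ α) (t : ℝ) :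
    Real.log (vol3 a t) = ∑ i, Real.log (a i t) :=
  Real.log_prod fun i _ => (h.scale.pos i t).ne'

/-- Since `vol3` is nondecreasing and the area nearly constant, this identity lets the logarithm of
the mean radius fall by little more than three times the elapsed clock time. -/
lemma log_meanRad (h : TailLimit a t₀ α) (ht : t₀ < t) : Real.log (meanRad a t) =
    Real.log 3 + Real.log (vol3 a t) - 3 * clock a t - Real.log (areaTail a t) := by
  have h1 := h.vol3_pos' t
  have h2 := h.volTail_pos ht
  have h3 := h.areaTail_pos ht
  rw [meanRad, Real.log_div (by positivity) h3.ne', Real.log_mul (by positivity) h2.ne',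
    Real.log_mul (by norm_num) h1.ne', clock]
  ring

lemma log_ell (h : TailLimit a t₀ α) (t : ℝ) (i : Fin 3) :
    Real.log (ell a t i) = -(2 * Real.log (a i t)) - Real.log (isqSum a t) := by
  rw [ell, Real.log_div (isq_pos h.scale t i).ne' (h.isqSum_pos t).ne', isq, Real.log_inv,
    Real.log_pow]
  push_cast
  ring

lemma log_mono (h : TailLimit a t₀ α) (i : Fin 3) {t' : ℝ} (ht : t ≤ t') :
    Real.log (a i t) ≤ Real.log (a i t') := Real.log_le_log (h.scale.pos i t) (h.mono i ht)

/-- Late times lie between nearly round states that are close to each other. -/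
lemma exists_isNear (h : TailLimit a t₀ α) {R F : ℝ} {c : Fin 3 → ℝ}
    (H : ∀ ε > 0, ∃ δ > 0, ∀ᶠ t in atTop,
      |deficit a α t| < δ → IsNear a t₀ α R c F ε t ∨
        (meanRad a t < ε ∧ ∑ i, meanRad a t / qLen a i t ≤ 9 / 4)) {ε : ℝ} (hε : 0 < ε) (T : ℝ) :
    ∀ᶠ t in atTop, ∃ t₁ ≥ T, ∃ t₂, t₁ ≤ t ∧ t ≤ t₂ ∧ clock a t₂ ≤ clock a t₁ + 2 * ε ∧
      IsNear a t₀ α R c F ε t₁ ∧ IsNear a t₀ α R c F ε t₂ := by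
  have hC := h.clocked H
  obtain ⟨M, hM, hnear⟩ := hC.exists_near
  have hL := h.lim_pos
  have hlogA := h.tendsto_areaTail.log hL.ne'
  obtain ⟨T₁, hT₁⟩ := eventually_atTop.1 (((hnear 1 one_pos).and (eventually_gt_atTop t₀)).and
    (Metric.tendsto_nhds.1 hlogA 1 one_pos))
  -- A near-round state, with logarithmic radius above `log R - 1`, occurs within clock time `M`
  -- before. Since then the logarithm has fallen by at most `3M + 2`, so radii below this threshold,
  -- hence the degenerate alternative, are excluded.
  set ε₀ := min ε (Real.exp (Real.log R - 3 * M - 3))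
  have hε₀ : 0 < ε₀ := lt_min hε (Real.exp_pos _)
  obtain ⟨δ, hδ, hcl⟩ := H ε₀ hε₀
  have hT1 := (hT₁ T₁ le_rfl).1.2
  have hgood : ∀ᶠ r in atTop, |deficit a α r| < δ → IsNear a t₀ α R c F ε r := by
    filter_upwards [hcl, hC.top.eventually_ge_atTop (clock a T₁ + M), eventually_ge_atTop T₁]
      with r h1 h2 h3 hd
    rcases h1 hd with hn | ⟨hs, -⟩
    · exact ⟨hn.1.trans_le (min_le_left _ _), fun i => (hn.2.1 i).trans_le (min_le_left _ _),
        hn.2.2.trans_le (min_le_left _ _)⟩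
    · exfalso
      obtain ⟨u, hu1, hu2, hu3⟩ := hC.exists_earlier hT1 h3 hM.le h2
      obtain ⟨v, hv, hP⟩ := (hT₁ u hu1).1.1 r hu2 hu3.symm
      have hvT := hu1.trans hv.1
      have k1 := abs_lt.1 hP.1
      have k2 := h.log_meanRad ((hT₁ v hvT).1.2)
      have k3 := h.log_meanRad ((hT₁ r h3).1.2)
      have k4 := abs_lt.1 (hT₁ v hvT).2
      have k5 := abs_lt.1 (hT₁ r h3).2
      have k6 : Real.log (vol3 a v) ≤ Real.log (vol3 a r) :=
        Real.log_le_log (h.vol3_pos' v) (vol3_mono h.scale h.mono hv.2)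
      have k7 := hC.clock_mono (hT₁ u hu1).1.2 hv.1
      have k8 := (Real.log_lt_log (h.meanRad_pos (hT₁ r h3).1.2) hs).trans_le
        (Real.log_le_log hε₀ (min_le_right _ _))
      rw [Real.log_exp] at k8
      linarith
  obtain ⟨T₂, hT₂⟩ := eventually_atTop.1 (((hC.exists_small hε hδ).and hgood).and
    ((eventually_ge_atTop T).and (eventually_ge_atTop T₁)))
  have hT2 : t₀ < T₂ := hT1.trans_le (hT₂ T₂ le_rfl).2.2
  filter_upwards [hC.top.eventually_ge_atTop (clock a T₂ + ε), eventually_ge_atTop T₂] with t h1 h2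
  obtain ⟨u, hu1, hu2, hu3⟩ := hC.exists_earlier hT2 h2 hε.le h1
  obtain ⟨v, hv1, hv2⟩ := hC.exists_later (hT2.trans_le h2) hε.le
  obtain ⟨r₁, hr₁, hd₁⟩ := (hT₂ u hu1).1.1 t hu2 hu3.symm
  obtain ⟨r₂, hr₂, hd₂⟩ := (hT₂ t h2).1.1 v hv1 hv2
  refine ⟨r₁, (hT₂ u hu1).2.1.trans hr₁.1, r₂, hr₁.2, hr₂.1, ?_,
    (hT₂ r₁ (hu1.trans hr₁.1)).1.2 hd₁, (hT₂ r₂ (h2.trans hr₂.1)).1.2 hd₂⟩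
  have e1 := hC.clock_mono (hT2.trans_le (h2.trans hr₂.1)) hr₂.2
  have e2 := hC.clock_mono (hT2.trans_le hu1) hr₁.1
  linarith

/-- The light cones become round and the expansion isotropic. -/
theorem isotropization (h : TailLimit a t₀ α) {R : ℝ} (hR0 : 0 < R)
    (hR : 4 * Real.pi * R ^ 2 = ∫ p, α p ∂sph) :
    Tendsto (meanRad a) atTop (𝓝 R) ∧
      ∀ i j, ∃ ρ > 0, Tendsto (fun t => a i t / a j t) atTop (𝓝 ρ) := by
  obtain ⟨c, F, H⟩ := h.classification_log hR0 hR
  have hC := h.clocked H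
  have hlogA := h.tendsto_areaTail.log h.lim_pos.ne'
  have main : ∀ ε > 0, ∀ᶠ t in atTop, |Real.log (meanRad a t) - Real.log R| < 20 * ε ∧
      ∀ i j, |Real.log (a i t) - Real.log (a j t) -
        1 / 2 * (Real.log (c j) - Real.log (c i))| < 20 * ε := by
    intro ε hε
    obtain ⟨T, hT⟩ := eventually_atTop.1 ((Metric.tendsto_nhds.1 hlogA ε hε).and
      (eventually_gt_atTop t₀))
    filter_upwards [h.exists_isNear H hε T] with t ⟨t₁, ht₁, t₂, h1, h2, hs, n1, n2⟩
    have l0 := (hT t₁ ht₁).2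
    have m1 := h.log_meanRad l0
    have m := h.log_meanRad (l0.trans_le h1)
    have m2 := h.log_meanRad (l0.trans_le (h1.trans h2))
    have A1 := abs_lt.1 (hT t₁ ht₁).1
    have A := abs_lt.1 (hT t (ht₁.le.trans h1)).1
    have A2 := abs_lt.1 (hT t₂ (ht₁.le.trans (h1.trans h2))).1
    have s1 := hC.clock_mono l0 h1
    have s2 := hC.clock_mono (l0.trans_le h1) h2
    have r1 := abs_lt.1 n1.1
    have r2 := abs_lt.1 n2.1
    have v1 := h.log_vol3 t₁
    have v := h.log_vol3 t
    have v2 := h.log_vol3 t₂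
    rw [Fin.sum_univ_three] at v1 v v2
    have b := fun i => h.log_mono i h1
    have b' := fun i => h.log_mono i h2
    have b0 := b 0; have b1 := b 1; have b2 := b 2
    have b0' := b' 0; have b1' := b' 1; have b2' := b' 2
    -- Between the two near-round times `log vol3` grows by at most `10ε`: `2ε` from the radius,
    -- `6ε` from the clock, `2ε` from the area. Each `log (a i)` is nondecreasing, so none moves by
    -- more than the sum.
    have hup : ∀ i, Real.log (a i t) ≤ Real.log (a i t₁) + 10 * ε := by
      intro i
      fin_cases i <;> simp <;> linarith
    refine ⟨by rw [abs_lt]; constructor <;> linarith, fun i j => ?_⟩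
    have c1 := abs_lt.1 (n1.2.1 i)
    have c2 := abs_lt.1 (n1.2.1 j)
    rw [h.log_ell] at c1 c2
    have := hup i; have := hup j; have := b i; have := b j
    rw [abs_lt]
    constructor <;> linarith
  constructor
  · have : Tendsto (fun t => Real.log (meanRad a t)) atTop (𝓝 (Real.log R)) := by
      rw [Metric.tendsto_nhds]
      intro ε hε
      filter_upwards [main (ε / 20) (by positivity)] with t ht
      rw [Real.dist_eq]
      linarith [ht.1]
    have h2 := this.rexp
    rw [Real.exp_log hR0] at h2
    refine h2.congr' ?_
    filter_upwards [eventually_gt_atTop t₀] with t ht using Real.exp_log (h.meanRad_pos ht)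
  · intro i j
    refine ⟨Real.exp (1 / 2 * (Real.log (c j) - Real.log (c i))), Real.exp_pos _, ?_⟩
    have : Tendsto (fun t => Real.log (a i t) - Real.log (a j t)) atTop
        (𝓝 (1 / 2 * (Real.log (c j) - Real.log (c i)))) := by
      rw [Metric.tendsto_nhds]
      intro ε hε
      filter_upwards [main (ε / 20) (by positivity)] with t ht
      rw [Real.dist_eq]
      linarith [ht.2 i j]
    refine this.rexp.congr fun t => ?_
    rw [Real.exp_sub, Real.exp_log (h.scale.pos i t), Real.exp_log (h.scale.pos j t)]

end TailLimit

end BianchiI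

namespace BianchiI

open Bianchi

/-! ### Light cones at finite tip time -/

/-- Comoving velocity along the light rays for arbitrary scale factors. -/
def vel (a : Fin 3 → ℝ → ℝ) (r : ℝ) (p : Space) : Space :=
  WithLp.toLp 2 fun j => p j / a j r ^ 2 / fq a r p

/-- Comoving position on the light cone with tip time `T`. -/
def ray (a : Fin 3 → ℝ → ℝ) (T t : ℝ) (p : Space) : Space :=
  WithLp.toLp 2 fun j => ∫ r in t..T, vel a r p j

/-- Coordinate functions of space. -/
def coordL (j : Fin 3) : Space →L[ℝ] ℝ := PiLp.proj 2 (fun _ : Fin 3 => ℝ) j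

@[simp] lemma coordL_apply (j : Fin 3) (e : Space) : coordL j e = e j := rfl

/-- Components of the Hessian of the support function with weights `m`. -/
def shear (m : Fin 3 → ℝ) (p : Space) (j : Fin 3) : Space →L[ℝ] ℝ :=
  m (j + 2) • (p (j + 1) • (p (j + 1) • coordL j - p j • coordL (j + 1))) +
    m (j + 1) • (p (j + 2) • (p (j + 2) • coordL j - p j • coordL (j + 2)))

lemma shear_apply (m : Fin 3 → ℝ) (p : Space) (j : Fin 3) (e : Space) : shear m p j e =
    m (j + 2) * (p (j + 1) * (p (j + 1) * e j - p j * e (j + 1))) +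
      m (j + 1) * (p (j + 2) * (p (j + 2) * e j - p j * e (j + 2))) := by
  simp [shear]

/-- The Hessian of the support function. -/
def shearV (m : Fin 3 → ℝ) (p e : Space) : Space := WithLp.toLp 2 fun j => shear m p j e

section

variable {a : Fin 3 → ℝ → ℝ} {p : Space}

lemma hasFDerivAt_coord (j : Fin 3) (p : Space) : HasFDerivAt (fun p : Space => p j) (coordL j) p :=
  (coordL j).hasFDerivAt

lemma hasFDerivAt_fq {r : ℝ} (ha : ∀ i, 0 < a i r) (hp : p ≠ 0) :
    HasFDerivAt (fq a r) ((fq a r p)⁻¹ • ∑ i, (p i / a i r ^ 2) • coordL i) p := by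
  have h0 := fq_pos ha hp
  have h1 : HasFDerivAt (fun p : Space => ∑ i, (p i / a i r) ^ 2)
      (∑ i, (2 * (p i / a i r ^ 2)) • coordL i) p := by
    refine HasFDerivAt.fun_sum fun i _ => ?_
    refine (((hasFDerivAt_coord i p).mul_const (a i r)⁻¹).pow 2).congr_fderiv ?_
    have := (ha i).ne'
    ext e
    simp
    field_simp
  refine (h1.sqrt (by rw [← fq_sq]; positivity)).congr_fderiv ?_
  change (1 / (2 * fq a r p)) • _ = _
  ext e
  simp only [Fin.sum_univ_three, _root_.smul_apply, _root_.add_apply,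
    smul_eq_mul]
  field_simp

/-- The velocity is the gradient of `fq` in the momentum, so its derivative is a Hessian.
Homogeneity of `fq` puts `p` in its kernel, which is why only the minors `p_i e_j - p_j e_i` enter
`shear`. -/
lemma hasFDerivAt_vel {r : ℝ} (ha : ∀ i, 0 < a i r) (hp : p ≠ 0) (j : Fin 3) :
    HasFDerivAt (fun p => vel a r p j) (shear (fun k => hk a k r p) p j) p := by
  have h0 := fq_pos ha hp
  refine (((hasFDerivAt_coord j p).mul_const (a j r ^ 2)⁻¹).mul
    ((hasDerivAt_inv h0.ne').comp_hasFDerivAt p (hasFDerivAt_fq ha hp))).congr_fderiv ?_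
  have e2 : fq a r p ^ 2 = (p 0 / a 0 r) ^ 2 + (p 1 / a 1 r) ^ 2 + (p 2 / a 2 r) ^ 2 := by
    rw [fq_sq, Fin.sum_univ_three]
  have a0 := ha 0; have a1 := ha 1; have a2 := ha 2
  have e3 : fq a r p ^ 2 * (a 0 r ^ 2 * a 1 r ^ 2 * a 2 r ^ 2) = p 0 ^ 2 * (a 1 r ^ 2 * a 2 r ^ 2) +
      p 1 ^ 2 * (a 0 r ^ 2 * a 2 r ^ 2) + p 2 ^ 2 * (a 0 r ^ 2 * a 1 r ^ 2) := by
    rw [e2]; field_simp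
  ext e
  rw [shear_apply]
  simp only [hk, Fin.sum_univ_three, _root_.smul_apply,
    _root_.add_apply, smul_eq_mul, coordL_apply, Function.comp_apply]
  generalize fq a r p = f at *
  fin_cases j <;> simp <;> field_simp
  · linear_combination (e 0) * e3
  · linear_combination (e 1) * e3
  · linear_combination (e 2) * e3

lemma continuous_vel (ha : IsScale a) (j : Fin 3) :
    ContinuousOn (fun z : ℝ × Space => vel a z.1 z.2 j) (univ ×ˢ {0}ᶜ) := by
  refine ContinuousOn.div (Continuous.continuousOn ?_) (continuous_fq ha).continuousOn
    fun z hz => (fq_pos (fun i => ha.pos i _) hz.2).ne'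
  refine Continuous.div (by fun_prop) (((ha.cont j).comp continuous_fst).pow 2) fun z =>
    (pow_pos (ha.pos j _) 2).ne'

lemma continuousOn_shear {X : Type*} [TopologicalSpace X] {m : Fin 3 → X → ℝ} {q : X → Space}
    {S : Set X} (hm : ∀ k, ContinuousOn (m k) S) (hq : ContinuousOn q S) (j : Fin 3) :
    ContinuousOn (fun x => shear (fun k => m k x) (q x) j) S := by
  have hc : ∀ i, ContinuousOn (fun x => q x i) S := fun i =>
    (coordL i).continuous.comp_continuousOn hq
  unfold shear
  have h0 := hc j; have h1 := hc (j + 1); have h2 := hc (j + 2)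
  have m1 := hm (j + 1); have m2 := hm (j + 2)
  fun_prop

lemma intervalIntegrable_hk (ha : IsScale a) (k : Fin 3) (hp : p ≠ 0) (t T : ℝ) :
    IntervalIntegrable (fun r => hk a k r p) volume t T :=
  (continuous_hk_left ha k hp).intervalIntegrable _ _

lemma continuousOn_primitive {f : ℝ → Space → ℝ}
    (hf : ContinuousOn (fun z : ℝ × Space => f z.1 z.2) (univ ×ˢ {0}ᶜ)) :
    ContinuousOn (fun z : ℝ × ℝ × Space => ∫ r in z.1..z.2.1, f r z.2.2)
      (univ ×ˢ univ ×ˢ {0}ᶜ) := by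
  have hcont : Continuous fun z : {q : Space // q ≠ 0} × ℝ => f z.2 z.1 :=
    hf.comp_continuous (continuous_snd.prodMk (continuous_subtype_val.comp continuous_fst))
      fun z => ⟨mem_univ _, z.1.2⟩
  have hprim : Continuous fun z : {q : Space // q ≠ 0} × ℝ => ∫ r in (0 : ℝ)..z.2, f r z.1 :=
    intervalIntegral.continuous_parametric_intervalIntegral_of_continuous
      (f := fun (z : {q : Space // q ≠ 0} × ℝ) r => f r z.1)
      (hcont.comp ((continuous_fst.comp continuous_fst).prodMk continuous_snd)) continuous_snd
  have hleft : ∀ q : Space, q ≠ 0 → Continuous fun r => f r q := fun q hq =>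
    hf.comp_continuous (continuous_id.prodMk continuous_const) fun r => ⟨mem_univ _, hq⟩
  rw [continuousOn_iff_continuous_domRestrict]
  have hsub : Continuous fun z : ↥((univ : Set ℝ) ×ˢ (univ : Set ℝ) ×ˢ ({0}ᶜ : Set Space)) =>
      (⟨z.1.2.2, z.2.2.2⟩ : {q : Space // q ≠ 0}) :=
    Continuous.subtype_mk (by fun_prop) _
  refine ((hprim.comp (hsub.prodMk (continuous_fst.comp (continuous_snd.comp
    continuous_subtype_val)))).sub (hprim.comp (hsub.prodMk (continuous_fst.comp
    continuous_subtype_val)))).congr fun z => ?_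
  exact intervalIntegral.integral_interval_sub_left
    ((hleft _ z.2.2.2).intervalIntegrable _ _) ((hleft _ z.2.2.2).intervalIntegrable _ _)

lemma continuousOn_hInt (ha : IsScale a) (k : Fin 3) :
    ContinuousOn (fun z : ℝ × ℝ × Space => hInt a k z.1 z.2.1 z.2.2) (univ ×ˢ univ ×ˢ {0}ᶜ) :=
  continuousOn_primitive (continuousOn_hk ha k)

lemma hasFDerivAt_ray_right (ha : IsScale a) (t T : ℝ) (hp : p ≠ 0) (j : Fin 3) :
    HasFDerivAt (fun p => ∫ r in t..T, vel a r p j) (shear (fun k => hInt a k t T p) p j) p := by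
  have hball : ∀ x ∈ Metric.closedBall p (‖p‖ / 2), x ≠ 0 := by
    rintro x hx rfl
    rw [Metric.mem_closedBall, dist_zero_left] at hx
    have := norm_pos_iff.2 hp
    linarith
  have hcs : ContinuousOn (fun z : ℝ × Space => shear (fun k => hk a k z.1 z.2) z.2 j)
      (univ ×ˢ {0}ᶜ) :=
    continuousOn_shear (fun k => continuousOn_hk ha k) continuousOn_snd j
  obtain ⟨C, hC⟩ := ((isCompact_uIcc (a := t) (b := T)).prod
    (isCompact_closedBall p (‖p‖ / 2))).exists_bound_of_continuousOn
    (hcs.mono (prod_mono (subset_univ _) fun x hx => hball x hx))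
  have hv : ∀ x ≠ 0, Continuous fun r => vel a r x j := fun x hx =>
    (continuous_vel ha j).comp_continuous (continuous_id.prodMk continuous_const) fun r =>
      ⟨mem_univ _, hx⟩
  have hs : Continuous fun r => shear (fun k => hk a k r p) p j :=
    hcs.comp_continuous (continuous_id.prodMk continuous_const) fun r => ⟨mem_univ _, hp⟩
  have h := intervalIntegral.hasFDerivAt_integral_of_dominated_of_fderiv_le (𝕜 := ℝ) (a := t)
    (b := T) (μ := volume) (F := fun x r => vel a r x j)
    (F' := fun x r => shear (fun k => hk a k r x) x j) (bound := fun _ => C) (x₀ := p)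
    (Metric.closedBall_mem_nhds p (by have := norm_pos_iff.2 hp; positivity))
    ((isOpen_compl_singleton.eventually_mem hp).mono fun x hx =>
      (hv x hx).aestronglyMeasurable)
    ((hv p hp).intervalIntegrable _ _) hs.aestronglyMeasurable
    (Eventually.of_forall fun r hr x hx => hC (r, x) ⟨uIoc_subset_uIcc hr, hx⟩)
    intervalIntegrable_const
    (Eventually.of_forall fun r _ x hx => hasFDerivAt_vel (fun i => ha.pos i r) (hball x hx) j)
  refine h.congr_fderiv ?_
  ext e
  rw [ContinuousLinearMap.intervalIntegral_apply (hs.intervalIntegrable _ _), shear_apply]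
  simp only [shear_apply]
  rw [intervalIntegral.integral_add ((intervalIntegrable_hk ha _ hp _ _).mul_const _)
    ((intervalIntegrable_hk ha _ hp _ _).mul_const _), intervalIntegral.integral_mul_const,
    intervalIntegral.integral_mul_const]
  rfl

lemma hasFDerivAt_ray (ha : IsScale a) (t T : ℝ) (hp : p ≠ 0) (j : Fin 3) :
    HasFDerivAt (fun z : ℝ × Space => ray a T z.1 z.2 j)
      ((ContinuousLinearMap.toSpanSingleton ℝ (-vel a t p j)).coprod
        (shear (fun k => hInt a k t T p) p j)) (t, p) := by
  have hv : ∀ x ≠ 0, Continuous fun r => vel a r x j := fun x hx =>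
    (continuous_vel ha j).comp_continuous (continuous_id.prodMk continuous_const) fun r =>
      ⟨mem_univ _, hx⟩
  have hmem : ∀ᶠ v : ℝ × Space in 𝓝 (t, p), v.2 ≠ 0 :=
    continuous_snd.continuousAt.eventually_ne hp
  have hnhds : (univ : Set ℝ) ×ˢ ({0}ᶜ : Set Space) ∈ 𝓝 (t, p) :=
    prod_mem_nhds univ_mem (isOpen_compl_singleton.mem_nhds hp)
  refine (hasStrictFDerivAt_uncurry_coprod (u := (t, p))
    (f := fun t p => ∫ r in t..T, vel a r p j)
    (f₁ := fun t p => ContinuousLinearMap.toSpanSingleton ℝ (-vel a t p j))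
    (f₂ := fun t p => shear (fun k => hInt a k t T p) p j) ?_ ?_ ?_ ?_).hasFDerivAt
  · filter_upwards [hmem] with v hv2
    exact (intervalIntegral.integral_hasDerivAt_left ((hv _ hv2).intervalIntegrable _ _)
      ((hv _ hv2).stronglyMeasurableAtFilter _ _) (hv _ hv2).continuousAt).hasFDerivAt
  · filter_upwards [hmem] with v hv2 using hasFDerivAt_ray_right ha _ _ hv2 j
  · refine ((ContinuousLinearMap.toSpanSingletonCLE (𝕜 := ℝ) (E := ℝ)).continuous.comp_continuousOn
      (continuous_vel ha j).neg).continuousAt hnhds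
  · refine (continuousOn_shear (S := univ ×ˢ {0}ᶜ) (m := fun k (z : ℝ × Space) =>
      hInt a k z.1 T z.2) (q := fun z => z.2) (fun k => ?_) continuousOn_snd j).continuousAt hnhds
    exact (continuousOn_hInt ha k).comp (f := fun z : ℝ × Space => (z.1, T, z.2)) (by fun_prop)
      fun z hz => ⟨mem_univ _, mem_univ _, hz.2⟩

end

/-! ### Gram determinants -/

/-- The metric with scale factors `b` on the vectors `(x, u)`, `(y, v)`. -/
def gram (b : Fin 3 → ℝ) (x y : ℝ) (u v : Space) : ℝ := -(x * y) + ∑ i, b i ^ 2 * (u i * v i)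

/-- Gram determinant of `(x, u)`, `(y, v)`. -/
def gramDet (b : Fin 3 → ℝ) (x y : ℝ) (u v : Space) : ℝ :=
  gram b x x u u * gram b y y v v - gram b x y u v ^ 2

lemma det3_eq (u v w : Space) : det3 u v w = u 0 * v 1 * w 2 - u 0 * v 2 * w 1 - u 1 * v 0 * w 2 +
    u 1 * v 2 * w 0 + u 2 * v 0 * w 1 - u 2 * v 1 * w 0 := by
  exact Matrix.det_fin_three _

section

variable {a : Fin 3 → ℝ → ℝ} {p : Space} {t : ℝ}

/-- The generator is null and metrically orthogonal to the range of the Hessian, so the tilt of the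
slice, given by `x` and `y`, drops out of the induced metric. -/
lemma gram_null (ha : ∀ i, 0 < a i t) (hp : p ≠ 0) (m : Fin 3 → ℝ) (x y : ℝ) (e d : Space) :
    gram (fun i => a i t) x y (-(x • vel a t p) + shearV m p e) (-(y • vel a t p) + shearV m p d) =
      ∑ i, a i t ^ 2 * (shear m p i e * shear m p i d) := by
  have h0 := fq_pos ha hp
  have e2 : fq a t p ^ 2 = (p 0 / a 0 t) ^ 2 + (p 1 / a 1 t) ^ 2 + (p 2 / a 2 t) ^ 2 := by
    rw [fq_sq, Fin.sum_univ_three]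
  have a0 := ha 0; have a1 := ha 1; have a2 := ha 2
  have hv : ∀ i, a i t ^ 2 * vel a t p i = p i / fq a t p := fun i => by
    have := ha i
    simp only [vel]
    field_simp
  have h1 : ∑ i, a i t ^ 2 * vel a t p i * vel a t p i = 1 := by
    simp only [hv, Fin.sum_univ_three]
    simp only [vel]
    field_simp at e2 ⊢
    linarith
  have h2 : ∀ e, ∑ i, a i t ^ 2 * vel a t p i * shear m p i e = 0 := fun e => by
    simp only [hv, Fin.sum_univ_three, shear_apply]
    simp
    ring
  have h3 := h2 e
  have h4 := h2 d
  simp only [gram, PiLp.add_apply, PiLp.neg_apply, PiLp.smul_apply, smul_eq_mul, shearV,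
    Fin.sum_univ_three] at h1 h3 h4 ⊢
  linear_combination x * y * h1 - x * h4 - y * h3

/-- The cross product of two columns of the Hessian is `curv m p * det3 p e d` times `p`, because
`p` spans its kernel. Lagrange's identity for the spatial metric then yields a perfect square. -/
lemma gramDet_null (ha : ∀ i, 0 < a i t) (hp : p ≠ 0) (m : Fin 3 → ℝ) (x y : ℝ) (e d : Space) :
    gramDet (fun i => a i t) x y (-(x • vel a t p) + shearV m p e)
      (-(y • vel a t p) + shearV m p d) =
      (vol3 a t * fq a t p * (curv m p * det3 p e d)) ^ 2 := by
  have e2 : fq a t p ^ 2 = (p 0 / a 0 t) ^ 2 + (p 1 / a 1 t) ^ 2 + (p 2 / a 2 t) ^ 2 := by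
    rw [fq_sq, Fin.sum_univ_three]
  have a0 := ha 0; have a1 := ha 1; have a2 := ha 2
  have hc : ∀ i : Fin 3, shear m p (i + 1) e * shear m p (i + 2) d -
      shear m p (i + 2) e * shear m p (i + 1) d = curv m p * det3 p e d * p i := fun i => by
    simp only [shear_apply, curv, det3_eq, Fin.sum_univ_three]
    fin_cases i <;> simp <;> ring
  have c0 := hc 0; have c1 := hc 1; have c2 := hc 2
  simp only [Fin.isValue, zero_add, show (1 : Fin 3) + 1 = 2 from rfl,
    show (1 : Fin 3) + 2 = 0 from rfl, show (2 : Fin 3) + 1 = 0 from rfl,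
    show (2 : Fin 3) + 2 = 1 from rfl] at c0 c1 c2
  rw [gramDet, gram_null ha hp, gram_null ha hp, gram_null ha hp, mul_pow, mul_pow, e2]
  have e3 : vol3 a t ^ 2 * ((p 0 / a 0 t) ^ 2 + (p 1 / a 1 t) ^ 2 + (p 2 / a 2 t) ^ 2) *
      (curv m p * det3 p e d) ^ 2 = (a 1 t * a 2 t * (curv m p * det3 p e d * p 0)) ^ 2 +
      (a 0 t * a 2 t * (curv m p * det3 p e d * p 1)) ^ 2 +
      (a 0 t * a 1 t * (curv m p * det3 p e d * p 2)) ^ 2 := by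
    simp only [vol3, Fin.prod_univ_three]
    field_simp
  rw [e3, ← c0, ← c1, ← c2]
  simp only [Fin.sum_univ_three]
  ring

lemma det3_vel (ha : ∀ i, 0 < a i t) (hp : p ≠ 0) (m : Fin 3 → ℝ) (x y : ℝ) (e d : Space) :
    det3 (-vel a t p) (-(x • vel a t p) + shearV m p e) (-(y • vel a t p) + shearV m p d) =
      -(fq a t p * curv m p * det3 p e d) := by
  have h0 := fq_pos ha hp
  have e2 : fq a t p ^ 2 = (p 0 / a 0 t) ^ 2 + (p 1 / a 1 t) ^ 2 + (p 2 / a 2 t) ^ 2 := by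
    rw [fq_sq, Fin.sum_univ_three]
  have a0 := ha 0; have a1 := ha 1; have a2 := ha 2
  have h1 : vel a t p 0 * p 0 + vel a t p 1 * p 1 + vel a t p 2 * p 2 = fq a t p := by
    simp only [vel]
    field_simp at e2 ⊢
    linarith
  rw [← h1]
  simp only [det3_eq, shearV, shear_apply, curv, Fin.sum_univ_three, PiLp.add_apply,
    PiLp.neg_apply, PiLp.smul_apply, smul_eq_mul]
  simp
  ring

lemma differentiable_gramDet (x y : ℝ) :
    Differentiable ℝ fun z : (Fin 3 → ℝ) × Space × Space => gramDet z.1 x y z.2.1 z.2.2 := by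
  have h1 : ∀ i, Differentiable ℝ fun z : (Fin 3 → ℝ) × Space × Space => z.1 i := by fun_prop
  have h2 : ∀ i, Differentiable ℝ fun z : (Fin 3 → ℝ) × Space × Space => z.2.1 i := fun i =>
    (coordL i).differentiable.comp (by fun_prop)
  have h3 : ∀ i, Differentiable ℝ fun z : (Fin 3 → ℝ) × Space × Space => z.2.2 i := fun i =>
    (coordL i).differentiable.comp (by fun_prop)
  unfold gramDet gram
  fun_prop

end

end BianchiI

namespace BianchiI

open Bianchi

/-! ### Slices of light cones and their areas. -/

/-- Area density of a light cone with tip time `T`. -/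
def dens (a : Fin 3 → ℝ → ℝ) (T t : ℝ) (p : Space) : ℝ :=
  vol3 a t * fq a t p * curv (fun k => hInt a k t T p) p

/-- Rate of change of the comoving volume along the generators of a light cone. -/
def flux (a : Fin 3 → ℝ → ℝ) (T t : ℝ) (p : Space) : ℝ :=
  fq a t p * curv (fun k => hInt a k t T p) p

/-- The scale factors, frozen before the time `t₀`. -/
def clamp (M : BianchiI) (t₀ : ℝ) (i : Fin 3) (t : ℝ) : ℝ := M.a i (max t t₀)

section

variable {M : BianchiI} {t₀ t T : ℝ} {p : Space}

lemma isOpen_domain (M : BianchiI) : IsOpen {t : ℝ | M.ti < (t : WithBot ℝ)} := by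
  cases h : M.ti with
  | bot => simp
  | coe x =>
    simp only [WithBot.coe_lt_coe]
    exact isOpen_Ioi

lemma exists_domain_lt (M : BianchiI) {x : ℝ} (h : M.ti < (x : WithBot ℝ)) :
    ∃ y : ℝ, M.ti < (y : WithBot ℝ) ∧ y < x := by
  cases h' : M.ti with
  | bot => exact ⟨x - 1, WithBot.bot_lt_coe _, by linarith⟩
  | coe z =>
    rw [h'] at h
    obtain ⟨y, h1, h2⟩ := exists_between (WithBot.coe_lt_coe.1 h)
    exact ⟨y, WithBot.coe_lt_coe.2 h1, h2⟩

lemma domain_mono (h : M.ti < (t₀ : WithBot ℝ)) (ht : t₀ ≤ t) : M.ti < (t : WithBot ℝ) :=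
  h.trans_le (WithBot.coe_le_coe.2 ht)

lemma differentiableAt_a (M : BianchiI) (h : M.ti < (t : WithBot ℝ)) (i : Fin 3) :
    DifferentiableAt ℝ (M.a i) t :=
  ((M.smooth i).contDiffAt ((isOpen_domain M).mem_nhds h)).differentiableAt (by simp)

/-- Freezing produces scale factors that are positive and continuous on the whole line, whatever the
initial time; at times from `t₀` on nothing changes. -/
lemma isScale_clamp (h : M.ti < (t₀ : WithBot ℝ)) : IsScale (M.clamp t₀) where
  cont i := by
    refine (M.smooth i).continuousOn.comp_continuous (continuous_id.max continuous_const) fun t =>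
      domain_mono h (le_max_right _ _)
  pos i t := M.pos i _ (domain_mono h (le_max_right _ _))

lemma clamp_eq (ht : t₀ ≤ t) (i : Fin 3) : M.clamp t₀ i t = M.a i t := by
  rw [clamp, max_eq_left ht]

lemma fq_clamp (ht : t₀ ≤ t) : fq (M.clamp t₀) t p = fq M.a t p := by
  simp only [fq, clamp_eq ht]

lemma hk_clamp (ht : t₀ ≤ t) (k : Fin 3) : hk (M.clamp t₀) k t p = hk M.a k t p := by
  simp only [hk, clamp_eq ht, fq_clamp ht]

lemma vol3_clamp (ht : t₀ ≤ t) : vol3 (M.clamp t₀) t = vol3 M.a t := by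
  simp only [vol3, clamp_eq ht]

lemma vel_clamp (ht : t₀ ≤ t) : vel (M.clamp t₀) t p = vel M.a t p := by
  simp only [vel, clamp_eq ht, fq_clamp ht]

lemma le_of_mem_uIcc {r : ℝ} (ht : t₀ ≤ t) (hT : t₀ ≤ T) (hr : r ∈ uIcc t T) : t₀ ≤ r :=
  (le_min ht hT).trans hr.1

lemma hInt_clamp (ht : t₀ ≤ t) (hT : t₀ ≤ T) (k : Fin 3) :
    hInt (M.clamp t₀) k t T p = hInt M.a k t T p :=
  intervalIntegral.integral_congr fun _ hr => hk_clamp (le_of_mem_uIcc ht hT hr) k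

lemma dens_clamp (ht : t₀ ≤ t) (hT : t₀ ≤ T) : dens (M.clamp t₀) T t p = dens M.a T t p := by
  simp only [dens, vol3_clamp ht, fq_clamp ht, hInt_clamp ht hT]

lemma flux_clamp (ht : t₀ ≤ t) (hT : t₀ ≤ T) : flux (M.clamp t₀) T t p = flux M.a T t p := by
  simp only [flux, fq_clamp ht, hInt_clamp ht hT]

lemma lightCone_eq (ht : t₀ ≤ t) (hT : t₀ ≤ T) :
    M.lightCone T t p = (t, ray (M.clamp t₀) T t p) := by
  simp only [lightCone, ray, Prod.mk.injEq, true_and, WithLp.toLp.injEq]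
  funext j
  refine intervalIntegral.integral_congr fun r hr => ?_
  change vel M.a r p j = _
  dsimp only
  rw [vel_clamp (le_of_mem_uIcc ht hT hr)]

/-- The linear map with given components. -/
def spaceL {E : Type*} [NormedAddCommGroup E] [NormedSpace ℝ E] (f : Fin 3 → E →L[ℝ] ℝ) :
    E →L[ℝ] Space :=
  ((PiLp.continuousLinearEquiv 2 ℝ (fun _ : Fin 3 => ℝ)).symm : (Fin 3 → ℝ) →L[ℝ] Space) ∘L
    ContinuousLinearMap.pi f

lemma spaceL_apply {E : Type*} [NormedAddCommGroup E] [NormedSpace ℝ E] (f : Fin 3 → E →L[ℝ] ℝ)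
    (e : E) (j : Fin 3) : spaceL f e j = f j e := rfl

lemma hasFDerivAt_space {E : Type*} [NormedAddCommGroup E] [NormedSpace ℝ E] {f : E → Space}
    {f' : Fin 3 → E →L[ℝ] ℝ} {x : E} (h : ∀ j, HasFDerivAt (fun q => f q j) (f' j) x) :
    HasFDerivAt f (spaceL f') x :=
  hasFDerivWithinAt_univ.1 (hasFDerivWithinAt_euclidean.2 fun j =>
    ((h j).congr_fderiv (by ext e; rfl)).hasFDerivWithinAt)

lemma hasFDerivAt_slice (h₀ : M.ti < (t₀ : WithBot ℝ)) {f : Space → ℝ} {f' : Space →L[ℝ] ℝ}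
    (hf : HasFDerivAt f f' p) (hp : p ≠ 0) (h1 : t₀ < f p) (h2 : f p < T) :
    HasFDerivAt (M.slice T f) (f'.prod (spaceL fun j => -(vel M.a (f p) p j) • f' +
      shear (fun k => hInt M.a k (f p) T p) p j)) p := by
  have hc := isScale_clamp h₀
  have key : HasFDerivAt (fun q => (f q, ray (M.clamp t₀) T (f q) q)) (f'.prod (spaceL fun j =>
      -(vel M.a (f p) p j) • f' + shear (fun k => hInt M.a k (f p) T p) p j)) p := by
    refine hf.prodMk (hasFDerivAt_space fun j => ?_)
    have := (hasFDerivAt_ray hc (f p) T hp j).comp (f := fun q => (f q, q)) p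
      (hf.prodMk (hasFDerivAt_id p))
    refine this.congr_fderiv ?_
    ext e
    simp only [vel_clamp h1.le, hInt_clamp h1.le (h1.trans h2).le]
    simp [mul_comm]
  refine key.congr_of_eventuallyEq ?_
  filter_upwards [hf.continuousAt.eventually_const_lt h1] with q hq
  exact lightCone_eq hq.le (h1.trans h2).le

lemma fderiv_slice (h₀ : M.ti < (t₀ : WithBot ℝ)) {f : Space → ℝ} {f' : Space →L[ℝ] ℝ}
    (hf : HasFDerivAt f f' p) (hp : p ≠ 0) (h1 : t₀ < f p) (h2 : f p < T) (e : Space) :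
    fderiv ℝ (M.slice T f) p e = (f' e, -(f' e • vel M.a (f p) p) +
      shearV (fun k => hInt M.a k (f p) T p) p e) := by
  rw [(hasFDerivAt_slice h₀ hf hp h1 h2).fderiv]
  refine Prod.ext rfl ?_
  ext j
  change (spaceL _ e) j = _
  rw [spaceL_apply]
  simp [shearV, mul_comm]

lemma areaDensity_slice (h₀ : M.ti < (t₀ : WithBot ℝ)) {f : Space → ℝ}
    (hf : DifferentiableAt ℝ f p) (hp : p ≠ 0) (h1 : t₀ < f p) (h2 : f p < T) (e d : Space) :
    M.areaDensity (M.slice T f) p e d = dens M.a T (f p) p * |det3 p e d| := by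
  have ha : ∀ i, 0 < M.a i (f p) := fun i => M.pos i _ (domain_mono h₀ h1.le)
  have hm : ∀ k, 0 ≤ hInt M.a k (f p) T p := fun k =>
    intervalIntegral.integral_nonneg h2.le fun _ _ => hk_nonneg k
  have h := gramDet_null ha hp (fun k => hInt M.a k (f p) T p) (fderiv ℝ f p e) (fderiv ℝ f p d) e d
  have hd : 0 ≤ dens M.a T (f p) p :=
    mul_nonneg (mul_nonneg (vol3_pos ha).le fq_nonneg) (curv_nonneg hm)
  rw [areaDensity, fderiv_slice h₀ hf.hasFDerivAt hp h1 h2, fderiv_slice h₀ hf.hasFDerivAt hp h1 h2]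
  change √(gramDet (fun i => M.a i (f p)) _ _ _ _) = _
  rw [h, Real.sqrt_sq_eq_abs, ← mul_assoc, abs_mul]
  congr 1
  exact abs_of_nonneg hd

/-! ### Areas of slices -/

lemma continuousOn_curv {X : Type*} [TopologicalSpace X] {m : Fin 3 → X → ℝ} {q : X → Space}
    {S : Set X} (hm : ∀ k, ContinuousOn (m k) S) (hq : ContinuousOn q S) :
    ContinuousOn (fun x => curv (fun k => m k x) (q x)) S :=
  continuousOn_finsetSum _ fun n _ => (((coordL n).continuous.comp_continuousOn hq).pow 2).mul
    ((hm _).mul (hm _))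

lemma continuousOn_flux {a : Fin 3 → ℝ → ℝ} (ha : IsScale a) :
    ContinuousOn (fun z : ℝ × ℝ × Space => flux a z.2.1 z.1 z.2.2) (univ ×ˢ univ ×ˢ {0}ᶜ) :=
  ((continuous_fq ha).comp (f := fun z : ℝ × ℝ × Space => (z.1, z.2.2))
    (by fun_prop)).continuousOn.mul
    (continuousOn_curv (fun k => continuousOn_hInt ha k) (by fun_prop))

lemma dens_eq_flux (a : Fin 3 → ℝ → ℝ) (T t : ℝ) (p : Space) :
    dens a T t p = vol3 a t * flux a T t p := mul_assoc _ _ _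

lemma continuousOn_dens_slice {a : Fin 3 → ℝ → ℝ} (ha : IsScale a) (T : ℝ) {f : Space → ℝ}
    (hf : ContinuousOn f {0}ᶜ) : ContinuousOn (fun p => dens a T (f p) p) {0}ᶜ := by
  simp only [dens_eq_flux]
  refine ((continuous_vol3 ha).comp_continuousOn hf).mul ?_
  exact (continuousOn_flux ha).comp (f := fun p : Space => (f p, T, p))
    (hf.prodMk (by fun_prop)) fun p hp => ⟨mem_univ _, mem_univ _, hp⟩

/-- Compactness of the sphere keeps the slice away from the initial time, so the scale factors can
be frozen before it. -/
lemma IsSlice.exists_lower {f : Space → ℝ} (h : M.IsSlice T f) :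
    ∃ t₀ : ℝ, M.ti < (t₀ : WithBot ℝ) ∧ ∀ p : Space, ‖p‖ = 1 → t₀ < f p := by
  have hne : (Metric.sphere (0 : Space) 1).Nonempty := NormedSpace.sphere_nonempty.2 zero_le_one
  obtain ⟨q, hq, hmin⟩ := (isCompact_sphere (0 : Space) 1).exists_isMinOn hne
    (h.smooth.continuousOn.mono fun p hp => ne_zero_of_norm (mem_sphere_zero_iff_norm.1 hp))
  obtain ⟨t₀, h1, h2⟩ := exists_domain_lt M (h.mem q hq).1
  exact ⟨t₀, h1, fun p hp => h2.trans_le (hmin (mem_sphere_zero_iff_norm.2 hp))⟩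

lemma IsSlice.lt {f : Space → ℝ} (h : M.IsSlice T f) (hp : ‖p‖ = 1) : f p < T :=
  (h.mem p (mem_sphere_zero_iff_norm.2 hp)).2

lemma IsSlice.differentiableAt {f : Space → ℝ} (h : M.IsSlice T f) (hp : p ≠ 0) :
    DifferentiableAt ℝ f p :=
  (h.smooth.contDiffAt (isOpen_compl_singleton.mem_nhds hp)).differentiableAt (by simp)

lemma det3_dir (θ φ : ℝ) : det3 (dir θ φ) (dirθ θ φ) (dirφ θ φ) = Real.sin θ := by
  rw [det3_eq]
  simp [dir, dirθ, dirφ]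
  linear_combination (Real.sin θ * (Real.sin θ ^ 2 + Real.cos θ ^ 2)) * Real.sin_sq_add_cos_sq φ +
    Real.sin θ * Real.sin_sq_add_cos_sq θ

lemma IsSlice.integrable_dens {f : Space → ℝ} (h : M.IsSlice T f) :
    Integrable (fun p => dens M.a T (f p) p) sph ∧
      M.area (M.slice T f) = ∫ p, dens M.a T (f p) p ∂sph := by
  obtain ⟨t₀, h₀, hlow⟩ := h.exists_lower
  have hcont := continuousOn_dens_slice (isScale_clamp h₀) T h.smooth.continuousOn
  have hae : (fun p => dens (M.clamp t₀) T (f p) p) =ᵐ[sph] fun p => dens M.a T (f p) p := by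
    filter_upwards [ae_sph_norm] with p hp
    exact dens_clamp (hlow p hp).le ((hlow p hp).trans (h.lt hp)).le
  refine ⟨(integrable_sph hcont).congr hae, ?_⟩
  rw [← integral_congr_ae hae, integral_sph hcont, area]
  refine intervalIntegral.integral_congr fun θ hθ => ?_
  refine intervalIntegral.integral_congr fun φ _ => ?_
  rw [uIcc_of_le Real.pi_pos.le] at hθ
  have hn := norm_dir θ φ
  rw [areaDensity_slice h₀ (h.differentiableAt (ne_zero_of_norm hn)) (ne_zero_of_norm hn)
    (hlow _ hn) (h.lt hn), det3_dir, abs_of_nonneg (Real.sin_nonneg_of_nonneg_of_le_pi hθ.1 hθ.2),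
    dens_clamp (hlow _ hn).le ((hlow _ hn).trans (h.lt hn)).le, mul_comm]

end

end BianchiI

namespace BianchiI

open Bianchi

/-! ### The marginality condition -/

lemma exists_isTangentFrame {p : Space} (hp : ‖p‖ = 1) : ∃ e d, IsTangentFrame p e d := by
  obtain ⟨θ, -, φ, -, rfl⟩ := exists_dir hp
  refine ⟨dirθ θ φ, !₂[-Real.sin φ, Real.cos φ, 0], ?_, ?_, ?_⟩
  · simp [dir, dirθ, PiLp.inner_apply, Fin.sum_univ_three]
    linear_combination (Real.sin θ * Real.cos θ) * Real.sin_sq_add_cos_sq φ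
  · simp [dir, PiLp.inner_apply, Fin.sum_univ_three]
    ring
  · have : det3 (dir θ φ) (dirθ θ φ) !₂[-Real.sin φ, Real.cos φ, 0] = 1 := by
      rw [det3_eq]
      simp [dir, dirθ]
      linear_combination (Real.sin θ ^ 2 + Real.cos θ ^ 2) * Real.sin_sq_add_cos_sq φ +
        Real.sin_sq_add_cos_sq θ
    rw [this]
    exact one_pos

lemma hasDerivAt_space {w : ℝ → Space} {w' : Space} {r : ℝ}
    (h : ∀ j, HasDerivAt (fun r => w r j) (w' j) r) : HasDerivAt w w' r := by
  refine (hasFDerivAt_space fun j => (h j).hasFDerivAt).hasDerivAt.congr_deriv ?_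
  ext j
  rw [spaceL_apply]
  simp

section

variable {M : BianchiI} {t t₀ T : ℝ} {p : Space}

lemma differentiableAt_vel (ht : M.ti < (t : WithBot ℝ)) (hp : p ≠ 0) (j : Fin 3) :
    DifferentiableAt ℝ (fun z : ℝ × Space => vel M.a z.1 z.2 j) (t, p) := by
  have ha : ∀ i, M.a i t ≠ 0 := fun i => (M.pos i t ht).ne'
  have hd : ∀ i, DifferentiableAt ℝ (fun z : ℝ × Space => M.a i z.1) (t, p) := fun i =>
    (differentiableAt_a M ht i).comp (f := fun z : ℝ × Space => z.1) (t, p) differentiableAt_fst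
  have hc : ∀ i, DifferentiableAt ℝ (fun z : ℝ × Space => z.2 i) (t, p) := fun i =>
    (coordL i).differentiableAt.comp (t, p) differentiableAt_snd
  have hi : ∀ i, DifferentiableAt ℝ (fun z : ℝ × Space => (M.a i z.1)⁻¹) (t, p) := fun i =>
    (hd i).fun_inv (ha i)
  have hf : DifferentiableAt ℝ (fun z : ℝ × Space => fq M.a z.1 z.2) (t, p) := by
    simp only [fq, div_eq_mul_inv]
    refine DifferentiableAt.sqrt (DifferentiableAt.fun_sum fun i _ =>
      ((hc i).mul (hi i)).fun_pow 2) ?_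
    simp only [← div_eq_mul_inv]
    rw [← fq_sq]
    have := fq_pos (fun i => M.pos i t ht) hp
    positivity
  have hv : DifferentiableAt ℝ (fun z : ℝ × Space => (fq M.a z.1 z.2)⁻¹) (t, p) :=
    hf.fun_inv (fq_pos (fun i => M.pos i t ht) hp).ne'
  simp only [vel, div_eq_mul_inv, ← inv_pow]
  exact ((hc j).mul ((hi j).fun_pow 2)).mul hv

lemma hasDerivAt_hInt (ht : M.ti < (t : WithBot ℝ)) (htT : t < T) (hp : p ≠ 0) (k : Fin 3) :
    HasDerivAt (fun t => hInt M.a k t T p) (-hk M.a k t p) t := by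
  obtain ⟨t₀, h₀, h1⟩ := exists_domain_lt M ht
  have hcont := continuous_hk_left (isScale_clamp h₀) k hp
  have h := intervalIntegral.integral_hasDerivAt_left (hcont.intervalIntegrable t T)
    (hcont.stronglyMeasurableAtFilter _ _) hcont.continuousAt
  rw [hk_clamp h1.le] at h
  refine h.congr_of_eventuallyEq ?_
  filter_upwards [eventually_gt_nhds h1] with r hr
  exact (hInt_clamp hr.le (h1.trans htT).le k).symm

lemma hInt_pos (ht : M.ti < (t : WithBot ℝ)) (htT : t < T) (hp : p ≠ 0) (k : Fin 3) :
    0 < hInt M.a k t T p := by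
  rw [← hInt_clamp le_rfl htT.le]
  have hc := isScale_clamp ht
  exact intervalIntegral.intervalIntegral_pos_of_pos ((continuous_hk_left hc k hp).intervalIntegrable
    _ _) (fun r => hk_pos (fun i => hc.pos i r) hp k) htT

lemma flux_pos (ht : M.ti < (t : WithBot ℝ)) (htT : t < T) (hp : p ≠ 0) : 0 < flux M.a T t p :=
  mul_pos (fq_pos (fun i => M.pos i t ht) hp) (curv_pos (fun k => hInt_pos ht htT hp k) hp)

lemma dens_pos (ht : M.ti < (t : WithBot ℝ)) (htT : t < T) (hp : p ≠ 0) : 0 < dens M.a T t p := by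
  rw [dens_eq_flux]
  exact mul_pos (vol3_pos fun i => M.pos i t ht) (flux_pos ht htT hp)

/-- On a slice that is marginal along the light cone, the area density is stationary up to the
contribution of the matter entropy. -/
theorem hasDerivAt_dens_of_marginal {G s : ℝ} {f : Space → ℝ} (hf : DifferentiableAt ℝ f p)
    (hp : ‖p‖ = 1) (h1 : M.ti < (f p : WithBot ℝ)) (h2 : f p < T)
    (hm : ∀ e d, IsTangentFrame p e d →
      M.quantumExpansion G s (M.slice T f) (M.generator f) p e d = 0) :
    HasDerivAt (fun t => dens M.a T t p) (4 * G * s * flux M.a T (f p) p) (f p) := by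
  obtain ⟨e, d, hed⟩ := exists_isTangentFrame hp
  have hm := hm e d hed
  have hdet := hed.2.2
  have hp0 := ne_zero_of_norm hp
  obtain ⟨t₀, h₀, h3⟩ := exists_domain_lt M h1
  have hf' := hf.hasFDerivAt
  set f' := fderiv ℝ f p
  have ha : ∀ i, 0 < M.a i (f p) := fun i => M.pos i _ h1
  choose D hD using fun j => differentiableAt_vel h1 hp0 j
  have hDp : ∀ j e, D j (0, e) = shear (fun k => hk M.a k (f p) p) p j e := fun j e => by
    have := ((hD j).comp (f := fun q => (f p, q)) p ((hasFDerivAt_const (f p) p).prodMk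
      (hasFDerivAt_id p))).unique (hasFDerivAt_vel ha hp0 j)
    rw [← this]
    rfl
  have hDt : ∀ j, HasDerivAt (fun r => vel M.a r p j) (D j (1, 0)) (f p) := fun j =>
    (hD j).comp_hasDerivAt (f := fun r => (r, p)) (f p)
      ((hasDerivAt_id (f p)).prodMk (hasDerivAt_const _ _))
  set L : Space →L[ℝ] Event := (0 : Space →L[ℝ] ℝ).prod
    (spaceL fun j => -(D j ∘L (f'.prod (ContinuousLinearMap.id ℝ Space))))
  have hL : HasFDerivAt (M.generator f) L p := by
    refine (hasFDerivAt_const (1 : ℝ) p).prodMk (hasFDerivAt_space fun j => ?_)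
    exact ((hD j).comp (f := fun q => (f q, q)) p (hf'.prodMk (hasFDerivAt_id p))).neg
  -- Spatial parts of the tangent vectors after moving the slice by coordinate time `ε` along the
  -- cone, whereas the quantum expansion displaces points along straight coordinate lines.
  set u : Space → ℝ → Space := fun e ε => -(f' e • vel M.a (f p + ε) p) +
    shearV (fun k => hInt M.a k (f p + ε) T p) p e with hu
  have hsh : HasDerivAt (fun ε : ℝ => f p + ε) 1 0 := by
    simpa using (hasDerivAt_id (0 : ℝ)).const_add (f p)
  have hu' : ∀ e, HasDerivAt (u e) (L e).2 0 := by
    intro e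
    refine hasDerivAt_space fun j => ?_
    have i1 : HasDerivAt (fun ε => vel M.a (f p + ε) p j) (D j (1, 0)) 0 := by
      have := HasDerivAt.comp (h := fun ε => f p + ε) (0 : ℝ) (by simpa using hDt j) hsh
      simpa using! this
    have i2 : ∀ k, HasDerivAt (fun ε => hInt M.a k (f p + ε) T p) (-hk M.a k (f p) p) 0 :=
      fun k => by
        have := HasDerivAt.comp (h := fun ε => f p + ε) (0 : ℝ)
          (by simpa using hasDerivAt_hInt h1 h2 hp0 k) hsh
        simpa using! this
    have e1 : (L e).2 j = -(f' e * D j (1, 0)) +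
        (-hk M.a (j + 2) (f p) p * (p (j + 1) * (p (j + 1) * e j - p j * e (j + 1))) +
        -hk M.a (j + 1) (f p) p * (p (j + 2) * (p (j + 2) * e j - p j * e (j + 2)))) := by
      have : (L e).2 j = -(D j (f' e, e)) := rfl
      have e2 : ((f' e, e) : ℝ × Space) = f' e • (1, 0) + (0, e) := by simp
      rw [this, e2, map_add, map_smul, hDp, shear_apply, smul_eq_mul]
      ring
    rw [e1]
    have := ((i1.const_mul (f' e)).neg).add (((i2 (j + 2)).mul_const
      (p (j + 1) * (p (j + 1) * e j - p j * e (j + 1)))).add ((i2 (j + 1)).mul_const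
      (p (j + 2) * (p (j + 2) * e j - p j * e (j + 2)))))
    refine this.congr_of_eventuallyEq (Eventually.of_forall fun ε => ?_)
    simp [hu, shearV, shear_apply]
  have hF : HasFDerivAt (M.slice T f) (fderiv ℝ (M.slice T f) p) p :=
    (hasFDerivAt_slice h₀ hf' hp0 h3 h2).differentiableAt.hasFDerivAt
  have hFe : ∀ e, fderiv ℝ (M.slice T f) p e = (f' e, u e 0) := fun e => by
    rw [fderiv_slice h₀ hf' hp0 h3 h2]
    simp only [hu, add_zero]
  have hb : HasDerivAt (fun ε i => M.a i (f p + ε)) (fun i => deriv (M.a i) (f p)) 0 := by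
    refine hasDerivAt_pi.2 fun i => ?_
    have h0 : HasDerivAt (M.a i) (deriv (M.a i) (f p)) (f p + 0) := by
      rw [add_zero]
      exact (differentiableAt_a M h1 i).hasDerivAt
    simpa using! HasDerivAt.comp (h := fun ε => f p + ε) (0 : ℝ) h0 hsh
  have hlin : ∀ e, HasDerivAt (fun ε : ℝ => u e 0 + ε • (L e).2) (L e).2 0 := fun e => by
    simpa using ((hasDerivAt_id (0 : ℝ)).smul_const (L e).2).const_add (u e 0)
  set Γ := fun z : (Fin 3 → ℝ) × Space × Space => gramDet z.1 (f' e) (f' d) z.2.1 z.2.2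
  have hΓ : DifferentiableAt ℝ Γ (fun i => M.a i (f p), u e 0, u d 0) :=
    differentiable_gramDet _ _ _
  set D' := fderiv ℝ Γ (fun i => M.a i (f p), u e 0, u d 0)
    (fun i => deriv (M.a i) (f p), (L e).2, (L d).2)
  -- The straight displacement (`g1`) and the motion along the cone (`g2`) agree to first order, so
  -- the Gram determinant has the same derivative for both.
  have g1 : HasDerivAt (fun ε : ℝ => Γ (fun i => M.a i (f p + ε), u e 0 + ε • (L e).2,
      u d 0 + ε • (L d).2)) D' 0 := by
    have h0 : HasFDerivAt Γ (fderiv ℝ Γ (fun i => M.a i (f p), u e 0, u d 0))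
      (fun i => M.a i (f p + 0), u e 0 + (0 : ℝ) • (L e).2, u d 0 + (0 : ℝ) • (L d).2) := by
      simpa using hΓ.hasFDerivAt
    exact h0.comp_hasDerivAt (f := fun ε : ℝ => ((fun i => M.a i (f p + ε)),
      u e 0 + ε • (L e).2, u d 0 + ε • (L d).2)) 0 (hb.prodMk ((hlin e).prodMk (hlin d)))
  have g2 : HasDerivAt (fun ε : ℝ => Γ (fun i => M.a i (f p + ε), u e ε, u d ε)) D' 0 := by
    have h0 : HasFDerivAt Γ (fderiv ℝ Γ (fun i => M.a i (f p), u e 0, u d 0))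
      (fun i => M.a i (f p + 0), u e 0, u d 0) := by
      simpa using hΓ.hasFDerivAt
    exact h0.comp_hasDerivAt (f := fun ε : ℝ => ((fun i => M.a i (f p + ε)), u e ε, u d ε)) 0
      (hb.prodMk ((hu' e).prodMk (hu' d)))
  have hval : ∀ ε, M.ti < ((f p + ε : ℝ) : WithBot ℝ) →
      Γ (fun i => M.a i (f p + ε), u e ε, u d ε) = (dens M.a T (f p + ε) p * det3 p e d) ^ 2 := by
    intro ε hε
    have := gramDet_null (a := M.a) (t := f p + ε) (fun i => M.pos i _ hε) hp0
      (fun k => hInt M.a k (f p + ε) T p) (f' e) (f' d) e d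
    rw [← mul_assoc] at this
    exact this
  have hA : 0 < dens M.a T (f p) p * det3 p e d := mul_pos (dens_pos h1 h2 hp0) hdet
  have hv0 := hval 0 (by simpa using h1)
  rw [add_zero] at hv0
  have hpos : Γ (fun i => M.a i (f p), u e 0, u d 0) ≠ 0 := by rw [hv0]; positivity
  have r1 := g1.sqrt (by simpa using hpos)
  have r2 := g2.sqrt (by simpa using hpos)
  simp only [zero_smul, add_zero, hv0, Real.sqrt_sq hA.le] at r1 r2
  set E := D' / (2 * (dens M.a T (f p) p * det3 p e d))
  have hE : deriv (fun ε : ℝ => M.areaDensity (fun q => M.slice T f q + ε • M.generator f q) p e d) 0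
      = E := by
    refine HasDerivAt.deriv (r1.congr_of_eventuallyEq (Eventually.of_forall fun ε => ?_))
    have : ∀ e, fderiv ℝ (fun q => M.slice T f q + ε • M.generator f q) p e =
        (f' e, u e 0 + ε • (L e).2) := fun e => by
      rw [show fderiv ℝ (fun q => M.slice T f q + ε • M.generator f q) p =
        fderiv ℝ (M.slice T f) p + ε • L from (hF.add (hL.const_smul ε)).fderiv]
      change fderiv ℝ (M.slice T f) p e + ε • L e = _
      rw [hFe]
      refine Prod.ext ?_ rfl
      change f' e + ε * 0 = f' e
      ring
    dsimp only [areaDensity]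
    rw [this, this]
    change √(gramDet (fun i => M.a i (f p + ε * 1)) _ _ _ _) = _
    rw [mul_one]
  have hdens : HasDerivAt (fun ε => dens M.a T (f p + ε) p * det3 p e d) E 0 := by
    refine r2.congr_of_eventuallyEq ?_
    have hev : ∀ᶠ ε in 𝓝 (0 : ℝ), M.ti < ((f p + ε : ℝ) : WithBot ℝ) ∧ f p + ε < T := by
      have hc : Tendsto (fun ε => f p + ε) (𝓝 (0 : ℝ)) (𝓝 (f p)) := by
        have : ContinuousAt (fun ε => f p + ε) 0 := by fun_prop
        simpa [ContinuousAt] using this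
      exact hc.eventually (((isOpen_domain M).eventually_mem h1).and (eventually_lt_nhds h2))
    filter_upwards [hev] with ε hε
    rw [hval ε hε.1, Real.sqrt_sq (mul_pos (dens_pos hε.1 hε.2 hp0) hdet).le]
  -- The minus sign: the future-directed generator runs towards the tip, so the enclosed volume
  -- decreases.
  have hflux : det3 (M.generator f p).2 (fderiv ℝ (M.slice T f) p e).2
      (fderiv ℝ (M.slice T f) p d).2 = -(flux M.a T (f p) p * det3 p e d) := by
    rw [hFe, hFe]
    simp only [hu, add_zero]
    exact det3_vel ha hp0 _ _ _ e d
  have hq : E = 4 * G * s * (flux M.a T (f p) p * det3 p e d) := by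
    rw [quantumExpansion, hE, hflux, div_eq_zero_iff] at hm
    rcases hm with hm | hm
    · linarith
    · rw [areaDensity_slice h₀ hf hp0 h3 h2, abs_of_pos hdet] at hm
      exact absurd hm hA.ne'
  have hfin := hdens.div_const (det3 p e d)
  have e4 : ∀ ε, dens M.a T (f p + ε) p * det3 p e d / det3 p e d = dens M.a T (f p + ε) p :=
    fun ε => mul_div_cancel_right₀ _ hdet.ne'
  simp only [e4] at hfin
  have e5 : E / det3 p e d = 4 * G * s * flux M.a T (f p) p := by
    rw [hq]
    field_simp
  rw [e5] at hfin
  have hback : HasDerivAt (fun t => t - f p) 1 (f p) := (hasDerivAt_id _).sub_const _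
  have := HasDerivAt.comp (h := fun t => t - f p) (f p) (by simpa using hfin) hback
  rw [mul_one] at this
  exact this.congr_of_eventuallyEq (Eventually.of_forall fun t => by simp)

end

end BianchiI

namespace BianchiI

open Bianchi

/-! ### The comoving volume enclosed by a slice -/

/-- Determinant of a linear map of space from the images of the basis vectors. -/
lemma det_eq_det3 (L : Space →L[ℝ] Space) :
    L.det = det3 (L (EuclideanSpace.single 0 1)) (L (EuclideanSpace.single 1 1))
      (L (EuclideanSpace.single 2 1)) := by
  have h := LinearMap.det_toMatrix (EuclideanSpace.basisFun (Fin 3) ℝ).toBasis (L : Space →ₗ[ℝ] Space)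
  rw [ContinuousLinearMap.det, ← h, Matrix.det_fin_three, det3_eq]
  simp only [LinearMap.toMatrix_apply, OrthonormalBasis.coe_toBasis, EuclideanSpace.basisFun_apply,
    OrthonormalBasis.coe_toBasis_repr_apply, EuclideanSpace.basisFun_repr,
    ContinuousLinearMap.coe_coe]
  ring

/-- Cylindrical coordinates: time and the two polar angles. -/
def cyl (w : Space) : ℝ × ℝ × ℝ := (w 2, w 0, w 1)

lemma measurePreserving_cyl : MeasurePreserving cyl :=
  ((MeasurePreserving.id volume).prod (volume_preserving_finTwoArrow ℝ)).comp
    ((volume_preserving_piFinSuccAbove (fun _ : Fin 3 => ℝ) 2).comp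
      (PiLp.volume_preserving_ofLp (Fin 3)))

lemma hasFDerivAt_dir (w : Space) : HasFDerivAt (fun w : Space => dir (w 0) (w 1))
    (spaceL fun j => dirθ (w 0) (w 1) j • coordL 0 + dirφ (w 0) (w 1) j • coordL 1) w := by
  have h0 := hasFDerivAt_coord 0 w
  have h1 := hasFDerivAt_coord 1 w
  refine hasFDerivAt_space fun j => ?_
  fin_cases j
  · refine (h0.sin.mul h1.cos).congr_fderiv ?_
    ext e
    simp [dirθ, dirφ]
    ring
  · refine (h0.sin.mul h1.sin).congr_fderiv ?_
    ext e
    simp [dirθ, dirφ]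
    ring
  · refine h0.cos.congr_fderiv ?_
    ext e
    simp [dirθ, dirφ]

section

variable {a : Fin 3 → ℝ → ℝ} {T : ℝ}

lemma continuousOn_flux_pair (ha : IsScale a) (T : ℝ) :
    ContinuousOn (fun z : ℝ × Space => flux a T z.1 z.2) (univ ×ˢ {0}ᶜ) :=
  (continuousOn_flux ha).comp (f := fun z : ℝ × Space => (z.1, T, z.2)) (by fun_prop)
    fun _ hz => ⟨mem_univ _, mem_univ _, hz.2⟩

lemma continuous_flux_left (ha : IsScale a) (T : ℝ) {p : Space} (hp : p ≠ 0) :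
    Continuous fun t => flux a T t p :=
  (continuousOn_flux_pair ha T).comp_continuous (continuous_id.prodMk continuous_const)
    fun _ => ⟨mem_univ _, hp⟩

lemma hasFDerivAt_cone (ha : IsScale a) (T : ℝ) (w : Space) :
    ∃ L : Space →L[ℝ] Space, HasFDerivAt (fun w : Space => ray a T (w 2) (dir (w 0) (w 1))) L w ∧
      |L.det| = |flux a T (w 2) (dir (w 0) (w 1)) * Real.sin (w 0)| := by
  have hp := ne_zero_of_norm (norm_dir (w 0) (w 1))
  refine ⟨_, hasFDerivAt_space fun j => (hasFDerivAt_ray ha (w 2) T hp j).comp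
    (f := fun w : Space => (w 2, dir (w 0) (w 1))) w
    ((hasFDerivAt_coord 2 w).prodMk (hasFDerivAt_dir w)), ?_⟩
  set m := fun k => hInt a k (w 2) T (dir (w 0) (w 1))
  have h := det3_vel (fun i => ha.pos i (w 2)) hp m 0 0 (dirθ (w 0) (w 1)) (dirφ (w 0) (w 1))
  rw [det3_dir] at h
  rw [det_eq_det3, flux, ← abs_neg (_ * Real.sin (w 0)), ← h]
  congr 1
  set u := spaceL fun j => dirθ (w 0) (w 1) j • coordL 0 + dirφ (w 0) (w 1) j • coordL 1
  have u0 : u (EuclideanSpace.single 0 1) = dirθ (w 0) (w 1) := by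
    ext j; simp [u, spaceL_apply]
  have u1 : u (EuclideanSpace.single 1 1) = dirφ (w 0) (w 1) := by
    ext j; simp [u, spaceL_apply]
  have u2 : u (EuclideanSpace.single 2 1) = 0 := by
    ext j; simp [u, spaceL_apply]
  simp only [det3_eq, spaceL_apply, ContinuousLinearMap.comp_apply, ContinuousLinearMap.prod_apply,
    ContinuousLinearMap.coprod_apply, u0, u1, u2, map_zero, coordL_apply, shearV, PiLp.add_apply,
    PiLp.neg_apply, PiLp.smul_apply, ContinuousLinearMap.toSpanSingleton_apply]
  simp
  ring

end

variable {M : BianchiI} {T : ℝ}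

lemma continuousOn_fluxInt {a : Fin 3 → ℝ → ℝ} (ha : IsScale a) (T : ℝ) {f : Space → ℝ}
    (hf : ContinuousOn f {0}ᶜ) :
    ContinuousOn (fun p => ∫ r in f p..T, flux a T r p) {0}ᶜ :=
  (continuousOn_primitive (continuousOn_flux_pair ha T)).comp (f := fun p : Space => (f p, T, p))
    (hf.prodMk (by fun_prop)) fun _ hp => ⟨mem_univ _, mem_univ _, hp⟩

lemma flux_nonneg {a : Fin 3 → ℝ → ℝ} {t : ℝ} (h : t ≤ T) (p : Space) : 0 ≤ flux a T t p :=
  mul_nonneg fq_nonneg (curv_nonneg fun _ => intervalIntegral.integral_nonneg h fun _ _ =>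
    hk_nonneg _)

/-- The area formula as an inequality. An upper bound suffices, since the generalized entropy of the
leaves only has to be bounded above by the integral of `coneEnt`; injectivity of the cone map is not
needed. -/
lemma volume_image_cone_le {a : Fin 3 → ℝ → ℝ} (ha : IsScale a) (T : ℝ) {f : Space → ℝ}
    (hf : ContinuousOn f {0}ᶜ) (hfT : ∀ p : Space, ‖p‖ = 1 → f p ≤ T) :
    volume ((fun w : Space => ray a T (w 2) (dir (w 0) (w 1))) ''
      {w | w 0 ∈ Icc 0 Real.pi ∧ w 1 ∈ Icc 0 (2 * Real.pi) ∧ w 2 ∈ Icc (f (dir (w 0) (w 1))) T}) ≤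
      ENNReal.ofReal (∫ p, (∫ r in f p..T, flux a T r p) ∂sph) := by
  have hfd : Continuous fun z : ℝ × ℝ => f (dir z.1 z.2) :=
    hf.comp_continuous continuous_dirMap fun z => ne_zero_of_norm (norm_dir _ _)
  set Z : Set (ℝ × ℝ × ℝ) := {z | z.2.1 ∈ Icc 0 Real.pi ∧ z.2.2 ∈ Icc 0 (2 * Real.pi) ∧
    z.1 ∈ Icc (f (dir z.2.1 z.2.2)) T}
  have hZ : MeasurableSet Z := by
    have hc1 : IsClosed Z := by
      refine (isClosed_Icc.preimage (by fun_prop)).inter ((isClosed_Icc.preimage (by fun_prop)).inter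
        ((isClosed_le (hfd.comp continuous_snd) continuous_fst).inter
          (isClosed_le continuous_fst continuous_const)))
    exact hc1.measurableSet
  have hfl : Continuous fun z : ℝ × ℝ × ℝ => flux a T z.1 (dir z.2.1 z.2.2) :=
    (continuousOn_flux_pair ha T).comp_continuous (continuous_fst.prodMk
      (continuous_dirMap.comp continuous_snd)) fun z => ⟨mem_univ _, ne_zero_of_norm (norm_dir _ _)⟩
  set g : ℝ × ℝ × ℝ → ENNReal := fun z =>
    ENNReal.ofReal |flux a T z.1 (dir z.2.1 z.2.2) * Real.sin z.2.1|
  have hg : Measurable g := by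
    refine (Continuous.measurable ?_).ennreal_ofReal
    exact (hfl.mul (by fun_prop)).abs
  choose L hL hdet using hasFDerivAt_cone ha T
  have hS : MeasurableSet (cyl ⁻¹' Z) := measurePreserving_cyl.measurable hZ
  refine (addHaar_image_le_lintegral_abs_det_fderiv volume hS
    fun w _ => (hL w).hasFDerivWithinAt).trans ?_
  have e1 : ∫⁻ w in cyl ⁻¹' Z, ENNReal.ofReal |(L w).det| = ∫⁻ z, Z.indicator g z := by
    rw [← measurePreserving_cyl.lintegral_comp (hg.indicator hZ), ← lintegral_indicator hS]
    refine lintegral_congr fun w => ?_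
    by_cases hw : w ∈ cyl ⁻¹' Z
    · rw [indicator_of_mem hw, indicator_of_mem (show cyl w ∈ Z from hw), hdet]
      rfl
    · rw [indicator_of_notMem hw, indicator_of_notMem (show cyl w ∉ Z from hw)]
  rw [e1, Measure.volume_eq_prod, lintegral_prod_symm' _ (hg.indicator hZ)]
  have hI := continuousOn_fluxInt ha T hf
  have hI0 : ∀ p : Space, ‖p‖ = 1 → 0 ≤ ∫ r in f p..T, flux a T r p := fun p hp =>
    intervalIntegral.integral_nonneg (hfT p hp) fun r hr => flux_nonneg hr.2 p
  rw [ofReal_integral_eq_lintegral_ofReal (integrable_sph hI)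
    (ae_sph_norm.mono fun p hp => hI0 p hp)]
  have hm := (aestronglyMeasurable_sph hI).aemeasurable.ennreal_ofReal
  unfold sph at hm ⊢
  rw [lintegral_map' hm measurable_dirMap.aemeasurable]
  unfold angleMeasure
  have hId : Continuous fun z : ℝ × ℝ => ∫ r in f (dirMap z)..T, flux a T r (dirMap z) :=
    hI.comp_continuous continuous_dirMap fun z => ne_zero_of_norm (norm_dir _ _)
  rw [lintegral_withDensity_eq_lintegral_mul _ (by fun_prop) hId.measurable.ennreal_ofReal,
    Measure.prod_restrict, ← Measure.volume_eq_prod,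
    ← lintegral_indicator (measurableSet_Ioc.prod measurableSet_Ioc)]
  refine lintegral_mono_ae ?_
  -- The angles at the lower ends form a null set, which reconciles the closed rectangle of the
  -- image with the half-open one of `angleMeasure`.
  have hz : ∀ᵐ z : ℝ × ℝ, z.1 ≠ 0 ∧ z.2 ≠ 0 := by
    have h0 : ∀ᵐ x : ℝ, x ≠ 0 := by simp [ae_iff]
    exact (Measure.quasiMeasurePreserving_fst.ae h0).and (Measure.quasiMeasurePreserving_snd.ae h0)
  filter_upwards [hz] with z hz0
  by_cases hzm : z.1 ∈ Icc 0 Real.pi ∧ z.2 ∈ Icc 0 (2 * Real.pi)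
  · rw [indicator_of_mem (show z ∈ Ioc 0 Real.pi ×ˢ Ioc 0 (2 * Real.pi) from
      ⟨⟨hzm.1.1.lt_of_ne' hz0.1, hzm.1.2⟩, ⟨hzm.2.1.lt_of_ne' hz0.2, hzm.2.2⟩⟩)]
    have hs := Real.sin_nonneg_of_nonneg_of_le_pi hzm.1.1 hzm.1.2
    have hn := norm_dir z.1 z.2
    have hle := hfT _ hn
    have e2 : ∀ t, Z.indicator g (t, z) = (Icc (f (dir z.1 z.2)) T).indicator (fun t =>
        ENNReal.ofReal (Real.sin z.1) * ENNReal.ofReal (flux a T t (dir z.1 z.2))) t := by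
      intro t
      by_cases ht : t ∈ Icc (f (dir z.1 z.2)) T
      · rw [indicator_of_mem ht, indicator_of_mem (show (t, z) ∈ Z from ⟨hzm.1, hzm.2, ht⟩)]
        simp only [g]
        rw [abs_of_nonneg (mul_nonneg (flux_nonneg ht.2 _) hs), mul_comm, ENNReal.ofReal_mul hs]
      · rw [indicator_of_notMem ht, indicator_of_notMem fun h => ht h.2.2]
    have hc := continuous_flux_left ha T (ne_zero_of_norm hn)
    simp only [e2]
    rw [lintegral_indicator measurableSet_Icc, lintegral_const_mul _ hc.measurable.ennreal_ofReal,
      Pi.mul_apply, ← restrict_Ioc_eq_restrict_Icc, dirMap, intervalIntegral.integral_of_le hle,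
      ofReal_integral_eq_lintegral_ofReal
        ((hc.integrableOn_Icc (a := f (dir z.1 z.2)) (b := T)).mono_set Ioc_subset_Icc_self)
        ((ae_restrict_mem measurableSet_Ioc).mono fun r hr => flux_nonneg hr.2 _)]
  · have e2 : ∀ t, Z.indicator g (t, z) = 0 := fun t =>
      indicator_of_notMem (fun h => hzm ⟨h.1, h.2.1⟩) _
    simp [e2]

theorem IsSlice.volume_enclosed_le {f : Space → ℝ} (h : M.IsSlice T f) :
    Integrable (fun p => ∫ r in f p..T, flux M.a T r p) sph ∧
      volume.real (M.enclosed T f) ≤ ∫ p, (∫ r in f p..T, flux M.a T r p) ∂sph := by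
  obtain ⟨t₀, h₀, hlow⟩ := h.exists_lower
  have ha := isScale_clamp h₀
  have hae : (fun p => ∫ r in f p..T, flux (M.clamp t₀) T r p) =ᵐ[sph]
      fun p => ∫ r in f p..T, flux M.a T r p := by
    filter_upwards [ae_sph_norm] with p hp
    have hT := ((hlow p hp).trans (h.lt hp)).le
    exact intervalIntegral.integral_congr fun r hr =>
      flux_clamp (le_of_mem_uIcc (hlow p hp).le hT hr) hT
  have hI := integrable_sph (continuousOn_fluxInt ha T h.smooth.continuousOn)
  refine ⟨hI.congr hae, ?_⟩
  rw [← integral_congr_ae hae]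
  refine ENNReal.toReal_le_of_le_ofReal (integral_nonneg_of_ae ?_) ?_
  · filter_upwards [ae_sph_norm] with p hp
    exact intervalIntegral.integral_nonneg (h.lt hp).le fun r hr => flux_nonneg hr.2 p
  refine (measure_mono ?_).trans (volume_image_cone_le ha T h.smooth.continuousOn
    fun p hp => (h.lt hp).le)
  rintro x ⟨p, hp, t, ht, rfl⟩
  obtain ⟨θ, hθ, φ, hφ, rfl⟩ := exists_dir (mem_sphere_zero_iff_norm.1 hp)
  have hl := hlow _ (mem_sphere_zero_iff_norm.1 hp)
  refine ⟨!₂[θ, φ, t], ⟨hθ, hφ, ht⟩, ?_⟩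
  rw [lightCone_eq (hl.le.trans ht.1) (hl.le.trans (ht.1.trans ht.2))]
  rfl

end BianchiI

namespace BianchiI

open Bianchi

/-! ### Generalized entropy per solid angle -/

/-- Contribution of the generator with direction `p` to the generalized entropy (times `4G`) of a
section of the light cone at time `t`. -/
def coneEnt (a : Fin 3 → ℝ → ℝ) (κ T t : ℝ) (p : Space) : ℝ :=
  dens a T t p + κ * ∫ r in t..T, flux a T r p

section scale

variable {a : Fin 3 → ℝ → ℝ} {κ t T T' : ℝ} {p : Space}

lemma hInt_nonneg (k : Fin 3) (h : t ≤ T) : 0 ≤ hInt a k t T p :=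
  intervalIntegral.integral_nonneg h fun _ _ => hk_nonneg k

lemma hInt_mono_right (ha : IsScale a) (hp : p ≠ 0) (k : Fin 3) (h : t ≤ T) (h' : T ≤ T') :
    hInt a k t T p ≤ hInt a k t T' p :=
  intervalIntegral.integral_mono_interval le_rfl h h'
    (.of_forall fun _ => hk_nonneg k) (intervalIntegrable_hk ha k hp _ _)

lemma flux_mono_right (ha : IsScale a) (hp : p ≠ 0) (h : t ≤ T) (h' : T ≤ T') :
    flux a T t p ≤ flux a T' t p :=
  mul_le_mul_of_nonneg_left (curv_mono (fun k => hInt_nonneg k h)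
    fun k => hInt_mono_right ha hp k h h') fq_nonneg

lemma dens_mono_right (ha : IsScale a) (hp : p ≠ 0) (h : t ≤ T) (h' : T ≤ T') :
    dens a T t p ≤ dens a T' t p := by
  rw [dens_eq_flux, dens_eq_flux]
  exact mul_le_mul_of_nonneg_left (flux_mono_right ha hp h h') (vol3_pos fun i => ha.pos i _).le

lemma dens_nonneg (ha : IsScale a) (h : t ≤ T) (p : Space) : 0 ≤ dens a T t p := by
  rw [dens_eq_flux]
  exact mul_nonneg (vol3_pos fun i => ha.pos i _).le (flux_nonneg h p)

lemma coneEnt_mono_right (ha : IsScale a) (hκ : 0 ≤ κ) (hp : p ≠ 0) (h : t ≤ T) (h' : T ≤ T') :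
    coneEnt a κ T t p ≤ coneEnt a κ T' t p := by
  refine add_le_add (dens_mono_right ha hp h h') (mul_le_mul_of_nonneg_left ?_ hκ)
  have hi := fun T x y => (continuous_flux_left ha T hp).intervalIntegrable (μ := volume) x y
  refine (intervalIntegral.integral_mono_on h (hi T _ _) (hi T' _ _) fun r hr =>
    flux_mono_right ha hp hr.2 h').trans ?_
  rw [← intervalIntegral.integral_add_adjacent_intervals (hi T' t T) (hi T' T T')]
  exact le_add_of_nonneg_right (intervalIntegral.integral_nonneg h' fun r hr => flux_nonneg hr.2 p)

lemma continuous_flux_times (ha : IsScale a) (hp : p ≠ 0) :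
    Continuous fun z : ℝ × ℝ => flux a z.2 z.1 p := by
  rw [← continuousOn_univ]
  exact (continuousOn_flux ha).comp (f := fun z : ℝ × ℝ => (z.1, z.2, p)) (by fun_prop)
    fun z _ => ⟨trivial, trivial, hp⟩

lemma continuous_dens_times (ha : IsScale a) (hp : p ≠ 0) :
    Continuous fun z : ℝ × ℝ => dens a z.2 z.1 p := by
  simp only [dens_eq_flux]
  exact ((continuous_vol3 ha).comp continuous_fst).mul (continuous_flux_times ha hp)

lemma continuous_coneEnt (ha : IsScale a) (κ : ℝ) (hp : p ≠ 0) :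
    Continuous fun z : ℝ × ℝ => coneEnt a κ z.2 z.1 p := by
  refine (continuous_dens_times ha hp).add (continuous_const.mul ?_)
  have hf : Continuous (Function.uncurry fun (z : ℝ × ℝ) r => flux a z.2 r p) :=
    (continuous_flux_times ha hp).comp (g := fun z : ℝ × ℝ => flux a z.2 z.1 p)
      (f := fun w : (ℝ × ℝ) × ℝ => (w.2, w.1.2)) (by fun_prop)
  have h := fun (s : ℝ × ℝ → ℝ) (hs : Continuous s) =>
    intervalIntegral.continuous_parametric_intervalIntegral_of_continuous (μ := volume)
      (a₀ := 0) hf hs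
  refine ((h _ continuous_snd).sub (h _ continuous_fst)).congr fun z => ?_
  exact intervalIntegral.integral_interval_sub_left
    ((continuous_flux_left ha _ hp).intervalIntegrable _ _)
    ((continuous_flux_left ha _ hp).intervalIntegrable _ _)

/-- Under marginality the growth of the area density exactly compensates the loss of enclosed matter
entropy. -/
lemma hasDerivAt_coneEnt (ha : IsScale a) (hp : p ≠ 0)
    (hd : HasDerivAt (fun t => dens a T t p) (κ * flux a T t p) t) :
    HasDerivAt (fun t => coneEnt a κ T t p) 0 t := by
  have hc := continuous_flux_left ha T hp
  have := hd.add ((intervalIntegral.integral_hasDerivAt_left (hc.intervalIntegrable t T)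
    (hc.stronglyMeasurableAtFilter _ _) hc.continuousAt).const_mul κ)
  refine this.congr_deriv ?_
  ring

end scale

lemma coneEnt_clamp {M : BianchiI} {κ t₀ t T : ℝ} {p : Space} (ht : t₀ ≤ t) (hT : t₀ ≤ T) :
    coneEnt (M.clamp t₀) κ T t p = coneEnt M.a κ T t p := by
  unfold coneEnt
  rw [dens_clamp ht hT, intervalIntegral.integral_congr fun r hr =>
    flux_clamp (M := M) (p := p) (le_of_mem_uIcc ht hT hr) hT]

/-- The properties of a screen that determine the asymptotics of spacetime. -/
structure LateScreen (M : BianchiI) (κ L T₀ t₀ : ℝ) (τ : ℝ → Space → ℝ) : Prop where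
  nonneg : 0 ≤ κ
  dom : M.ti < (t₀ : WithBot ℝ)
  slice : ∀ T > T₀, M.IsSlice T (τ T)
  diff : ∀ T > T₀, ∀ p : Space, ‖p‖ = 1 → DifferentiableAt ℝ (fun T => τ T p) T
  marginal : ∀ T > T₀, ∀ p : Space, ‖p‖ = 1 →
    HasDerivAt (fun t => dens M.a T t p) (κ * flux M.a T (τ T p) p) (τ T p)
  late : ∀ p : Space, ‖p‖ = 1 → Tendsto (fun T => τ T p) atTop atTop
  top : ∀ i, Tendsto (M.a i) atTop atTop
  mono : ∀ i, MonotoneOn (M.a i) (Ici t₀)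
  cut : ∀ T > T₀, ∀ t ≥ t₀, t < T → ∫ p, dens M.a T t p ∂sph ≤ L
  ent : ∀ l < L, ∀ᶠ T in atTop, l < ∫ p, coneEnt M.a κ T (τ T p) p ∂sph

namespace LateScreen

variable {M : BianchiI} {κ L T₀ t₀ : ℝ} {τ : ℝ → Space → ℝ} {p : Space}

lemma mem (h : LateScreen M κ L T₀ t₀ τ) {T : ℝ} (hT : T₀ < T) (hp : ‖p‖ = 1) :
    M.ti < (τ T p : WithBot ℝ) ∧ τ T p < T :=
  (h.slice T hT).mem p (by simpa using hp)

/-- The entropy of the leaves increases along each direction. -/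
theorem coneEnt_mono (h : LateScreen M κ L T₀ t₀ τ) (hp : ‖p‖ = 1) {T₁ T₂ : ℝ} (hT : T₀ < T₁)
    (hT' : T₁ ≤ T₂) : coneEnt M.a κ T₁ (τ T₁ p) p ≤ coneEnt M.a κ T₂ (τ T₂ p) p := by
  have hp0 := ne_zero_of_norm hp
  have hτc : ContinuousOn (fun T => τ T p) (Icc T₁ T₂) := fun T hT3 =>
    (h.diff T (hT.trans_le hT3.1) p hp).continuousAt.continuousWithinAt
  -- The earliest time reached by the generator on the compact interval of tip times serves as the
  -- freezing time.
  obtain ⟨Tm, hTm, hmin⟩ := isCompact_Icc.exists_isMinOn (nonempty_Icc.2 hT') hτc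
  have hTm' := h.mem (p := p) (hT.trans_le hTm.1) hp
  set t₁ := τ Tm p
  have hle : ∀ T ∈ Icc T₁ T₂, t₁ ≤ τ T p := fun T hT3 => hmin hT3
  have hle' : ∀ T ∈ Icc T₁ T₂, t₁ ≤ T := fun T hT3 =>
    (hle T hT3).trans (h.mem (hT.trans_le hT3.1) hp).2.le
  have ha := isScale_clamp hTm'.1
  have hcont : ContinuousOn (fun T => -coneEnt M.a κ T (τ T p) p) (Icc T₁ T₂) := by
    refine ContinuousOn.neg ?_
    refine ((continuous_coneEnt ha κ hp0).comp_continuousOn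
      (hτc.prodMk continuousOn_id)).congr fun T hT3 => ?_
    exact (coneEnt_clamp (hle T hT3) (hle' T hT3)).symm
  have key := image_le_of_liminf_slope_right_le_deriv_boundary (f := fun T =>
    -coneEnt M.a κ T (τ T p) p) (a := T₁) (b := T₂) hcont
    (B := fun _ => -coneEnt M.a κ T₁ (τ T₁ p) p) (B' := fun _ => 0) le_rfl continuousOn_const
    (fun x _ => (hasDerivAt_const _ _).hasDerivWithinAt) (fun x hx => ?_) ⟨hT', le_rfl⟩
  · exact neg_le_neg_iff.1 key
  intro r hr
  have hx0 : T₀ < x := hT.trans_le hx.1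
  have hm := h.mem hx0 hp
  obtain ⟨y, hy, hyx⟩ := M.exists_domain_lt hm.1
  -- With the tip held fixed the entropy is stationary. Moving the tip as well only increases it, so
  -- right slopes have nonnegative lower limit; differentiability in the tip time is not required.
  have hd : HasDerivAt (fun z => coneEnt M.a κ x (τ z p) p) 0 x := by
    have h1 : HasDerivAt (fun t => coneEnt (M.clamp y) κ x t p) 0 (τ x p) := by
      refine hasDerivAt_coneEnt (isScale_clamp hy) hp0 ?_
      rw [flux_clamp hyx.le (hyx.trans hm.2).le]
      refine (h.marginal x hx0 p hp).congr_of_eventuallyEq ?_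
      filter_upwards [Ioi_mem_nhds hyx] with t ht
      exact dens_clamp (le_of_lt ht) (hyx.trans hm.2).le
    have h2 : HasDerivAt (fun t => coneEnt M.a κ x t p) 0 (τ x p) := by
      refine h1.congr_of_eventuallyEq ?_
      filter_upwards [Ioi_mem_nhds hyx] with t ht
      exact (coneEnt_clamp (le_of_lt ht) (hyx.trans hm.2).le).symm
    exact (HasDerivAt.comp x (h := fun z => τ z p) (h₂ := fun t => coneEnt M.a κ x t p) h2
      (h.diff x hx0 p hp).hasDerivAt).congr_deriv (zero_mul _)
  have hd' : HasDerivAt (fun z => -coneEnt M.a κ x (τ z p) p) 0 x  :=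
    hd.fun_neg.congr_deriv neg_zero
  have hs : ∀ᶠ z in 𝓝[>] x, slope (fun z => -coneEnt M.a κ x (τ z p) p) x z < r :=
    ((hasDerivAt_iff_tendsto_slope.1 hd').mono_left
      (nhdsWithin_mono _ fun z hz => ne_of_gt hz)).eventually_lt_const hr
  have hτx : ∀ᶠ z in 𝓝[>] x, τ z p ∈ Ioo y x :=
    nhdsWithin_le_nhds ((h.diff x hx0 p hp).continuousAt.eventually_mem
      (Ioo_mem_nhds hyx hm.2))
  refine Eventually.frequently ?_
  filter_upwards [hs, hτx, self_mem_nhdsWithin] with z hz hτz hxz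
  have hxz' : x < z := hxz
  refine lt_of_le_of_lt ?_ hz
  rw [slope_def_field, slope_def_field]
  refine div_le_div_of_nonneg_right (sub_le_sub_right (neg_le_neg ?_) _) (by linarith)
  rw [← coneEnt_clamp (M := M) hτz.1.le (hτz.1.trans hτz.2).le,
    ← coneEnt_clamp (M := M) hτz.1.le (by linarith [hτz.1, hτz.2] : y ≤ z)]
  exact coneEnt_mono_right (isScale_clamp hy) h.nonneg hp0 hτz.2.le hxz'.le

end LateScreen

end BianchiI

namespace BianchiI

open Bianchi

/-! ### Passage to tips at infinity. -/

section scale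

variable {a : Fin 3 → ℝ → ℝ} {t T : ℝ} {p : Space}

lemma continuousOn_dens (ha : IsScale a) (T t : ℝ) : ContinuousOn (fun p => dens a T t p) {0}ᶜ :=
  continuousOn_dens_slice ha T (f := fun _ => t) continuousOn_const

lemma exists_near {q : Space} (hp : ∀ i, p i ≠ 0) (hq : ∀ i, q i ≠ 0) : ∃ θ > 0, Near θ p q := by
  have hs : ∀ i, |q i| / |p i| ≤ ∑ i, (|q i| / |p i| + |p i| / |q i|) ∧
      |p i| / |q i| ≤ ∑ i, (|q i| / |p i| + |p i| / |q i|) := fun i => by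
    have := Finset.single_le_sum (f := fun i => |q i| / |p i| + |p i| / |q i|)
      (fun i _ => by positivity) (Finset.mem_univ i)
    have h1 : 0 ≤ |q i| / |p i| := by positivity
    have h2 : 0 ≤ |p i| / |q i| := by positivity
    constructor <;> linarith
  refine ⟨_, lt_of_lt_of_le ?_ (hs 0).1, fun i => ⟨?_, ?_⟩⟩
  · exact div_pos (abs_pos.2 (hq 0)) (abs_pos.2 (hp 0))
  · exact (div_le_iff₀ (abs_pos.2 (hp i))).1 (hs i).1
  · exact (div_le_iff₀ (abs_pos.2 (hq i))).1 (hs i).2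

/-- If the density of a section stays bounded as the tip moves to infinity, then so do the
Hessian weights. -/
lemma integrableOn_hk_of_bound (ha : IsScale a) (hp : ∀ i, p i ≠ 0) {C : ℝ} {u : ℕ → ℝ}
    (hu : Tendsto u atTop atTop) (hut : ∀ n, t < u n) (hum : ∀ n, u 0 ≤ u n)
    (hC : ∀ n, dens a (u n) t p ≤ C)
    (k : Fin 3) : IntegrableOn (fun r => hk a k r p) (Ioi t) := by
  have hp0 := ne_zero_of_generic hp
  have hv := vol3_pos fun i => ha.pos i t
  have hf := fq_pos (fun i => ha.pos i t) hp0
  have hm0 : 0 < hInt a (k + 1) t (u 0) p :=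
    intervalIntegral.intervalIntegral_pos_of_pos (intervalIntegrable_hk ha _ hp0 _ _)
      (fun r => hk_pos (fun i => ha.pos i r) hp0 _) (hut 0)
  have hp2 : 0 < p (k + 2) ^ 2 := by have := hp (k + 2); positivity
  refine integrableOn_Ioi_of_intervalIntegral_norm_bounded
    (C / (vol3 a t * fq a t p * p (k + 2) ^ 2 * hInt a (k + 1) t (u 0) p)) t
    (fun n => ((continuous_hk_left ha k hp0).integrableOn_Icc).mono_set Ioc_subset_Icc_self)
    hu (.of_forall fun n => ?_)
  simp only [Real.norm_of_nonneg (hk_nonneg k)]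
  change hInt a k t (u n) p ≤ _
  rw [le_div_iff₀ (by positivity)]
  refine le_trans ?_ (hC n)
  -- `curv` contains the product of the weights `k` and `k + 1` with coefficient `p (k+2)²`. The
  -- second weight stays above its initial positive value, so a bounded density bounds the first.
  have h1 : p (k + 2) ^ 2 * (hInt a k t (u n) p * hInt a (k + 1) t (u n) p) ≤
      curv (fun k => hInt a k t (u n) p) p := by
    have := Finset.single_le_sum (f := fun n' => p n' ^ 2 * (hInt a (n' + 1) t (u n) p *
      hInt a (n' + 2) t (u n) p)) (fun i _ => mul_nonneg (sq_nonneg _) (mul_nonneg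
        (hInt_nonneg _ (hut n).le) (hInt_nonneg _ (hut n).le))) (Finset.mem_univ (k + 2))
    rwa [show k + 2 + 1 = k by fin_cases k <;> rfl,
      show k + 2 + 2 = k + 1 by fin_cases k <;> rfl] at this
  have h2 := hInt_mono_right ha hp0 (k + 1) (hut 0).le (hum n)
  calc _ = vol3 a t * fq a t p * (p (k + 2) ^ 2 *
        (hInt a k t (u n) p * hInt a (k + 1) t (u 0) p)) := by ring
    _ ≤ vol3 a t * fq a t p * (p (k + 2) ^ 2 *
        (hInt a k t (u n) p * hInt a (k + 1) t (u n) p)) := by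
      gcongr
      exact hInt_nonneg k (hut n).le
    _ ≤ _ := mul_le_mul_of_nonneg_left h1 (by positivity)

lemma tendsto_hInt (hT : TailIntegrable a) (hp : ∀ i, p i ≠ 0) (k : Fin 3) (t : ℝ) :
    Tendsto (fun T => hInt a k t T p) atTop (𝓝 (hTail a k t p)) :=
  intervalIntegral_tendsto_integral_Ioi t (hT p hp k t) tendsto_id

lemma hInt_le_hTail (hT : TailIntegrable a) (hp : ∀ i, p i ≠ 0) (k : Fin 3) (h : t ≤ T) :
    hInt a k t T p ≤ hTail a k t p := by
  rw [hInt, intervalIntegral.integral_of_le h]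
  exact setIntegral_mono_set (hT p hp k t) (.of_forall fun _ => hk_nonneg k)
    Ioc_subset_Ioi_self.eventuallyLE

lemma flux_le_tail (hT : TailIntegrable a) (hp : ∀ i, p i ≠ 0) (h : t ≤ T) :
    flux a T t p ≤ fq a t p * curvTail a t p :=
  mul_le_mul_of_nonneg_left (curv_mono (fun k => hInt_nonneg k h)
    fun k => hInt_le_hTail hT hp k h) fq_nonneg

lemma densTail_eq_mul (a : Fin 3 → ℝ → ℝ) (t : ℝ) (p : Space) :
    densTail a t p = vol3 a t * (fq a t p * curvTail a t p) := mul_assoc _ _ _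

lemma dens_le_densTail (ha : IsScale a) (hT : TailIntegrable a) (hp : ∀ i, p i ≠ 0) (h : t ≤ T) :
    dens a T t p ≤ densTail a t p := by
  rw [dens_eq_flux, densTail_eq_mul]
  exact mul_le_mul_of_nonneg_left (flux_le_tail hT hp h) (vol3_pos fun i => ha.pos i _).le

lemma tendsto_dens (hT : TailIntegrable a) (hp : ∀ i, p i ≠ 0) (t : ℝ) :
    Tendsto (fun T => dens a T t p) atTop (𝓝 (densTail a t p)) :=
  (tendsto_finsetSum _ fun _ _ => ((tendsto_hInt hT hp _ t).mul
    (tendsto_hInt hT hp _ t)).const_mul _).const_mul _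

lemma measurable_densTail (ha : IsScale a) :
    Measurable fun z : ℝ × Space => densTail a z.1 z.2 := by
  have hh : ∀ k, Measurable fun z : ℝ × Space => hTail a k z.1 z.2 := fun k => by
    have : (fun z : ℝ × Space => hTail a k z.1 z.2) =
        fun z => ∫ r, {w : (ℝ × Space) × ℝ | w.1.1 < w.2}.indicator
          (fun w => hk a k w.2 w.1.2) (z, r) := by
      funext z
      rw [hTail, ← integral_indicator measurableSet_Ioi]
      rfl
    rw [this]
    refine (StronglyMeasurable.integral_prod_right' (f := {w : (ℝ × Space) × ℝ |
      w.1.1 < w.2}.indicator (fun w => hk a k w.2 w.1.2)) ?_).measurable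
    refine (Measurable.indicator ?_ (measurableSet_lt (by fun_prop) (by fun_prop))).stronglyMeasurable
    exact (measurable_hk ha k).comp (f := fun w : (ℝ × Space) × ℝ => (w.2, w.1.2)) (by fun_prop)
  have hv : Measurable fun z : ℝ × Space => vol3 a z.1 :=
    (continuous_vol3 ha).measurable.comp measurable_fst
  refine (hv.mul (measurable_fq ha)).mul (f := fun z : ℝ × Space => vol3 a z.1 * fq a z.1 z.2)
    (g := fun z : ℝ × Space => ∑ n, z.2 n ^ 2 * (hTail a (n + 1) z.1 z.2 * hTail a (n + 2) z.1 z.2))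
    (Finset.measurable_fun_sum _ fun n _ => ?_)
  have hn : Measurable fun z : ℝ × Space => z.2 n := by fun_prop
  exact (hn.pow_const 2).mul ((hh _).mul (hh _))

end scale

namespace LateScreen

variable {M : BianchiI} {κ L T₀ t₀ : ℝ} {τ : ℝ → Space → ℝ} {p : Space} {t : ℝ}

lemma scale (h : LateScreen M κ L T₀ t₀ τ) : IsScale (M.clamp t₀) := isScale_clamp h.dom

lemma clamp_mono (h : LateScreen M κ L T₀ t₀ τ) (i : Fin 3) : Monotone (M.clamp t₀ i) :=
  fun _ _ hxy => h.mono i (mem_Ici.2 (le_max_right _ _)) (mem_Ici.2 (le_max_right _ _)) (max_le_max_right _ hxy)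

lemma lintegral_dens_le (h : LateScreen M κ L T₀ t₀ τ) (ht : t₀ ≤ t) {T : ℝ} (hT : T₀ < T)
    (htT : t < T) : ∫⁻ p, ENNReal.ofReal (dens (M.clamp t₀) T t p) ∂sph ≤ ENNReal.ofReal L := by
  rw [← ofReal_integral_eq_lintegral_ofReal (integrable_sph (continuousOn_dens h.scale T t))
    (.of_forall (dens_nonneg h.scale htT.le))]
  refine ENNReal.ofReal_le_ofReal ((le_of_eq ?_).trans (h.cut T hT t ht htT))
  exact integral_congr_ae (.of_forall fun p => dens_clamp ht (ht.trans htT.le))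

/-- A sequence of tip times. -/
def tip (T₀ t : ℝ) (n : ℕ) : ℝ := max T₀ t + 1 + n

lemma lt_tip (T₀ t : ℝ) (n : ℕ) : T₀ < tip T₀ t n ∧ t < tip T₀ t n := by
  have := le_max_left T₀ t
  have := le_max_right T₀ t
  have : (0 : ℝ) ≤ n := n.cast_nonneg
  unfold tip
  constructor <;> linarith

lemma tip_mono (T₀ t : ℝ) : Monotone (tip T₀ t) := fun m n h => by
  unfold tip
  gcongr

lemma tendsto_tip (T₀ t : ℝ) : Tendsto (tip T₀ t) atTop atTop :=
  tendsto_atTop_add_const_left _ _ tendsto_natCast_atTop_atTop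

/-- The areas of a fixed-time slice are bounded by `L` for all tips, so by monotone convergence the
densities stay bounded in almost every direction. One such generic direction gives integrable
weights, and `Near` carries this to all generic directions. -/
theorem tailIntegrable (h : LateScreen M κ L T₀ t₀ τ) : TailIntegrable (M.clamp t₀) := by
  have ha := h.scale
  have hle : ∫⁻ p, ⨆ n, ENNReal.ofReal (dens (M.clamp t₀) (tip T₀ t₀ n) t₀ p) ∂sph ≤
      ENNReal.ofReal L := by
    rw [lintegral_iSup' (fun n => (aestronglyMeasurable_sph
      (continuousOn_dens ha _ _)).aemeasurable.ennreal_ofReal)]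
    · exact iSup_le fun n => h.lintegral_dens_le le_rfl (lt_tip _ _ n).1 (lt_tip _ _ n).2
    · filter_upwards [ae_sph_norm] with p hp m n hmn
      exact ENNReal.ofReal_le_ofReal (dens_mono_right ha (ne_zero_of_norm hp) (lt_tip _ _ m).2.le
        (tip_mono _ _ hmn))
  have hfin := ae_lt_top' (AEMeasurable.iSup fun n => (aestronglyMeasurable_sph
    (continuousOn_dens ha (tip T₀ t₀ n) t₀)).aemeasurable.ennreal_ofReal)
    (hle.trans_lt ENNReal.ofReal_lt_top).ne
  have : NeBot (ae sph) := ae_neBot.2 TailLimit.sph_ne_zero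
  obtain ⟨p, hp1, hp⟩ := (hfin.and ae_sph_coord_ne).exists
  have hb : ∀ n, dens (M.clamp t₀) (tip T₀ t₀ n) t₀ p ≤
      (⨆ n, ENNReal.ofReal (dens (M.clamp t₀) (tip T₀ t₀ n) t₀ p)).toReal := fun n =>
    (ENNReal.ofReal_le_iff_le_toReal hp1.ne).1
      (le_iSup (fun n => ENNReal.ofReal (dens (M.clamp t₀) (tip T₀ t₀ n) t₀ p)) n)
  intro q hq k t
  obtain ⟨θ, hθ, hn⟩ := exists_near hp hq
  have hcq := continuous_hk_left ha k (ne_zero_of_generic hq)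
  have h1 : IntegrableOn (fun r => hk (M.clamp t₀) k r q) (Ioi t₀) := by
    refine ((integrableOn_hk_of_bound ha hp (tendsto_tip T₀ t₀) (fun n => (lt_tip _ _ n).2)
      (fun n => tip_mono _ _ n.zero_le) hb k).const_mul (θ ^ 3)).mono'
      hcq.aestronglyMeasurable (.of_forall fun r => ?_)
    rw [Real.norm_of_nonneg (hk_nonneg k)]
    exact hn.hk_le ha hθ (ne_zero_of_generic hp) (ne_zero_of_generic hq) k
  refine ((hcq.integrableOn_Icc (a := t) (b := t₀)).union h1).mono_set fun r hr => ?_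
  rcases le_or_gt r t₀ with h2 | h2
  · exact .inl ⟨le_of_lt hr, h2⟩
  · exact .inr h2

lemma lintegral_densTail_le (h : LateScreen M κ L T₀ t₀ τ) (ht : t₀ ≤ t) :
    ∫⁻ p, ENNReal.ofReal (densTail (M.clamp t₀) t p) ∂sph ≤ ENNReal.ofReal L := by
  have ha := h.scale
  refine le_of_tendsto' (lintegral_tendsto_of_tendsto_of_monotone
    (f := fun n p => ENNReal.ofReal (dens (M.clamp t₀) (tip T₀ t n) t p))
    (fun n => (aestronglyMeasurable_sph (continuousOn_dens ha _ _)).aemeasurable.ennreal_ofReal)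
    ?_ ?_) fun n => h.lintegral_dens_le ht (lt_tip _ _ n).1 (lt_tip _ _ n).2
  · filter_upwards [ae_sph_norm] with p hp m n hmn
    exact ENNReal.ofReal_le_ofReal (dens_mono_right ha (ne_zero_of_norm hp) (lt_tip _ _ m).2.le
      (tip_mono _ _ hmn))
  · filter_upwards [ae_sph_coord_ne] with p hp
    exact (ENNReal.continuous_ofReal.tendsto _).comp
      ((tendsto_dens h.tailIntegrable hp t).comp (tendsto_tip T₀ t))

lemma densTail_nonneg (h : LateScreen M κ L T₀ t₀ τ) (t : ℝ) (p : Space) :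
    0 ≤ densTail (M.clamp t₀) t p :=
  mul_nonneg (mul_nonneg (vol3_pos fun i => h.scale.pos i t).le fq_nonneg)
    (curvTail_nonneg t)

lemma integrable_densTail (h : LateScreen M κ L T₀ t₀ τ) (ht : t₀ ≤ t) :
    Integrable (densTail (M.clamp t₀) t) sph := by
  have hm : Measurable (densTail (M.clamp t₀) t) :=
    (measurable_densTail h.scale).comp (f := fun p => (t, p)) (by fun_prop)
  refine ⟨hm.aestronglyMeasurable, ?_⟩
  rw [hasFiniteIntegral_iff_ofReal (.of_forall (h.densTail_nonneg t))]
  exact (h.lintegral_densTail_le ht).trans_lt ENNReal.ofReal_lt_top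

/-- The total flux at time `r` is the area divided by `vol3`, hence at most `L / vol3`, which is
integrable in `r`; Fubini gives the claim for almost every direction. -/
lemma ae_integrable_flux (h : LateScreen M κ L T₀ t₀ τ) : ∀ᵐ p ∂sph,
    IntegrableOn (fun r => fq (M.clamp t₀) r p * curvTail (M.clamp t₀) r p) (Ioi t₀) := by
  set a := M.clamp t₀
  have ha : IsScale a := h.scale
  have hv := fun r => vol3_pos fun i => ha.pos i r
  have hm : Measurable fun z : ℝ × Space => (vol3 a z.1)⁻¹ * densTail a z.1 z.2 :=
    ((continuous_vol3 ha).measurable.comp measurable_fst).inv.mul (measurable_densTail ha)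
  have hI : Integrable (fun z : ℝ × Space => (vol3 a z.1)⁻¹ * densTail a z.1 z.2)
      ((volume.restrict (Ioi t₀)).prod sph) := by
    refine ⟨hm.aestronglyMeasurable, ?_⟩
    rw [hasFiniteIntegral_iff_ofReal (.of_forall fun z => mul_nonneg (inv_nonneg.2 (hv _).le)
      (h.densTail_nonneg _ _)), lintegral_prod _ hm.ennreal_ofReal.aemeasurable]
    have hvi := TailLimit.integrableOn_inv_vol3_of ha h.clamp_mono h.tailIntegrable t₀
    refine lt_of_le_of_lt (setLIntegral_mono' (g := fun r =>
      ENNReal.ofReal (vol3 a r)⁻¹ * ENNReal.ofReal L) measurableSet_Ioi fun r hr => ?_) ?_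
    · simp only [ENNReal.ofReal_mul (inv_nonneg.2 (hv r).le)]
      rw [lintegral_const_mul' _ _ ENNReal.ofReal_ne_top]
      gcongr
      exact h.lintegral_densTail_le (le_of_lt hr)
    · rw [lintegral_mul_const' _ _ ENNReal.ofReal_ne_top]
      refine ENNReal.mul_lt_top ?_ ENNReal.ofReal_lt_top
      exact (hasFiniteIntegral_iff_ofReal (.of_forall fun r => inv_nonneg.2 (hv r).le)).1 hvi.2
  filter_upwards [((integrable_prod_iff' hm.aestronglyMeasurable).1 hI).1] with p hp
  refine hp.congr (.of_forall fun r => ?_)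
  simp only [densTail_eq_mul]
  have := (hv r).ne'
  field_simp

end LateScreen

end BianchiI

namespace BianchiI

open Bianchi

/-! ### The limiting entropy density. -/

namespace LateScreen

variable {M : BianchiI} {κ L T₀ t₀ : ℝ} {τ : ℝ → Space → ℝ} {p : Space} {t : ℝ}

/-- Entropy of the leaf with tip time `T` per solid angle. -/
def leafEnt (M : BianchiI) (κ : ℝ) (τ : ℝ → Space → ℝ) (T : ℝ) (p : Space) : ℝ :=
  coneEnt M.a κ T (τ T p) p

/-- Entropy of matter per solid angle on a light cone that extends to future infinity. -/
def matterTail (M : BianchiI) (t₀ κ t : ℝ) (p : Space) : ℝ :=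
  κ * ∫ r in Ioi t, fq (M.clamp t₀) r p * curvTail (M.clamp t₀) r p

/-- Directions for which the tail integrals behave well. -/
def IsGood (M : BianchiI) (t₀ : ℝ) (p : Space) : Prop := ‖p‖ = 1 ∧ (∀ i, p i ≠ 0) ∧
  IntegrableOn (fun r => fq (M.clamp t₀) r p * curvTail (M.clamp t₀) r p) (Ioi t₀)

lemma ae_isGood (h : LateScreen M κ L T₀ t₀ τ) : ∀ᵐ p ∂sph, IsGood M t₀ p := by
  filter_upwards [ae_sph_norm, ae_sph_coord_ne, h.ae_integrable_flux] with p h1 h2 h3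
  exact ⟨h1, h2, h3⟩

lemma integrable_leafEnt (h : LateScreen M κ L T₀ t₀ τ) {T : ℝ} (hT : T₀ < T) :
    Integrable (leafEnt M κ τ T) sph :=
  (h.slice T hT).integrable_dens.1.add ((h.slice T hT).volume_enclosed_le.1.const_mul κ)

lemma leafEnt_pos (h : LateScreen M κ L T₀ t₀ τ) {T : ℝ} (hT : T₀ < T) (hp : ‖p‖ = 1) :
    0 < leafEnt M κ τ T p := by
  have hm := h.mem hT hp
  refine add_pos_of_pos_of_nonneg (dens_pos hm.1 hm.2 (ne_zero_of_norm hp)) (mul_nonneg h.nonneg ?_)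
  exact intervalIntegral.integral_nonneg hm.2.le fun r hr => flux_nonneg hr.2 p

lemma tendsto_matterTail (hp : IsGood M t₀ p) :
    Tendsto (fun t => matterTail M t₀ κ t p) atTop (𝓝 0) := by
  simpa [matterTail] using (tendsto_tail hp.2.2).const_mul κ

lemma matter_le_tail (h : LateScreen M κ L T₀ t₀ τ) (hp : IsGood M t₀ p) {T : ℝ} (ht : t₀ ≤ t)
    (htT : t ≤ T) : κ * ∫ r in t..T, flux (M.clamp t₀) T r p ≤ matterTail M t₀ κ t p := by
  have hp0 := ne_zero_of_norm hp.1
  refine mul_le_mul_of_nonneg_left ?_ h.nonneg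
  have hi : IntegrableOn (fun r => fq (M.clamp t₀) r p * curvTail (M.clamp t₀) r p) (Ioi t) :=
    hp.2.2.mono_set (Ioi_subset_Ioi ht)
  rw [intervalIntegral.integral_of_le htT]
  refine (setIntegral_mono_on ((continuous_flux_left h.scale T hp0).integrableOn_Icc.mono_set
    Ioc_subset_Icc_self) (hi.mono_set Ioc_subset_Ioi_self) measurableSet_Ioc fun r hr =>
      flux_le_tail h.tailIntegrable hp.2.1 hr.2).trans ?_
  exact setIntegral_mono_set hi (.of_forall fun r => mul_nonneg fq_nonneg (curvTail_nonneg _))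
    Ioc_subset_Ioi_self.eventuallyLE

/-- The entropy of a leaf is bounded by that of late sections of the limiting light cone. -/
lemma leafEnt_le (h : LateScreen M κ L T₀ t₀ τ) (hp : IsGood M t₀ p) {T : ℝ} (hT : T₀ < T) :
    ∀ᶠ t in atTop, leafEnt M κ τ T p ≤ densTail (M.clamp t₀) t p + matterTail M t₀ κ t p := by
  filter_upwards [eventually_ge_atTop t₀, eventually_ge_atTop (τ T p)] with t ht ht'
  have hc : ContinuousOn (fun T => τ T p) (Ici T) := fun T' hT' =>
    (h.diff T' (hT.trans_le hT') p hp.1).continuousAt.continuousWithinAt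
  -- By continuity a later leaf meets this generator direction exactly at time `t`; monotonicity in
  -- the fixed direction compares the two leaves.
  obtain ⟨T', hT', rfl⟩ : ∃ T' ∈ Ici T, τ T' p = t := by
    obtain ⟨T2, h2, h3⟩ := ((h.late p hp.1).eventually_ge_atTop t).and
      (eventually_ge_atTop T) |>.exists
    obtain ⟨T', h4, h5⟩ := intermediate_value_Icc h3 (hc.mono Icc_subset_Ici_self) ⟨ht', h2⟩
    exact ⟨T', h4.1, h5⟩
  have hlt := (h.mem (hT.trans_le hT') hp.1).2
  refine (h.coneEnt_mono hp.1 hT hT').trans ?_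
  rw [← coneEnt_clamp ht (ht.trans hlt.le)]
  exact add_le_add (dens_le_densTail h.scale h.tailIntegrable hp.2.1 hlt.le)
    (h.matter_le_tail hp ht hlt.le)

/-- Limit of the entropy of the leaves in a given direction. -/
def limEntE (M : BianchiI) (κ T₀ : ℝ) (τ : ℝ → Space → ℝ) (p : Space) : ENNReal :=
  ⨆ n, ENNReal.ofReal (leafEnt M κ τ (tip T₀ T₀ n) p)

/-- Limit of the entropy of the leaves in a given direction. -/
def limEnt (M : BianchiI) (κ T₀ : ℝ) (τ : ℝ → Space → ℝ) (p : Space) : ℝ :=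
  (limEntE M κ T₀ τ p).toReal

lemma aemeasurable_limEntE (h : LateScreen M κ L T₀ t₀ τ) : AEMeasurable (limEntE M κ T₀ τ) sph :=
  AEMeasurable.iSup fun n => (h.integrable_leafEnt (lt_tip T₀ T₀ n).1).1.aemeasurable.ennreal_ofReal

/-- The matter tail vanishes, so the limiting leaf entropy is at most the lower limit of the section
densities. Fatou's lemma bounds its integral by `L`. -/
lemma lintegral_limEntE_le (h : LateScreen M κ L T₀ t₀ τ) :
    ∫⁻ p, limEntE M κ T₀ τ p ∂sph ≤ ENNReal.ofReal L := by
  have h1 : ∀ᵐ p ∂sph, limEntE M κ T₀ τ p ≤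
      liminf (fun n => ENNReal.ofReal (densTail (M.clamp t₀) (tip t₀ t₀ n) p)) atTop := by
    filter_upwards [h.ae_isGood] with p hp
    refine iSup_le fun n => ?_
    have h2 : Tendsto (fun m => ENNReal.ofReal (leafEnt M κ τ (tip T₀ T₀ n) p -
        matterTail M t₀ κ (tip t₀ t₀ m) p)) atTop
        (𝓝 (ENNReal.ofReal (leafEnt M κ τ (tip T₀ T₀ n) p))) := by
      refine (ENNReal.continuous_ofReal.tendsto _).comp ?_
      simpa using ((tendsto_matterTail (κ := κ) hp).comp (tendsto_tip t₀ t₀)).const_sub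
        (leafEnt M κ τ (tip T₀ T₀ n) p)
    rw [← h2.liminf_eq]
    refine liminf_le_liminf ?_
    filter_upwards [(tendsto_tip t₀ t₀).eventually (h.leafEnt_le hp (lt_tip T₀ T₀ n).1)] with m h4
    exact ENNReal.ofReal_le_ofReal (by linarith)
  refine (lintegral_mono_ae h1).trans ((lintegral_liminf_le' fun n => ?_).trans ?_)
  · exact (h.integrable_densTail (lt_tip t₀ t₀ n).1.le).1.aemeasurable.ennreal_ofReal
  · refine (liminf_le_liminf (v := fun _ => ENNReal.ofReal L) (.of_forall fun n =>
      h.lintegral_densTail_le (lt_tip t₀ t₀ n).1.le)).trans_eq (by simp)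

lemma ae_limEntE_lt (h : LateScreen M κ L T₀ t₀ τ) : ∀ᵐ p ∂sph, limEntE M κ T₀ τ p < ⊤ :=
  ae_lt_top' h.aemeasurable_limEntE (h.lintegral_limEntE_le.trans_lt ENNReal.ofReal_lt_top).ne

lemma integrable_limEnt (h : LateScreen M κ L T₀ t₀ τ) : Integrable (limEnt M κ T₀ τ) sph :=
  integrable_toReal_of_lintegral_ne_top h.aemeasurable_limEntE
    (h.lintegral_limEntE_le.trans_lt ENNReal.ofReal_lt_top).ne

lemma leafEnt_le_limEnt (h : LateScreen M κ L T₀ t₀ τ) (hp : ‖p‖ = 1)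
    (hfin : limEntE M κ T₀ τ p < ⊤) {T : ℝ} (hT : T₀ < T) :
    leafEnt M κ τ T p ≤ limEnt M κ T₀ τ p := by
  obtain ⟨n, hn⟩ := ((tendsto_tip T₀ T₀).eventually_ge_atTop T).exists
  refine (h.coneEnt_mono hp hT hn).trans ((ENNReal.ofReal_le_iff_le_toReal hfin.ne).1 ?_)
  exact le_iSup (fun n => ENNReal.ofReal (leafEnt M κ τ (tip T₀ T₀ n) p)) n

lemma tendsto_leafEnt (h : LateScreen M κ L T₀ t₀ τ) (hp : ‖p‖ = 1)
    (hfin : limEntE M κ T₀ τ p < ⊤) :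
    Tendsto (fun T => leafEnt M κ τ T p) atTop (𝓝 (limEnt M κ T₀ τ p)) := by
  refine tendsto_order.2 ⟨fun b hb => ?_, fun b hb => ?_⟩
  · have hlt : ENNReal.ofReal b < limEntE M κ T₀ τ p := by
      rw [← ENNReal.ofReal_toReal hfin.ne, ENNReal.ofReal_lt_ofReal_iff]
      · exact hb
      · exact (h.leafEnt_pos (lt_tip T₀ T₀ 0).1 hp).trans_le
          (h.leafEnt_le_limEnt hp hfin (lt_tip T₀ T₀ 0).1)
    obtain ⟨n, hn⟩ := lt_iSup_iff.1 hlt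
    filter_upwards [eventually_ge_atTop (tip T₀ T₀ n)] with T hT
    refine lt_of_lt_of_le ?_ (h.coneEnt_mono hp (lt_tip T₀ T₀ n).1 hT)
    exact (ENNReal.ofReal_lt_ofReal_iff (h.leafEnt_pos (lt_tip T₀ T₀ n).1 hp)).1 hn
  · filter_upwards [eventually_gt_atTop T₀] with T hT
    exact (h.leafEnt_le_limEnt hp hfin hT).trans_lt hb

lemma integral_limEnt (h : LateScreen M κ L T₀ t₀ τ) (hL : 0 ≤ L) :
    ∫ p, limEnt M κ T₀ τ p ∂sph = L := by
  apply le_antisymm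
  · unfold limEnt
    rw [integral_toReal h.aemeasurable_limEntE h.ae_limEntE_lt]
    exact ENNReal.toReal_le_of_le_ofReal hL h.lintegral_limEntE_le
  · refine le_of_forall_lt fun l hl => ?_
    obtain ⟨T, h1, hT⟩ := ((h.ent l hl).and (eventually_gt_atTop T₀)).exists
    refine h1.trans_le (integral_mono_ae (h.integrable_leafEnt hT) h.integrable_limEnt ?_)
    filter_upwards [ae_sph_norm, h.ae_limEntE_lt] with p hp hfin
    exact h.leafEnt_le_limEnt hp hfin hT

/-- Pointwise, only the shortfall of the section density below the limit is controlled. It is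
dominated by `limEnt`, as the density is nonnegative. -/
lemma tendsto_deficiency (h : LateScreen M κ L T₀ t₀ τ) :
    Tendsto (fun t => ∫ p, max (limEnt M κ T₀ τ p - densTail (M.clamp t₀) t p) 0 ∂sph) atTop
      (𝓝 0) := by
  have := tendsto_integral_filter_of_dominated_convergence (μ := sph) (l := atTop)
    (F := fun t p => max (limEnt M κ T₀ τ p - densTail (M.clamp t₀) t p) 0) (f := fun _ => 0)
    (limEnt M κ T₀ τ) ?_ ?_ h.integrable_limEnt ?_
  · simpa using this
  · filter_upwards [eventually_ge_atTop t₀] with t ht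
    exact (h.integrable_limEnt.sub (h.integrable_densTail ht)).pos_part.1
  · refine .of_forall fun t => .of_forall fun p => ?_
    rw [Real.norm_of_nonneg (le_max_right _ _)]
    exact max_le (sub_le_self _ (h.densTail_nonneg _ _)) ENNReal.toReal_nonneg
  · filter_upwards [h.ae_isGood, h.ae_limEntE_lt] with p hp hfin
    refine tendsto_order.2 ⟨fun b hb => .of_forall fun t => hb.trans_le (le_max_right _ _),
      fun b hb => ?_⟩
    obtain ⟨T, h1, hT⟩ := (((h.tendsto_leafEnt hp.1 hfin).eventually_const_lt
      (sub_lt_self _ (half_pos hb))).and (eventually_gt_atTop T₀)).exists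
    filter_upwards [h.leafEnt_le hp hT, (tendsto_matterTail (κ := κ) hp).eventually_lt_const
      (half_pos hb)] with t h2 h3
    exact max_lt (by linarith) hb

/-- The limiting light cones of a spacetime with a screen have sections whose area density
converges. -/
theorem tailLimit (h : LateScreen M κ L T₀ t₀ τ) (hL : 0 ≤ L) :
    TailLimit (M.clamp t₀) t₀ (limEnt M κ T₀ τ) where
  scale := h.scale
  mono := h.clamp_mono
  tail := h.tailIntegrable
  int t ht := h.integrable_densTail (le_of_lt ht)
  limInt := h.integrable_limEnt
  limPos := by
    filter_upwards [ae_sph_norm, h.ae_limEntE_lt] with p hp hfin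
    exact (h.leafEnt_pos (lt_tip T₀ T₀ 0).1 hp).trans_le
      (h.leafEnt_le_limEnt hp hfin (lt_tip T₀ T₀ 0).1)
  lim := by
    refine tendsto_of_tendsto_of_tendsto_of_le_of_le' tendsto_const_nhds
      (by simpa using h.tendsto_deficiency.const_mul 2)
      (.of_forall fun t => integral_nonneg fun p => abs_nonneg _) ?_
    filter_upwards [eventually_ge_atTop t₀] with t ht
    have hi := h.integrable_densTail ht
    have hs := h.integrable_limEnt.sub hi
    -- Scheffé's argument: the section area is at most `L`, the integral of the limit, so twice the
    -- shortfall bounds the L¹ distance.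
    have h1 : ∀ x y : ℝ, |x - y| = x - y + 2 * max (y - x) 0 := fun x y => by
      rcases le_total x y with hxy | hxy
      · rw [abs_of_nonpos (by linarith), max_eq_left (by linarith)]; ring
      · rw [abs_of_nonneg (by linarith), max_eq_right (by linarith)]; ring
    simp only [h1]
    have hs' : Integrable (fun p => 2 * max (limEnt M κ T₀ τ p - densTail (M.clamp t₀) t p) 0) sph :=
      hs.pos_part.const_mul 2
    have hd : Integrable (fun p => densTail (M.clamp t₀) t p - limEnt M κ T₀ τ p) sph :=
      hi.sub h.integrable_limEnt
    rw [integral_add hd hs', integral_sub hi h.integrable_limEnt, h.integral_limEnt hL, integral_const_mul]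
    have h2 : ∫ p, densTail (M.clamp t₀) t p ∂sph ≤ L := by
      rw [integral_eq_lintegral_of_nonneg_ae (.of_forall (h.densTail_nonneg t)) hi.1]
      exact ENNReal.toReal_le_of_le_ofReal hL (h.lintegral_densTail_le ht)
    linarith

/-- The area density of the leaves converges in almost every direction. -/
theorem tendsto_leaf_dens (h : LateScreen M κ L T₀ t₀ τ) : ∀ᵐ p ∂sph,
    Tendsto (fun T => dens M.a T (τ T p) p) atTop (𝓝 (limEnt M κ T₀ τ p)) := by
  filter_upwards [h.ae_isGood, h.ae_limEntE_lt] with p hp hfin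
  have h1 : Tendsto (fun T => κ * ∫ r in τ T p..T, flux M.a T r p) atTop (𝓝 0) := by
    refine tendsto_of_tendsto_of_tendsto_of_le_of_le' tendsto_const_nhds
      ((tendsto_matterTail (κ := κ) hp).comp (h.late p hp.1)) ?_ ?_
    · filter_upwards [eventually_gt_atTop T₀] with T hT
      exact mul_nonneg h.nonneg (intervalIntegral.integral_nonneg (h.mem hT hp.1).2.le
        fun r hr => flux_nonneg hr.2 p)
    · filter_upwards [eventually_gt_atTop T₀, (h.late p hp.1).eventually_ge_atTop t₀] with T hT ht
      have hlt := (h.mem hT hp.1).2.le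
      rw [intervalIntegral.integral_congr fun r hr =>
        (flux_clamp (M := M) (p := p) (le_of_mem_uIcc ht (ht.trans hlt) hr) (ht.trans hlt)).symm]
      exact h.matter_le_tail hp ht hlt
  refine (by simpa using (h.tendsto_leafEnt hp.1 hfin).sub h1 : Tendsto (fun T => leafEnt M κ τ T p -
    κ * ∫ r in τ T p..T, flux M.a T r p) atTop _).congr fun T => ?_
  simp [leafEnt, coneEnt]

end LateScreen

end BianchiI

namespace BianchiI

open Bianchi

/-! ### Asymptotics of an isotropizing spacetime -/

/-- Geometric mean of the scale factors. -/
def gmean (a : Fin 3 → ℝ → ℝ) (t : ℝ) : ℝ := vol3 a t ^ (1 / 3 : ℝ)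

lemma gmean_pos {a : Fin 3 → ℝ → ℝ} {t : ℝ} (ha : ∀ i, 0 < a i t) : 0 < gmean a t :=
  Real.rpow_pos_of_pos (vol3_pos ha) _

lemma gmean_pow {a : Fin 3 → ℝ → ℝ} {t : ℝ} (ha : ∀ i, 0 < a i t) : gmean a t ^ 3 = vol3 a t := by
  rw [gmean, ← Real.rpow_natCast, ← Real.rpow_mul (vol3_pos ha).le]
  norm_num

lemma inv_gmean_le {a : Fin 3 → ℝ → ℝ} {t : ℝ} (ha : ∀ i, 0 < a i t) :
    (gmean a t)⁻¹ ≤ ∑ i, (a i t)⁻¹ := by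
  have h0 : ∀ i, 0 ≤ (a i t)⁻¹ := fun i => (inv_pos.2 (ha i)).le
  refine le_of_pow_le_pow_left₀ three_ne_zero (Finset.sum_nonneg fun i _ => h0 i) ?_
  rw [inv_pow, gmean_pow ha, vol3, ← Finset.prod_inv_distrib]
  refine (Finset.prod_le_prod (fun i _ => h0 i) fun i _ =>
    Finset.single_le_sum (fun i _ => h0 i) (Finset.mem_univ i)).trans (by simp)

/-- A limit along a continuous path to infinity is a limit at infinity. -/
lemma tendsto_of_comp {f u : ℝ → ℝ} {l T₀ : ℝ} (hu : ContinuousOn u (Ioi T₀))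
    (hut : Tendsto u atTop atTop) (h : Tendsto (fun T => f (u T)) atTop (𝓝 l)) :
    Tendsto f atTop (𝓝 l) := by
  refine tendsto_def.2 fun s hs => ?_
  obtain ⟨T₁, h1⟩ := eventually_atTop.1 ((h.eventually_mem hs).and (eventually_gt_atTop T₀))
  filter_upwards [eventually_ge_atTop (u T₁)] with t ht
  obtain ⟨T₂, h2, h3⟩ := ((hut.eventually_ge_atTop t).and (eventually_ge_atTop T₁)).exists
  obtain ⟨T, h4, rfl⟩ := intermediate_value_Icc h3
    (hu.mono fun T hT => (h1 T hT.1).2) ⟨ht, h2⟩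
  exact (h1 T h4.1).1

/-- If almost every direction `p` satisfies `∑ p_j² z_j → 0` then each `z_j` tends to zero. -/
lemma tendsto_zero_of_ae {z : Fin 3 → ℝ → ℝ}
    (h : ∀ᵐ p ∂sph, Tendsto (fun t => ∑ j, p j ^ 2 * z j t) atTop (𝓝 0)) (j : Fin 3) :
    Tendsto (z j) atTop (𝓝 0) := by
  -- Coefficient vectors whose combination tends to zero form a subspace. If it were proper, a
  -- nonzero functional would annihilate the vectors `(p_j²)` for almost every, hence by continuity
  -- every, direction, in particular the axes.
  let S : Submodule ℝ (Fin 3 → ℝ) :=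
    { carrier := {x | Tendsto (fun t => ∑ j, x j * z j t) atTop (𝓝 0)}
      zero_mem' := by simp
      add_mem' := fun {x y} hx hy => by
        have h0 := Tendsto.add hx hy
        simp only [add_zero] at h0
        refine h0.congr fun t => ?_
        rw [← Finset.sum_add_distrib]
        exact Finset.sum_congr rfl fun i _ => (add_mul _ _ _).symm
      smul_mem' := fun c x hx => by
        have h0 := Tendsto.const_mul c hx
        simp only [mul_zero] at h0
        refine h0.congr fun t => ?_
        rw [Finset.mul_sum]
        exact Finset.sum_congr rfl fun i _ => (mul_assoc _ _ _).symm }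
  have hS : S = ⊤ := by
    by_contra hne
    obtain ⟨f, hf0, hf⟩ := Submodule.exists_le_ker_of_lt_top S (lt_top_iff_ne_top.2 hne)
    have hfe : ∀ x : Fin 3 → ℝ, f x = ∑ i, x i * f (Pi.single i 1) := fun x => by
      conv_lhs => rw [← Finset.univ_sum_single x]
      rw [map_sum]
      refine Finset.sum_congr rfl fun i _ => ?_
      rw [← smul_eq_mul, ← map_smul]
      congr 1
      ext k
      by_cases hk : k = i
      · subst hk; simp
      · simp [hk]
    have h1 : ∀ᵐ p ∂sph, ∑ i, p i ^ 2 * f (Pi.single i 1) = 0 := by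
      filter_upwards [h] with p hp
      have := hf (show (fun i => p i ^ 2) ∈ S from hp)
      rwa [LinearMap.mem_ker, hfe] at this
    refine hf0 (LinearMap.ext fun x => ?_)
    rw [hfe]
    refine Finset.sum_eq_zero fun i _ => ?_
    have h2 := eq_of_ae_sph (f := fun p => ∑ i, p i ^ 2 * f (Pi.single i 1)) (g := fun _ => 0)
      (by fun_prop) continuousOn_const h1 (p := EuclideanSpace.single i 1) (by simp)
    have h3 : f (Pi.single i 1) = 0 := by simpa [Pi.single_apply, ite_pow] using h2
    rw [h3, mul_zero]
  have hj : (Pi.single j 1 : Fin 3 → ℝ) ∈ S := hS ▸ Submodule.mem_top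
  refine Tendsto.congr (fun t => ?_) (show Tendsto (fun t => ∑ i, (Pi.single j 1 : Fin 3 → ℝ) i *
    z i t) atTop (𝓝 0) from hj)
  simp [Pi.single_apply]

/-- A function with asymptotically constant logarithmic derivative grows exponentially. -/
lemma tendsto_shift_div {f : ℝ → ℝ} {H t₀ : ℝ} (hpos : ∀ t > t₀, 0 < f t)
    (hd : ∀ t > t₀, DifferentiableAt ℝ f t)
    (h : Tendsto (fun t => deriv f t / f t) atTop (𝓝 H)) (Δ : ℝ) :
    Tendsto (fun t => f (t + Δ) / f t) atTop (𝓝 (Real.exp (H * Δ))) := by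
  have hlog : Tendsto (fun t => Real.log (f (t + Δ)) - Real.log (f t)) atTop (𝓝 (H * Δ)) := by
    refine Metric.tendsto_atTop'.2 fun ε hε => ?_
    have hδ : 0 < ε / (|Δ| + 1) := by positivity
    obtain ⟨N, hN⟩ := eventually_atTop.1 ((h.eventually (Metric.ball_mem_nhds H hδ)).and
      (eventually_gt_atTop t₀))
    refine ⟨N + |Δ|, fun t ht => ?_⟩
    have hder : ∀ x ∈ Ici N, HasDerivWithinAt (fun x => Real.log (f x) - H * x)
        (deriv f x / f x - H) (Ici N) x := fun x hx => by
      have h1 := (hd x (hN x hx).2).hasDerivAt.log (hpos x (hN x hx).2).ne'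
      have h2 := (hasDerivAt_id x).const_mul H
      exact ((h1.sub h2).congr_deriv (by simp)).hasDerivWithinAt
    have h3 := (convex_Ici N).norm_image_sub_le_of_norm_hasDerivWithin_le hder
      (C := ε / (|Δ| + 1)) (fun x hx => (Metric.mem_ball.1 (hN x hx).1).le)
      (x := t) (y := t + Δ) (mem_Ici.2 (by linarith [abs_nonneg Δ]))
      (mem_Ici.2 (by linarith [neg_abs_le Δ]))
    rw [Real.dist_eq]
    calc _ = ‖Real.log (f (t + Δ)) - H * (t + Δ) - (Real.log (f t) - H * t)‖ := by
          rw [Real.norm_eq_abs]; congr 1; ring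
      _ ≤ ε / (|Δ| + 1) * ‖t + Δ - t‖ := h3
      _ < ε := by
          rw [add_sub_cancel_left, Real.norm_eq_abs, div_mul_eq_mul_div, div_lt_iff₀ (by positivity)]
          nlinarith [abs_nonneg Δ]
  refine ((Real.continuous_exp.tendsto _).comp hlog).congr' ?_
  filter_upwards [eventually_gt_atTop t₀, (tendsto_atTop_add_const_right atTop Δ
    tendsto_id).eventually_gt_atTop t₀] with t h1 h2
  rw [Function.comp_apply, Real.exp_sub, Real.exp_log (hpos _ h1),
    Real.exp_log (show 0 < f (t + Δ) from hpos _ h2)]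

namespace TailLimit

variable {a : Fin 3 → ℝ → ℝ} {t₀ R : ℝ} {α : Space → ℝ} {C : Fin 3 → ℝ}

/-- Tails of functions that decay like the inverse of the scale factor. -/
theorem tendsto_gmean_mul_tail (h : TailLimit a t₀ α) (hR0 : 0 < R)
    (hR : Tendsto (meanRad a) atTop (𝓝 R)) {f : ℝ → ℝ} {k : ℝ} (hf : ContinuousOn f (Ioi t₀))
    (hi : ∀ t > t₀, IntegrableOn f (Ioi t))
    (hk : Tendsto (fun t => gmean a t * f t) atTop (𝓝 k)) :
    Tendsto (fun t => gmean a t * ∫ r in Ioi t, f r) atTop (𝓝 (k * R)) := by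
  have hg := fun t => gmean_pos fun i => h.scale.pos i t
  have hK : 0 < R * (∫ p, α p ∂sph) / 3 := by have := h.lim_pos; positivity
  -- `W` is the cube root of `V`. It decays like `1 / gmean`, since `vol3 * V = meanRad * A / 3`
  -- converges, and `W' / W = -1 / meanRad`; this makes it the comparison function for L'Hôpital's
  -- rule.
  set W : ℝ → ℝ := fun t => Real.exp (Real.log (volTail a t) / 3) with hW
  have hgW : Tendsto (fun t => gmean a t * W t) atTop
      (𝓝 ((R * (∫ p, α p ∂sph) / 3) ^ (1 / 3 : ℝ))) := by
    have h1 : Tendsto (fun t => vol3 a t * volTail a t) atTop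
        (𝓝 (R * (∫ p, α p ∂sph) / 3)) := by
      refine ((hR.mul h.tendsto_areaTail).div_const 3).congr' ?_
      filter_upwards [eventually_gt_atTop t₀] with t ht
      have := (h.areaTail_pos ht).ne'
      rw [meanRad]
      field_simp
    refine (h1.rpow_const (.inl hK.ne')).congr' ?_
    filter_upwards [eventually_gt_atTop t₀] with t ht
    have hV := h.volTail_pos ht
    rw [Real.mul_rpow (h.vol3_pos' t).le hV.le, Real.rpow_def_of_pos hV, hW, gmean]
    congr 2
    ring
  have hKp := Real.rpow_pos_of_pos hK (1 / 3 : ℝ)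
  have hdW : ∀ t > t₀, HasDerivAt W (W t * (-(3 / meanRad a t) / 3)) t := fun t ht =>
    ((h.hasDerivAt_log_volTail ht).div_const 3).exp
  have hWt : Tendsto W atTop (𝓝 0) := by
    refine Real.tendsto_exp_atBot.comp (Tendsto.atBot_div_const three_pos ?_)
    refine Real.tendsto_log_nhdsGT_zero.comp (tendsto_nhdsWithin_iff.2 ⟨h.tendsto_volTail, ?_⟩)
    filter_upwards [eventually_gt_atTop t₀] with t ht using h.volTail_pos ht
  have hft : Tendsto (fun t => ∫ r in Ioi t, f r) atTop (𝓝 0) := tendsto_tail (hi (t₀ + 1) (by simp))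
  have hlop := HasDerivAt.lhopital_zero_atTop (f := fun t => ∫ r in Ioi t, f r) (g := W)
    (f' := fun t => -f t) (g' := fun t => W t * (-(3 / meanRad a t) / 3))
    (l := 𝓝 (k * R / (R * (∫ p, α p ∂sph) / 3) ^ (1 / 3 : ℝ))) ?_ ?_ ?_ hft hWt ?_
  · have h2 := hgW.mul hlop
    rw [mul_div_cancel₀ _ hKp.ne'] at h2
    refine h2.congr fun t => ?_
    have := (Real.exp_pos (Real.log (volTail a t) / 3)).ne'
    simp only [hW]
    field_simp
  · filter_upwards [eventually_gt_atTop t₀] with t ht using hasDerivAt_tail hf hi ht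
  · filter_upwards [eventually_gt_atTop t₀] with t ht using hdW t ht
  · filter_upwards [eventually_gt_atTop t₀] with t ht
    have := h.meanRad_pos ht
    exact mul_ne_zero (Real.exp_pos _).ne' (by simp [this.ne'])
  · refine ((hk.mul hR).div hgW hKp.ne').congr' ?_
    filter_upwards [eventually_gt_atTop t₀] with t ht
    have := (h.meanRad_pos ht).ne'
    have := (Real.exp_pos (Real.log (volTail a t) / 3)).ne'
    have := (hg t).ne'
    simp only [hW, Pi.div_apply]
    field_simp

/-- Limit of the frequency relative to the inverse scale factor. -/
def fqLim (C : Fin 3 → ℝ) (p : Space) : ℝ := √(∑ i, (p i / C i) ^ 2)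

/-- Limit of the Hessian weights relative to the inverse scale factor. -/
def hkLim (C : Fin 3 → ℝ) (k : Fin 3) (p : Space) : ℝ :=
  ((C (k + 1) * C (k + 2)) ^ 2 * fqLim C p ^ 3)⁻¹

lemma fqLim_pos (hC0 : ∀ i, 0 < C i) {p : Space} (hp : p ≠ 0) : 0 < fqLim C p :=
  fq_pos (a := fun i _ => C i) (t := 0) hC0 hp

lemma hkLim_pos (hC0 : ∀ i, 0 < C i) {p : Space} (hp : p ≠ 0) (k : Fin 3) : 0 < hkLim C k p :=
  hk_pos (a := fun i _ => C i) (t := 0) hC0 hp k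

lemma tendsto_gmean_mul_fq (h : TailLimit a t₀ α) (hC0 : ∀ i, 0 < C i)
    (hC : ∀ i, Tendsto (fun t => a i t / gmean a t) atTop (𝓝 (C i))) (p : Space) :
    Tendsto (fun t => gmean a t * fq a t p) atTop (𝓝 (fqLim C p)) := by
  have h1 : Tendsto (fun t => √(∑ i, (p i / (a i t / gmean a t)) ^ 2)) atTop (𝓝 (fqLim C p)) :=
    (tendsto_finsetSum _ fun i _ => (tendsto_const_nhds.div (hC i) (hC0 i).ne').pow 2).sqrt
  refine h1.congr fun t => ?_
  have hg := gmean_pos fun i => h.scale.pos i t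
  rw [fq, ← Real.sqrt_sq hg.le, ← Real.sqrt_mul (sq_nonneg _), Real.sqrt_sq hg.le, Finset.mul_sum]
  refine congrArg _ (Finset.sum_congr rfl fun i _ => ?_)
  have := (h.scale.pos i t).ne'
  field_simp

lemma tendsto_gmean_mul_hk (h : TailLimit a t₀ α) (hC0 : ∀ i, 0 < C i)
    (hC : ∀ i, Tendsto (fun t => a i t / gmean a t) atTop (𝓝 (C i))) {p : Space} (hp : p ≠ 0)
    (k : Fin 3) : Tendsto (fun t => gmean a t * hk a k t p) atTop (𝓝 (hkLim C k p)) := by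
  have hφ := fqLim_pos hC0 hp
  have h1 := ((((hC (k + 1)).mul (hC (k + 2))).pow 2).mul
    ((h.tendsto_gmean_mul_fq hC0 hC p).pow 3)).inv₀ (by
      have := (hC0 (k + 1)).ne'; have := (hC0 (k + 2)).ne'; positivity)
  refine h1.congr fun t => ?_
  have hg := (gmean_pos fun i => h.scale.pos i t).ne'
  have := (h.fq_pos' t hp).ne'
  have := (h.scale.pos (k + 1) t).ne'
  have := (h.scale.pos (k + 2) t).ne'
  rw [hk]
  field_simp

lemma tendsto_gmean_mul_hTail (h : TailLimit a t₀ α) (hR0 : 0 < R)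
    (hR : Tendsto (meanRad a) atTop (𝓝 R)) (hC0 : ∀ i, 0 < C i)
    (hC : ∀ i, Tendsto (fun t => a i t / gmean a t) atTop (𝓝 (C i))) {p : Space}
    (hp : ∀ i, p i ≠ 0) (k : Fin 3) :
    Tendsto (fun t => gmean a t * hTail a k t p) atTop (𝓝 (hkLim C k p * R)) :=
  h.tendsto_gmean_mul_tail hR0 hR (continuous_hk_left h.scale k (ne_zero_of_generic hp)).continuousOn
    (fun t _ => h.tail p hp k t) (h.tendsto_gmean_mul_hk hC0 hC (ne_zero_of_generic hp) k)

lemma densTail_eq_gmean (h : TailLimit a t₀ α) (t : ℝ) (p : Space) : densTail a t p =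
    gmean a t * fq a t p * curv (fun k => gmean a t * hTail a k t p) p := by
  rw [densTail, ← gmean_pow fun i => h.scale.pos i t, curvTail, curv, curv, Finset.mul_sum,
    Finset.mul_sum]
  exact Finset.sum_congr rfl fun i _ => by ring

lemma tendsto_curv {m : Fin 3 → ℝ → ℝ} {l : Filter ℝ} {m' : Fin 3 → ℝ}
    (hm : ∀ k, Tendsto (m k) l (𝓝 (m' k))) (p : Space) :
    Tendsto (fun t => curv (fun k => m k t) p) l (𝓝 (curv m' p)) :=
  tendsto_finsetSum _ fun _ _ => ((hm _).mul (hm _)).const_mul _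

/-- The limiting area density is that of an isotropic light cone. -/
theorem ae_eq_limit (h : TailLimit a t₀ α) (hR0 : 0 < R)
    (hR : Tendsto (meanRad a) atTop (𝓝 R)) (hC0 : ∀ i, 0 < C i)
    (hC : ∀ i, Tendsto (fun t => a i t / gmean a t) atTop (𝓝 (C i))) :
    ∀ᵐ p ∂sph, α p = fqLim C p * curv (fun k => hkLim C k p * R) p := by
  set β : Space → ℝ := fun p => fqLim C p * curv (fun k => hkLim C k p * R) p
  have hβ : ∀ᵐ p ∂sph, Tendsto (fun t => densTail a t p) atTop (𝓝 (β p)) := by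
    filter_upwards [ae_sph_coord_ne] with p hp
    refine ((h.tendsto_gmean_mul_fq hC0 hC p).mul (tendsto_curv (fun k =>
      h.tendsto_gmean_mul_hTail hR0 hR hC0 hC hp k) p)).congr fun t => ?_
    exact (h.densTail_eq_gmean t p).symm
  have hn : ∀ n : ℕ, t₀ < t₀ + 1 + n := fun n => by
    have : (0 : ℝ) ≤ n := n.cast_nonneg
    linarith
  have htt : Tendsto (fun n : ℕ => t₀ + 1 + (n : ℝ)) atTop atTop :=
    tendsto_atTop_add_const_left _ _ tendsto_natCast_atTop_atTop
  have hm : ∀ n : ℕ, AEMeasurable (fun p => ENNReal.ofReal |densTail a (t₀ + 1 + n) p - α p|) sph :=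
    fun n => ((h.int _ (hn n)).sub h.limInt).abs.1.aemeasurable.ennreal_ofReal
  have hD : ∀ᵐ p ∂sph, Tendsto (fun n : ℕ => ENNReal.ofReal |densTail a (t₀ + 1 + n) p - α p|)
      atTop (𝓝 (ENNReal.ofReal |β p - α p|)) := by
    filter_upwards [hβ] with p hp
    exact (ENNReal.continuous_ofReal.tendsto _).comp ((hp.comp htt).sub_const _).abs
  -- Fatou along a sequence of times: the L¹ limit `α` and the almost everywhere limit `β` coincide.
  have hz : ∫⁻ p, ENNReal.ofReal |β p - α p| ∂sph = 0 := by
    refine le_antisymm ?_ zero_le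
    rw [lintegral_congr_ae (hD.mono fun p hp => hp.liminf_eq.symm)]
    refine (lintegral_liminf_le' hm).trans (le_of_eq ?_)
    have h1 : Tendsto (fun n : ℕ => ∫⁻ p, ENNReal.ofReal |densTail a (t₀ + 1 + n) p - α p| ∂sph)
        atTop (𝓝 (ENNReal.ofReal 0)) := by
      refine ((ENNReal.continuous_ofReal.tendsto 0).comp (h.lim.comp htt)).congr fun n => ?_
      exact ofReal_integral_eq_lintegral_ofReal ((h.int _ (hn n)).sub h.limInt).abs
        (.of_forall fun p => abs_nonneg _)
    rw [h1.liminf_eq, ENNReal.ofReal_zero]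
  filter_upwards [(lintegral_eq_zero_iff' (aemeasurable_of_tendsto_metrizable_ae' hm hD)).1 hz]
    with p hp
  have h3 := abs_nonpos_iff.1 (ENNReal.ofReal_eq_zero.1 hp)
  linarith

end TailLimit

end BianchiI

/-! ### Convergence of the Hubble rates. -/

namespace BianchiI

open Bianchi

/-- `curv` is increasing in nonnegative weights, with positive coefficients in generic directions.
If the smaller weights have the same limiting total as the larger ones, no single weight can lag
behind. -/
lemma tendsto_of_curv {l : Filter ℝ} {x y : Fin 3 → ℝ → ℝ} {Y : Fin 3 → ℝ} {p : Space}
    (hx : ∀ᶠ t in l, ∀ k, 0 ≤ x k t ∧ x k t ≤ y k t) (hy : ∀ k, Tendsto (y k) l (𝓝 (Y k)))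
    (hY : ∀ k, 0 < Y k) (hp : ∀ i, p i ≠ 0)
    (hc : Tendsto (fun t => curv (fun k => x k t) p) l (𝓝 (curv Y p))) (k : Fin 3) :
    Tendsto (x k) l (𝓝 (Y k)) := by
  have hp2 : 0 < p (k + 2) ^ 2 := by have := hp (k + 2); positivity
  have hE := ((TailLimit.tendsto_curv hy p).sub hc).div ((hy (k + 1)).const_mul (p (k + 2) ^ 2))
    (mul_pos hp2 (hY _)).ne'
  rw [sub_self, zero_div] at hE
  have h0 : Tendsto (fun t => y k t - x k t) l (𝓝 0) := by
    refine tendsto_of_tendsto_of_tendsto_of_le_of_le' tendsto_const_nhds hE ?_ ?_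
    · filter_upwards [hx] with t ht using sub_nonneg.2 (ht k).2
    · filter_upwards [hx, (hy (k + 1)).eventually_const_lt (hY _)] with t ht hy1
      rw [Pi.div_apply, le_div_iff₀ (mul_pos hp2 hy1)]
      have h1 : ∀ n, 0 ≤ p n ^ 2 * (y (n + 1) t * y (n + 2) t - x (n + 1) t * x (n + 2) t) :=
        fun n => mul_nonneg (sq_nonneg _) (sub_nonneg.2 (mul_le_mul (ht _).2 (ht _).2 (ht _).1
          ((ht _).1.trans (ht _).2)))
      have h2 := Finset.single_le_sum (fun n _ => h1 n) (Finset.mem_univ (k + 2))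
      rw [show k + 2 + 1 = k by fin_cases k <;> rfl,
        show k + 2 + 2 = k + 1 by fin_cases k <;> rfl] at h2
      have h3 : curv (fun k => y k t) p - curv (fun k => x k t) p =
          ∑ n, p n ^ 2 * (y (n + 1) t * y (n + 2) t - x (n + 1) t * x (n + 2) t) := by
        simp only [curv, ← Finset.sum_sub_distrib, mul_sub]
      rw [h3]
      refine le_trans ?_ h2
      have h4 := mul_le_mul_of_nonneg_left (ht (k + 1)).2 (ht k).1
      nlinarith
  simpa using (hy k).sub h0

/-- Hubble rate along the axis `i`. -/
def hub (M : BianchiI) (i : Fin 3) (t : ℝ) : ℝ := deriv (M.a i) t / M.a i t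

section deriv

variable {M : BianchiI} {t T : ℝ} {p : Space}

lemma hasDerivAt_a (ht : M.ti < (t : WithBot ℝ)) (i : Fin 3) :
    HasDerivAt (M.a i) (M.a i t * hub M i t) t :=
  (differentiableAt_a M ht i).hasDerivAt.congr_deriv (by
    have := (M.pos i t ht).ne'
    rw [hub]
    field_simp)

lemma hasDerivAt_vol3 (ht : M.ti < (t : WithBot ℝ)) :
    HasDerivAt (vol3 M.a) (vol3 M.a t * ∑ i, hub M i t) t := by
  have h := ((hasDerivAt_a ht 0).fun_mul (hasDerivAt_a ht 1)).fun_mul (hasDerivAt_a ht 2)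
  have he : vol3 M.a = fun t => M.a 0 t * M.a 1 t * M.a 2 t :=
    funext fun t => Fin.prod_univ_three _
  rw [he]
  refine h.congr_deriv ?_
  rw [Fin.sum_univ_three]
  ring

lemma hasDerivAt_fq (ht : M.ti < (t : WithBot ℝ)) (hp : p ≠ 0) :
    HasDerivAt (fun t => fq M.a t p)
      (-((∑ i, (p i / M.a i t) ^ 2 * hub M i t) / fq M.a t p)) t := by
  have hf := fq_pos (fun i => M.pos i t ht) hp
  have h1 : HasDerivAt (fun t => ∑ i, (p i / M.a i t) ^ 2)
      (∑ i, -(2 * ((p i / M.a i t) ^ 2 * hub M i t))) t :=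
    HasDerivAt.fun_sum fun i _ => by
      have h0 := (M.pos i t ht).ne'
      refine (((hasDerivAt_const t (p i)).fun_div (hasDerivAt_a ht i) h0).fun_pow 2).congr_deriv ?_
      simp only [Nat.add_one_sub_one, pow_one, Nat.cast_ofNat, zero_mul, zero_sub]
      field_simp
  refine (h1.sqrt (by rw [← fq_sq]; positivity)).congr_deriv ?_
  change _ / (2 * fq M.a t p) = _
  rw [Finset.sum_neg_distrib, ← Finset.mul_sum]
  field_simp

/-- Rate of change of the curvature function, up to sign. -/
def curvRate (a : Fin 3 → ℝ → ℝ) (T t : ℝ) (p : Space) : ℝ :=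
  ∑ n, p n ^ 2 * (hk a (n + 1) t p * hInt a (n + 2) t T p +
    hInt a (n + 1) t T p * hk a (n + 2) t p)

lemma hasDerivAt_curv (ht : M.ti < (t : WithBot ℝ)) (htT : t < T) (hp : p ≠ 0) :
    HasDerivAt (fun t => curv (fun k => hInt M.a k t T p) p) (-curvRate M.a T t p) t := by
  refine (HasDerivAt.fun_sum fun n _ => ((hasDerivAt_hInt ht htT hp (n + 1)).fun_mul
    (hasDerivAt_hInt ht htT hp (n + 2))).const_mul (p n ^ 2)).congr_deriv ?_
  rw [curvRate, ← Finset.sum_neg_distrib]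
  exact Finset.sum_congr rfl fun n _ => by ring

/-- The Hubble rates at a marginal section. -/
lemma sum_hub_of_marginal {κ : ℝ} (ht : M.ti < (t : WithBot ℝ)) (htT : t < T) (hp : p ≠ 0)
    (hm : HasDerivAt (fun t => dens M.a T t p) (κ * flux M.a T t p) t) :
    ∑ j, (p j / M.a j t) ^ 2 * (∑ i, hub M i t - hub M j t) =
      fq M.a t p ^ 2 * (curvRate M.a T t p / curv (fun k => hInt M.a k t T p) p +
        κ / vol3 M.a t) := by
  have hv := (vol3_pos fun i => M.pos i t ht).ne'
  have hf := (fq_pos (fun i => M.pos i t ht) hp).ne'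
  have hc := (curv_pos (fun k => hInt_pos ht htT hp k) hp).ne'
  have hd := ((hasDerivAt_vol3 ht).fun_mul (hasDerivAt_fq ht hp)).fun_mul (hasDerivAt_curv ht htT hp)
  -- Dividing the product rule for `vol3 * fq * curv` by the density turns marginality into an
  -- equation linear in the Hubble rates.
  have he := hm.unique hd
  simp only [mul_sub, Finset.sum_sub_distrib, ← Finset.sum_mul, ← fq_sq]
  rw [flux] at he
  field_simp at he ⊢
  linear_combination -he

end deriv

lemma gmean_clamp {M : BianchiI} {t₀ t : ℝ} (ht : t₀ ≤ t) :
    gmean (M.clamp t₀) t = gmean M.a t := by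
  rw [gmean, gmean, vol3_clamp ht]

namespace LateScreen

open TailLimit

variable {M : BianchiI} {κ L T₀ t₀ R : ℝ} {τ : ℝ → Space → ℝ} {p : Space} {C : Fin 3 → ℝ}

/-- The Hessian weights of the sections in the screen approach those of the limiting cone. -/
lemma ae_tendsto_hInt (h : LateScreen M κ L T₀ t₀ τ) (hL : 0 ≤ L) (hR0 : 0 < R)
    (hR : Tendsto (meanRad (M.clamp t₀)) atTop (𝓝 R)) (hC0 : ∀ i, 0 < C i)
    (hC : ∀ i, Tendsto (fun t => M.clamp t₀ i t / gmean (M.clamp t₀) t) atTop (𝓝 (C i))) :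
    ∀ᵐ p ∂sph, ∀ k, Tendsto (fun T => gmean M.a (τ T p) * hInt M.a k (τ T p) T p) atTop
      (𝓝 (hkLim C k p * R)) := by
  have hT := h.tailLimit hL
  filter_upwards [ae_sph_norm, ae_sph_coord_ne, h.tendsto_leaf_dens,
    hT.ae_eq_limit hR0 hR hC0 hC] with p hp1 hp hd hα
  have hp0 := ne_zero_of_norm hp1
  have hlate := h.late p hp1
  refine tendsto_of_curv (y := fun k T => gmean (M.clamp t₀) (τ T p) *
    hTail (M.clamp t₀) k (τ T p) p) ?_ (fun k =>
      (hT.tendsto_gmean_mul_hTail hR0 hR hC0 hC hp k).comp hlate)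
    (fun k => mul_pos (hkLim_pos hC0 hp0 k) hR0) hp ?_
  · filter_upwards [eventually_gt_atTop T₀, hlate.eventually_ge_atTop t₀] with T h1 h2 k
    have hlt := (h.mem h1 hp1).2.le
    rw [← gmean_clamp h2, ← hInt_clamp h2 (h2.trans hlt)]
    have hg := (gmean_pos fun i => h.scale.pos i (τ T p)).le
    exact ⟨mul_nonneg hg (hInt_nonneg k hlt),
      mul_le_mul_of_nonneg_left (hInt_le_hTail h.tailIntegrable hp k hlt) hg⟩
  -- The leaf densities converge to the same limit as the sections of the infinite cone; dividing
  -- out the frequency leaves equal limits of the curvature functions, as `tendsto_of_curv`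
  -- requires.
  · have hφ := (fqLim_pos hC0 hp0).ne'
    have h1 := hd.div ((hT.tendsto_gmean_mul_fq hC0 hC p).comp hlate) hφ
    rw [hα, mul_div_cancel_left₀ _ hφ] at h1
    refine h1.congr' ?_
    filter_upwards [eventually_gt_atTop T₀, hlate.eventually_ge_atTop t₀] with T h1 h2
    have hm := h.mem h1 hp1
    have hg := (gmean_pos fun i => M.pos i (τ T p) hm.1).ne'
    have hf := (fq_pos (fun i => M.pos i (τ T p) hm.1) hp0).ne'
    rw [Pi.div_apply, Function.comp_apply, gmean_clamp h2, fq_clamp h2, dens,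
      ← gmean_pow fun i => M.pos i (τ T p) hm.1, div_eq_iff (mul_ne_zero hg hf), curv, curv,
      Finset.mul_sum, Finset.sum_mul]
    exact Finset.sum_congr rfl fun i _ => by ring

lemma tendsto_vol3 (h : LateScreen M κ L T₀ t₀ τ) : Tendsto (vol3 M.a) atTop atTop := by
  have he : vol3 M.a = fun t => M.a 0 t * M.a 1 t * M.a 2 t :=
    funext fun t => Fin.prod_univ_three _
  rw [he]
  exact ((h.top 0).atTop_mul_atTop₀ (h.top 1)).atTop_mul_atTop₀ (h.top 2)

/-- The Hubble rates converge. -/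
theorem tendsto_hub (h : LateScreen M κ L T₀ t₀ τ) (hL : 0 ≤ L) (hR0 : 0 < R)
    (hR : Tendsto (meanRad (M.clamp t₀)) atTop (𝓝 R)) (hC0 : ∀ i, 0 < C i)
    (hC : ∀ i, Tendsto (fun t => M.clamp t₀ i t / gmean (M.clamp t₀) t) atTop (𝓝 (C i)))
    (i : Fin 3) : Tendsto (hub M i) atTop (𝓝 R⁻¹) := by
  have hT := h.tailLimit hL
  -- At the leaves `curvRate / curv` tends to `2 / R` and the matter term `κ / vol3` to zero. In
  -- each generic direction marginality then says that a combination of these three functions with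
  -- coefficients `p_j²` vanishes in the limit.
  have hz : ∀ j, Tendsto (fun t => (gmean M.a t / M.a j t) ^ 2 *
      (∑ i, hub M i t - hub M j t - 2 * R⁻¹)) atTop (𝓝 0) := by
    refine tendsto_zero_of_ae (z := fun j t => (gmean M.a t / M.a j t) ^ 2 *
      (∑ i, hub M i t - hub M j t - 2 * R⁻¹)) ?_
    filter_upwards [ae_sph_norm, ae_sph_coord_ne, h.ae_tendsto_hInt hL hR0 hR hC0 hC]
      with p hp1 hp hI
    have hp0 := ne_zero_of_norm hp1
    have hlate := h.late p hp1
    refine tendsto_of_comp (T₀ := T₀) (u := fun T => τ T p) (fun T hT =>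
      (h.diff T hT p hp1).continuousAt.continuousWithinAt) hlate ?_
    have hkt : ∀ k, Tendsto (fun T => gmean M.a (τ T p) * hk M.a k (τ T p) p) atTop
        (𝓝 (hkLim C k p)) := fun k => by
      refine ((hT.tendsto_gmean_mul_hk hC0 hC hp0 k).comp hlate).congr' ?_
      filter_upwards [hlate.eventually_ge_atTop t₀] with T h2
      rw [Function.comp_apply, gmean_clamp h2, hk_clamp h2]
    have hft : Tendsto (fun T => gmean M.a (τ T p) * fq M.a (τ T p) p) atTop
        (𝓝 (fqLim C p)) := by
      refine ((hT.tendsto_gmean_mul_fq hC0 hC p).comp hlate).congr' ?_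
      filter_upwards [hlate.eventually_ge_atTop t₀] with T h2
      rw [Function.comp_apply, gmean_clamp h2, fq_clamp h2]
    have hN : Tendsto (fun T => ∑ n, p n ^ 2 *
        (gmean M.a (τ T p) * hk M.a (n + 1) (τ T p) p *
            (gmean M.a (τ T p) * hInt M.a (n + 2) (τ T p) T p) +
          gmean M.a (τ T p) * hInt M.a (n + 1) (τ T p) T p *
            (gmean M.a (τ T p) * hk M.a (n + 2) (τ T p) p))) atTop
        (𝓝 (∑ n, p n ^ 2 * (hkLim C (n + 1) p * (hkLim C (n + 2) p * R) +
          hkLim C (n + 1) p * R * hkLim C (n + 2) p))) :=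
      tendsto_finsetSum _ fun n _ => (((hkt _).mul (hI _)).add ((hI _).mul (hkt _))).const_mul _
    have hcurv := tendsto_curv hI p
    have hcp := curv_pos (m := fun k => hkLim C k p * R)
      (fun k => mul_pos (hkLim_pos hC0 hp0 k) hR0) hp0
    have hlim : (∑ n, p n ^ 2 * (hkLim C (n + 1) p * (hkLim C (n + 2) p * R) +
        hkLim C (n + 1) p * R * hkLim C (n + 2) p)) / curv (fun k => hkLim C k p * R) p =
        2 * R⁻¹ := by
      rw [div_eq_iff hcp.ne', curv, Finset.mul_sum]
      exact Finset.sum_congr rfl fun n _ => by field_simp; ring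
    have hrate := hN.div hcurv hcp.ne'
    rw [hlim] at hrate
    have hκ : Tendsto (fun T => κ / vol3 M.a (τ T p)) atTop (𝓝 0) :=
      tendsto_const_nhds.div_atTop (h.tendsto_vol3.comp hlate)
    have hfin := (hft.pow 2).mul ((hrate.add hκ).sub_const (2 * R⁻¹))
    rw [add_zero, sub_self, mul_zero] at hfin
    refine hfin.congr' ?_
    filter_upwards [eventually_gt_atTop T₀] with T h1
    have hm := h.mem h1 hp1
    have hg := (gmean_pos fun i => M.pos i (τ T p) hm.1).ne'
    have hs := sum_hub_of_marginal hm.1 hm.2 hp0 (h.marginal T h1 p hp1)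
    have h2 : ∑ j, p j ^ 2 * ((gmean M.a (τ T p) / M.a j (τ T p)) ^ 2 *
        (∑ i, hub M i (τ T p) - hub M j (τ T p) - 2 * R⁻¹)) = gmean M.a (τ T p) ^ 2 *
        (∑ j, (p j / M.a j (τ T p)) ^ 2 * (∑ i, hub M i (τ T p) - hub M j (τ T p)) -
          2 * R⁻¹ * fq M.a (τ T p) p ^ 2) := by
      rw [fq_sq, Finset.mul_sum, ← Finset.sum_sub_distrib, Finset.mul_sum]
      exact Finset.sum_congr rfl fun j _ => by
        have := (M.pos j (τ T p) hm.1).ne'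
        field_simp
    have h3 : (∑ n, p n ^ 2 *
        (gmean M.a (τ T p) * hk M.a (n + 1) (τ T p) p *
            (gmean M.a (τ T p) * hInt M.a (n + 2) (τ T p) T p) +
          gmean M.a (τ T p) * hInt M.a (n + 1) (τ T p) T p *
            (gmean M.a (τ T p) * hk M.a (n + 2) (τ T p) p))) =
        gmean M.a (τ T p) ^ 2 * curvRate M.a T (τ T p) p := by
      rw [curvRate, Finset.mul_sum]
      exact Finset.sum_congr rfl fun n _ => by ring
    have h4 : curv (fun k => gmean M.a (τ T p) * hInt M.a k (τ T p) T p) p =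
        gmean M.a (τ T p) ^ 2 * curv (fun k => hInt M.a k (τ T p) T p) p := by
      rw [curv, curv, Finset.mul_sum]
      exact Finset.sum_congr rfl fun n _ => by ring
    rw [h2, hs, Pi.div_apply, h3, h4, mul_div_mul_left _ _ (pow_ne_zero 2 hg)]
    ring
  have hd : ∀ j, Tendsto (fun t => ∑ i, hub M i t - hub M j t - 2 * R⁻¹) atTop (𝓝 0) := fun j => by
    have h1 := ((hC j).pow 2).mul (hz j)
    rw [mul_zero] at h1
    refine h1.congr' ?_
    filter_upwards [eventually_ge_atTop t₀] with t ht
    have h0 := domain_mono h.dom ht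
    have hg := (gmean_pos fun i => M.pos i t h0).ne'
    have := (M.pos j t h0).ne'
    rw [gmean_clamp ht, clamp_eq ht]
    field_simp
  -- Half the sum of the three limits gives `∑ hub - 3 / R → 0`; subtracting the limit for axis `i`
  -- isolates its rate.
  have hS := (((hd 0).add (hd 1)).add (hd 2)).div_const 2
  have hfin := (hS.sub (hd i)).add_const R⁻¹
  simp only [add_zero, zero_div, sub_zero, zero_add] at hfin
  refine hfin.congr fun t => ?_
  simp only [Fin.sum_univ_three]
  ring

end LateScreen

end BianchiI

/-! ### Asymptotically de Sitter behaviour. -/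

namespace BianchiI

open Bianchi

/-- The quotient `a i / gmean` is the cube root of the product over `j` of the ratios `a i / a j`.
-/
lemma exists_tendsto_div_gmean {a : Fin 3 → ℝ → ℝ} (ha : IsScale a)
    (h : ∀ i j, ∃ ρ > 0, Tendsto (fun t => a i t / a j t) atTop (𝓝 ρ)) :
    ∃ C : Fin 3 → ℝ, (∀ i, 0 < C i) ∧
      ∀ i, Tendsto (fun t => a i t / gmean a t) atTop (𝓝 (C i)) := by
  choose ρ hρ0 hρ using h
  have hP : ∀ i, 0 < ∏ j, ρ i j := fun i => Finset.prod_pos fun j _ => hρ0 i j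
  refine ⟨fun i => (∏ j, ρ i j) ^ (1 / 3 : ℝ), fun i => Real.rpow_pos_of_pos (hP i) _, fun i => ?_⟩
  refine ((tendsto_finsetProd _ fun j _ => hρ i j).rpow_const (.inl (hP i).ne')).congr fun t => ?_
  have hi := ha.pos i t
  rw [Finset.prod_div_distrib, Finset.prod_const, Finset.card_univ, Fintype.card_fin,
    Real.div_rpow (by positivity) (Finset.prod_nonneg fun j _ => (ha.pos j t).le),
    ← Real.rpow_natCast, ← Real.rpow_mul hi.le, gmean, vol3]
  norm_num

lemma continuous_gmean {a : Fin 3 → ℝ → ℝ} (ha : IsScale a) : Continuous (gmean a) :=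
  (continuous_vol3 ha).rpow_const fun t => .inl (vol3_pos fun i => ha.pos i t).ne'

lemma TailLimit.integrableOn_inv_gmean {a : Fin 3 → ℝ → ℝ} {t₀ t : ℝ} {α : Space → ℝ}
    (h : TailLimit a t₀ α) (ht : t₀ < t) : IntegrableOn (fun r => (gmean a r)⁻¹) (Ioi t) := by
  have hg := fun r => gmean_pos fun i => h.scale.pos i r
  refine (integrable_finsetSum Finset.univ fun i _ => h.integrableOn_inv ht i).mono'
    ((continuous_gmean h.scale).inv₀ fun r => (hg r).ne').aestronglyMeasurable
    (.of_forall fun r => ?_)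
  rw [Real.norm_of_nonneg (inv_pos.2 (hg r)).le]
  exact inv_gmean_le fun i => h.scale.pos i r

lemma meanScale_eq (M : BianchiI) : M.meanScale = gmean M.a := rfl

namespace LateScreen

variable {M : BianchiI} {κ L T₀ t₀ R : ℝ} {τ : ℝ → Space → ℝ}

lemma integrableOn_inv_meanScale (h : LateScreen M κ L T₀ t₀ τ) (hL : 0 ≤ L) {t : ℝ}
    (ht : M.ti < (t : WithBot ℝ)) : IntegrableOn (fun r => (M.meanScale r)⁻¹) (Ioi t) := by
  have h1 : IntegrableOn (fun r => (M.meanScale r)⁻¹) (Ioi (t₀ + 1)) := by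
    refine ((h.tailLimit hL).integrableOn_inv_gmean (lt_add_one t₀)).congr_fun (fun r hr => ?_)
      measurableSet_Ioi
    have hr' : t₀ + 1 < r := hr
    simp only [meanScale_eq]
    rw [gmean_clamp (by linarith)]
  have h2 : IntegrableOn (fun r => (M.meanScale r)⁻¹) (Icc t (t₀ + 1)) := by
    refine (((continuous_gmean (isScale_clamp ht)).inv₀ fun r =>
      (gmean_pos fun i => (isScale_clamp ht).pos i r).ne').integrableOn_Icc).congr_fun
      (fun r hr => ?_) measurableSet_Icc
    simp only [meanScale_eq, Pi.inv_apply]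
    rw [gmean_clamp hr.1]
  refine (h2.union h1).mono_set fun r hr => ?_
  rcases le_or_gt r (t₀ + 1) with h3 | h3
  · exact .inl ⟨le_of_lt hr, h3⟩
  · exact .inr h3

/-- A spacetime with a screen of bounded entropy is asymptotically de Sitter. -/
theorem asymptotics (h : LateScreen M κ L T₀ t₀ τ) (hL : 0 ≤ L) (hR0 : 0 < R)
    (hR : 4 * Real.pi * R ^ 2 = L) : ∃ C : Fin 3 → ℝ, (∀ i, 0 < C i) ∧
      (∀ i, Tendsto (fun t => M.a i t * (R⁻¹ * M.conformalTimeLeft t)) atTop (𝓝 (C i))) ∧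
      (∀ i, Tendsto (hub M i) atTop (𝓝 R⁻¹)) ∧
      (∀ i (Δ : ℝ), Tendsto (fun t => M.a i (t + Δ) / M.meanScale t) atTop
        (𝓝 (C i * Real.exp (R⁻¹ * Δ)))) := by
  have hT := h.tailLimit hL
  obtain ⟨hrad, hiso⟩ := hT.isotropization hR0 (hR.trans (h.integral_limEnt hL).symm)
  obtain ⟨C, hC0, hC⟩ := exists_tendsto_div_gmean h.scale hiso
  have hH := h.tendsto_hub hL hR0 hrad hC0 hC
  have hC' : ∀ i, Tendsto (fun t => M.a i t / M.meanScale t) atTop (𝓝 (C i)) := fun i => by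
    refine (hC i).congr' ?_
    filter_upwards [eventually_ge_atTop t₀] with t ht
    rw [clamp_eq ht, gmean_clamp ht, meanScale_eq]
  have hg := fun t => gmean_pos fun i => h.scale.pos i t
  refine ⟨C, hC0, fun i => ?_, hH, fun i Δ => ?_⟩
  · have h1 := hT.tendsto_gmean_mul_tail hR0 hrad (f := fun r => (gmean (M.clamp t₀) r)⁻¹) (k := 1)
      ((continuous_gmean h.scale).inv₀ fun r => (hg r).ne').continuousOn
      (fun t ht => hT.integrableOn_inv_gmean ht)
      (tendsto_const_nhds.congr fun t => (mul_inv_cancel₀ (hg t).ne').symm)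
    have h2 := (hC' i).mul (h1.const_mul R⁻¹)
    rw [one_mul, inv_mul_cancel₀ hR0.ne', mul_one] at h2
    refine h2.congr' ?_
    filter_upwards [eventually_ge_atTop t₀] with t ht
    have h3 : ∫ r in Ioi t, (gmean (M.clamp t₀) r)⁻¹ = M.conformalTimeLeft t :=
      setIntegral_congr_fun measurableSet_Ioi fun r hr => by
        have hr' : t < r := hr
        simp only [meanScale_eq]
        rw [gmean_clamp (by linarith)]
    rw [h3, gmean_clamp ht, meanScale_eq]
    have := (gmean_pos fun i => M.pos i t (domain_mono h.dom ht)).ne'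
    field_simp
  · have h1 := tendsto_shift_div (f := M.a i) (t₀ := t₀)
      (fun t ht => M.pos i t (domain_mono h.dom (le_of_lt ht)))
      (fun t ht => differentiableAt_a M (domain_mono h.dom (le_of_lt ht)) i) (hH i) Δ
    refine ((hC' i).mul h1).congr' ?_
    filter_upwards [eventually_ge_atTop t₀] with t ht
    have := (M.pos i t (domain_mono h.dom ht)).ne'
    field_simp

end LateScreen

section screen

variable {M : BianchiI} {G s T₀ Smax : ℝ} {τ : ℝ → Space → ℝ}

lemma isSlice_const {t T : ℝ} (ht : M.ti < (t : WithBot ℝ)) (htT : t < T) :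
    M.IsSlice T fun _ => t := ⟨contDiffOn_const, fun _ _ => ⟨ht, htT⟩⟩

lemma exists_domain_gt (M : BianchiI) (x : ℝ) : ∃ t : ℝ, x < t ∧ M.ti < (t : WithBot ℝ) := by
  cases hM : M.ti with
  | bot => exact ⟨x + 1, lt_add_one x, WithBot.bot_lt_coe _⟩
  | coe y =>
    exact ⟨max x y + 1, by linarith [le_max_left x y],
      WithBot.coe_lt_coe.2 (by linarith [le_max_right x y])⟩

/-- A past Q-screen with maximal leaves of bounded increasing entropy that extends to future
infinity in an expanding spacetime. -/
theorem exists_lateScreen (hG : 0 < G) (hs : 0 ≤ s) (hQ : M.IsPastQScreen G s T₀ τ)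
    (hmax : M.HasGloballyMaximalLeaves G s T₀ τ) (hGSL : M.GeneralizedSecondLaw G s T₀ τ)
    (htop : ∀ i, Tendsto (M.a i) atTop atTop) (hext : BianchiI.ExtendsToFutureInfinity τ)
    (hmono : ∀ i, ∃ tmono, ∀ t > tmono, 0 < deriv (M.a i) t)
    (hlim : Tendsto (fun T => M.genEntropy G s T (τ T)) atTop (𝓝 Smax)) :
    ∃ t₀, LateScreen M (4 * G * s) (4 * G * Smax) T₀ t₀ τ := by
  choose tm htm using hmono
  obtain ⟨t₀, ht₀, hdom⟩ := exists_domain_gt M (max (tm 0) (max (tm 1) (tm 2)))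
  have htm₀ : ∀ i, tm i < t₀ := fun i => by
    refine lt_of_le_of_lt ?_ ht₀
    fin_cases i <;> simp
  have hS : ∀ T > T₀, M.genEntropy G s T (τ T) ≤ Smax := fun T hT =>
    ge_of_tendsto hlim (by
      filter_upwards [eventually_ge_atTop T] with T' hT'
      exact hGSL.monotoneOn hT (lt_of_lt_of_le hT hT') hT')
  refine ⟨t₀, by positivity, hdom, hQ.isSlice, fun T hT p hp => ?_, fun T hT p hp => ?_,
    fun p hp => hext p (by simpa using hp), htop, fun i => ?_, fun T hT t ht htT => ?_,
    fun l hl => ?_⟩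
  · have hmem : Ioi T₀ ×ˢ ({0}ᶜ : Set Space) ∈ 𝓝 (T, p) :=
      (isOpen_Ioi.prod isOpen_compl_singleton).mem_nhds ⟨hT, ne_zero_of_norm hp⟩
    have h1 := (hQ.smooth.contDiffAt hmem).differentiableAt (by simp)
    exact DifferentiableAt.fun_comp' (g := fun z : ℝ × Space => τ z.1 z.2) (f := fun T => (T, p)) T
      h1 (by fun_prop)
  · have hsl := hQ.isSlice T hT
    have hm := hsl.mem p (by simpa using hp)
    exact hasDerivAt_dens_of_marginal (hsl.differentiableAt (ne_zero_of_norm hp)) hp hm.1 hm.2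
      fun e d => hQ.marginal T hT p (by simpa using hp) e d
  · refine (strictMonoOn_of_deriv_pos (convex_Ici t₀) (fun t ht =>
      (differentiableAt_a M (domain_mono hdom ht) i).continuousAt.continuousWithinAt)
      fun t ht => ?_).monotoneOn
    rw [interior_Ici] at ht
    exact htm i t ((htm₀ i).trans ht)
  · have hsl := isSlice_const (M := M) (domain_mono hdom ht) htT
    rw [← hsl.integrable_dens.2]
    have h1 := (hmax T hT _ hsl).trans (hS T hT)
    have h2 : M.area (M.slice T fun _ => t) / (4 * G) ≤ Smax :=
      (le_add_of_nonneg_right (mul_nonneg hs measureReal_nonneg)).trans h1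
    rw [div_le_iff₀ (by positivity)] at h2
    linarith
  · have hl' : l / (4 * G) < Smax := by
      rw [div_lt_iff₀ (by positivity)]
      linarith
    filter_upwards [hlim.eventually_const_lt hl', eventually_gt_atTop T₀] with T h1 hT
    have hsl := hQ.isSlice T hT
    have hd := hsl.integrable_dens
    have hv := hsl.volume_enclosed_le
    unfold coneEnt
    rw [integral_add hd.1 (hv.1.const_mul _), integral_const_mul, ← hd.2]
    rw [div_lt_iff₀ (by positivity), genEntropy] at h1
    have h2 := mul_le_mul_of_nonneg_left hv.2 (by positivity : 0 ≤ 4 * G * s)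
    have h3 : M.area (M.slice T (τ T)) / (4 * G) * (4 * G) = M.area (M.slice T (τ T)) :=
      div_mul_cancel₀ _ (by positivity)
    nlinarith

end screen

end BianchiI

end

theorem mainTheorem4 (M : BianchiI) (G s T₀ Smax : ℝ) (τ : ℝ → Bianchi.Space → ℝ)
    (hG : 0 < G) (hs : 0 ≤ s)
    (hQ : M.IsPastQScreen G s T₀ τ)
    (hmax : M.HasGloballyMaximalLeaves G s T₀ τ)
    (hGSL : M.GeneralizedSecondLaw G s T₀ τ)
    (h_i : ∀ i, Tendsto (M.a i) atTop atTop)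
    (h_ii : (∃ ttime, M.IsTimelikeAfter T₀ τ ttime) ∧ BianchiI.ExtendsToFutureInfinity τ)
    (h_iii : ∀ i, ∃ tmono, ∀ t > tmono, 0 < deriv (M.a i) t)
    (h_iv : Tendsto (fun T => M.genEntropy G s T (τ T)) atTop (𝓝 Smax)) :
    ∃ H : ℝ, 0 < H ∧ H ^ 2 = Real.pi / (G * Smax) ∧
      ∃ C : Fin 3 → ℝ, (∀ i, 0 < C i) ∧
        (∀ t : ℝ, M.ti < (t : WithBot ℝ) →
          IntegrableOn (fun r => (M.meanScale r)⁻¹) (Ioi t)) ∧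
        (∀ i, Tendsto (fun t => M.a i t * (H * M.conformalTimeLeft t)) atTop (𝓝 (C i))) ∧
        (∀ i, Tendsto (fun t => deriv (M.a i) t / M.a i t) atTop (𝓝 H)) ∧
        (∀ i (Δ : ℝ), Tendsto (fun t => M.a i (t + Δ) / M.meanScale t) atTop
          (𝓝 (C i * Real.exp (H * Δ)))) := by
  obtain ⟨t₀, h⟩ := BianchiI.exists_lateScreen hG hs hQ hmax hGSL h_i h_ii.2 h_iii h_iv
  have hS : 0 ≤ Smax := ge_of_tendsto' h_iv fun T => add_nonneg
    (div_nonneg (intervalIntegral.integral_nonneg Real.pi_pos.le fun θ _ =>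
      intervalIntegral.integral_nonneg Real.two_pi_pos.le fun φ _ => Real.sqrt_nonneg _)
      (by positivity)) (mul_nonneg hs measureReal_nonneg)
  have hL : 0 ≤ 4 * G * Smax := by positivity
  -- The limit density is positive almost everywhere and has integral `4 G Smax`.
  have hS' : 0 < Smax := by
    have := (h.tailLimit hL).lim_pos
    rw [h.integral_limEnt hL] at this
    exact pos_of_mul_pos_right this (by positivity)
  have hx : 0 < G * Smax / Real.pi := by have := Real.pi_pos; positivity
  -- The radius solves `4 π R² = 4 G Smax`: the limiting sections have the area of a round sphere of
  -- radius `R = 1 / H`.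
  obtain ⟨C, hC0, hC1, hC2, hC3⟩ := h.asymptotics hL (R := √(G * Smax / Real.pi))
    (Real.sqrt_pos.2 hx) (by
      rw [Real.sq_sqrt hx.le]
      have := Real.pi_pos.ne'
      field_simp)
  refine ⟨(√(G * Smax / Real.pi))⁻¹, inv_pos.2 (Real.sqrt_pos.2 hx), ?_, C, hC0,
    fun t ht => h.integrableOn_inv_meanScale hL ht, hC1, hC2, hC3⟩
  rw [inv_pow, Real.sq_sqrt hx.le, inv_div]
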